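/- **Setting.** Let $G$ be a graph with ordered vertex set $V(G)$, $|V(G)|=n\ge 1$, and let $w:V(G)\to\mathbb{Q}$, $w(X):=\sum_{v\in X}w(v)$, and $\mathrm{opt}\in\{\min,\max\}$, where $\min\emptyset=+\infty$ and $\max\emptyset=-\infty$. For $A\subseteq V(G)$ write $\overline{A}=V(G)\setminus A$. A rooted layout $(T,\delta)$ of $G$ is a rooted binary tree $T$ (every internal node has two children) with a bijection $\delta$ between $V(G)$ and the leaves of $T$; for a node $x$, $V_x$ is the set of vertices placed on the leaves below $x$ (for a leaf $x$, on $x$ itself). For a function $f:2^{V(G)}\to\mathbb{N}$ let $f(T,\delta)=\max_{x} f(V_x)$ over all nodes $x$ of $T$. For $X,Y\subseteq A$ write $X\equiv_A^d Y$ if $\min(d,|X\cap N(u)|)=\min(d,|Y\cap N(u)|)$ for all $u\in\overline{A}$, and let $\mathrm{nec}_d(A)$ be the number of classes of $\equiv_A^d$ on subsets of $A$. Let $\mathrm{mw}(A)=|\{N(v)\cap\overline{A}: v\in A\}|$; let $\mathrm{rw}(A)$ and $\mathrm{rw}_{\mathbb{Q}}(A)$ be the rank over $GF(2)$ and over $\mathbb{Q}$,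 respectively, of the $(A,\overline{A})$ adjacency matrix; and let $\mathrm{mim}(A)$ be the maximum number of edges of an induced matching of the bipartite graph $G[A,\overline{A}]$. Put $$\mathcal{N}_{\mathrm{mw}}=2^{\mathrm{mw}(T,\delta)}\cdot 2n,\quad \mathcal{N}_{\mathrm{rw}_{\mathbb{Q}}}=(2\,\mathrm{rw}_{\mathbb{Q}}(T,\delta)+1)^{\mathrm{rw}_{\mathbb{Q}}(T,\delta)}\cdot 2n,\quad \mathcal{N}_{\mathrm{rw}}=2^{2\,\mathrm{rw}(T,\delta)^2}\cdot 2n,\quad \mathcal{N}_{\mathrm{mim}}=2\,n^{2\,\mathrm{mim}(T,\delta)+1}.$$ For $\mathcal{A}\subseteq 2^{V(G)}$ and $Y\subseteq V(G)$ let $\mathrm{best}^{\mathrm{acy}}(\mathcal{A},Y)=\mathrm{opt}\{w(X): X\in\mathcal{A},\ G[X\cup Y]\text{ is a tree}\}$ (a tree is non-empty). For a node $x$ of $T$, $R'\subseteq\overline{V_x}$ and $\mathcal{A},\mathcal{B}\subseteq 2^{V_x}$, say that $\mathcal{B}$ $(x,R')^{\mathrm{acy}}$-represents $\mathcal{A}$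 if $\mathrm{best}^{\mathrm{acy}}(\mathcal{A},Y)=\mathrm{best}^{\mathrm{acy}}(\mathcal{B},Y)$ for every $Y\subseteq\overline{V_x}$ with $Y\equiv^2_{\overline{V_x}}R'$. Running times are numbers of steps of a unit-cost word RAM: word operations take unit time, the words have $O(\log(\text{time bound}))$ bits, and copying, adding and comparing rational weights takes unit time; memory not holding the input is not assumed to be initialised. Let $\omega$ be the matrix multiplication exponent, i.e. the infimum of the reals $\tau$ such that two $m\times m$ matrices over $GF(2)$ can be multiplied in time $O(m^{\tau})$. **Theorem.** Let $\mathsf{f}\in\{\mathrm{mw},\mathrm{rw},\mathrm{rw}_{\mathbb{Q}},\mathrm{mim}\}$ and $\mathrm{opt}\in\{\min,\max\}$, and let $\tau$ be a real number with $\tau>\omega$, or such that $m\times m$ matrices over $GF(2)$ can be multiplied in time $O(m^{\tau})$ (so $\tau=\omega$ is allowed if the infimum is attained). There is an algorithm $\mathsf{reduce}^{\mathrm{acy}}_{\mathsf{f}}$ that, given $G$, $w$, $V_x$, $R'$ and $\mathcal{A}$, where $x$ is a node of a rooted layout $(T,\delta)$ of $G$, $R'\subseteq\overline{V_x}$, and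 $\mathcal{A}\subseteq 2^{V_x}$ is such that for some $R\subseteq V_x$ every $X\in\mathcal{A}$ satisfies $X\equiv^2_{V_x}R$, outputs a subset $\mathcal{B}\subseteq\mathcal{A}$ such that $\mathcal{B}$ $(x,R')^{\mathrm{acy}}$-represents $\mathcal{A}$ and $$|\mathcal{B}|\le \mathcal{N}_{\mathsf{f}}\cdot \mathrm{nec}_1(V_x)^2,$$ in time $$O\big((|\mathcal{A}|+1)\cdot(\mathrm{nec}_1(V_x)^{2(\tau-1)}+\mathcal{N}_{\mathsf{f}})\cdot n^2\big).$$ The constant in $O(\cdot)$ depends only on $\mathsf{f}$, $\mathrm{opt}$ and $\tau$. -/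

import Mathlib

/-! ### Machine model

A unit-cost word RAM, programmed in a structured language.  A machine has word registers and word
arrays, and weight registers and weight arrays holding rational numbers.  A program names only
finitely many of them.  Words are natural numbers below a capacity `W` (the machine has words of
`log₂ W` bits): a step that would produce a word `≥ W` is not allowed.  Weights can only be set to
zero, copied, added and compared. -/

/-- The memory of the machine. -/
structure RamState where
  reg : ℕ → ℕ
  arr : ℕ → ℕ → ℕ
  wreg : ℕ → ℚ
  warr : ℕ → ℕ → ℚ

/-- All words in memory are smaller than the capacity `W`. -/
def RamState.Fits (s : RamState) (W : ℕ) : Prop :=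
  (∀ x, s.reg x < W) ∧ ∀ a i, s.arr a i < W

/-- Binary operations on words (subtraction is truncated, division rounds down). -/
inductive RamOp where
  | add | sub | mul | div | mod | lt | eq

def RamOp.eval : RamOp → ℕ → ℕ → ℕ
  | .add, a, b => a + b
  | .sub, a, b => a - b
  | .mul, a, b => a * b
  | .div, a, b => a / b
  | .mod, a, b => a % b
  | .lt, a, b => if a < b then 1 else 0
  | .eq, a, b => if a = b then 1 else 0

/-- The elementary instructions. -/
inductive RamInstr where
  /-- `reg x := c` -/
  | const (x c : ℕ)
  /-- `reg x := reg y` -/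
  | copy (x y : ℕ)
  /-- `reg x := reg y ∘ reg z` -/
  | op (o : RamOp) (x y z : ℕ)
  /-- `reg x := arr a [reg y]` -/
  | load (x a y : ℕ)
  /-- `arr a [reg x] := reg y` -/
  | store (a x y : ℕ)
  /-- `wreg x := 0` -/
  | wzero (x : ℕ)
  /-- `wreg x := wreg y` -/
  | wcopy (x y : ℕ)
  /-- `wreg x := wreg y + wreg z` -/
  | wplus (x y z : ℕ)
  /-- `reg x := 1` if `wreg y ≤ wreg z`, and `reg x := 0` otherwise -/
  | wle (x y z : ℕ)
  /-- `wreg x := warr a [reg y]` -/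
  | wload (x a y : ℕ)
  /-- `warr a [reg x] := wreg y` -/
  | wstore (a x y : ℕ)

/-- The effect of an instruction on the memory. -/
def RamInstr.exec (s : RamState) : RamInstr → RamState
  | .const x c => { s with reg := Function.update s.reg x c }
  | .copy x y => { s with reg := Function.update s.reg x (s.reg y) }
  | .op o x y z => { s with reg := Function.update s.reg x (o.eval (s.reg y) (s.reg z)) }
  | .load x a y => { s with reg := Function.update s.reg x (s.arr a (s.reg y)) }
  | .store a x y =>
      { s with arr := Function.update s.arr a (Function.update (s.arr a) (s.reg x) (s.reg y)) }
  | .wzero x => { s with wreg := Function.update s.wreg x 0 }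
  | .wcopy x y => { s with wreg := Function.update s.wreg x (s.wreg y) }
  | .wplus x y z => { s with wreg := Function.update s.wreg x (s.wreg y + s.wreg z) }
  | .wle x y z =>
      { s with reg := Function.update s.reg x (if s.wreg y ≤ s.wreg z then 1 else 0) }
  | .wload x a y => { s with wreg := Function.update s.wreg x (s.warr a (s.reg y)) }
  | .wstore a x y =>
      { s with warr := Function.update s.warr a (Function.update (s.warr a) (s.reg x) (s.wreg y)) }

/-- Programs. `ite x p q` runs `p` if `reg x ≠ 0` and `q` otherwise; `loop x p` repeats `p` as long
as `reg x ≠ 0`. -/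
inductive RamProg where
  | skip
  | instr (i : RamInstr)
  | seq (p q : RamProg)
  | ite (x : ℕ) (p q : RamProg)
  | loop (x : ℕ) (p : RamProg)

/-- `RamRun W p s s' t`: with words of capacity `W`, the program `p` started in memory `s` halts in
memory `s'` after `t` steps, and no word overflow occurs.  Every instruction and every test costs
one step. -/
inductive RamRun (W : ℕ) : RamProg → RamState → RamState → ℕ → Prop
  | skip (s : RamState) : RamRun W .skip s s 1
  | instr (i : RamInstr) (s : RamState) (h : (i.exec s).Fits W) :
      RamRun W (.instr i) s (i.exec s) 1
  | seq {p q : RamProg} {s s₁ s₂ : RamState} {t₁ t₂ : ℕ}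
      (h₁ : RamRun W p s s₁ t₁) (h₂ : RamRun W q s₁ s₂ t₂) :
      RamRun W (.seq p q) s s₂ (t₁ + t₂)
  | iteTrue {x : ℕ} {p q : RamProg} {s s₁ : RamState} {t : ℕ}
      (hx : s.reg x ≠ 0) (h : RamRun W p s s₁ t) : RamRun W (.ite x p q) s s₁ (t + 1)
  | iteFalse {x : ℕ} {p q : RamProg} {s s₁ : RamState} {t : ℕ}
      (hx : s.reg x = 0) (h : RamRun W q s s₁ t) : RamRun W (.ite x p q) s s₁ (t + 1)
  | loopStop {x : ℕ} {p : RamProg} {s : RamState}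
      (hx : s.reg x = 0) : RamRun W (.loop x p) s s 1
  | loopStep {x : ℕ} {p : RamProg} {s s₁ s₂ : RamState} {t₁ t₂ : ℕ}
      (hx : s.reg x ≠ 0) (h₁ : RamRun W p s s₁ t₁) (h₂ : RamRun W (.loop x p) s₁ s₂ t₂) :
      RamRun W (.loop x p) s s₂ (t₁ + t₂ + 1)

/-! ### Matrix multiplication -/

/-- Array `a` holds the `m × m` matrix `M` over the two-element field, row by row. -/
def RamState.HoldsMatrix (s : RamState) (a : ℕ) {m : ℕ} (M : Matrix (Fin m) (Fin m) (ZMod 2)) :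
    Prop :=
  ∀ i j : Fin m, s.arr a (i.val * m + j.val) = (M i j).val

/-- Two `m × m` matrices over the two-element field can be multiplied in time `O(m ^ τ)` on
machines with words of `O(log m)` bits.  The memory not holding the input may contain arbitrary
words, so that such a program can be used as a subroutine. -/
def MatMulTime (τ : ℝ) : Prop :=
  ∃ (P : RamProg) (C k : ℕ), ∀ m : ℕ, 1 ≤ m → ∀ M N : Matrix (Fin m) (Fin m) (ZMod 2),
    ∀ W : ℕ, C * m ^ k ≤ W → ∀ s : RamState, s.Fits W →
      s.reg 0 = m → s.HoldsMatrix 0 M → s.HoldsMatrix 1 N →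
      ∃ (s' : RamState) (t : ℕ), RamRun W P s s' t ∧ (t : ℝ) ≤ C * (m : ℝ) ^ τ ∧
        s'.HoldsMatrix 2 (M * N)

/-- The matrix multiplication exponent `ω`. -/
noncomputable def matMulExponent : ℝ := sInf {τ : ℝ | MatMulTime τ}

/-! ### Rooted layouts -/

/-- Rooted binary trees in which every internal node has two children and every leaf carries a
vertex. A node is identified with the subtree below it. -/
inductive LayoutTree (V : Type*) where
  | leaf (v : V)
  | node (l r : LayoutTree V)

namespace LayoutTree

variable {V : Type*}

/-- The vertices at the leaves, from left to right. -/
def leaves : LayoutTree V → List V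
  | leaf v => [v]
  | node l r => l.leaves ++ r.leaves

/-- The nodes of the tree. -/
def nodes : LayoutTree V → List (LayoutTree V)
  | leaf v => [leaf v]
  | node l r => node l r :: (l.nodes ++ r.nodes)

/-- The tree is a rooted layout: its leaves are in bijection with the vertices. -/
def IsLayout (T : LayoutTree V) : Prop := T.leaves.Nodup ∧ ∀ v, v ∈ T.leaves

/-- The set `V_x` of vertices at the leaves below the node `x`. -/
def verts [DecidableEq V] (x : LayoutTree V) : Finset V := x.leaves.toFinset

/-- The `f`-width of the layout, the maximum of `f V_x` over all nodes `x`. -/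
def width [DecidableEq V] (f : Finset V → ℕ) (T : LayoutTree V) : ℕ :=
  (T.nodes.map fun x => f x.verts).foldr max 0

end LayoutTree

/-! ### Neighbor equivalence and the width parameters -/

section Graph

variable {V : Type*} [Fintype V] [DecidableEq V] (G : SimpleGraph V) [DecidableRel G.Adj]

/-- `X` and `Y` are `d`-neighbor equivalent over `A`. -/
def NbrEquiv (d : ℕ) (A X Y : Finset V) : Prop :=
  ∀ u ∈ Aᶜ, min d (X ∩ G.neighborFinset u).card = min d (Y ∩ G.neighborFinset u).card

/-- The `d`-neighbor equivalence on the subsets of `A`. -/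
def nbrSetoid (d : ℕ) (A : Finset V) : Setoid {X : Finset V // X ⊆ A} where
  r X Y := NbrEquiv G d A X Y
  iseqv := ⟨fun _ _ _ => rfl, fun h u hu => (h u hu).symm,
    fun h h' u hu => (h u hu).trans (h' u hu)⟩

/-- The number of classes of the `d`-neighbor equivalence over `A`. -/
noncomputable def nec (d : ℕ) (A : Finset V) : ℕ := Nat.card (Quotient (nbrSetoid G d A))

/-- The adjacency matrix between `A` and its complement. -/
def cutMatrix (K : Type*) [Zero K] [One K] (A : Finset V) :
    Matrix {v // v ∈ A} {v // v ∈ Aᶜ} K :=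
  (G.adjMatrix K).submatrix Subtype.val Subtype.val

/-- The bipartite graph formed by the edges between `A` and its complement. -/
def cutGraph (A : Finset V) : SimpleGraph V where
  Adj u v := G.Adj u v ∧ (u ∈ A ∧ v ∉ A ∨ u ∉ A ∧ v ∈ A)
  symm := ⟨fun _ _ h => ⟨h.1.symm, h.2.elim (fun h => .inr h.symm) fun h => .inl h.symm⟩⟩
  loopless := ⟨fun _ h => G.loopless.irrefl _ h.1⟩

/-- Module-width: the number of distinct neighborhoods of vertices of `A` in the complement. -/
def mwCut (A : Finset V) : ℕ := (A.image fun v => G.neighborFinset v ∩ Aᶜ).card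

/-- Rank-width. -/
noncomputable def rwCut (A : Finset V) : ℕ := (cutMatrix G (ZMod 2) A).rank

/-- `ℚ`-rank-width. -/
noncomputable def rwQCut (A : Finset V) : ℕ := (cutMatrix G ℚ A).rank

/-- Mim-width: the maximum size of an induced matching of the bipartite graph between `A` and its
complement. -/
noncomputable def mimCut (A : Finset V) : ℕ :=
  sSup {k : ℕ | ∃ M : (cutGraph G A).Subgraph,
    M.IsMatching ∧ M.IsInduced ∧ M.edgeSet.ncard = k}

end Graph

/-- The four width parameters. -/
inductive WidthParam where
  | mw | rw | rwQ | mim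

/-- The quantity `𝒩_f(T, δ)`. -/
noncomputable def classBound {n : ℕ} (G : SimpleGraph (Fin n)) [DecidableRel G.Adj]
    (T : LayoutTree (Fin n)) : WidthParam → ℕ
  | .mw => 2 ^ T.width (mwCut G) * (2 * n)
  | .rwQ => (2 * T.width (rwQCut G) + 1) ^ T.width (rwQCut G) * (2 * n)
  | .rw => 2 ^ (2 * T.width (rwCut G) ^ 2) * (2 * n)
  | .mim => 2 * n ^ (2 * T.width (mimCut G) + 1)

/-! ### Representativity -/

/-- Whether weights are minimized or maximized. -/
inductive OptKind where
  | min | max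

/-- `opt` over a set of extended reals; `max ∅ = -∞` and `min ∅ = +∞`. -/
noncomputable def OptKind.opt : OptKind → Set EReal → EReal
  | .min, S => sInf S
  | .max, S => sSup S

section Represent

variable {V : Type*} [Fintype V] [DecidableEq V] (G : SimpleGraph V) [DecidableRel G.Adj]

/-- The optimal weight of a member `X` of `𝒜` such that `G[X ∪ Y]` is a tree. -/
noncomputable def bestAcy (w : V → ℚ) (o : OptKind) (𝒜 : Finset (Finset V)) (Y : Finset V) :
    EReal :=
  o.opt {b | ∃ X ∈ 𝒜, (G.induce (↑(X ∪ Y) : Set V)).IsTree ∧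
    b = (((∑ v ∈ X, w v : ℚ) : ℝ) : EReal)}

/-- `ℬ` represents `𝒜` with respect to the vertex set `A` (the set `V_x` of a node `x`) and
`R' ⊆ Aᶜ`, for the property of inducing a tree. -/
def AcyRepresents (w : V → ℚ) (o : OptKind) (A R' : Finset V) (ℬ 𝒜 : Finset (Finset V)) : Prop :=
  ∀ Y : Finset V, Y ⊆ Aᶜ → NbrEquiv G 2 Aᶜ Y R' → bestAcy G w o 𝒜 Y = bestAcy G w o ℬ Y

end Represent

/-! ### Input and output conventions -/

section Encoding

variable {n : ℕ}

/-- Register `0` holds `n` and array `0` holds the adjacency matrix of `G`, row by row. -/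
def RamState.HoldsGraph (s : RamState) (G : SimpleGraph (Fin n)) [DecidableRel G.Adj] : Prop :=
  s.reg 0 = n ∧ ∀ u v : Fin n, s.arr 0 (u.val * n + v.val) = if G.Adj u v then 1 else 0

/-- Array `a` holds the indicator vector of `S`. -/
def RamState.HoldsSet (s : RamState) (a : ℕ) (S : Finset (Fin n)) : Prop :=
  ∀ v : Fin n, s.arr a v.val = if v ∈ S then 1 else 0

/-- Register `x` holds the number of members of `𝓕`, and array `a` holds the indicator vectors of
its members, one after the other, each exactly once and in some order. -/
def RamState.HoldsFamily (s : RamState) (x a : ℕ) (𝓕 : Finset (Finset (Fin n))) : Prop :=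
  s.reg x = 𝓕.card ∧ ∃ e : Fin 𝓕.card ≃ {X // X ∈ 𝓕},
    ∀ (i : Fin 𝓕.card) (v : Fin n),
      s.arr a (i.val * n + v.val) = if v ∈ (e i).val then 1 else 0

/-- Weight array `0` holds the weights of the vertices. -/
def RamState.HoldsWeights (s : RamState) (w : Fin n → ℚ) : Prop :=
  ∀ v : Fin n, s.warr 0 v.val = w v

end Encoding

/-- The quantity `(|𝒜| + 1) ⬝ (nec₁(A) ^ (2 (τ - 1)) + 𝒩) ⬝ n²` in which running times are
measured. -/
noncomputable def timeScale (τ : ℝ) (n card nec₁ N : ℕ) : ℝ :=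
  ((card : ℝ) + 1) * ((nec₁ : ℝ) ^ (2 * (τ - 1)) + (N : ℝ)) * (n : ℝ) ^ 2

/-! ### A small imperative language compiled to the machine -/

namespace RamState

def setReg (s : RamState) (x v : ℕ) : RamState := { s with reg := Function.update s.reg x v }

def withArr (s : RamState) (a : ℕ) (g : ℕ → ℕ) : RamState :=
  { s with arr := Function.update s.arr a g }

def setArr (s : RamState) (a i v : ℕ) : RamState := s.withArr a (Function.update (s.arr a) i v)

def setWreg (s : RamState) (x : ℕ) (v : ℚ) : RamState :=
  { s with wreg := Function.update s.wreg x v }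

def withWarr (s : RamState) (a : ℕ) (g : ℕ → ℚ) : RamState :=
  { s with warr := Function.update s.warr a g }

def setWarr (s : RamState) (a i : ℕ) (v : ℚ) : RamState :=
  s.withWarr a (Function.update (s.warr a) i v)

variable (s : RamState)

@[simp] theorem reg_setReg (x v y : ℕ) :
    (s.setReg x v).reg y = if y = x then v else s.reg y := Function.update_apply ..
@[simp] theorem arr_setReg (x v : ℕ) : (s.setReg x v).arr = s.arr := (rfl)
@[simp] theorem wreg_setReg (x v : ℕ) : (s.setReg x v).wreg = s.wreg := (rfl)
@[simp] theorem warr_setReg (x v : ℕ) : (s.setReg x v).warr = s.warr := (rfl)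
@[simp] theorem reg_withArr (a : ℕ) (g : ℕ → ℕ) : (s.withArr a g).reg = s.reg := (rfl)
@[simp] theorem arr_withArr (a : ℕ) (g : ℕ → ℕ) (b : ℕ) :
    (s.withArr a g).arr b = if b = a then g else s.arr b := Function.update_apply ..
@[simp] theorem wreg_withArr (a : ℕ) (g : ℕ → ℕ) : (s.withArr a g).wreg = s.wreg := (rfl)
@[simp] theorem warr_withArr (a : ℕ) (g : ℕ → ℕ) : (s.withArr a g).warr = s.warr := (rfl)
@[simp] theorem reg_setArr (a i v : ℕ) : (s.setArr a i v).reg = s.reg := (rfl)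
@[simp] theorem arr_setArr (a i v b j : ℕ) :
    (s.setArr a i v).arr b j = if b = a ∧ j = i then v else s.arr b j := by
  unfold setArr
  by_cases h : b = a <;> simp [h, Function.update_apply]
@[simp] theorem warr_setArr (a i v : ℕ) : (s.setArr a i v).warr = s.warr := (rfl)
@[simp] theorem reg_setWreg (x : ℕ) (v : ℚ) : (s.setWreg x v).reg = s.reg := (rfl)
@[simp] theorem arr_setWreg (x : ℕ) (v : ℚ) : (s.setWreg x v).arr = s.arr := (rfl)
@[simp] theorem wreg_setWreg (x : ℕ) (v : ℚ) (y : ℕ) :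
    (s.setWreg x v).wreg y = if y = x then v else s.wreg y := Function.update_apply ..
@[simp] theorem warr_setWreg (x : ℕ) (v : ℚ) : (s.setWreg x v).warr = s.warr := (rfl)
@[simp] theorem warr_setWarr (a i : ℕ) (v : ℚ) (b j : ℕ) :
    (s.setWarr a i v).warr b j = if b = a ∧ j = i then v else s.warr b j := by
  by_cases h : b = a <;> simp [setWarr, withWarr, h, Function.update_apply]

variable {s}

theorem setReg_setReg (x v w : ℕ) : (s.setReg x v).setReg x w = s.setReg x w := by
  simp [setReg]

theorem setReg_comm {x y : ℕ} (h : x ≠ y) (v w : ℕ) :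
    (s.setReg x v).setReg y w = (s.setReg y w).setReg x v := by
  simp [setReg, Function.update_comm h]

theorem setReg_self {x v : ℕ} (h : s.reg x = v) : s.setReg x v = s := by
  subst h; simp [setReg]

theorem Fits.setReg {W : ℕ} (h : s.Fits W) {v : ℕ} (hv : v < W) (x : ℕ) :
    (s.setReg x v).Fits W :=
  ⟨fun y => by rw [reg_setReg]; split_ifs; exacts [hv, h.1 y], h.2⟩

theorem Fits.setArr {W : ℕ} (h : s.Fits W) {v : ℕ} (hv : v < W) (a i : ℕ) :
    (s.setArr a i v).Fits W :=
  ⟨h.1, fun b j => by rw [arr_setArr]; split_ifs; exacts [hv, h.2 b j]⟩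

end RamState

/-- Expressions; `sum x y e` is the sum of `e` over all values of register `x` below the content of
register `y`. -/
inductive Ex where
  | c (k : ℕ)
  | r (x : ℕ)
  | l (a : ℕ) (e : Ex)
  | o (op : RamOp) (e f : Ex)
  | sum (x y : ℕ) (e : Ex)

namespace Ex

instance : Add Ex := ⟨.o .add⟩
instance : Sub Ex := ⟨.o .sub⟩
instance : Mul Ex := ⟨.o .mul⟩
instance : Div Ex := ⟨.o .div⟩
instance : Mod Ex := ⟨.o .mod⟩

/-- The indicator of `e < f`. -/
def lt (e f : Ex) : Ex := .o .lt e f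

/-- The indicator of `e = f`. -/
def eq (e f : Ex) : Ex := .o .eq e f

def eval : Ex → RamState → ℕ
  | c k, _ => k
  | r x, s => s.reg x
  | l a e, s => s.arr a (e.eval s)
  | o op e f, s => op.eval (e.eval s) (f.eval s)
  | sum x y e, s => ∑ i ∈ Finset.range (s.reg y), e.eval (s.setReg x i)

/-- No intermediate result overflows. -/
def ok (W : ℕ) : Ex → RamState → Prop
  | c k, _ => k < 3 ∨ k < W
  | r _, _ => True
  | l _ e, s => e.ok W s
  | o .add e f, s => e.ok W s ∧ f.ok W s ∧ e.eval s + f.eval s < W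
  | o .mul e f, s => e.ok W s ∧ f.ok W s ∧ e.eval s * f.eval s < W
  | o _ e f, s => e.ok W s ∧ f.ok W s
  | sum x y e, s => (∀ i < s.reg y, e.ok W (s.setReg x i)) ∧
      ∑ i ∈ Finset.range (s.reg y), e.eval (s.setReg x i) < W

def cost : Ex → RamState → ℕ
  | c _, _ => 1
  | r _, _ => 1
  | l _ e, s => e.cost s + 1
  | o _ e f, s => e.cost s + f.cost s + 1
  | sum x y e, s => 1 + ∑ i ∈ Finset.range (s.reg y), (e.cost (s.setReg x i) + 1)

/-- The registers mentioned lie below the registers reserved for temporaries. -/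
def wf : Ex → Bool
  | c _ => true
  | r x => x < 50
  | l _ e => e.wf
  | o _ e f => e.wf && f.wf
  | sum x y e => x < 50 && y < 50 && x != y && e.wf

/-- The number of additional temporaries used. -/
def depth : Ex → ℕ
  | c _ => 0
  | r _ => 0
  | l _ e => e.depth
  | o _ e f => max e.depth (f.depth + 1)
  | sum _ _ e => e.depth + 3

/-- Code computing the value in register `d`. -/
def comp : Ex → ℕ → RamProg
  | c k, d => .instr (.const d k)
  | r x, d => .instr (.copy d x)
  | l a e, d => .seq (e.comp d) (.instr (.load d a d))
  | o op e f, d => .seq (e.comp d) (.seq (f.comp (d + 1))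
      (.seq (.instr (.op op d d (d + 1))) (.instr (.const (d + 1) 0))))
  | sum x y e, d => .seq (.instr (.const d 0)) (.seq (.instr (.copy (d + 1) x))
      (.seq (.instr (.const x 0)) (.seq (.instr (.op .lt (d + 2) x y))
      (.seq (.loop (d + 2) (.seq (e.comp (d + 3)) (.seq (.instr (.op .add d d (d + 3)))
        (.seq (.instr (.const (d + 3) 1)) (.seq (.instr (.op .add x x (d + 3)))
        (.seq (.instr (.const (d + 3) 0)) (.instr (.op .lt (d + 2) x y))))))))
      (.seq (.instr (.copy x (d + 1))) (.instr (.const (d + 1) 0)))))))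

section simps
variable (s : RamState) (W : ℕ) (e f : Ex)

@[simp] theorem eval_c (k : ℕ) : (c k).eval s = k := (rfl)
@[simp] theorem eval_r (x : ℕ) : (r x).eval s = s.reg x := (rfl)
@[simp] theorem eval_l (a : ℕ) : (l a e).eval s = s.arr a (e.eval s) := (rfl)
@[simp] theorem eval_add : (e + f).eval s = e.eval s + f.eval s := (rfl)
@[simp] theorem eval_sub : (e - f).eval s = e.eval s - f.eval s := (rfl)
@[simp] theorem eval_mul : (e * f).eval s = e.eval s * f.eval s := (rfl)
@[simp] theorem eval_div : (e / f).eval s = e.eval s / f.eval s := (rfl)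
@[simp] theorem eval_mod : (e % f).eval s = e.eval s % f.eval s := (rfl)
@[simp] theorem eval_lt : (lt e f).eval s = if e.eval s < f.eval s then 1 else 0 := (rfl)
@[simp] theorem eval_eq : (eq e f).eval s = if e.eval s = f.eval s then 1 else 0 := (rfl)
@[simp] theorem eval_sum (x y : ℕ) :
    (sum x y e).eval s = ∑ i ∈ Finset.range (s.reg y), e.eval (s.setReg x i) := (rfl)
@[simp] theorem ok_c (k : ℕ) : (c k).ok W s ↔ k < 3 ∨ k < W := Iff.rfl
@[simp] theorem ok_r (x : ℕ) : (r x).ok W s := trivial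
@[simp] theorem ok_l (a : ℕ) : (l a e).ok W s ↔ e.ok W s := Iff.rfl
@[simp] theorem ok_add :
    (e + f).ok W s ↔ e.ok W s ∧ f.ok W s ∧ e.eval s + f.eval s < W := Iff.rfl
@[simp] theorem ok_sub : (e - f).ok W s ↔ e.ok W s ∧ f.ok W s := Iff.rfl
@[simp] theorem ok_mul :
    (e * f).ok W s ↔ e.ok W s ∧ f.ok W s ∧ e.eval s * f.eval s < W := Iff.rfl
@[simp] theorem ok_div : (e / f).ok W s ↔ e.ok W s ∧ f.ok W s := Iff.rfl
@[simp] theorem ok_mod : (e % f).ok W s ↔ e.ok W s ∧ f.ok W s := Iff.rfl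
@[simp] theorem ok_lt : (lt e f).ok W s ↔ e.ok W s ∧ f.ok W s := Iff.rfl
@[simp] theorem ok_eq : (eq e f).ok W s ↔ e.ok W s ∧ f.ok W s := Iff.rfl
@[simp] theorem ok_sum (x y : ℕ) : (sum x y e).ok W s ↔
    (∀ i < s.reg y, e.ok W (s.setReg x i)) ∧
      ∑ i ∈ Finset.range (s.reg y), e.eval (s.setReg x i) < W := Iff.rfl
@[simp] theorem cost_c (k : ℕ) : (c k).cost s = 1 := (rfl)
@[simp] theorem cost_r (x : ℕ) : (r x).cost s = 1 := (rfl)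
@[simp] theorem cost_l (a : ℕ) : (l a e).cost s = e.cost s + 1 := (rfl)
@[simp] theorem cost_add : (e + f).cost s = e.cost s + f.cost s + 1 := (rfl)
@[simp] theorem cost_sub : (e - f).cost s = e.cost s + f.cost s + 1 := (rfl)
@[simp] theorem cost_mul : (e * f).cost s = e.cost s + f.cost s + 1 := (rfl)
@[simp] theorem cost_div : (e / f).cost s = e.cost s + f.cost s + 1 := (rfl)
@[simp] theorem cost_mod : (e % f).cost s = e.cost s + f.cost s + 1 := (rfl)
@[simp] theorem cost_lt : (lt e f).cost s = e.cost s + f.cost s + 1 := (rfl)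
@[simp] theorem cost_eq : (eq e f).cost s = e.cost s + f.cost s + 1 := (rfl)
@[simp] theorem cost_sum (x y : ℕ) : (sum x y e).cost s =
    1 + ∑ i ∈ Finset.range (s.reg y), (e.cost (s.setReg x i) + 1) := (rfl)

end simps

theorem ok_o {W : ℕ} {op : RamOp} {e f : Ex} {s : RamState} (h : (o op e f).ok W s) :
    e.ok W s ∧ f.ok W s := by
  cases op
  case add => exact ⟨h.1, h.2.1⟩
  case mul => exact ⟨h.1, h.2.1⟩
  all_goals exact h

theorem eval_lt_cap {W : ℕ} (hW : 3 ≤ W) {s : RamState} (hs : s.Fits W) :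
    ∀ {e : Ex}, e.ok W s → e.eval s < W
  | c _, h => by rcases h with h | h <;> simp only [eval_c] <;> omega
  | r x, _ => hs.1 x
  | l a e, _ => hs.2 a _
  | o op e f, h => by
    have he := eval_lt_cap hW hs (ok_o h).1
    have hf := eval_lt_cap hW hs (ok_o h).2
    cases op
    case add => exact h.2.2
    case mul => exact h.2.2
    case sub => exact lt_of_le_of_lt (Nat.sub_le _ _) he
    case div => exact lt_of_le_of_lt (Nat.div_le_self _ _) he
    case mod => exact lt_of_le_of_lt (Nat.mod_le _ _) he
    case lt => simp only [eval, RamOp.eval]; split_ifs <;> omega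
    case eq => simp only [eval, RamOp.eval]; split_ifs <;> omega
  | sum _ _ _, h => h.2

theorem congr_state {W : ℕ} : ∀ {e : Ex} {s s' : RamState}, e.wf = true →
    (∀ x < 50, s.reg x = s'.reg x) → s.arr = s'.arr →
    e.eval s = e.eval s' ∧ (e.ok W s → e.ok W s') ∧ e.cost s = e.cost s'
  | c _, _, _, _, _, _ => ⟨rfl, id, rfl⟩
  | r x, _, _, h, hr, _ => ⟨hr x (by simpa [wf] using h), id, rfl⟩
  | l a e, s, s', h, hr, ha => by
    obtain ⟨h1, h2, h3⟩ := congr_state (W := W) (e := e) h hr ha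
    exact ⟨by simp [h1, ha], h2, by simp [h3]⟩
  | o op e f, s, s', h, hr, ha => by
    simp only [wf, Bool.and_eq_true] at h
    obtain ⟨h1, h2, h3⟩ := congr_state (W := W) (e := e) h.1 hr ha
    obtain ⟨g1, g2, g3⟩ := congr_state (W := W) (e := f) h.2 hr ha
    refine ⟨by simp [eval, h1, g1], fun k => ?_, by simp [cost, h3, g3]⟩
    cases op
    case add => exact ⟨h2 k.1, g2 k.2.1, h1 ▸ g1 ▸ k.2.2⟩
    case mul => exact ⟨h2 k.1, g2 k.2.1, h1 ▸ g1 ▸ k.2.2⟩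
    all_goals exact ⟨h2 k.1, g2 k.2⟩
  | sum x y e, s, s', h, hr, ha => by
    simp only [wf, Bool.and_eq_true, decide_eq_true_eq] at h
    have key : ∀ i, e.eval (s.setReg x i) = e.eval (s'.setReg x i) ∧
        (e.ok W (s.setReg x i) → e.ok W (s'.setReg x i)) ∧
        e.cost (s.setReg x i) = e.cost (s'.setReg x i) := fun i =>
      congr_state h.2 (fun z hz => by simp [hr z hz]) ha
    have hy := hr y h.1.1.2
    refine ⟨?_, fun k => ⟨fun i hi => (key i).2.1 (k.1 i (hy ▸ hi)), ?_⟩, ?_⟩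
    · simp [hy, (key _).1]
    · have := k.2; simpa [hy, (key _).1] using this
    · simp [hy, (key _).2.2]

end Ex

section Instr
variable {W : ℕ} {s : RamState}

theorem run_const (hs : s.Fits W) {k : ℕ} (hk : k < W) (x : ℕ) :
    RamRun W (.instr (.const x k)) s (s.setReg x k) 1 := .instr _ _ (hs.setReg hk x)

theorem run_copy (hs : s.Fits W) (x y : ℕ) : RamRun W (.instr (.copy x y)) s (s.setReg x (s.reg y)) 1 :=
  .instr _ _ (hs.setReg (hs.1 y) x)

theorem run_op (hs : s.Fits W) {op : RamOp} {x y z : ℕ} (h : op.eval (s.reg y) (s.reg z) < W) :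
    RamRun W (.instr (.op op x y z)) s (s.setReg x (op.eval (s.reg y) (s.reg z))) 1 :=
  .instr _ _ (hs.setReg h x)

theorem run_load (hs : s.Fits W) (x a y : ℕ) :
    RamRun W (.instr (.load x a y)) s (s.setReg x (s.arr a (s.reg y))) 1 :=
  .instr _ _ (hs.setReg (hs.2 a _) x)

theorem run_store (hs : s.Fits W) (a x y : ℕ) :
    RamRun W (.instr (.store a x y)) s (s.setArr a (s.reg x) (s.reg y)) 1 :=
  .instr _ _ (hs.setArr (hs.1 y) a _)

end Instr

/-- Compiled expressions compute their values, leaving the temporaries clean. -/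
theorem comp_run {W : ℕ} (hW : 3 ≤ W) : ∀ (e : Ex) (d : ℕ) (s : RamState), e.wf = true → 50 ≤ d →
    d + e.depth < 100 → s.Fits W → e.ok W s → (∀ r, d ≤ r → r < 100 → s.reg r = 0) →
    ∃ t, RamRun W (e.comp d) s (s.setReg d (e.eval s)) t ∧ t ≤ 10 * e.cost s
  | .c k, d, s, _, _, _, hs, ho, _ =>
    ⟨1, run_const hs (by rcases ho with h | h <;> omega) d, by simp⟩
  | .r x, d, s, _, _, _, hs, _, _ => ⟨1, run_copy hs d x, by simp⟩
  | .l a e, d, s, hw, hd, hde, hs, ho, hz => by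
    obtain ⟨t, h, ht⟩ := comp_run hW e d s hw hd hde hs ho hz
    have hv := Ex.eval_lt_cap (e := e) hW hs ho
    have h2 := run_load (hs.setReg hv d) d a d
    rw [RamState.setReg_setReg] at h2
    refine ⟨t + 1, .seq h (by simpa using h2), ?_⟩
    simp; omega
  | .o op e f, d, s, hw, hd, hde, hs, ho, hz => by
    simp only [Ex.wf, Bool.and_eq_true] at hw
    simp only [Ex.depth] at hde
    have hoe := (Ex.ok_o ho).1
    have hof := (Ex.ok_o ho).2
    obtain ⟨t, h, ht⟩ := comp_run hW e d s hw.1 hd (by omega) hs hoe hz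
    have hv := Ex.eval_lt_cap hW hs hoe
    have hs1 := hs.setReg hv d
    have cg := Ex.congr_state (W := W) (e := f) (s := s) (s' := s.setReg d (e.eval s)) hw.2
      (fun x hx => by simp; intro h; omega) rfl
    obtain ⟨t', h', ht'⟩ := comp_run hW f (d + 1) (s.setReg d (e.eval s)) hw.2 (by omega)
      (by omega) hs1 (cg.2.1 hof) (fun r h1 h2 => by simp [hz r (by omega) h2]; omega)
    have hs2 := hs1.setReg (Ex.eval_lt_cap hW hs1 (cg.2.1 hof)) (d + 1)
    rw [← cg.1] at h' hs2
    have hval : op.eval (e.eval s) (f.eval s) < W :=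
      Ex.eval_lt_cap (e := .o op e f) hW hs ho
    have h3 := run_op hs2 (op := op) (x := d) (y := d) (z := d + 1) (by simpa using hval)
    have h4 := run_const (hs2.setReg (v := op.eval (e.eval s) (f.eval s)) hval d) (k := 0)
      (by omega) (d + 1)
    simp only [RamState.reg_setReg, if_true, Nat.left_eq_add, one_ne_zero, if_false] at h3
    have hfin : ((((s.setReg d (e.eval s)).setReg (d + 1) (f.eval s)).setReg d
        (op.eval (e.eval s) (f.eval s))).setReg (d + 1) 0) = s.setReg d ((Ex.o op e f).eval s) := by
      rw [RamState.setReg_comm (by omega), RamState.setReg_setReg,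
        RamState.setReg_comm (by omega), RamState.setReg_setReg]
      exact RamState.setReg_self (by simpa using hz (d + 1) (by omega) (by omega))
    rw [hfin] at h4
    refine ⟨_, .seq h (.seq h' (.seq h3 h4)), ?_⟩
    have := cg.2.2
    simp only [Ex.cost]
    omega
  | .sum x y e, d, s, hw, hd, hde, hs, ho, hz => by
    simp only [Ex.wf, Bool.and_eq_true, decide_eq_true_eq, bne_iff_ne] at hw
    obtain ⟨⟨⟨hx, hy⟩, hxy⟩, hwe⟩ := hw
    simp only [Ex.depth] at hde
    rw [Ex.ok_sum] at ho
    obtain ⟨hok, htot⟩ := ho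
    set N := s.reg y with hN
    have hNW : N < W := hs.1 y
    have hsW : s.reg x < W := hs.1 x
    let ps : ℕ → ℕ := fun i => ∑ j ∈ Finset.range i, e.eval (s.setReg x j)
    have hps : ∀ i ≤ N, ps i < W := fun i hi => lt_of_le_of_lt
      (Finset.sum_le_sum_of_subset (Finset.range_mono hi)) htot
    let S : ℕ → ℕ → RamState := fun i fl =>
      (((s.setReg d (ps i)).setReg (d + 1) (s.reg x)).setReg x i).setReg (d + 2) fl
    have hS : ∀ i ≤ N, ∀ fl < 2, (S i fl).Fits W := fun i hi fl hfl =>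
      (((hs.setReg (hps i hi) d).setReg hsW _).setReg (by omega) _).setReg (by omega) _
    have hloop : ∀ k i, i + k = N → ∃ t, RamRun W (.loop (d + 2) (.seq (e.comp (d + 3))
        (.seq (.instr (.op .add d d (d + 3)))
        (.seq (.instr (.const (d + 3) 1)) (.seq (.instr (.op .add x x (d + 3)))
        (.seq (.instr (.const (d + 3) 0)) (.instr (.op .lt (d + 2) x y))))))))
        (S i (if i < N then 1 else 0)) (S N 0) t ∧
        t ≤ 1 + ∑ j ∈ Finset.Ico i N, 10 * (e.cost (s.setReg x j) + 1) := by
      intro k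
      induction k with
      | zero =>
        intro i hi
        obtain rfl : i = N := by omega
        rw [if_neg (lt_irrefl _)]
        exact ⟨1, .loopStop (by simp [S]), by simp⟩
      | succ k ih =>
        intro i hi
        have hiN : i < N := by omega
        rw [if_pos hiN]
        have hs1 := hS i hiN.le 1 (by omega)
        have cg := Ex.congr_state (W := W) (e := e) (s := s.setReg x i) (s' := S i 1) hwe
          (fun z hz => by
            have h1 : z ≠ d + 2 := by omega
            have h2 : z ≠ d + 1 := by omega
            have h3 : z ≠ d := by omega
            simp [S, h1, h2, h3]) rfl
        have hok1 := cg.2.1 (hok i hiN)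
        obtain ⟨t, h, ht⟩ := comp_run hW e (d + 3) (S i 1) hwe (by omega) (by omega) hs1 hok1
          (fun r h1 h2 => by
            have h3 : r ≠ d + 2 := by omega
            have h4 : r ≠ d + 1 := by omega
            have h5 : r ≠ d := by omega
            have h6 : r ≠ x := by omega
            simp [S, h3, h4, h5, h6, hz r (by omega) h2])
        have hs2 := hs1.setReg (Ex.eval_lt_cap hW hs1 hok1) (d + 3)
        rw [← cg.1] at h hs2
        have e1 : ps i + e.eval (s.setReg x i) = ps (i + 1) :=
          (Finset.sum_range_succ (fun j => e.eval (s.setReg x j)) i).symm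
        have d1 : d ≠ x := by omega
        have d2 : d + 1 ≠ x := by omega
        have d3 : d + 2 ≠ x := by omega
        have d4 : d + 3 ≠ x := by omega
        have y1 : y ≠ d := by omega
        have y2 : y ≠ d + 1 := by omega
        have y3 : y ≠ d + 2 := by omega
        have y4 : y ≠ d + 3 := by omega
        have y5 : y ≠ x := fun h => hxy h.symm
        have hv : ((S i 1).setReg (d + 3) (e.eval (s.setReg x i))).reg d +
            ((S i 1).setReg (d + 3) (e.eval (s.setReg x i))).reg (d + 3) = ps (i + 1) := by
          simp [S, d1, e1]
        have h2 := run_op hs2 (op := .add) (x := d) (y := d) (z := d + 3)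
          (by change _ + _ < W; rw [hv]; exact hps _ hiN)
        simp only [RamOp.eval] at h2
        rw [hv] at h2
        have hs3 := hs2.setReg (hps _ hiN) d
        have h3 := run_const hs3 (k := 1) (by omega) (d + 3)
        have hs4 := hs3.setReg (v := 1) (by omega) (d + 3)
        have hv2 : ∀ u : RamState, u = (((S i 1).setReg (d + 3) (e.eval (s.setReg x i))).setReg d
            (ps (i + 1))).setReg (d + 3) 1 → u.reg x + u.reg (d + 3) = i + 1 := by
          rintro u rfl
          simp [S, d1.symm, d3.symm, d4.symm]
        have h4 := run_op hs4 (op := .add) (x := x) (y := x) (z := d + 3)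
          (by change _ + _ < W; rw [hv2 _ rfl]; omega)
        simp only [RamOp.eval] at h4
        rw [hv2 _ rfl] at h4
        have hs5 := hs4.setReg (v := i + 1) (by omega) x
        have h5 := run_const hs5 (k := 0) (by omega) (d + 3)
        have hs6 := hs5.setReg (v := 0) (by omega) (d + 3)
        have hbd : ∀ a b : ℕ, (if a < b then 1 else 0) < W := fun a b => by
          split_ifs <;> omega
        have h6 := run_op hs6 (op := .lt) (x := d + 2) (y := x) (z := y) (hbd _ _)
        obtain ⟨t', h', ht'⟩ := ih (i + 1) (by omega)
        have hst : ((((((S i 1).setReg (d + 3) (e.eval (s.setReg x i))).setReg d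
            (ps (i + 1))).setReg (d + 3) 1).setReg x (i + 1)).setReg (d + 3) 0) =
            S (i + 1) 1 := by
          simp only [S]
          have hz3 := hz (d + 3) (by omega) (by omega)
          cases s
          simp only [RamState.setReg, RamState.mk.injEq, and_true]
          funext z
          simp only [Function.update_apply]
          simp only at hz3
          by_cases z1 : z = d + 3
          · subst z1; simp [d4, hz3]
          · by_cases z2 : z = x
            · subst z2; simp [d3.symm, z1]
            · by_cases z3 : z = d
              · subst z3; simp [d1]
              · simp [z1, z2, z3]
        rw [hst] at h6
        have hxi : (S (i + 1) 1).reg x = i + 1 := by simp [S, d3.symm]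
        have hyi : (S (i + 1) 1).reg y = N := by simp [S, y1, y2, y3, y5, hN]
        rw [hxi, hyi] at h6
        have hst2 : (S (i + 1) 1).setReg (d + 2) (RamOp.lt.eval (i + 1) N) =
            S (i + 1) (if i + 1 < N then 1 else 0) := RamState.setReg_setReg _ _ _
        rw [hst2] at h6
        refine ⟨_, .loopStep (by simp [S]) (.seq h (.seq h2 (.seq h3 (.seq h4 (.seq
          (hst ▸ h5) h6))))) h', ?_⟩
        rw [Finset.sum_eq_sum_Ico_succ_bot hiN]
        have := cg.2.2
        omega
    obtain ⟨t, h, ht⟩ := hloop N 0 (by omega)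
    have d1 : d ≠ x := by omega
    have d2 : d + 1 ≠ x := by omega
    have d3 : d + 2 ≠ x := by omega
    have g1 := run_const hs (k := 0) (by omega) d
    have hs1 := hs.setReg (v := 0) (by omega) d
    have g2 := run_copy hs1 (d + 1) x
    have q2 : (s.setReg d 0).reg x = s.reg x := by simp [d1.symm]
    rw [q2] at g2
    have hs2 := hs1.setReg hsW (d + 1)
    have g3 := run_const hs2 (k := 0) (by omega) x
    have hs3 := hs2.setReg (v := 0) (by omega) x
    have g4 := run_op hs3 (op := .lt) (x := d + 2) (y := x) (z := y)
      (by simp only [RamOp.eval]; split_ifs <;> omega)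
    have q4 : ((((s.setReg d 0).setReg (d + 1) (s.reg x)).setReg x 0)).reg y = N := by
      have y1 : y ≠ d := by omega
      have y2 : y ≠ d + 1 := by omega
      simp [y1, y2, Ne.symm hxy, hN]
    have q5 : ((((s.setReg d 0).setReg (d + 1) (s.reg x)).setReg x 0)).reg x = 0 := by simp
    rw [q4, q5] at g4
    have hsN := hS N le_rfl 0 (by omega)
    have g5 := run_copy hsN x (d + 1)
    have q6 : (S N 0).reg (d + 1) = s.reg x := by simp [S, d2]
    rw [q6] at g5
    have g6 := run_const (hsN.setReg hsW x) (k := 0) (by omega) (d + 1)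
    have hfin : (((S N 0).setReg x (s.reg x)).setReg (d + 1) 0) =
        s.setReg d ((Ex.sum x y e).eval s) := by
      have z1 := hz (d + 1) (by omega) (by omega)
      have z2 := hz (d + 2) (by omega) (by omega)
      simp only [S]
      change _ = s.setReg d (ps N)
      generalize ps N = A
      cases s
      simp only [RamState.setReg, RamState.mk.injEq, and_true]
      simp only at z1 z2
      funext z
      simp only [Function.update_apply]
      by_cases e1 : z = d + 1
      · subst e1; simp [z1]
      · by_cases e2 : z = d + 2
        · subst e2; simp [z2, d3]
        · by_cases e3 : z = x
          · subst e3; simp [d1.symm, e1]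
          · simp [e1, e2, e3]
    rw [hfin] at g6
    refine ⟨_, .seq g1 (.seq g2 (.seq g3 (.seq g4 (.seq h (.seq g5 g6))))), ?_⟩
    rw [Ex.cost_sum, ← hN]
    rw [← Finset.mul_sum, ← Finset.range_eq_Ico] at ht
    omega

/-! ### Commands -/

namespace RamProg

/-- The program moved to registers and arrays with numbers from `100` on. -/
def shift : RamProg → RamProg
  | skip => skip
  | instr i => instr (match i with
      | .const x c => .const (x + 100) c
      | .copy x y => .copy (x + 100) (y + 100)
      | .op o x y z => .op o (x + 100) (y + 100) (z + 100)
      | .load x a y => .load (x + 100) (a + 100) (y + 100)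
      | .store a x y => .store (a + 100) (x + 100) (y + 100)
      | .wzero x => .wzero (x + 100)
      | .wcopy x y => .wcopy (x + 100) (y + 100)
      | .wplus x y z => .wplus (x + 100) (y + 100) (z + 100)
      | .wle x y z => .wle (x + 100) (y + 100) (z + 100)
      | .wload x a y => .wload (x + 100) (a + 100) (y + 100)
      | .wstore a x y => .wstore (a + 100) (x + 100) (y + 100))
  | seq p q => seq p.shift q.shift
  | ite x p q => ite (x + 100) p.shift q.shift
  | loop x p => loop (x + 100) p.shift

end RamProg

/-- The part of the memory visible to a shifted program. -/
def RamState.view (s : RamState) : RamState where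
  reg x := s.reg (x + 100)
  arr a := s.arr (a + 100)
  wreg x := s.wreg (x + 100)
  warr a := s.warr (a + 100)

/-- Replace the part of the memory visible to a shifted program. -/
def RamState.put (s u : RamState) : RamState where
  reg x := if x < 100 then s.reg x else u.reg (x - 100)
  arr a := if a < 100 then s.arr a else u.arr (a - 100)
  wreg x := if x < 100 then s.wreg x else u.wreg (x - 100)
  warr a := if a < 100 then s.warr a else u.warr (a - 100)

namespace RamState

theorem put_view (s : RamState) : s.put s.view = s := by
  cases s
  simp only [put, view, mk.injEq]
  refine ⟨?_, ?_, ?_, ?_⟩ <;> funext x <;> split_ifs with h <;>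
    first | rfl | simp [Nat.sub_add_cancel (not_lt.1 h)]

theorem view_put (s u : RamState) : (s.put u).view = u := by
  cases u
  simp [put, view]

theorem put_put (s u v : RamState) : (s.put u).put v = s.put v := by
  simp only [put, mk.injEq]
  refine ⟨?_, ?_, ?_, ?_⟩ <;> funext x <;> split_ifs <;> rfl

theorem Fits.view {s : RamState} {W : ℕ} (h : s.Fits W) : s.view.Fits W :=
  ⟨fun _ => h.1 _, fun _ _ => h.2 _ _⟩

theorem Fits.put {s u : RamState} {W : ℕ} (h : s.Fits W) (h' : u.Fits W) : (s.put u).Fits W :=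
  ⟨fun x => by simp only [RamState.put]; split_ifs; exacts [h.1 _, h'.1 _],
    fun a i => by simp only [RamState.put]; split_ifs; exacts [h.2 _ _, h'.2 _ _]⟩

end RamState

theorem RamRun.fits {W : ℕ} {p : RamProg} {s s' : RamState} {t : ℕ} (h : RamRun W p s s' t) :
    s.Fits W → s'.Fits W := by
  induction h with
  | skip => exact id
  | instr i s h => exact fun _ => h
  | seq _ _ h1 h2 => exact h2 ∘ h1
  | iteTrue _ _ h => exact h
  | iteFalse _ _ h => exact h
  | loopStop => exact id
  | loopStep _ _ _ h1 h2 => exact h2 ∘ h1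

theorem RamRun.shift {W : ℕ} {p : RamProg} {u u' : RamState} {t : ℕ} (h : RamRun W p u u' t) :
    ∀ s : RamState, s.view = u → s.Fits W → RamRun W p.shift s (s.put u') t := by
  induction h with
  | skip u => rintro s rfl _; rw [s.put_view]; exact .skip s
  | instr i u h =>
    rintro s rfl hs
    have key : ∀ j : RamInstr, j.exec s = s.put (i.exec s.view) →
        RamRun W (.instr j) s (s.put (i.exec s.view)) 1 := fun j hj => by
      rw [← hj]; exact .instr _ _ (hj ▸ hs.put h)
    apply key
    have sub : ∀ x y : ℕ, ¬ x < 100 → (x - 100 = y ↔ x = y + 100) := fun x y h => by omega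
    have nsub : ∀ x y : ℕ, x < 100 → ¬ x = y + 100 := fun x y h => by omega
    cases i <;> cases s <;> simp only [RamInstr.exec, RamState.put, RamState.view,
      RamState.mk.injEq] <;> refine ⟨?_, ?_, ?_, ?_⟩ <;> funext x <;>
      by_cases hx : x < 100 <;>
      simp +contextual [hx, Function.update_apply, sub, nsub, Nat.sub_add_cancel, not_lt.1] <;>
      (try exact if_congr Iff.rfl (if_congr Iff.rfl rfl rfl) rfl)
  | seq h1 h2 ih1 ih2 =>
    rintro s rfl hs
    have := ih2 (s.put _) (s.view_put _) (hs.put (h1.fits hs.view))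
    rw [s.put_put] at this
    exact .seq (ih1 s rfl hs) this
  | iteTrue hx h ih => rintro s rfl hs; exact .iteTrue hx (ih s rfl hs)
  | iteFalse hx h ih => rintro s rfl hs; exact .iteFalse hx (ih s rfl hs)
  | loopStop hx => rintro s rfl hs; rw [s.put_view]; exact .loopStop hx
  | loopStep hx h1 h2 ih1 ih2 =>
    rintro s rfl hs
    have := ih2 (s.put _) (s.view_put _) (hs.put (h1.fits hs.view))
    rw [s.put_put] at this
    exact .loopStep hx (ih1 s rfl hs) this

/-- Commands; `call P` runs `P` on registers and arrays with numbers from `100` on. -/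
inductive Cmd where
  | skip
  | set (x : ℕ) (e : Ex)
  | sto (a : ℕ) (e f : Ex)
  | seq (p q : Cmd)
  | ite (e : Ex) (p q : Cmd)
  | while (e : Ex) (p : Cmd)
  | wzero (x : ℕ)
  | wcopy (x y : ℕ)
  | wplus (x y z : ℕ)
  | wle (x y z : ℕ)
  | wload (x a : ℕ) (e : Ex)
  | wsto (a : ℕ) (e : Ex) (x : ℕ)
  | call (P : RamProg)
  | blk (p : Cmd)

namespace Cmd

def compile : Cmd → RamProg
  | skip => .skip
  | set x e => .seq (e.comp 50) (.seq (.instr (.copy x 50)) (.instr (.const 50 0)))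
  | sto a e f => .seq (e.comp 50) (.seq (f.comp 51) (.seq (.instr (.store a 50 51))
      (.seq (.instr (.const 50 0)) (.instr (.const 51 0)))))
  | seq p q => .seq p.compile q.compile
  | ite e p q => .seq (e.comp 50) (.ite 50 (.seq (.instr (.const 50 0)) p.compile) q.compile)
  | .while e p => .seq (e.comp 50)
      (.loop 50 (.seq (.instr (.const 50 0)) (.seq p.compile (e.comp 50))))
  | wzero x => .instr (.wzero x)
  | wcopy x y => .instr (.wcopy x y)
  | wplus x y z => .instr (.wplus x y z)
  | wle x y z => .instr (.wle x y z)
  | wload x a e => .seq (e.comp 50) (.seq (.instr (.wload x a 50)) (.instr (.const 50 0)))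
  | wsto a e x => .seq (e.comp 50) (.seq (.instr (.wstore a 50 x)) (.instr (.const 50 0)))
  | call P => P.shift
  | blk p => p.compile

/-- Expressions are well-formed, and registers reserved for temporaries are not written. -/
def wf : Cmd → Bool
  | set x e => (x < 50 || 100 ≤ x) && e.wf && e.depth < 40
  | sto _ e f => e.wf && e.depth < 40 && f.wf && f.depth < 40
  | seq p q => p.wf && q.wf
  | ite e p q => e.wf && e.depth < 40 && p.wf && q.wf
  | .while e p => e.wf && e.depth < 40 && p.wf
  | wle x _ _ => x < 50 || 100 ≤ x
  | wload _ _ e => e.wf && e.depth < 40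
  | wsto _ e _ => e.wf && e.depth < 40
  | blk p => p.wf
  | _ => true

end Cmd

/-- Execution of commands, with cost. -/
inductive Run (W : ℕ) : Cmd → RamState → RamState → ℕ → Prop
  | skip (s) : Run W .skip s s 1
  | set {x e s} (h : e.ok W s) : Run W (.set x e) s (s.setReg x (e.eval s)) (e.cost s + 1)
  | sto {a e f s} (he : e.ok W s) (hf : f.ok W s) :
      Run W (.sto a e f) s (s.setArr a (e.eval s) (f.eval s)) (e.cost s + f.cost s + 1)
  | seq {p q s s₁ s₂ t₁ t₂} (h₁ : Run W p s s₁ t₁) (h₂ : Run W q s₁ s₂ t₂) :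
      Run W (.seq p q) s s₂ (t₁ + t₂)
  | iteTrue {e p q s s₁ t} (he : e.ok W s) (h : e.eval s ≠ 0) (h₁ : Run W p s s₁ t) :
      Run W (.ite e p q) s s₁ (e.cost s + 1 + t)
  | iteFalse {e p q s s₁ t} (he : e.ok W s) (h : e.eval s = 0) (h₁ : Run W q s s₁ t) :
      Run W (.ite e p q) s s₁ (e.cost s + 1 + t)
  | whileStop {e p s} (he : e.ok W s) (h : e.eval s = 0) :
      Run W (.while e p) s s (e.cost s + 1)
  | whileStep {e p s s₁ s₂ t₁ t₂} (he : e.ok W s) (h : e.eval s ≠ 0) (h₁ : Run W p s s₁ t₁)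
      (h₂ : Run W (.while e p) s₁ s₂ t₂) : Run W (.while e p) s s₂ (e.cost s + 1 + t₁ + t₂)
  | wzero (x s) : Run W (.wzero x) s (s.setWreg x 0) 1
  | wcopy (x y s) : Run W (.wcopy x y) s (s.setWreg x (s.wreg y)) 1
  | wplus (x y z s) : Run W (.wplus x y z) s (s.setWreg x (s.wreg y + s.wreg z)) 1
  | wle (x y z s) : Run W (.wle x y z) s (s.setReg x (if s.wreg y ≤ s.wreg z then 1 else 0)) 1
  | wload {x a e s} (he : e.ok W s) :
      Run W (.wload x a e) s (s.setWreg x (s.warr a (e.eval s))) (e.cost s + 1)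
  | wsto {a e x s} (he : e.ok W s) :
      Run W (.wsto a e x) s (s.setWarr a (e.eval s) (s.wreg x)) (e.cost s + 1)
  | call {P s u t} (h : RamRun W P s.view u t) : Run W (.call P) s (s.put u) (t + 1)
  | blk {p s s₁ t} (h : Run W p s s₁ t) : Run W (.blk p) s s₁ t

theorem Run.fits {W : ℕ} (hW : 3 ≤ W) {p : Cmd} {s s' : RamState} {t : ℕ}
    (h : Run W p s s' t) : s.Fits W → s'.Fits W := by
  induction h with
  | skip => exact id
  | set h => exact fun hs => hs.setReg (Ex.eval_lt_cap hW hs h) _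
  | sto he hf => exact fun hs => hs.setArr (Ex.eval_lt_cap hW hs hf) _ _
  | seq _ _ h1 h2 => exact h2 ∘ h1
  | iteTrue _ _ _ h => exact h
  | iteFalse _ _ _ h => exact h
  | whileStop => exact id
  | whileStep _ _ _ _ h1 h2 => exact h2 ∘ h1
  | wle x y z s => exact fun hs => hs.setReg (by split_ifs <;> omega) _
  | call h => exact fun hs => hs.put (h.fits hs.view)
  | blk _ h => exact h
  | _ => exact fun hs => ⟨hs.1, hs.2⟩

def RamState.Clean (s : RamState) : Prop := ∀ r, 50 ≤ r → r < 100 → s.reg r = 0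

theorem RamState.Clean.setReg {s : RamState} (h : s.Clean) {x : ℕ} (hx : x < 50 ∨ 100 ≤ x)
    (v : ℕ) : (s.setReg x v).Clean := fun r h1 h2 => by
  rw [RamState.reg_setReg, if_neg (by omega)]; exact h r h1 h2

/-- Compiled commands do what the commands do, in proportional time. -/
theorem Run.compile {W : ℕ} (hW : 3 ≤ W) {p : Cmd} {s s' : RamState} {t : ℕ}
    (h : Run W p s s' t) : p.wf = true → s.Fits W → s.Clean →
    (∃ t', RamRun W p.compile s s' t' ∧ t' ≤ 10 * t) ∧ s'.Clean := by
  have comp50 : ∀ {e : Ex} {s : RamState}, e.wf = true → e.depth < 40 → s.Fits W → e.ok W s →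
      s.Clean → ∃ t, RamRun W (e.comp 50) s (s.setReg 50 (e.eval s)) t ∧ t ≤ 10 * e.cost s :=
    fun {e s} hw hd hs ho hc => comp_run hW e 50 s hw le_rfl (by omega) hs ho hc
  have clear : ∀ {s : RamState} {v : ℕ}, s.Clean → (s.setReg 50 v).Fits W →
      RamRun W (.instr (.const 50 0)) (s.setReg 50 v) s 1 := fun {s v} hc hf => by
    have := run_const hf (k := 0) (by omega) 50
    rwa [RamState.setReg_setReg, RamState.setReg_self (hc 50 le_rfl (by omega))] at this
  induction h with
  | skip s => exact fun _ _ hc => ⟨⟨1, .skip s, by omega⟩, hc⟩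
  | @set x e s ho =>
    intro hw hs hc
    simp only [Cmd.wf, Bool.and_eq_true, Bool.or_eq_true, decide_eq_true_eq] at hw
    have hc' := hc.setReg hw.1.1 (e.eval s)
    obtain ⟨t, h, ht⟩ := comp50 hw.1.2 hw.2 hs ho hc
    have hv := Ex.eval_lt_cap hW hs ho
    have h2 := run_copy (hs.setReg hv 50) x 50
    simp only [RamState.reg_setReg, if_true] at h2
    rw [RamState.setReg_comm (by omega)] at h2
    exact ⟨⟨_, .seq h (.seq h2 (clear hc' ((hs.setReg hv x).setReg hv 50))), by omega⟩, hc'⟩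
  | @sto a e f s he hf =>
    intro hw hs hc
    simp only [Cmd.wf, Bool.and_eq_true, decide_eq_true_eq] at hw
    obtain ⟨t, h, ht⟩ := comp50 hw.1.1.1 hw.1.1.2 hs he hc
    have hv := Ex.eval_lt_cap hW hs he
    have hv' := Ex.eval_lt_cap hW hs hf
    have hs1 := hs.setReg hv 50
    have cg := Ex.congr_state (W := W) (e := f) (s := s) (s' := s.setReg 50 (e.eval s)) hw.1.2
      (fun x hx => by simp; intro h; omega) rfl
    obtain ⟨t', h', ht'⟩ := comp_run hW f 51 (s.setReg 50 (e.eval s)) hw.1.2 (by omega) (by omega)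
      hs1 (cg.2.1 hf) (fun r h1 h2 => by
        rw [RamState.reg_setReg, if_neg (by omega)]; exact hc r (by omega) h2)
    rw [← cg.1] at h'
    have hs2 := hs1.setReg hv' 51
    have h3 := run_store hs2 a 50 51
    have hs3 := hs2.setArr hv' a (e.eval s)
    have h4 := run_const hs3 (k := 0) (by omega) 50
    have h5 := run_const (hs3.setReg (v := 0) (by omega) 50) (k := 0) (by omega) 51
    have hfin : ((((((s.setReg 50 (e.eval s)).setReg 51 (f.eval s)).setArr a (e.eval s)
        (f.eval s)).setReg 50 0).setReg 51 0)) = s.setArr a (e.eval s) (f.eval s) := by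
      have z1 := hc 50 (by omega) (by omega)
      have z2 := hc 51 (by omega) (by omega)
      generalize e.eval s = A
      generalize f.eval s = B
      cases s
      simp only [RamState.setReg, RamState.setArr, RamState.withArr, RamState.mk.injEq, and_true]
      simp only at z1 z2
      funext z
      simp only [Function.update_apply]
      by_cases e1 : z = 50
      · subst e1; simp [z1]
      · by_cases e2 : z = 51
        · subst e2; simp [z2]
        · simp [e1, e2]
    rw [hfin] at h5
    refine ⟨⟨_, .seq h (.seq h' (.seq h3 (.seq h4 h5))), ?_⟩, hc⟩
    have := cg.2.2
    omega
  | seq h1 _ ih1 ih2 =>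
    intro hw hs hc
    simp only [Cmd.wf, Bool.and_eq_true] at hw
    obtain ⟨⟨t, h, ht⟩, hc1⟩ := ih1 hw.1 hs hc
    obtain ⟨⟨t', h', ht'⟩, hc2⟩ := ih2 hw.2 (h1.fits hW hs) hc1
    exact ⟨⟨_, .seq h h', by omega⟩, hc2⟩
  | @iteTrue e p q s s₁ t₁ he hne h1 ih =>
    intro hw hs hc
    simp only [Cmd.wf, Bool.and_eq_true, decide_eq_true_eq] at hw
    obtain ⟨t, h, ht⟩ := comp50 hw.1.1.1 hw.1.1.2 hs he hc
    obtain ⟨⟨t', h', ht'⟩, hc'⟩ := ih hw.1.2 hs hc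
    have hs1 := hs.setReg (Ex.eval_lt_cap hW hs he) 50
    exact ⟨⟨_, .seq h (.iteTrue (by simpa using hne) (.seq (clear hc hs1) h')), by omega⟩, hc'⟩
  | @iteFalse e p q s s₁ t₁ he hne h1 ih =>
    intro hw hs hc
    simp only [Cmd.wf, Bool.and_eq_true, decide_eq_true_eq] at hw
    obtain ⟨t, h, ht⟩ := comp50 hw.1.1.1 hw.1.1.2 hs he hc
    obtain ⟨⟨t', h', ht'⟩, hc'⟩ := ih hw.2 hs hc
    rw [hne, RamState.setReg_self (hc 50 le_rfl (by omega))] at h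
    exact ⟨⟨_, .seq h (.iteFalse (hc 50 le_rfl (by omega)) h'), by omega⟩, hc'⟩
  | @whileStop e p s he hne =>
    intro hw hs hc
    simp only [Cmd.wf, Bool.and_eq_true, decide_eq_true_eq] at hw
    obtain ⟨t, h, ht⟩ := comp50 hw.1.1 hw.1.2 hs he hc
    rw [hne, RamState.setReg_self (hc 50 le_rfl (by omega))] at h
    exact ⟨⟨_, .seq h (.loopStop (hc 50 le_rfl (by omega))), by omega⟩, hc⟩
  | @whileStep e p s s₁ s₂ t₁ t₂ he hne h1 h2 ih1 ih2 =>
    intro hw hs hc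
    have hw' := hw
    simp only [Cmd.wf, Bool.and_eq_true, decide_eq_true_eq] at hw
    obtain ⟨t, h, ht⟩ := comp50 hw.1.1 hw.1.2 hs he hc
    have hs1 := hs.setReg (Ex.eval_lt_cap hW hs he) 50
    obtain ⟨⟨t', h', ht'⟩, hc'⟩ := ih1 hw.2 hs hc
    obtain ⟨⟨t'', h'', ht''⟩, hc''⟩ := ih2 hw' (h1.fits hW hs) hc'
    cases h'' with
    | seq g1 g2 =>
      exact ⟨⟨_, .seq h (.loopStep (by simpa using hne)
        (.seq (clear hc hs1) (.seq h' g1)) g2), by omega⟩, hc''⟩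
  | wzero x s => exact fun _ hs hc => ⟨⟨1, .instr _ _ ⟨hs.1, hs.2⟩, by omega⟩, hc⟩
  | wcopy x y s => exact fun _ hs hc => ⟨⟨1, .instr _ _ ⟨hs.1, hs.2⟩, by omega⟩, hc⟩
  | wplus x y z s => exact fun _ hs hc => ⟨⟨1, .instr _ _ ⟨hs.1, hs.2⟩, by omega⟩, hc⟩
  | wle x y z s =>
    intro hw hs hc
    simp only [Cmd.wf, Bool.or_eq_true, decide_eq_true_eq] at hw
    exact ⟨⟨1, .instr _ _ (hs.setReg (by split_ifs <;> omega) x), by omega⟩, hc.setReg hw _⟩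
  | @wload x a e s he =>
    intro hw hs hc
    simp only [Cmd.wf, Bool.and_eq_true, decide_eq_true_eq] at hw
    obtain ⟨t, h, ht⟩ := comp50 hw.1 hw.2 hs he hc
    have hs1 := hs.setReg (Ex.eval_lt_cap hW hs he) 50
    have hc' : (s.setWreg x (s.warr a (e.eval s))).Clean := hc
    have h2 : RamRun W (.instr (.wload x a 50)) (s.setReg 50 (e.eval s))
        ((s.setWreg x (s.warr a (e.eval s))).setReg 50 (e.eval s)) 1 := by
      have : ((RamInstr.wload x a 50).exec (s.setReg 50 (e.eval s))).Fits W := ⟨hs1.1, hs1.2⟩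
      have h := RamRun.instr _ _ this
      simpa [RamInstr.exec, RamState.setWreg, RamState.setReg] using h
    exact ⟨⟨_, .seq h (.seq h2 (clear hc' ⟨hs1.1, hs1.2⟩)), by omega⟩, hc'⟩
  | @wsto a e x s he =>
    intro hw hs hc
    simp only [Cmd.wf, Bool.and_eq_true, decide_eq_true_eq] at hw
    obtain ⟨t, h, ht⟩ := comp50 hw.1 hw.2 hs he hc
    have hs1 := hs.setReg (Ex.eval_lt_cap hW hs he) 50
    have hc' : (s.setWarr a (e.eval s) (s.wreg x)).Clean := hc
    have h2 : RamRun W (.instr (.wstore a 50 x)) (s.setReg 50 (e.eval s))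
        ((s.setWarr a (e.eval s) (s.wreg x)).setReg 50 (e.eval s)) 1 := by
      have : ((RamInstr.wstore a 50 x).exec (s.setReg 50 (e.eval s))).Fits W := ⟨hs1.1, hs1.2⟩
      have h := RamRun.instr _ _ this
      simpa [RamInstr.exec, RamState.setWarr, RamState.withWarr, RamState.setReg] using h
    exact ⟨⟨_, .seq h (.seq h2 (clear hc' ⟨hs1.1, hs1.2⟩)), by omega⟩, hc'⟩
  | @call P s u t h =>
    intro _ hs hc
    exact ⟨⟨t, h.shift s rfl hs, by omega⟩, fun r h1 h2 => by
      simp only [RamState.put, if_pos h2]; exact hc r h1 h2⟩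
  | blk _ ih => exact ih

/-! ### Reasoning about commands -/

namespace Cmd

/-- The command may modify register `x`. -/
def mr : Cmd → ℕ → Bool
  | set x _, z => z == x
  | seq p q, z => p.mr z || q.mr z
  | ite _ p q, z => p.mr z || q.mr z
  | .while _ p, z => p.mr z
  | wle x _ _, z => z == x
  | call _, z => 100 ≤ z
  | blk p, z => p.mr z
  | _, _ => false

/-- The command may modify array `a`. -/
def ma : Cmd → ℕ → Bool
  | sto a _ _, z => z == a
  | seq p q, z => p.ma z || q.ma z
  | ite _ p q, z => p.ma z || q.ma z
  | .while _ p, z => p.ma z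
  | call _, z => 100 ≤ z
  | blk p, z => p.ma z
  | _, _ => false

/-- The command may modify weight register `x`. -/
def mw : Cmd → ℕ → Bool
  | wzero x, z => z == x
  | wcopy x _, z => z == x
  | wplus x _ _, z => z == x
  | wload x _ _, z => z == x
  | seq p q, z => p.mw z || q.mw z
  | ite _ p q, z => p.mw z || q.mw z
  | .while _ p, z => p.mw z
  | call _, z => 100 ≤ z
  | blk p, z => p.mw z
  | _, _ => false

/-- The command may modify weight array `a`. -/
def mwa : Cmd → ℕ → Bool
  | wsto a _ _, z => z == a
  | seq p q, z => p.mwa z || q.mwa z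
  | ite _ p q, z => p.mwa z || q.mwa z
  | .while _ p, z => p.mwa z
  | call _, z => 100 ≤ z
  | blk p, z => p.mwa z
  | _, _ => false

end Cmd

/-- The two states differ only where the command may modify the memory. -/
structure Frame (p : Cmd) (s s' : RamState) : Prop where
  r : ∀ {x}, p.mr x = false → s'.reg x = s.reg x
  a : ∀ {x}, p.ma x = false → s'.arr x = s.arr x
  w : ∀ {x}, p.mw x = false → s'.wreg x = s.wreg x
  wa : ∀ {x}, p.mwa x = false → s'.warr x = s.warr x

theorem Frame.trans {p : Cmd} {s s' s'' : RamState} (h : Frame p s s') (h' : Frame p s' s'') :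
    Frame p s s'' :=
  ⟨fun k => (h'.r k).trans (h.r k), fun k => (h'.a k).trans (h.a k),
    fun k => (h'.w k).trans (h.w k), fun k => (h'.wa k).trans (h.wa k)⟩

theorem Frame.weaken {p q : Cmd} {s s' : RamState} (h : Frame p s s')
    (hr : ∀ x, q.mr x = false → p.mr x = false := by simp +contextual [Cmd.mr])
    (ha : ∀ x, q.ma x = false → p.ma x = false := by simp +contextual [Cmd.ma])
    (hw : ∀ x, q.mw x = false → p.mw x = false := by simp +contextual [Cmd.mw])
    (hwa : ∀ x, q.mwa x = false → p.mwa x = false := by simp +contextual [Cmd.mwa]) :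
    Frame q s s' :=
  ⟨fun k => h.r (hr _ k), fun k => h.a (ha _ k), fun k => h.w (hw _ k), fun k => h.wa (hwa _ k)⟩

theorem Run.frame {W : ℕ} {p : Cmd} {s s' : RamState} {t : ℕ} (h : Run W p s s' t) :
    Frame p s s' := by
  induction h with
  | seq _ _ h1 h2 => exact h1.weaken.trans h2.weaken
  | iteTrue _ _ _ h => exact h.weaken
  | iteFalse _ _ _ h => exact h.weaken
  | whileStep _ _ _ _ h1 h2 => exact h1.weaken.trans h2
  | call h =>
    refine ⟨fun hx => ?_, fun hx => ?_, fun hx => ?_, fun hx => ?_⟩ <;>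
      simp only [Cmd.mr, Cmd.ma, Cmd.mw, Cmd.mwa, decide_eq_false_iff_not, not_le] at hx <;>
      simp [RamState.put, hx]
  | blk _ h => exact ⟨h.r, h.a, h.w, h.wa⟩
  | sto he hf =>
    refine ⟨fun _ => rfl, fun hx => ?_, fun _ => rfl, fun _ => rfl⟩
    simp only [Cmd.ma, beq_eq_false_iff_ne] at hx
    funext i
    simp [hx]
  | wsto he =>
    refine ⟨fun _ => rfl, fun _ => rfl, fun _ => rfl, fun hx => ?_⟩
    simp only [Cmd.mwa, beq_eq_false_iff_ne] at hx
    funext i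
    simp [hx]
  | _ =>
    refine ⟨fun hx => ?_, fun hx => ?_, fun hx => ?_, fun hx => ?_⟩ <;>
      simp only [Cmd.mr, Cmd.ma, Cmd.mw, Cmd.mwa, beq_eq_false_iff_ne] at hx <;> simp [hx]

/-- Started in `s` with capacity `W`, the command halts, and the final state and the cost satisfy
`Q`. -/
def Tri (W : ℕ) (p : Cmd) (s : RamState) (Q : RamState → ℕ → Prop) : Prop :=
  3 ≤ W → s.Fits W → ∃ s' t, Run W p s s' t ∧ Q s' t

/-- Weakest preconditions; blocks and loops are not unfolded. -/
def Cmd.wp (W : ℕ) : Cmd → (RamState → ℕ → Prop) → RamState → Prop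
  | skip, Q, s => Q s 1
  | set x e, Q, s => e.ok W s ∧ Q (s.setReg x (e.eval s)) (e.cost s + 1)
  | sto a e f, Q, s => e.ok W s ∧ f.ok W s ∧
      Q (s.setArr a (e.eval s) (f.eval s)) (e.cost s + f.cost s + 1)
  | seq p q, Q, s => p.wp W (fun s₁ t₁ => q.wp W (fun s₂ t₂ => Q s₂ (t₁ + t₂)) s₁) s
  | ite e p q, Q, s => e.ok W s ∧
      (e.eval s ≠ 0 → p.wp W (fun s' t => Q s' (e.cost s + 1 + t)) s) ∧
      (e.eval s = 0 → q.wp W (fun s' t => Q s' (e.cost s + 1 + t)) s)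
  | .while e p, Q, s => Tri W (.while e p) s Q
  | wzero x, Q, s => Q (s.setWreg x 0) 1
  | wcopy x y, Q, s => Q (s.setWreg x (s.wreg y)) 1
  | wplus x y z, Q, s => Q (s.setWreg x (s.wreg y + s.wreg z)) 1
  | wle x y z, Q, s => Q (s.setReg x (if s.wreg y ≤ s.wreg z then 1 else 0)) 1
  | wload x a e, Q, s => e.ok W s ∧ Q (s.setWreg x (s.warr a (e.eval s))) (e.cost s + 1)
  | wsto a e x, Q, s => e.ok W s ∧ Q (s.setWarr a (e.eval s) (s.wreg x)) (e.cost s + 1)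
  | call P, Q, s => Tri W (call P) s Q
  | blk p, Q, s => Tri W p s Q

theorem Tri.mono {W : ℕ} {p : Cmd} {s : RamState} {Q Q' : RamState → ℕ → Prop}
    (h : Tri W p s Q) (hQ : ∀ s' t, s'.Fits W → Frame p s s' → Q s' t → Q' s' t) :
    Tri W p s Q' := fun hW hs => by
  obtain ⟨s', t, hr, hq⟩ := h hW hs
  exact ⟨s', t, hr, hQ s' t (hr.fits hW hs) hr.frame hq⟩

theorem Tri.intro {W : ℕ} {p : Cmd} {s : RamState} {Q : RamState → ℕ → Prop}
    (h : 3 ≤ W → s.Fits W → Tri W p s Q) : Tri W p s Q := fun hW hs => h hW hs hW hs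

theorem Tri.seq {W : ℕ} {p q : Cmd} {s : RamState} {Q : RamState → ℕ → Prop}
    (h : Tri W p s (fun s₁ t₁ => Tri W q s₁ (fun s₂ t₂ => Q s₂ (t₁ + t₂)))) :
    Tri W (.seq p q) s Q := fun hW hs => by
  obtain ⟨s', t, hr, hq⟩ := h hW hs
  obtain ⟨s'', t', hr', hq'⟩ := hq hW (hr.fits hW hs)
  exact ⟨s'', _, .seq hr hr', hq'⟩

theorem Tri.blk {W : ℕ} {p : Cmd} {s : RamState} {Q : RamState → ℕ → Prop}
    (h : Tri W p s Q) : Tri W (.blk p) s Q := fun hW hs => by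
  obtain ⟨s', t, hr, hq⟩ := h hW hs
  exact ⟨s', t, .blk hr, hq⟩

theorem Tri.of_wp {W : ℕ} : ∀ {p : Cmd} {Q : RamState → ℕ → Prop} {s : RamState},
    p.wp W Q s → Tri W p s Q
  | .skip, _, _, h => fun _ _ => ⟨_, _, .skip _, h⟩
  | .set _ _, _, _, h => fun _ _ => ⟨_, _, .set h.1, h.2⟩
  | .sto _ _ _, _, _, h => fun _ _ => ⟨_, _, .sto h.1 h.2.1, h.2.2⟩
  | .seq _ _, _, _, h => .seq (Tri.mono (of_wp h) fun _ _ _ _ h' => of_wp h')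
  | .ite e _ _, _, s, h => fun hW hs => by
    by_cases he : e.eval s = 0
    · obtain ⟨s', t, hr, hq⟩ := of_wp (h.2.2 he) hW hs
      exact ⟨_, _, .iteFalse h.1 he hr, hq⟩
    · obtain ⟨s', t, hr, hq⟩ := of_wp (h.2.1 he) hW hs
      exact ⟨_, _, .iteTrue h.1 he hr, hq⟩
  | .while _ _, _, _, h => h
  | .wzero _, _, _, h => fun _ _ => ⟨_, _, .wzero _ _, h⟩
  | .wcopy _ _, _, _, h => fun _ _ => ⟨_, _, .wcopy _ _ _, h⟩
  | .wplus _ _ _, _, _, h => fun _ _ => ⟨_, _, .wplus _ _ _ _, h⟩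
  | .wle _ _ _, _, _, h => fun _ _ => ⟨_, _, .wle _ _ _ _, h⟩
  | .wload _ _ _, _, _, h => fun _ _ => ⟨_, _, .wload h.1, h.2⟩
  | .wsto _ _ _, _, _, h => fun _ _ => ⟨_, _, .wsto h.1, h.2⟩
  | .call _, _, _, h => h
  | .blk _, _, _, h => .blk h

theorem Tri.while_step {W : ℕ} {e : Ex} {p : Cmd} {s : RamState} {Q : RamState → ℕ → Prop}
    (he : e.ok W s) (h : e.eval s ≠ 0)
    (hp : Tri W p s fun s₁ t₁ => Tri W (.while e p) s₁ fun s₂ t₂ =>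
      Q s₂ (e.cost s + 1 + t₁ + t₂)) : Tri W (.while e p) s Q := fun hW hs => by
  obtain ⟨s', t, hr, hq⟩ := hp hW hs
  obtain ⟨s'', t', hr', hq'⟩ := hq hW (hr.fits hW hs)
  exact ⟨_, _, .whileStep he h hr hr', hq'⟩

theorem Tri.while_stop {W : ℕ} {e : Ex} {p : Cmd} {s : RamState} {Q : RamState → ℕ → Prop}
    (he : e.ok W s) (h : e.eval s = 0) (hQ : Q s (e.cost s + 1)) : Tri W (.while e p) s Q :=
  fun _ _ => ⟨_, _, .whileStop he h, hQ⟩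

theorem Tri.call {W : ℕ} {P : RamProg} {s : RamState} {Q : RamState → ℕ → Prop}
    (h : s.Fits W → ∃ u t, RamRun W P s.view u t ∧ Q (s.put u) (t + 1)) : Tri W (.call P) s Q :=
  fun _ hs => by
    obtain ⟨u, t, hr, hq⟩ := h hs
    exact ⟨_, _, .call hr, hq⟩

/-- Run `p` for all values of register `x` from `0` up to the content of register `y`. -/
def Cmd.loopFor (x y : ℕ) (p : Cmd) : Cmd :=
  .seq (.set x (.c 0)) (.while (.lt (.r x) (.r y)) (.seq p (.set x (.r x + .c 1))))

/-- Run `p` for all values of register `x` from `0` up to the content of register `y`, as a block. -/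
def Cmd.for (x y : ℕ) (p : Cmd) : Cmd := .blk (.loopFor x y p)

@[simp] theorem Cmd.wp_for {W x y : ℕ} {p : Cmd} {Q : RamState → ℕ → Prop} {s : RamState} :
    (Cmd.for x y p).wp W Q s = Tri W (.loopFor x y p) s Q := rfl

/-- Loops with an invariant that may mention the time spent so far. -/
theorem Tri.loop_time {W x y : ℕ} {p : Cmd} {s₀ : RamState} {Q : RamState → ℕ → Prop}
    {N : ℕ} (hN : s₀.reg y = N) (hxy : x ≠ y) (hx : p.mr x = false) (hy : p.mr y = false)
    (I : ℕ → RamState → ℕ → Prop) (h0 : I 0 (s₀.setReg x 0) 0)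
    (hs : ∀ i s t, i < N → s.Fits W → s.reg x = i → Frame (.loopFor x y p) s₀ s →
      I i s t → Tri W p s fun s' t' => I (i + 1) (s'.setReg x (i + 1)) (t + t' + 8))
    (hQ : ∀ s t, s.Fits W → s.reg x = N → Frame (.loopFor x y p) s₀ s → I N s t →
      Q s (t + 6)) : Tri W (.loopFor x y p) s₀ Q := by
  subst hN
  intro hW hf
  have hcost : ∀ s : RamState, (Ex.lt (.r x) (.r y)).cost s = 3 := fun s => by simp
  have hf0 : Frame (.loopFor x y p) s₀ (s₀.setReg x 0) :=
    ⟨fun {z} hz => by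
      rw [RamState.reg_setReg, if_neg]
      rintro rfl; simp [Cmd.loopFor, Cmd.mr] at hz, fun _ => rfl, fun _ => rfl, fun _ => rfl⟩
  have fr : ∀ {s s'}, Frame p s s' → ∀ v, Frame (.loopFor x y p) s (s'.setReg x v) := fun h v =>
    ⟨fun {z} hz => by
      simp only [Cmd.loopFor, Cmd.mr, Bool.or_eq_false_iff, beq_eq_false_iff_ne] at hz
      rw [RamState.reg_setReg, if_neg hz.1]
      exact h.r hz.2.1,
    fun hz => h.a (by simpa [Cmd.loopFor, Cmd.ma] using hz),
    fun hz => h.w (by simpa [Cmd.loopFor, Cmd.mw] using hz),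
    fun hz => h.wa (by simpa [Cmd.loopFor, Cmd.mwa] using hz)⟩
  have hyf : (Cmd.loopFor x y p).mr y = false := by
    simp [Cmd.loopFor, Cmd.mr, hy, hxy.symm]
  have key : ∀ k i s t, i + k = s₀.reg y → s.Fits W → s.reg x = i →
      Frame (.loopFor x y p) s₀ s → I i s t →
      ∃ s' t', Run W (.while (.lt (.r x) (.r y)) (.seq p (.set x (.r x + .c 1)))) s s' t' ∧
        Q s' (t + t' + 2) := by
    intro k
    induction k with
    | zero =>
      intro i s t hi hsf hsx hfr hI
      refine ⟨s, _, .whileStop (by simp) ?_, ?_⟩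
      · have := hfr.r hyf
        simp only [Ex.eval_lt, Ex.eval_r]
        rw [if_neg (by omega)]
      · rw [hcost]
        obtain rfl : i = s₀.reg y := by omega
        exact hQ s t hsf hsx hfr hI
    | succ k ih =>
      intro i s t hi hsf hsx hfr hI
      have h1 := hfr.r hyf
      obtain ⟨s', t', hr, hq⟩ := hs i s t (by omega) hsf hsx hfr hI hW hsf
      have hx' : s'.reg x = i := by rw [hr.frame.r hx, hsx]
      have hsf' := hr.fits hW hsf
      have hiW : i + 1 < W := by have := hf.1 y; omega
      have hinc : Run W (.set x (.r x + .c 1)) s' (s'.setReg x (i + 1)) 4 := by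
        have := Run.set (W := W) (x := x) (e := .r x + .c 1) (s := s')
          (by simp; omega)
        simpa [hx'] using this
      obtain ⟨s'', t'', hr', hq'⟩ := ih (i + 1) (s'.setReg x (i + 1)) (t + t' + 8) (by omega)
        (hsf'.setReg hiW x) (by simp) (hfr.trans (fr hr.frame _)) hq
      refine ⟨s'', _, .whileStep (by simp) ?_ (.seq hr hinc) hr', ?_⟩
      · simp only [Ex.eval_lt, Ex.eval_r]
        rw [if_pos (by omega)]; exact one_ne_zero
      · rw [hcost]
        have : t + (3 + 1 + (t' + 4) + t'') + 2 = t + t' + 8 + t'' + 2 := by omega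
        rw [this]; exact hq'
  obtain ⟨s', t', hr, hq⟩ := key (s₀.reg y) 0 _ 0 (by omega) (hf.setReg (by omega) x) (by simp)
    hf0 h0
  refine ⟨s', _, .seq (Run.set (by simp)) hr, ?_⟩
  convert hq using 1
  simp; omega

/-- Loops with an invariant and a uniform bound on the time of an iteration. -/
theorem Tri.loop {W x y : ℕ} {p : Cmd} {s₀ : RamState} {Q : RamState → ℕ → Prop}
    {N : ℕ} (hN : s₀.reg y = N) (hxy : x ≠ y) (hx : p.mr x = false) (hy : p.mr y = false)
    (I : ℕ → RamState → Prop) (T : ℕ) (h0 : I 0 (s₀.setReg x 0))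
    (hs : ∀ i s, i < N → s.Fits W → s.reg x = i → Frame (.loopFor x y p) s₀ s →
      I i s → Tri W p s fun s' t' => t' ≤ T ∧ I (i + 1) (s'.setReg x (i + 1)))
    (hQ : ∀ s t, s.Fits W → s.reg x = N → Frame (.loopFor x y p) s₀ s → I N s →
      t ≤ N * (T + 8) + 6 → Q s t) : Tri W (.loopFor x y p) s₀ Q :=
  Tri.loop_time hN hxy hx hy (fun i s t => I i s ∧ t ≤ i * (T + 8)) ⟨h0, by simp⟩
    (fun i s t hi hsf hsx hfr hI => (hs i s hi hsf hsx hfr hI.1).mono fun s' t' _ _ h =>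
      ⟨h.2, by have := h.1; have := hI.2; rw [Nat.add_mul]; omega⟩)
    (fun s t hsf hx hfr hI => hQ s _ hsf hx hfr hI.1 (by have := hI.2; omega))

/-- Loops writing the values `g i` to the distinct places `addr i` of an array. -/
theorem Tri.scatter {W x y a : ℕ} {e f : Ex} {s : RamState} {Q : RamState → ℕ → Prop}
    {N : ℕ} (hN : s.reg y = N) (hxy : x ≠ y) (addr g : ℕ → ℕ) (T : ℕ)
    (inj : ∀ i < N, ∀ j < i, addr j ≠ addr i)
    (hb : ∀ i < N, ∀ h : ℕ → ℕ, (∀ j < i, h (addr j) = g j) →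
      (∀ p, (∀ j < i, p ≠ addr j) → h p = s.arr a p) →
      e.ok W ((s.withArr a h).setReg x i) ∧ f.ok W ((s.withArr a h).setReg x i) ∧
      e.eval ((s.withArr a h).setReg x i) = addr i ∧ f.eval ((s.withArr a h).setReg x i) = g i ∧
      e.cost ((s.withArr a h).setReg x i) + f.cost ((s.withArr a h).setReg x i) ≤ T)
    (hQ : ∀ h t, ((s.withArr a h).setReg x (N)).Fits W →
      (∀ j < N, h (addr j) = g j) →
      (∀ p, (∀ j < N, p ≠ addr j) → h p = s.arr a p) → t ≤ N * (T + 9) + 6 →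
      Q ((s.withArr a h).setReg x (N)) t) : Tri W (.loopFor x y (.sto a e f)) s Q := by
  refine Tri.loop hN hxy rfl rfl (fun i s' => ∃ h, (∀ j < i, h (addr j) = g j) ∧
    (∀ p, (∀ j < i, p ≠ addr j) → h p = s.arr a p) ∧ s' = (s.withArr a h).setReg x i) (T + 1)
    ⟨s.arr a, by simp, by simp, by simp [RamState.withArr, RamState.setReg]⟩ ?_ ?_
  · rintro i _ hi hsf - - ⟨h, h1, h2, rfl⟩
    obtain ⟨o1, o2, e1, e2, hc⟩ := hb i hi h h1 h2
    refine Tri.of_wp ⟨o1, o2, by omega, Function.update h (addr i) (g i), ?_, ?_, ?_⟩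
    · intro j hj
      rcases Nat.lt_succ_iff_lt_or_eq.1 hj with hj | rfl
      · rw [Function.update_of_ne (inj i hi j hj), h1 j hj]
      · simp
    · intro p hp
      rw [Function.update_of_ne (hp i (by omega)), h2 p fun j hj => hp j (by omega)]
    · rw [e1, e2]
      simp only [RamState.setReg, RamState.setArr, RamState.withArr, RamState.mk.injEq, and_true]
      constructor <;> funext z <;> simp [Function.update_apply] <;> split_ifs <;> rfl
  · rintro _ t hsf - - ⟨h, h1, h2, rfl⟩ ht
    exact hQ h t hsf h1 h2 ht

/-! ### Tables of distinct rows -/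

theorem idx_lt {i v a n W : ℕ} (hi : i < a) (hv : v < n) (h : a * n ≤ W) : i * n + v < W := by
  have : (i + 1) * n ≤ a * n := Nat.mul_le_mul_right n hi
  rw [Nat.add_mul] at this
  omega

theorem mul_lt_of_idx {i a n W : ℕ} (hi : i < a) (hn : 0 < n) (h : a * n ≤ W) : i * n < W :=
  idx_lt (v := 0) hi hn h

theorem sum_range_indicator_eq {w : ℕ} {p : ℕ → Prop} [DecidablePred p] :
    (∑ v ∈ Finset.range w, if p v then 1 else 0) = w ↔ ∀ v < w, p v := by
  rw [Finset.sum_boole, Nat.cast_id]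
  constructor
  · intro h v hv
    have : Finset.filter p (Finset.range w) = Finset.range w :=
      Finset.eq_of_subset_of_card_le (Finset.filter_subset _ _) (by simp [h])
    have hv' : v ∈ Finset.filter p (Finset.range w) := by rw [this]; simpa using hv
    exact (Finset.mem_filter.1 hv').2
  · intro h
    rw [Finset.filter_true_of_mem (by simpa using h), Finset.card_range]

theorem sum_range_le_one {w : ℕ} {f : ℕ → ℕ} (h : ∀ v < w, f v ≤ 1) :
    ∑ v ∈ Finset.range w, f v ≤ w := by
  have := Finset.sum_le_card_nsmul (Finset.range w) f 1 (by simpa using h)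
  simpa using this

/-- Whether row number `reg 40` of the table in array `a`, with rows of width `reg w`, agrees with
row number `reg y`. -/
def matchEx (a y w : ℕ) : Ex :=
  .eq (.sum 41 w (.eq (.l a (.r 40 * .r w + .r 41)) (.l a (.r y * .r w + .r 41)))) (.r w)

open Classical in
theorem matchEx_spec {W a y w : ℕ} (hy : y < 40) (hw : w < 40) {s : RamState} {B : ℕ}
    (hB : (B + 1) * s.reg w ≤ W) (hyB : s.reg y ≤ B) {j : ℕ} (hj : j ≤ B) (hf : s.Fits W) :
    (matchEx a y w).eval (s.setReg 40 j) =
      (if ∀ v < s.reg w, s.arr a (j * s.reg w + v) = s.arr a (s.reg y * s.reg w + v) then 1 else 0)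
    ∧ (matchEx a y w).ok W (s.setReg 40 j) ∧
    (matchEx a y w).cost (s.setReg 40 j) = s.reg w * 14 + 3 := by
  have h1 : w ≠ 40 := by omega
  have h2 : w ≠ 41 := by omega
  have h3 : y ≠ 40 := by omega
  have h4 : y ≠ 41 := by omega
  refine ⟨?_, ?_, ?_⟩
  · simp only [matchEx, Ex.eval_eq, Ex.eval_sum, RamState.reg_setReg, h1, if_false, Ex.eval_l,
      Ex.eval_add, Ex.eval_mul, Ex.eval_r, h2, h3, h4, RamState.arr_setReg, if_true,
      (by decide : (40 : ℕ) ≠ 41)]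
    exact if_congr sum_range_indicator_eq rfl rfl
  · simp only [matchEx, Ex.ok_eq, Ex.ok_sum, RamState.reg_setReg, h1, if_false, Ex.ok_l,
      Ex.ok_add, Ex.ok_mul, Ex.eval_add, Ex.eval_mul, Ex.eval_r, Ex.ok_r, h2, h3, h4,
      RamState.arr_setReg, if_true, (by decide : (40 : ℕ) ≠ 41), true_and, and_true, Ex.eval_eq,
      Ex.eval_l]
    refine ⟨fun i hi => ⟨⟨?_, ?_⟩, ?_, ?_⟩, ?_⟩
    · exact mul_lt_of_idx (Nat.lt_succ_of_le hj) (by omega) hB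
    · exact idx_lt (Nat.lt_succ_of_le hj) hi hB
    · exact mul_lt_of_idx (Nat.lt_succ_of_le hyB) (by omega) hB
    · exact idx_lt (Nat.lt_succ_of_le hyB) hi hB
    · exact lt_of_le_of_lt (sum_range_le_one fun v _ => by split_ifs <;> omega) (hf.1 w)
  · simp [matchEx, h1]
    ring

/-- The number of rows before row number `reg y` that agree with it. -/
def foundEx (a y w : ℕ) : Ex := .sum 40 y (matchEx a y w)

/-- The sum of the indices of the rows before row number `reg y` that agree with it. -/
def indexEx (a y w : ℕ) : Ex := .sum 40 y (.r 40 * matchEx a y w)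

section Table
variable {W a y w : ℕ} (hy : y < 40) (hw : w < 40) {s : RamState} (hf : s.Fits W)
  (hB : (s.reg y + 1) * s.reg w ≤ W)
include hy hw hf hB

open Classical in
theorem foundEx_spec : ((foundEx a y w).eval s ≠ 0 ↔ ∃ j < s.reg y, ∀ v < s.reg w,
      s.arr a (j * s.reg w + v) = s.arr a (s.reg y * s.reg w + v)) ∧ (foundEx a y w).ok W s ∧
    (foundEx a y w).cost s = s.reg y * (s.reg w * 14 + 4) + 1 := by
  have key := fun {j : ℕ} (hj : j < s.reg y) => matchEx_spec (W := W) (a := a) (y := y) (w := w)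
    hy hw hB le_rfl (j := j) hj.le hf
  refine ⟨?_, ?_, ?_⟩
  · rw [foundEx, Ex.eval_sum, Finset.sum_congr rfl fun j hj => (key (Finset.mem_range.1 hj)).1]
    rw [Finset.sum_boole, Nat.cast_id, Finset.card_ne_zero]
    simp [Finset.Nonempty]
  · rw [foundEx, Ex.ok_sum]
    refine ⟨fun j hj => (key hj).2.1, ?_⟩
    rw [Finset.sum_congr rfl fun j hj => (key (Finset.mem_range.1 hj)).1]
    exact lt_of_le_of_lt (sum_range_le_one fun v _ => by split_ifs <;> omega) (hf.1 y)
  · rw [foundEx, Ex.cost_sum, Finset.sum_congr rfl fun j hj => by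
      rw [(key (Finset.mem_range.1 hj)).2.2]]
    simp
    ring

theorem indexEx_spec {j : ℕ} (hj : j < s.reg y)
    (hv : ∀ i < s.reg y, (∀ v < s.reg w,
      s.arr a (i * s.reg w + v) = s.arr a (s.reg y * s.reg w + v)) ↔ i = j) :
    (indexEx a y w).eval s = j ∧ (indexEx a y w).ok W s ∧
    (indexEx a y w).cost s = s.reg y * (s.reg w * 14 + 6) + 1 := by
  classical
  have key := fun {j : ℕ} (hj : j < s.reg y) => matchEx_spec (W := W) (a := a) (y := y) (w := w)
    hy hw hB le_rfl (j := j) hj.le hf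
  have hev : ∀ i ∈ Finset.range (s.reg y), (Ex.r 40 * matchEx a y w).eval (s.setReg 40 i) =
      if i = j then j else 0 := by
    intro i hi
    rw [Ex.eval_mul, (key (Finset.mem_range.1 hi)).1, Ex.eval_r, RamState.reg_setReg, if_pos rfl]
    by_cases h : i = j
    · rw [if_pos h, if_pos ((hv i (Finset.mem_range.1 hi)).2 h), mul_one, h]
    · rw [if_neg h, if_neg fun h' => h ((hv i (Finset.mem_range.1 hi)).1 h'), mul_zero]
  have hsum : ∑ i ∈ Finset.range (s.reg y), (Ex.r 40 * matchEx a y w).eval (s.setReg 40 i) = j := by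
    rw [Finset.sum_congr rfl hev]
    simp [hj]
  have hyW := hf.1 y
  refine ⟨hsum, ?_, ?_⟩
  · rw [indexEx, Ex.ok_sum, hsum]
    refine ⟨fun i hi => ⟨Ex.ok_r .., (key hi).2.1, ?_⟩, by omega⟩
    have := hev i (Finset.mem_range.2 hi)
    rw [Ex.eval_mul] at this
    rw [this]
    split_ifs <;> omega
  · rw [indexEx, Ex.cost_sum, Finset.sum_congr rfl fun j hj => by
      rw [Ex.cost_mul, (key (Finset.mem_range.1 hj)).2.2]]
    simp
    ring

end Table

/-! ### Neighborhoods across a cut -/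

section Pure
variable {n : ℕ}

/-- The indicator function of a set. -/
def ind (S : Finset (Fin n)) (v : ℕ) : ℕ := if ∃ h : v < n, (⟨v, h⟩ : Fin n) ∈ S then 1 else 0

@[simp] theorem ind_val (S : Finset (Fin n)) (v : Fin n) : ind S v = if v ∈ S then 1 else 0 := by
  simp [ind]

theorem ind_le (S : Finset (Fin n)) (v : ℕ) : ind S v ≤ 1 := by unfold ind; split_ifs <;> omega

theorem ind_inj {S S' : Finset (Fin n)} (h : ∀ v < n, ind S v = ind S' v) : S = S' := by
  ext v
  have := h v v.2
  simp only [ind_val] at this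
  split_ifs at this <;> simp_all

theorem ind_eq_iff {S S' : Finset (Fin n)} : (∀ v < n, ind S v = ind S' v) ↔ S = S' :=
  ⟨ind_inj, by rintro rfl _ _; rfl⟩

variable (G : SimpleGraph (Fin n)) [DecidableRel G.Adj] (A : Finset (Fin n))

/-- The vertices of `A` with a neighbor in `Y`. -/
def nbhd (Y : Finset (Fin n)) : Finset (Fin n) := A.filter fun v => ∃ u ∈ Y, G.Adj u v

/-- All neighborhoods in `A` of subsets of the complement of `A`. -/
def nbhds : Finset (Finset (Fin n)) := Aᶜ.powerset.image (nbhd G A)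

/-- The neighborhoods in `A` of sets of vertices outside of `A` with numbers below `i`. -/
def nbhdsBelow (i : ℕ) : Finset (Finset (Fin n)) :=
  (Aᶜ.filter fun u => u.val < i).powerset.image (nbhd G A)

theorem nbhd_empty : nbhd G A ∅ = ∅ := by simp [nbhd]

theorem nbhd_insert (u : Fin n) (Y : Finset (Fin n)) :
    nbhd G A (insert u Y) = nbhd G A Y ∪ A.filter (G.Adj u) := by
  ext v
  simp only [nbhd, Finset.mem_filter, Finset.mem_insert, Finset.mem_union]
  constructor
  · rintro ⟨hv, w, rfl | hw, h⟩
    · exact .inr ⟨hv, h⟩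
    · exact .inl ⟨hv, w, hw, h⟩
  · rintro (⟨hv, w, hw, h⟩ | ⟨hv, h⟩)
    · exact ⟨hv, w, .inr hw, h⟩
    · exact ⟨hv, u, .inl rfl, h⟩

theorem nbhdsBelow_zero : nbhdsBelow G A 0 = {∅} := by simp [nbhdsBelow, nbhd_empty]

theorem nbhdsBelow_top : nbhdsBelow G A n = nbhds G A := by simp [nbhdsBelow, nbhds]

theorem nbhdsBelow_subset (i : ℕ) : nbhdsBelow G A i ⊆ nbhds G A :=
  Finset.image_subset_image (Finset.powerset_mono.2 (Finset.filter_subset _ _))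

theorem nbhdsBelow_succ_mem {u : Fin n} (hu : u ∈ A) :
    nbhdsBelow G A (u + 1) = nbhdsBelow G A u := by
  unfold nbhdsBelow
  congr 2
  ext v
  simp only [Finset.mem_filter, Finset.mem_compl, Order.lt_add_one_iff]
  refine and_congr_right fun hv => ⟨fun h => lt_of_le_of_ne h fun h' => hv ?_, le_of_lt⟩
  rwa [Fin.ext h']

theorem nbhdsBelow_succ {u : Fin n} (hu : u ∉ A) : nbhdsBelow G A (u + 1) =
    nbhdsBelow G A u ∪ (nbhdsBelow G A u).image (· ∪ A.filter (G.Adj u)) := by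
  have h : (Aᶜ.filter fun v => v.val < u.val + 1) = insert u (Aᶜ.filter fun v => v.val < u.val) := by
    ext v
    simp only [Finset.mem_filter, Finset.mem_compl, Order.lt_add_one_iff, Finset.mem_insert]
    constructor
    · rintro ⟨h1, h2⟩
      rcases h2.lt_or_eq with h | h
      · exact .inr ⟨h1, h⟩
      · exact .inl (Fin.ext h)
    · rintro (rfl | ⟨h1, h2⟩)
      · exact ⟨hu, le_rfl⟩
      · exact ⟨h1, h2.le⟩
  unfold nbhdsBelow
  rw [h, Finset.powerset_insert, Finset.image_union, Finset.image_image, Finset.image_image]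
  congr 1
  exact Finset.image_congr fun Y _ => nbhd_insert G A u Y

theorem image_range_update {α : Type*} [DecidableEq α] (row : ℕ → α) (q : ℕ) (x : α) :
    (Finset.range (q + 1)).image (Function.update row q x) =
      insert x ((Finset.range q).image row) := by
  rw [Finset.range_add_one, Finset.image_insert, Function.update_self]
  congr 1
  refine Finset.image_congr fun i hi => Function.update_of_ne ?_ _ _
  have : i < q := by simpa using hi
  omega

theorem injOn_update {α : Type*} [DecidableEq α] {row : ℕ → α} {q : ℕ} {x : α}
    (h : Set.InjOn row (Set.Iio q)) (hx : x ∉ (Finset.range q).image row) :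
    Set.InjOn (Function.update row q x) (Set.Iio (q + 1)) := by
  have hx' : ∀ i < q, row i ≠ x := fun i hi h' =>
    hx (Finset.mem_image.2 ⟨i, by simpa using hi, h'⟩)
  intro i hi j hj hij
  simp only [Set.mem_Iio] at hi hj
  simp only [Function.update_apply] at hij
  split_ifs at hij with h1 h2 h2
  · omega
  · exact absurd hij.symm (hx' j (by omega))
  · exact absurd hij (hx' i (by omega))
  · exact h (by simp; omega) (by simp; omega) hij

end Pure

/-! ### Listing the neighborhoods -/

/-- Appends to the table in array `5` the union of row `reg 10` and the neighborhood of vertex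
`reg 7`, unless it is already present. -/
def necStep : Cmd :=
  .seq (.for 11 0 (.sto 5 (.r 3 * .r 0 + .r 11) (.lt (.c 0)
    (.l 5 (.r 10 * .r 0 + .r 11) + .l 0 (.r 7 * .r 0 + .r 11) * .l 1 (.r 11)))))
  (.ite (foundEx 5 3 0) .skip (.set 3 (.r 3 + .c 1)))

/-- Lists in array `5` the neighborhoods in the set held in array `1`. -/
def necProg : Cmd :=
  .seq (.for 7 0 (.sto 5 (.r 7) (.c 0))) <| .seq (.set 3 (.c 1)) <|
  .for 7 0 <| .ite (.l 1 (.r 7)) .skip <| .seq (.set 9 (.r 3)) <| .for 10 9 necStep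

section Nec
variable {n : ℕ} (G : SimpleGraph (Fin n)) [DecidableRel G.Adj] (A : Finset (Fin n))

/-- Array `a` starts with `q` different rows of length `n`, the indicator functions of the members
of `F`. -/
structure RamState.Lists (s : RamState) (a q : ℕ) (F : Finset (Finset (Fin n)))
    (row : ℕ → Finset (Fin n)) : Prop where
  inj : Set.InjOn row (Set.Iio q)
  img : (Finset.range q).image row = F
  holds : ∀ i < q, ∀ v < n, s.arr a (i * n + v) = ind (row i) v

theorem RamState.Lists.card {s : RamState} {a q : ℕ} {F : Finset (Finset (Fin n))}
    {row : ℕ → Finset (Fin n)} (h : s.Lists a q F row) : q = F.card := by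
  rw [← h.img, Finset.card_image_of_injOn (by simpa using h.inj), Finset.card_range]

variable {G A}

theorem necStep_spec {W : ℕ} {s : RamState} {F : Finset (Finset (Fin n))}
    {row : ℕ → Finset (Fin n)} {B q j : ℕ} {u : Fin n}
    (hW : (B + 2) * n ≤ W) (hG : s.HoldsGraph G) (hA : s.HoldsSet 1 A) (hn2 : n * n ≤ W)
    (hq : s.reg 3 = q) (hu : s.reg 7 = u) (hj : s.reg 10 = j) (hjq : j < q)
    (hL : s.Lists 5 q F row) (hqB : q ≤ B) (h0 : row 0 = ∅) :
    Tri W necStep s fun s' t => t ≤ 40 * n * (q + 1) + 20 ∧ ∃ row' q', s'.reg 3 = q' ∧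
      s'.Lists 5 q' (insert (row j ∪ A.filter (G.Adj u)) F) row' ∧ row' 0 = ∅ ∧
      (∀ i < q, row' i = row i) ∧ q ≤ q' := by
  refine Tri.intro fun hW3 hf => ?_
  have hn := hG.1
  have hnp : 0 < n := u.pos
  have hnW : n < W := hn ▸ hf.1 0
  have hqW : q < W := hq ▸ hf.1 3
  have hqn : q * n < W := mul_lt_of_idx (by omega) hnp hW
  have hqv : ∀ v < n, q * n + v < W := fun v hv => idx_lt (by omega) hv hW
  have hjn : j * n < W := mul_lt_of_idx (by omega) hnp hW
  have hjv : ∀ v < n, j * n + v < W := fun v hv => idx_lt (by omega) hv hW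
  have hun : u * n < W := mul_lt_of_idx u.2 hnp hn2
  have huv : ∀ v < n, u * n + v < W := fun v hv => idx_lt u.2 hv hn2
  set new := row j ∪ A.filter (G.Adj u) with hnew
  have hlt : ∀ i < q, ∀ v < n, ∀ v', i * n + v ≠ q * n + v' := fun i hi v hv v' => by
    have := idx_lt (W := q * n) hi hv le_rfl
    omega
  refine Tri.of_wp ?_
  simp only [necStep, Cmd.wp, Cmd.wp_for]
  have hmem : ∀ v (hv : v < n), ind new v =
      if (⟨v, hv⟩ : Fin n) ∈ row j ∨ (⟨v, hv⟩ : Fin n) ∈ A ∧ G.Adj u ⟨v, hv⟩ then 1 else 0 :=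
    fun v hv => by simpa [hnew] using ind_val new ⟨v, hv⟩
  refine Tri.scatter hn (by decide) (fun v => q * n + v) (fun v => ind new v) 23
    (by intros; omega) ?_ ?_
  · intro v hv h h1 h2
    have e1 : h (j * n + v) = if (⟨v, hv⟩ : Fin n) ∈ row j then 1 else 0 := by
      rw [h2 _ fun v' _ => hlt j hjq v hv v', hL.holds j hjq v hv, ← ind_val]
    have e2 : s.arr 0 (u * n + v) = if G.Adj u ⟨v, hv⟩ then 1 else 0 := hG.2 u ⟨v, hv⟩
    have e3 : s.arr 1 v = if (⟨v, hv⟩ : Fin n) ∈ A then 1 else 0 := hA ⟨v, hv⟩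
    simp [hn, hq, hu, hj, hqn, hqv v hv, hjn, hjv v hv, hun, huv v hv, e1, e2, e3, hmem v hv]
    refine ⟨⟨?_, ?_⟩, ?_⟩
    · split_ifs <;> omega
    · split_ifs <;> omega
    · by_cases a1 : (⟨v, hv⟩ : Fin n) ∈ row j <;> by_cases a2 : (⟨v, hv⟩ : Fin n) ∈ A <;>
        by_cases a3 : G.Adj u ⟨v, hv⟩ <;> simp [a1, a2, a3]
  · intro h t hf' h1 h2 ht
    set s' := (s.withArr 5 h).setReg 11 n with hs'
    have r0 : s'.reg 0 = n := by simp [hs', hn]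
    have r3 : s'.reg 3 = q := by simp [hs', hq]
    have a5 : s'.arr 5 = h := by simp [hs']
    have hold : ∀ i < q, ∀ v < n, h (i * n + v) = ind (row i) v := fun i hi v hv => by
      rw [h2 _ fun v' _ => hlt i hi v hv v', hL.holds i hi v hv]
    have hB : (s'.reg 3 + 1) * s'.reg 0 ≤ W := by
      rw [r0, r3]
      exact (Nat.mul_le_mul_right n (by omega)).trans hW
    obtain ⟨f1, f2, f3⟩ := foundEx_spec (a := 5) (y := 3) (w := 0) (by omega) (by omega) hf' hB
    rw [r0, r3, a5] at f1
    rw [r0, r3] at f3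
    have hfound : (foundEx 5 3 0).eval s' ≠ 0 ↔ new ∈ F := by
      rw [f1, ← hL.img, Finset.mem_image]
      refine exists_congr fun i => ?_
      rw [Finset.mem_range]
      refine and_congr_right fun hi => ?_
      rw [← ind_eq_iff]
      exact forall₂_congr fun v hv => by rw [hold i hi v hv, h1 v hv]
    refine ⟨f2, fun hne => ⟨?_, row, q, r3, ⟨hL.inj, ?_, ?_⟩, h0, fun _ _ => rfl, le_rfl⟩,
      fun he => ?_⟩
    · rw [f3]; have := Nat.le_mul_of_pos_right q hnp; nlinarith
    · rw [hL.img, Finset.insert_eq_of_mem (hfound.1 hne)]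
    · rw [a5]; exact hold
    · have hnF : new ∉ F := fun h' => hfound.2 h' he
      have hq1 : q + 1 < W := by have := Nat.le_mul_of_pos_right (B + 2) hnp; omega
      simp only [Ex.ok_add, Ex.ok_r, Ex.ok_c, Ex.eval_add, Ex.eval_r, Ex.eval_c, r3, Ex.cost_add,
        Ex.cost_r, Ex.cost_c]
      refine ⟨by simpa using hq1, ?_, Function.update row q new, q + 1, by simp,
        ⟨injOn_update hL.inj (by rwa [hL.img]), ?_, ?_⟩, ?_, ?_, by omega⟩
      · rw [f3]; have := Nat.le_mul_of_pos_right q hnp; nlinarith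
      · rw [image_range_update, hL.img]
      · intro i hi v hv
        rw [RamState.arr_setReg, a5]
        rcases Nat.lt_succ_iff_lt_or_eq.1 hi with hi | rfl
        · rw [hold i hi v hv, Function.update_of_ne (by omega)]
        · rw [h1 v hv, Function.update_self]
      · rw [Function.update_of_ne (by omega), h0]
      · intro i hi
        rw [Function.update_of_ne (by omega)]
theorem HoldsGraph_of_eq {s s' : RamState} (h : s.HoldsGraph G) (h0 : s'.reg 0 = s.reg 0)
    (ha : s'.arr 0 = s.arr 0) : s'.HoldsGraph G := ⟨h0.trans h.1, by rw [ha]; exact h.2⟩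

theorem HoldsSet_of_eq {s s' : RamState} {a : ℕ} (h : s.HoldsSet a A)
    (ha : s'.arr a = s.arr a) : s'.HoldsSet a A := by
  unfold RamState.HoldsSet; rw [ha]; exact h

theorem Lists_of_eq {s s' : RamState} {a q : ℕ} {F : Finset (Finset (Fin n))}
    {row : ℕ → Finset (Fin n)} (h : s.Lists a q F row) (ha : s'.arr a = s.arr a) :
    s'.Lists a q F row := ⟨h.inj, h.img, by rw [ha]; exact h.holds⟩

theorem necProg_spec {W : ℕ} {s : RamState} (hW : ((nbhds G A).card + 2) * n ≤ W)
    (hG : s.HoldsGraph G) (hA : s.HoldsSet 1 A) (hn2 : n * n ≤ W) (hnp : 0 < n) :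
    Tri W necProg s fun s' t => t ≤ 200 * n ^ 2 * ((nbhds G A).card + 1) ^ 2 ∧
      s'.reg 3 = (nbhds G A).card ∧
      ∃ row, s'.Lists 5 (nbhds G A).card (nbhds G A) row ∧ row 0 = ∅ := by
  set B := (nbhds G A).card with hB
  have hn := hG.1
  refine Tri.of_wp ?_
  simp only [necProg, Cmd.wp, Cmd.wp_for]
  refine Tri.scatter hn (by decide) id (fun _ => 0) 2 (by simp; omega) (by simp) ?_
  intro h t₁ _ h1 _ ht₁
  simp only [id] at h1
  refine ⟨by simp, ?_⟩
  refine Tri.loop (N := n) (by simp [hn]) (by decide) rfl rfl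
    (fun i s' => ∃ row q, s'.reg 3 = q ∧ s'.Lists 5 q (nbhdsBelow G A i) row ∧ row 0 = ∅)
    (B * (40 * n * (B + 1) + 28) + 13) ?_ ?_ ?_
  · refine ⟨fun _ => ∅, 1, by simp, ⟨?_, by simp [nbhdsBelow_zero], ?_⟩, rfl⟩
    · intro a ha b hb _
      simp only [Set.mem_Iio] at ha hb; omega
    · intro i hi v hv
      obtain rfl : i = 0 := by omega
      simp [h1 v hv, ind]
  · rintro i s' hi hf hi' hfr ⟨row, q, hq, hL, h0⟩
    have hG' : s'.HoldsGraph G := HoldsGraph_of_eq hG (hfr.r rfl) ((hfr.a rfl).trans (by simp))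
    have hA' : s'.HoldsSet 1 A := HoldsSet_of_eq hA ((hfr.a rfl).trans (by simp))
    obtain ⟨u, rfl⟩ : ∃ u : Fin n, u.val = i := ⟨⟨i, hi⟩, rfl⟩
    have hAu := hA' u
    refine Tri.of_wp ?_
    simp only [Cmd.wp, Cmd.wp_for, Ex.ok_l, Ex.ok_r, Ex.eval_l, Ex.eval_r, hi', hAu, true_and,
      Ex.cost_l, Ex.cost_r]
    by_cases hu : u ∈ A
    · simp only [hu, if_true, ne_eq, one_ne_zero, not_false_eq_true, true_implies, false_implies,
        and_true]
      refine ⟨by omega, row, q, by simp [hq], ?_, h0⟩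
      rw [nbhdsBelow_succ_mem G A hu]
      exact Lists_of_eq hL (by simp)
    · simp only [hu, if_false, ne_eq, not_true, false_implies, true_implies, true_and]
      have hqB : q ≤ B := hL.card.trans_le (Finset.card_le_card (nbhdsBelow_subset G A _))
      refine Tri.loop (N := q) (by simp [hq]) (by decide) rfl rfl
        (fun j s'' => ∃ row' q', s''.reg 3 = q' ∧ s''.Lists 5 q' (nbhdsBelow G A u ∪
          (Finset.range j).image fun k => row k ∪ A.filter (G.Adj u)) row' ∧ row' 0 = ∅ ∧
          (∀ k < q, row' k = row k) ∧ q ≤ q')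
        (40 * n * (B + 1) + 20) ?_ ?_ ?_
      · exact ⟨row, q, by simp [hq], by simpa using Lists_of_eq hL (by simp), h0,
          fun _ _ => rfl, le_rfl⟩
      · rintro j s'' hj hf'' hj' hfr' ⟨row', q', hq', hL', h0', hrow, hle⟩
        have hq'B : q' ≤ B := by
          refine hL'.card.trans_le (Finset.card_le_card ?_)
          refine Finset.union_subset (nbhdsBelow_subset G A _) ?_
          refine subset_trans ?_ (nbhdsBelow_subset G A (u + 1))
          rw [nbhdsBelow_succ G A hu, ← hL.img, Finset.image_image]
          refine subset_trans ?_ Finset.subset_union_right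
          exact Finset.image_subset_image (Finset.range_mono hj.le)
        refine (necStep_spec (u := u) (j := j) hW (HoldsGraph_of_eq hG' ((hfr'.r rfl).trans
          (by simp)) (hfr'.a rfl))
          (HoldsSet_of_eq hA' (hfr'.a rfl)) hn2 hq' ((hfr'.r rfl).trans (by simp [hi'])) hj'
          (by omega) hL' hq'B h0').mono ?_
        rintro s₃ t₃ - - ⟨ht₃, row₃, q₃, hq₃, hL₃, h0₃, hrow₃, hle₃⟩
        refine ⟨ht₃.trans (by gcongr), row₃, q₃, by simp [hq₃], ?_, h0₃,
          fun k hk => (hrow₃ k (by omega)).trans (hrow k hk), by omega⟩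
        rw [Finset.range_add_one, Finset.image_insert, Finset.union_insert]
        rw [hrow j hj] at hL₃
        exact Lists_of_eq hL₃ (by simp)
      · rintro s'' t'' hf'' hx'' hfr'' ⟨row', q', hq', hL', h0', -, -⟩ ht''
        have : q * (40 * n * (B + 1) + 20 + 8) ≤ B * (40 * n * (B + 1) + 28) := by gcongr
        refine ⟨by omega, row', q', by simp [hq'], ?_, h0'⟩
        rw [nbhdsBelow_succ G A hu, ← hL.img, Finset.image_image]
        rw [← hL.img] at hL'
        exact Lists_of_eq hL' (by simp)
  · rintro s' t hf hx hfr ⟨row, q, hq, hL, h0⟩ ht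
    rw [nbhdsBelow_top] at hL
    have hqB : q = B := hL.card
    subst hqB
    refine ⟨?_, hq, row, hL, h0⟩
    simp only [Ex.cost_c]
    have : n ≤ n ^ 2 := Nat.le_self_pow (by omega) n
    have hB1 : 1 ≤ (B + 1) := by omega
    nlinarith [Nat.zero_le (n ^ 2 * B), Nat.zero_le (n ^ 2 * B ^ 2), Nat.zero_le (n * B)]

end Nec

/-! ### Private neighbors -/

section Pure
variable {n : ℕ} (G : SimpleGraph (Fin n)) [DecidableRel G.Adj] (A : Finset (Fin n))

/-- `v` is the only neighbor in `Z` of some vertex outside of `A`. -/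
def HasPrivate (Z : Finset (Fin n)) (v : Fin n) : Prop :=
  ∃ u ∉ A, G.Adj u v ∧ (Z.filter (G.Adj u)).card = 1

open Classical in
/-- The members of `Z` without a private neighbor outside of `A`. -/
noncomputable def peel (Z : Finset (Fin n)) : Finset (Fin n) := Z.filter fun v => ¬ HasPrivate G A Z v

/-- Subsets of `A` all of whose members have private neighbors outside of `A`. -/
noncomputable def goods : Finset (Finset (Fin n)) := A.powerset.filter fun S => peel G A S = ∅

noncomputable def goodsBelow (i : ℕ) : Finset (Finset (Fin n)) :=
  (A.filter fun u => u.val < i).powerset.filter fun S => peel G A S = ∅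

variable {G A}

theorem peel_eq_empty_mono {S S' : Finset (Fin n)} (h : S ⊆ S') (h' : peel G A S' = ∅) :
    peel G A S = ∅ := by
  simp only [peel, Finset.filter_eq_empty_iff, not_not] at h' ⊢
  intro v hv
  obtain ⟨u, hu, huv, hc⟩ := h' (h hv)
  refine ⟨u, hu, huv, le_antisymm ?_ ?_⟩
  · rw [← hc]; exact Finset.card_le_card (Finset.filter_subset_filter _ h)
  · exact Finset.card_pos.2 ⟨v, by simp [hv, huv]⟩

theorem goodsBelow_zero : goodsBelow G A 0 = {∅} := by
  have : (A.filter fun u => u.val < 0) = ∅ := by simp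
  rw [goodsBelow, this, Finset.powerset_empty, Finset.filter_singleton]
  simp [peel]

theorem goodsBelow_top : goodsBelow G A n = goods G A := by simp [goodsBelow, goods]

theorem goodsBelow_subset (i : ℕ) : goodsBelow G A i ⊆ goods G A :=
  Finset.filter_subset_filter _ (Finset.powerset_mono.2 (Finset.filter_subset _ _))

theorem notMem_of_goodsBelow {u : Fin n} {S : Finset (Fin n)} (h : S ∈ goodsBelow G A u) :
    u ∉ S := fun hu => by
  have := (Finset.mem_powerset.1 (Finset.mem_filter.1 h).1) hu
  simp at this

theorem goodsBelow_succ_notMem {u : Fin n} (hu : u ∉ A) :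
    goodsBelow G A (u + 1) = goodsBelow G A u := by
  unfold goodsBelow
  congr 2
  ext v
  simp only [Finset.mem_filter, Order.lt_add_one_iff]
  refine and_congr_right fun hv => ⟨fun h => lt_of_le_of_ne h fun h' => hu ?_, le_of_lt⟩
  rwa [← Fin.ext h']

theorem goodsBelow_succ {u : Fin n} (hu : u ∈ A) : goodsBelow G A (u + 1) =
    goodsBelow G A u ∪ ((goodsBelow G A u).image (insert u)).filter fun S => peel G A S = ∅ := by
  have h : (A.filter fun v => v.val < u.val + 1) = insert u (A.filter fun v => v.val < u.val) := by
    ext v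
    simp only [Finset.mem_filter, Order.lt_add_one_iff, Finset.mem_insert]
    constructor
    · rintro ⟨h1, h2⟩
      rcases h2.lt_or_eq with h | h
      · exact .inr ⟨h1, h⟩
      · exact .inl (Fin.ext h)
    · rintro (rfl | ⟨h1, h2⟩)
      · exact ⟨hu, le_rfl⟩
      · exact ⟨h1, h2.le⟩
  unfold goodsBelow
  rw [h, Finset.powerset_insert, Finset.filter_union]
  congr 1
  ext S
  simp only [Finset.mem_filter, Finset.mem_image]
  constructor
  · rintro ⟨⟨S', h1, rfl⟩, h2⟩
    exact ⟨⟨S', ⟨h1, peel_eq_empty_mono (Finset.subset_insert _ _) h2⟩, rfl⟩, h2⟩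
  · rintro ⟨⟨S', ⟨h1, -⟩, rfl⟩, h2⟩
    exact ⟨⟨S', h1, rfl⟩, h2⟩

end Pure

section Sums
variable {n : ℕ} {G : SimpleGraph (Fin n)} [DecidableRel G.Adj]

theorem sum_indicator_eq_card {f : ℕ → ℕ} {p : Fin n → Prop} [DecidablePred p]
    (h : ∀ v : Fin n, f v = if p v then 1 else 0) :
    ∑ v ∈ Finset.range n, f v = (Finset.univ.filter p).card := by
  rw [Finset.sum_range, Finset.sum_congr rfl fun v _ => h v, Finset.sum_boole, Nat.cast_id]

theorem sum_set_eq_card {s : RamState} {a : ℕ} {Z : Finset (Fin n)} (h : s.HoldsSet a Z) :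
    ∑ v ∈ Finset.range n, s.arr a v = Z.card := by
  rw [sum_indicator_eq_card h]; simp

theorem card_lt_cap {W : ℕ} (hn : n < W) (Z : Finset (Fin n)) : Z.card < W :=
  lt_of_le_of_lt (Finset.card_le_univ _) (by simpa using hn)

end Sums

/-- Writes row `reg 10` of the table in array `9` together with vertex `reg 7` as row `reg 13`, and
keeps this row if all its members have private neighbors. -/
def goodStep (peelP : Cmd) : Cmd :=
  .seq (.for 11 0 (.sto 9 (.r 13 * .r 0 + .r 11)
    (.l 9 (.r 10 * .r 0 + .r 11) + .eq (.r 11) (.r 7)))) <|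
  .seq (.for 11 0 (.sto 7 (.r 11) (.l 9 (.r 13 * .r 0 + .r 11)))) <| .seq (.blk peelP) <|
  .ite (.sum 40 0 (.l 7 (.r 40))) .skip <|
  .seq (.set 15 (.sum 40 0 (.l 9 (.r 13 * .r 0 + .r 40)))) <|
  .seq (.ite (.lt (.r 14) (.r 15)) (.set 14 (.r 15)) .skip) (.set 13 (.r 13 + .c 1))

/-- Lists in array `9` the subsets of the set held in array `1` all of whose members have private
neighbors, and computes their maximum size in register `14`. -/
def goodProg (peelP : Cmd) : Cmd :=
  .seq (.for 7 0 (.sto 9 (.r 7) (.c 0))) <| .seq (.set 13 (.c 1)) <| .seq (.set 14 (.c 0)) <|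
  .for 7 0 <| .ite (.l 1 (.r 7)) (.seq (.set 9 (.r 13)) <| .for 10 9 (goodStep peelP)) .skip

/-- Replaces the set held in array `7` by the set of its members without private neighbors outside
of the set held in array `1`. -/
def peelProg : Cmd :=
  .seq (.for 12 0 (.sto 6 (.r 12) ((.c 1 - .l 1 (.r 12)) *
    .sum 40 0 (.l 0 (.r 12 * .r 0 + .r 40) * .l 7 (.r 40)))))
  (.for 12 0 (.sto 7 (.r 12) (.l 7 (.r 12) *
    .eq (.sum 40 0 (.l 0 (.r 40 * .r 0 + .r 12) * .eq (.l 6 (.r 40)) (.c 1))) (.c 0))))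

section Peel
variable {n : ℕ} {G : SimpleGraph (Fin n)} [DecidableRel G.Adj] {A : Finset (Fin n)}

theorem peelProg_spec {W : ℕ} {s : RamState} {Z : Finset (Fin n)}
    (hG : s.HoldsGraph G) (hA : s.HoldsSet 1 A) (hn2 : n * n ≤ W) (hnp : 0 < n)
    (hZ : s.HoldsSet 7 Z) :
    Tri W peelProg s fun s' t => t ≤ 100 * n ^ 2 ∧ s'.HoldsSet 7 (peel G A Z) := by
  classical
  refine Tri.intro fun hW3 hf => ?_
  have hn := hG.1
  have hnW : n < W := hn ▸ hf.1 0
  have hun : ∀ u < n, u * n < W := fun u hu => mul_lt_of_idx hu hnp hn2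
  have huv : ∀ u < n, ∀ v < n, u * n + v < W := fun u hu v hv => idx_lt hu hv hn2
  refine Tri.of_wp ?_
  simp only [peelProg, Cmd.wp, Cmd.wp_for]
  have hsum : ∀ u : Fin n, ∑ v ∈ Finset.range n, s.arr 0 (u * n + v) * s.arr 7 v =
      (Z.filter (G.Adj u)).card := fun u => by
    rw [sum_indicator_eq_card (p := fun v => v ∈ Z ∧ G.Adj u v)]
    · congr 1; ext v; simp
    · intro v
      rw [hG.2, hZ]
      by_cases h1 : G.Adj u v <;> by_cases h2 : v ∈ Z <;> simp [h1, h2]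
  have hle : ∀ u : Fin n, ∀ v < n, s.arr 0 (u * n + v) ≤ 1 ∧ s.arr 7 v ≤ 1 := fun u v hv => by
    have h1 := hG.2 u ⟨v, hv⟩
    have h2 := hZ ⟨v, hv⟩
    simp only at h1 h2
    rw [h1, h2]; split_ifs <;> omega
  refine Tri.scatter hn (by decide) id (fun u => if h : u < n then if (⟨u, h⟩ : Fin n) ∈ A then 0
    else (Z.filter (G.Adj ⟨u, h⟩)).card else 0) (12 * n + 20) (by simp; omega) ?_ ?_
  · intro u hu h _ _
    have e1 := hA ⟨u, hu⟩
    simp only at e1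
    have e2 := hsum ⟨u, hu⟩
    simp only at e2
    have e3 := card_lt_cap hnW (Z.filter (G.Adj ⟨u, hu⟩))
    have hmul : ∀ v < n, s.arr 0 (u * n + v) * s.arr 7 v < W := fun v hv => by
      have := hle ⟨u, hu⟩ v hv
      simp only at this
      have := Nat.mul_le_mul this.1 this.2
      omega
    by_cases hA' : (⟨u, hu⟩ : Fin n) ∈ A
    · simp [hn, hu, e1, e2, hA', hun u hu, e3]
      exact ⟨⟨fun v hv => ⟨huv u hu v hv, hmul v hv⟩, by omega⟩, by ring_nf; omega⟩
    · simp [hn, hu, e1, e2, hA', hun u hu, e3]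
      exact ⟨fun v hv => ⟨huv u hu v hv, hmul v hv⟩, by ring_nf; omega⟩
  intro h t₁ hf₁ h1 h2 ht₁
  simp only [id] at h1
  have hsum2 : ∀ v : Fin n, v ∈ Z →
      ((∑ u ∈ Finset.range n, s.arr 0 (u * n + v) * if h u = 1 then 1 else 0) = 0 ↔
      v ∈ peel G A Z) := fun v hv => by
    rw [sum_indicator_eq_card (p := fun u : Fin n => u ∉ A ∧ G.Adj u v ∧
      (Z.filter (G.Adj u)).card = 1)]
    · rw [Finset.card_eq_zero, Finset.filter_eq_empty_iff]
      simp [peel, HasPrivate, hv]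
    · intro u
      rw [hG.2, h1 u u.2]
      by_cases h1 : G.Adj u v <;> by_cases h2 : u ∈ A <;> simp [h1, h2]
  refine Tri.scatter (N := n) (by simp [hn]) (by decide) id
    (fun v => if h : v < n then if (⟨v, h⟩ : Fin n) ∈ peel G A Z then 1 else 0 else 0) (14 * n + 20)
    (by simp; omega) ?_ ?_
  · intro v hv h' g1 g2
    have e1 : h' v = if (⟨v, hv⟩ : Fin n) ∈ Z then 1 else 0 := by
      rw [g2 v (fun j hj => by simp; omega)]
      simpa using hZ ⟨v, hv⟩
    have e2 := hsum2 ⟨v, hv⟩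
    simp only at e2
    have hmul : ∀ u < n, (s.arr 0 (u * n + v) * if h u = 1 then 1 else 0) ≤ 1 := fun u hu => by
      have := (hle ⟨u, hu⟩ v hv).1
      simp only at this
      split_ifs <;> omega
    have htot := sum_range_le_one hmul
    have hmul' : ∀ u < n, (s.arr 0 (u * n + v) * if h u = 1 then 1 else 0) < W := fun u hu => by
      have := hmul u hu; omega
    have htot' := htot.trans_lt hnW
    refine ⟨by simp, ?_, by simp, ?_, ?_⟩
    · simp only [Ex.ok_mul, Ex.ok_l, Ex.ok_r, Ex.ok_eq, Ex.ok_sum, Ex.ok_add, Ex.ok_c, Ex.eval_add,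
        Ex.eval_mul, Ex.eval_r, Ex.eval_l, Ex.eval_eq, Ex.eval_c, Ex.eval_sum]
      simp [hn, e1]
      refine ⟨⟨fun i hi => ⟨⟨hun i hi, huv i hi v hv⟩, by simpa using hmul' i hi⟩,
        by simpa using htot'⟩, by split_ifs <;> omega⟩
    · simp only [Ex.eval_add,
        Ex.eval_mul, Ex.eval_r, Ex.eval_l, Ex.eval_eq, Ex.eval_c, Ex.eval_sum]
      by_cases hvZ : (⟨v, hv⟩ : Fin n) ∈ Z
      · have e2 := e2 hvZ
        by_cases hvP : (⟨v, hv⟩ : Fin n) ∈ peel G A Z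
        · have e2 := e2.2 hvP
          simp [hn, e1, hv, hvZ, hvP] at e2 ⊢
          exact e2
        · have e2 := (not_congr e2).2 hvP
          simp [hn, e1, hv, hvZ, hvP] at e2 ⊢
          exact e2
      · have : (⟨v, hv⟩ : Fin n) ∉ peel G A Z := fun h => hvZ (Finset.mem_filter.1 h).1
        simp [hn, e1, hvZ, this]
    · simp [hn]
      ring_nf; omega
  · intro h' t₂ _ g1 g2 ht₂
    refine ⟨by nlinarith, fun v => ?_⟩
    have := g1 v v.2
    simpa using this


theorem peel_iterate_spec {W : ℕ} {s : RamState} {Z : Finset (Fin n)}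
    (hG : s.HoldsGraph G) (hA : s.HoldsSet 1 A) (hn2 : n * n ≤ W) (hnp : 0 < n)
    (hZ : s.HoldsSet 7 Z) :
    Tri W (.loopFor 13 0 peelProg) s fun s' t => t ≤ 120 * n ^ 3 ∧
      s'.HoldsSet 7 ((peel G A)^[n] Z) := by
  refine Tri.loop hG.1 (by decide) rfl rfl (fun i s' => s'.HoldsSet 7 ((peel G A)^[i] Z))
    (100 * n ^ 2) (HoldsSet_of_eq hZ (by simp)) ?_ ?_
  · intro i s' hi hf hi' hfr hI
    refine (peelProg_spec (HoldsGraph_of_eq hG (hfr.r rfl) (hfr.a rfl))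
      (HoldsSet_of_eq hA (hfr.a rfl)) hn2 hnp hI).mono ?_
    rintro s₁ t₁ - - ⟨h1, h2⟩
    refine ⟨h1, HoldsSet_of_eq ?_ (s := s₁) (by simp)⟩
    rwa [Function.iterate_succ_apply']
  · intro s' t hf hx hfr hI ht
    refine ⟨ht.trans ?_, hI⟩
    have h1 : n * (100 * n ^ 2) = 100 * n ^ 3 := by ring
    have h2 : n ≤ n ^ 3 := Nat.le_self_pow (by omega) n
    rw [Nat.mul_add, h1]
    omega


theorem goodStep_spec {W : ℕ} {s : RamState} {F : Finset (Finset (Fin n))}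
    {row : ℕ → Finset (Fin n)} {B q j : ℕ} {u : Fin n}
    (hW : (B + 2) * n ≤ W) (hG : s.HoldsGraph G) (hA : s.HoldsSet 1 A) (hn2 : n * n ≤ W)
    (hq : s.reg 13 = q) (hu : s.reg 7 = u) (hj : s.reg 10 = j) (hjq : j < q)
    (hL : s.Lists 9 q F row) (hqB : q ≤ B) (huj : u ∉ row j) (hnF : insert u (row j) ∉ F)
    (hmu : s.reg 14 = F.sup Finset.card) :
    Tri W (goodStep peelProg) s fun s' t => t ≤ 300 * n ^ 2 ∧ ∃ row' q', s'.reg 13 = q' ∧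
      s'.Lists 9 q' (F ∪ ({insert u (row j)} : Finset _).filter fun S => peel G A S = ∅) row' ∧
      (∀ i < q, row' i = row i) ∧ q ≤ q' ∧ s'.reg 14 =
        (F ∪ ({insert u (row j)} : Finset _).filter fun S => peel G A S = ∅).sup Finset.card := by
  refine Tri.intro fun hW3 hf => ?_
  have hn := hG.1
  have hnp : 0 < n := u.pos
  have hnW : n < W := hn ▸ hf.1 0
  have hqW : q < W := hq ▸ hf.1 13
  have hqn : q * n < W := mul_lt_of_idx (by omega) hnp hW
  have hqv : ∀ v < n, q * n + v < W := fun v hv => idx_lt (by omega) hv hW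
  have hjn : j * n < W := mul_lt_of_idx (by omega) hnp hW
  have hjv : ∀ v < n, j * n + v < W := fun v hv => idx_lt (by omega) hv hW
  set new := insert u (row j) with hnew
  have hlt : ∀ i < q, ∀ v < n, ∀ v', i * n + v ≠ q * n + v' := fun i hi v hv v' => by
    have := idx_lt (W := q * n) hi hv le_rfl
    omega
  refine Tri.of_wp ?_
  simp only [goodStep, Cmd.wp, Cmd.wp_for]
  have hmem : ∀ v (hv : v < n), ind new v =
      (if (⟨v, hv⟩ : Fin n) ∈ row j then 1 else 0) + if v = u then 1 else 0 := fun v hv => by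
    have := ind_val new ⟨v, hv⟩
    simp only at this
    rw [this, hnew]
    by_cases h1 : v = u
    · obtain rfl : u = ⟨v, hv⟩ := Fin.ext h1.symm
      simp [huj]
    · have : (⟨v, hv⟩ : Fin n) ≠ u := fun h => h1 (by rw [← h])
      simp [h1, this]
  refine Tri.scatter hn (by decide) (fun v => q * n + v) (fun v => ind new v) 20
    (by intros; omega) ?_ ?_
  · intro v hv h h1 h2
    have e1 : h (j * n + v) = if (⟨v, hv⟩ : Fin n) ∈ row j then 1 else 0 := by
      rw [h2 _ fun v' _ => hlt j hjq v hv v', hL.holds j hjq v hv, ← ind_val]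
    simp [hn, hq, hu, hj, hqn, hqv v hv, hjn, hjv v hv, e1, hmem v hv]
    split_ifs <;> omega
  intro h t₁ hf₁ h1 h2 ht₁
  have hold : ∀ i < q, ∀ v < n, h (i * n + v) = ind (row i) v := fun i hi v hv => by
    rw [h2 _ fun v' _ => hlt i hi v hv v', hL.holds i hi v hv]
  refine Tri.scatter (N := n) (by simp [hn]) (by decide) id (fun v => ind new v) 10
    (by simp; omega) ?_ ?_
  · intro v hv h' g1 g2
    simp [hn, hq, hqn, hqv v hv, h1 v hv]
  intro h' t₂ hf₂ g1 g2 ht₂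
  set s₂ := (((s.withArr 9 h).setReg 11 n).withArr 7 h').setReg 11 n with hs₂
  refine (peelProg_spec (s := s₂) (A := A) (HoldsGraph_of_eq hG (by simp [hs₂]) (by simp [hs₂]))
    (HoldsSet_of_eq hA (by simp [hs₂])) hn2 hnp (Z := new) (fun v => ?_)).mono ?_
  · have := g1 v v.2
    simpa [hs₂] using this
  rintro s₃ t₃ hf₃ hfr₃ ⟨ht₃, hZ₃⟩
  have r0 : s₃.reg 0 = n := (hfr₃.r rfl).trans (by simp [hs₂, hn])
  have r13 : s₃.reg 13 = q := (hfr₃.r rfl).trans (by simp [hs₂, hq])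
  have r14 : s₃.reg 14 = F.sup Finset.card := (hfr₃.r rfl).trans (by simp [hs₂, hmu])
  have a9 : s₃.arr 9 = h := (hfr₃.a rfl).trans (by simp [hs₂])
  have e7 := sum_set_eq_card hZ₃
  have hnn : n ≤ n ^ 2 := Nat.le_self_pow (by omega) n
  have hcard : ∑ v ∈ Finset.range n, h (q * n + v) = new.card := by
    rw [Finset.sum_congr rfl fun v hv => h1 v (Finset.mem_range.1 hv)]
    rw [sum_indicator_eq_card (fun v => ind_val new v)]; simp
  have hcW := card_lt_cap hnW new
  have hcW' := card_lt_cap hnW (peel G A new)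
  simp [r0, r13, r14, a9, e7, hqn, hcard, hcW, hcW']
  refine ⟨fun hne => ⟨?_, row, ⟨hL.inj, ?_, ?_⟩, fun _ _ => rfl, ?_⟩, fun he => ?_⟩
  · nlinarith
  · rw [hL.img, Finset.filter_singleton, if_neg hne, Finset.union_empty]
  · rw [a9]; exact hold
  · rw [Finset.filter_singleton, if_neg hne, Finset.union_empty]
  · have hq1 : q + 1 < W := by have := Nat.le_mul_of_pos_right (B + 2) hnp; omega
    rw [Finset.filter_singleton, if_pos he]
    have hL' : ∀ s' : RamState, s'.arr 9 = h →
        s'.Lists 9 (q + 1) (F ∪ {new}) (Function.update row q new) := fun s' hs' => by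
      refine ⟨injOn_update hL.inj (by rwa [hL.img]), ?_, ?_⟩
      · rw [image_range_update, hL.img, Finset.union_comm]; rfl
      · intro i hi v hv
        rw [hs']
        rcases Nat.lt_succ_iff_lt_or_eq.1 hi with hi | rfl
        · rw [hold i hi v hv, Function.update_of_ne (by omega)]
        · rw [h1 v hv, Function.update_self]
    refine ⟨hqv, fun hlt' => ⟨hq1, ?_, _, hL' _ (by simp [a9]), ?_, ?_⟩,
      fun hlt' => ⟨hq1, ?_, _, hL' _ (by simp [a9]), ?_, ?_⟩⟩
    · linarith
    · intro i hi; rw [Function.update_of_ne (by omega)]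
    · rw [Finset.sup_union, Finset.sup_singleton]; exact (sup_eq_right.2 hlt'.le).symm
    · linarith
    · intro i hi; rw [Function.update_of_ne (by omega)]
    · rw [Finset.sup_union, Finset.sup_singleton]; exact (sup_eq_left.2 hlt').symm

theorem goodProg_spec {W : ℕ} {s : RamState} (hW : ((goods G A).card + 2) * n ≤ W)
    (hG : s.HoldsGraph G) (hA : s.HoldsSet 1 A) (hn2 : n * n ≤ W) (hnp : 0 < n) :
    Tri W (goodProg peelProg) s fun s' t => t ≤ 400 * n ^ 3 * ((goods G A).card + 1) ∧
      s'.reg 14 = (goods G A).sup Finset.card := by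
  set B := (goods G A).card with hB
  have hn := hG.1
  refine Tri.of_wp ?_
  simp only [goodProg, Cmd.wp, Cmd.wp_for]
  refine Tri.scatter hn (by decide) id (fun _ => 0) 2 (by simp; omega) (by simp) ?_
  intro h t₁ _ h1 _ ht₁
  simp only [id] at h1
  refine ⟨by simp, by simp, ?_⟩
  refine Tri.loop (N := n) (by simp [hn]) (by decide) rfl rfl
    (fun i s' => ∃ row q, s'.reg 13 = q ∧ s'.Lists 9 q (goodsBelow G A i) row ∧
      s'.reg 14 = (goodsBelow G A i).sup Finset.card)
    (B * (300 * n ^ 2 + 8) + 13) ?_ ?_ ?_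
  · refine ⟨fun _ => ∅, 1, by simp, ⟨?_, by simp [goodsBelow_zero], ?_⟩,
      by simp [goodsBelow_zero]⟩
    · intro a ha b hb _
      simp only [Set.mem_Iio] at ha hb; omega
    · intro i hi v hv
      obtain rfl : i = 0 := by omega
      simp [h1 v hv, ind]
  · rintro i s' hi hf hi' hfr ⟨row, q, hq, hL, h14⟩
    have hG' : s'.HoldsGraph G := HoldsGraph_of_eq hG (hfr.r rfl) ((hfr.a rfl).trans (by simp))
    have hA' : s'.HoldsSet 1 A := HoldsSet_of_eq hA ((hfr.a rfl).trans (by simp))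
    obtain ⟨u, rfl⟩ : ∃ u : Fin n, u.val = i := ⟨⟨i, hi⟩, rfl⟩
    have hAu := hA' u
    refine Tri.of_wp ?_
    simp only [Cmd.wp, Cmd.wp_for, Ex.ok_l, Ex.ok_r, Ex.eval_l, Ex.eval_r, hi', hAu, true_and,
      Ex.cost_l, Ex.cost_r]
    by_cases hu : u ∈ A
    · simp only [hu, if_true, ne_eq, one_ne_zero, not_false_eq_true, true_implies, false_implies,
        and_true]
      have hqB : q ≤ B := hL.card.trans_le (Finset.card_le_card (goodsBelow_subset _))
      have hinj : ∀ j k : ℕ, j < q → k < q → insert u (row j) = insert u (row k) → j = k := by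
        have hmem : ∀ j < q, u ∉ row j := fun j hj => notMem_of_goodsBelow (hL.img ▸
          Finset.mem_image_of_mem row (Finset.mem_range.2 hj))
        intro j k hj hk h
        refine hL.inj hj hk ?_
        rw [← Finset.erase_insert (hmem j hj), h, Finset.erase_insert (hmem k hk)]
      have hmem : ∀ j < q, row j ∈ goodsBelow G A u := fun j hj => hL.img ▸
          Finset.mem_image_of_mem row (Finset.mem_range.2 hj)
      let F : ℕ → Finset (Finset (Fin n)) := fun j => goodsBelow G A u ∪
          ((Finset.range j).image fun k => insert u (row k)).filter fun S => peel G A S = ∅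
      have hFmono : ∀ j ≤ q, F j ⊆ F q := fun j hj => Finset.union_subset_union_right
        (Finset.filter_subset_filter _ (Finset.image_subset_image (Finset.range_mono hj)))
      have hFq : F q = goodsBelow G A (u + 1) := by
        rw [goodsBelow_succ hu]
        simp only [F]
        conv_rhs => rw [← hL.img, Finset.image_image]
        rw [hL.img]; rfl
      refine Tri.loop (N := q) (by simp [hq]) (by decide) rfl rfl
        (fun j s'' => ∃ row' q', s''.reg 13 = q' ∧ s''.Lists 9 q' (F j) row' ∧
          (∀ k < q, row' k = row k) ∧ q ≤ q' ∧ s''.reg 14 = (F j).sup Finset.card)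
        (300 * n ^ 2) ?_ ?_ ?_
      · exact ⟨row, q, by simp [hq], by simpa [F] using Lists_of_eq hL (by simp),
          fun _ _ => rfl, le_rfl, by simp [F, h14]⟩
      · rintro j s'' hj hf'' hj' hfr' ⟨row', q', hq', hL', hrow, hle, h14'⟩
        have hq'B : q' ≤ B := by
          refine hL'.card.trans_le (Finset.card_le_card ((hFmono j hj.le).trans ?_))
          rw [hFq]; exact goodsBelow_subset _
        have huj := notMem_of_goodsBelow (hmem j hj)
        refine (goodStep_spec (u := u) (j := j) hW (HoldsGraph_of_eq hG' ((hfr'.r rfl).trans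
          (by simp)) (hfr'.a rfl))
          (HoldsSet_of_eq hA' (hfr'.a rfl)) hn2 hq' ((hfr'.r rfl).trans (by simp [hi'])) hj'
          (by omega) hL' hq'B (by rwa [hrow j hj]) ?_ h14').mono ?_
        · rw [hrow j hj]
          simp only [F, Finset.mem_union, Finset.mem_filter, Finset.mem_image, Finset.mem_range,
            not_or]
          refine ⟨fun h => notMem_of_goodsBelow h (Finset.mem_insert_self _ _), ?_⟩
          rintro ⟨⟨k, hk, hk'⟩, -⟩
          have := hinj k j (by omega) hj hk'
          omega
        have hFs : F (j + 1) = F j ∪ ({insert u (row j)} : Finset _).filter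
            fun S => peel G A S = ∅ := by
          simp only [F]
          rw [Finset.range_add_one, Finset.image_insert, Finset.insert_eq, Finset.filter_union,
            Finset.union_assoc]
          congr 1
          exact Finset.union_comm _ _
        rintro s₃ t₃ - - ⟨ht₃, row₃, q₃, hq₃, hL₃, hrow₃, hle₃, h14₃⟩
        rw [hrow j hj, ← hFs] at hL₃ h14₃
        exact ⟨ht₃, row₃, q₃, by simp [hq₃], Lists_of_eq hL₃ (by simp),
          fun k hk => (hrow₃ k (by omega)).trans (hrow k hk), by omega, by simpa using h14₃⟩
      · rintro s'' t'' hf'' hx'' hfr'' ⟨row', q', hq', hL', -, -, h14'⟩ ht''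
        have : q * (300 * n ^ 2 + 8) ≤ B * (300 * n ^ 2 + 8) := by gcongr
        rw [hFq] at hL' h14'
        exact ⟨by omega, row', q', by simp [hq'], Lists_of_eq hL' (by simp), by simpa using h14'⟩
    · simp only [hu, if_false, ne_eq, not_true, false_implies, true_implies, true_and]
      refine ⟨by omega, row, q, by simp [hq], ?_, ?_⟩
      · rw [goodsBelow_succ_notMem hu]
        exact Lists_of_eq hL (by simp)
      · rw [goodsBelow_succ_notMem hu]
        simpa using h14
  · rintro s' t hf hx hfr ⟨row, q, hq, hL, h14⟩ ht
    rw [goodsBelow_top] at hL h14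
    refine ⟨?_, h14⟩
    simp only [Ex.cost_c]
    have h1 : n ≤ n ^ 3 := Nat.le_self_pow (by omega) n
    have h2 : n * (B * (300 * n ^ 2 + 8) + 13 + 8) = 300 * (n ^ 3 * B) + 8 * (n * B) + 21 * n := by
      ring
    have h3 : n * B ≤ n ^ 3 * B := Nat.mul_le_mul_right B h1
    nlinarith

end Peel

/-! ### Recursive Gaussian elimination -/

/-- Rows of a matrix over the two-element field, together with pivots: `flag r = 1` if row `r` has
the pivot `piv r`. -/
structure ElimState where
  row : ℕ → ℕ → ZMod 2
  flag : ℕ → ZMod 2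
  piv : ℕ → ℕ

/-- Size `0`: look for a pivot of row `dst`. Otherwise: add a combination of the `size` rows
starting with `src` to each of the `size` rows starting with `dst`. -/
structure ElimTask where
  size : ℕ
  dst : ℕ
  src : ℕ

namespace ElimTask

def shift (d : ℕ) (T : ElimTask) : ElimTask := ⟨T.size, T.dst + d, T.src + d⟩

/-- The effect of a task on matrices with `D` columns. -/
def Step (D : ℕ) (T : ElimTask) (a b : ElimState) : Prop :=
  if T.size = 0 then
    b.row = a.row ∧ (∀ r ≠ T.dst, b.flag r = a.flag r ∧ b.piv r = a.piv r) ∧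
      (b.flag T.dst = 1 ∧ b.piv T.dst < D ∧ a.row T.dst (b.piv T.dst) = 1 ∨
        b.flag T.dst = 0 ∧ a.row T.dst = 0)
  else
    b.flag = a.flag ∧ b.piv = a.piv ∧ (∀ r, (∀ k < T.size, r ≠ T.dst + k) → b.row r = a.row r) ∧
    ∀ k < T.size, b.row (T.dst + k) = a.row (T.dst + k) + ∑ l ∈ Finset.range T.size,
      (a.flag (T.src + l) * a.row (T.dst + k) (a.piv (T.src + l))) • a.row (T.src + l)

def Steps (D : ℕ) : List ElimTask → ElimState → ElimState → Prop
  | [], a, b => b = a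
  | T :: l, a, b => ∃ c, T.Step D a c ∧ Steps D l c b

theorem steps_append {D : ℕ} {l l' : List ElimTask} {a b : ElimState} :
    Steps D (l ++ l') a b ↔ ∃ c, Steps D l a c ∧ Steps D l' c b := by
  induction l generalizing a with
  | nil => simp [Steps]
  | cons T l ih =>
    simp only [List.cons_append, Steps, ih]
    constructor
    · rintro ⟨c, h, d, h', h''⟩; exact ⟨d, ⟨c, h, h'⟩, h''⟩
    · rintro ⟨d, ⟨c, h, h'⟩, h''⟩; exact ⟨c, h, d, h', h''⟩

theorem steps_singleton {D : ℕ} {T : ElimTask} {a b : ElimState} :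
    Steps D [T] a b ↔ T.Step D a b := by
  simp [Steps]

end ElimTask

open ElimTask in
/-- The tasks that eliminate in the `2 ^ J` rows starting with `lo`. -/
def elimTasks (lo : ℕ) : ℕ → List ElimTask
  | 0 => [⟨0, lo, lo⟩]
  | J + 1 => elimTasks lo J ++ [⟨2 ^ J, lo + 2 ^ J, lo⟩] ++
      (elimTasks lo J).map (shift (2 ^ J)) ++ [⟨2 ^ J, lo, lo + 2 ^ J⟩]

theorem elimTasks_shift (lo d J : ℕ) :
    (elimTasks lo J).map (ElimTask.shift d) = elimTasks (lo + d) J := by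
  induction J generalizing d with
  | zero => rfl
  | succ J ih =>
    have h1 : ((elimTasks lo J).map (ElimTask.shift (2 ^ J))).map (ElimTask.shift d) =
        (elimTasks (lo + d) J).map (ElimTask.shift (2 ^ J)) := by
      rw [← ih, List.map_map, List.map_map]
      refine List.map_congr_left fun T _ => ?_
      simp [ElimTask.shift]; omega
    simp only [elimTasks, List.map_append, h1, ih d, List.map_cons, List.map_nil, ElimTask.shift]
    rw [Nat.add_right_comm lo (2 ^ J) d]

theorem elimTasks_length (lo J : ℕ) : (elimTasks lo J).length + 2 = 3 * 2 ^ J := by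
  induction J with
  | zero => rfl
  | succ J ih => simp [elimTasks, pow_succ]; omega

/-- `b` arises from `a` by elimination in the `s` rows starting with `lo`. -/
structure Eliminated (D lo s : ℕ) (a b : ElimState) : Prop where
  frame : ∀ r, (r < lo ∨ lo + s ≤ r) →
    b.row r = a.row r ∧ b.flag r = a.flag r ∧ b.piv r = a.piv r
  mem : ∀ r, lo ≤ r → r < lo + s →
    b.row r ∈ Submodule.span (ZMod 2) (a.row '' Set.Ico lo (lo + s))
  flag : ∀ r, lo ≤ r → r < lo + s → b.flag r = 0 ∨ b.flag r = 1 ∧ b.piv r < D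
  red : ∀ r r', lo ≤ r → r < lo + s → lo ≤ r' → r' < lo + s → b.flag r' = 1 →
    b.row r (b.piv r') = if r = r' then 1 else 0
  drop : ∀ r, lo ≤ r → r < lo + s → b.flag r = 0 →
    a.row r ∈ Submodule.span (ZMod 2) (a.row '' Set.Ico lo r)

theorem eval_mem_span {S : Set (ℕ → ZMod 2)} {p : ℕ} (h : ∀ v ∈ S, v p = 0) {v : ℕ → ZMod 2}
    (hv : v ∈ Submodule.span (ZMod 2) S) : v p = 0 := by
  have : Submodule.span (ZMod 2) S ≤ LinearMap.ker (LinearMap.proj p : (ℕ → ZMod 2) →ₗ[ZMod 2] ZMod 2) :=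
    Submodule.span_le.2 fun v hv => h v hv
  exact this hv

/-- Clearing the pivots of the `s` rows starting with `src` in the rows starting with `dst`. -/
theorem ElimTask.Step.cleared {D dst src s : ℕ} {a b : ElimState} (hs : s ≠ 0)
    (h : ElimTask.Step D ⟨s, dst, src⟩ a b)
    (hred : ∀ r r', src ≤ r → r < src + s → src ≤ r' → r' < src + s → a.flag r' = 1 →
      a.row r (a.piv r') = if r = r' then 1 else 0) :
    (∀ r, (r < dst ∨ dst + s ≤ r) → b.row r = a.row r) ∧
    (∀ r, dst ≤ r → r < dst + s →
      b.row r - a.row r ∈ Submodule.span (ZMod 2) (a.row '' Set.Ico src (src + s)) ∧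
      (∀ p, (∀ r', src ≤ r' → r' < src + s → a.row r' p = 0) → b.row r p = a.row r p) ∧
      ∀ r', src ≤ r' → r' < src + s → a.flag r' = 1 → b.row r (a.piv r') = 0) := by
  simp only [Step, if_neg hs] at h
  obtain ⟨-, -, h1, h2⟩ := h
  refine ⟨fun r hr => h1 r fun k hk => by omega, fun r hr hr' => ?_⟩
  obtain ⟨k, rfl⟩ := Nat.exists_eq_add_of_le hr
  have hk := h2 k (by omega)
  refine ⟨?_, ?_, ?_⟩
  · rw [hk, add_sub_cancel_left]
    refine Submodule.sum_mem _ fun l hl => Submodule.smul_mem _ _ (Submodule.subset_span ?_)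
    exact ⟨src + l, ⟨by omega, by have := Finset.mem_range.1 hl; omega⟩, rfl⟩
  · intro p hp
    rw [hk, Pi.add_apply, Finset.sum_apply, Finset.sum_eq_zero, add_zero]
    intro l hl
    rw [Pi.smul_apply, hp _ (by omega) (by have := Finset.mem_range.1 hl; omega), smul_zero]
  · intro r' h3 h4 hf
    obtain ⟨m, rfl⟩ := Nat.exists_eq_add_of_le h3
    rw [hk, Pi.add_apply, Finset.sum_apply, Finset.sum_eq_single m]
    · rw [Pi.smul_apply, hred _ _ h3 h4 h3 h4 hf, if_pos rfl, hf, one_mul, smul_eq_mul, mul_one]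
      exact CharTwo.add_self_eq_zero _
    · intro l hl hlm
      have := Finset.mem_range.1 hl
      rw [Pi.smul_apply, hred _ _ (by omega) (by omega) h3 h4 hf, if_neg (by omega), smul_zero]
    · intro h; exact absurd (Finset.mem_range.2 (by omega)) h

theorem span_image_mono {f : ℕ → ℕ → ZMod 2} {S S' : Set ℕ} (h : S ⊆ S') :
    Submodule.span (ZMod 2) (f '' S) ≤ Submodule.span (ZMod 2) (f '' S') :=
  Submodule.span_mono (Set.image_mono h)

theorem eliminated_tasks {D J lo : ℕ} {a b : ElimState}
    (h : ElimTask.Steps D (elimTasks lo J) a b) : Eliminated D lo (2 ^ J) a b := by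
  induction J generalizing lo a b with
  | zero =>
    rw [elimTasks, ElimTask.steps_singleton] at h
    simp only [ElimTask.Step, if_true] at h
    obtain ⟨h1, h2, h3⟩ := h
    refine ⟨fun r hr => ⟨by rw [h1], h2 r (by omega)⟩, fun r hr hr' => ?_, fun r hr hr' => ?_,
      fun r r' hr hr' hs hs' hf => ?_, fun r hr hr' hf => ?_⟩
    · rw [h1]; exact Submodule.subset_span ⟨r, ⟨hr, hr'⟩, rfl⟩
    · obtain rfl : r = lo := by omega
      rcases h3 with h3 | h3
      · exact .inr ⟨h3.1, h3.2.1⟩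
      · exact .inl h3.1
    · obtain rfl : r = lo := by omega
      obtain rfl : r' = r := by omega
      rcases h3 with h3 | h3
      · rw [h1, h3.2.2, if_pos rfl]
      · rw [h3.1] at hf; exact absurd hf (by decide)
    · obtain rfl : r = lo := by omega
      rcases h3 with h3 | h3
      · rw [h3.1] at hf; exact absurd hf (by decide)
      · rw [h3.2]; exact Submodule.zero_mem _
  | succ J ih =>
    rw [elimTasks, elimTasks_shift, ElimTask.steps_append, ] at h
    obtain ⟨c₃, h, h4⟩ := h
    rw [ElimTask.steps_append] at h
    obtain ⟨c₂, h, h3⟩ := h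
    rw [ElimTask.steps_append] at h
    obtain ⟨c₁, h1, h2⟩ := h
    rw [ElimTask.steps_singleton] at h2 h4
    have e1 := ih h1
    have e3 := ih h3
    have hs : 2 ^ J ≠ 0 := by positivity
    have hpow : 2 ^ (J + 1) = 2 ^ J + 2 ^ J := by ring
    rw [hpow]
    have f2 : c₂.flag = c₁.flag ∧ c₂.piv = c₁.piv := by
      simp only [ElimTask.Step, if_neg hs] at h2; exact ⟨h2.1, h2.2.1⟩
    have f4 : b.flag = c₃.flag ∧ b.piv = c₃.piv := by
      simp only [ElimTask.Step, if_neg hs] at h4; exact ⟨h4.1, h4.2.1⟩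
    generalize 2 ^ J = s at *
    obtain ⟨g2, g2'⟩ := h2.cleared hs e1.red
    obtain ⟨g4, g4'⟩ := h4.cleared hs e3.red
    -- the first block is not changed by the second and third phase
    have k2 : ∀ r, lo ≤ r → r < lo + s → c₂.row r = c₁.row r := fun r hr hr' => g2 r (.inl hr')
    have k3 : ∀ r, lo ≤ r → r < lo + s → c₃.row r = c₁.row r := fun r hr hr' =>
      (e3.frame r (.inl hr')).1.trans (k2 r hr hr')
    have l3 : ∀ r, lo ≤ r → r < lo + s → c₃.flag r = c₁.flag r ∧ c₃.piv r = c₁.piv r :=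
      fun r hr hr' => ⟨((e3.frame r (.inl hr')).2.1).trans (by rw [f2.1]),
        ((e3.frame r (.inl hr')).2.2).trans (by rw [f2.2])⟩
    have hA1 : Submodule.span (ZMod 2) (c₁.row '' Set.Ico lo (lo + s)) ≤
        Submodule.span (ZMod 2) (a.row '' Set.Ico lo (lo + s)) :=
      Submodule.span_le.2 (by rintro _ ⟨r, hr, rfl⟩; exact e1.mem r hr.1 hr.2)
    have hA1r : ∀ r, lo + s ≤ r → Submodule.span (ZMod 2) (a.row '' Set.Ico lo (lo + s)) ≤
        Submodule.span (ZMod 2) (a.row '' Set.Ico lo r) := fun r hr =>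
      span_image_mono (Set.Ico_subset_Ico_right hr)
    have hsub : ∀ r, lo + s ≤ r → r < lo + s + s → c₂.row r - a.row r ∈
        Submodule.span (ZMod 2) (a.row '' Set.Ico lo (lo + s)) := fun r hr hr' => by
      have := hA1 (g2' r hr hr').1
      rwa [(e1.frame r (.inr hr)).1] at this
    have hA2 : ∀ r, lo + s ≤ r → r ≤ lo + s + s →
        Submodule.span (ZMod 2) (c₂.row '' Set.Ico (lo + s) r) ≤
        Submodule.span (ZMod 2) (a.row '' Set.Ico lo r) := fun r hr hr' =>
      Submodule.span_le.2 (by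
        rintro _ ⟨r', hr1, rfl⟩
        have h5 : a.row r' ∈ Submodule.span (ZMod 2) (a.row '' Set.Ico lo r) :=
          Submodule.subset_span ⟨r', ⟨by have := hr1.1; omega, hr1.2⟩, rfl⟩
        have h6 := hA1r r hr (hsub r' hr1.1 (by have := hr1.2; omega))
        have := Submodule.add_mem _ h6 h5
        simpa using this)
    have hsecond : ∀ r, lo + s ≤ r → r < lo + s + s → b.row r = c₃.row r := fun r hr hr' =>
      g4 r (.inr hr)
    -- the second block vanishes at the pivots of the first block
    have hz3 : ∀ r, lo + s ≤ r → r < lo + s + s → ∀ r', lo ≤ r' → r' < lo + s →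
        c₁.flag r' = 1 → c₃.row r (c₁.piv r') = 0 := fun r hr hr' r' hs1 hs2 hf => by
      refine eval_mem_span ?_ (e3.mem r hr hr')
      rintro _ ⟨r₁, hr₁, rfl⟩
      exact (g2' r₁ hr₁.1 hr₁.2).2.2 r' hs1 hs2 hf
    refine ⟨fun r hr => ?_, fun r hr hr' => ?_, fun r hr hr' => ?_,
      fun r r' hr hr' hs1 hs2 hf => ?_, fun r hr hr' hf => ?_⟩
    · have h5 := e1.frame r (by omega)
      have h6 := e3.frame r (by omega)
      rw [g2 r (by omega), f2.1, f2.2] at h6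
      rw [g4 r (by omega), f4.1, f4.2]
      exact ⟨h6.1.trans h5.1, h6.2.1.trans h5.2.1, h6.2.2.trans h5.2.2⟩
    · have hA2' := hA2 (lo + s + s) (by omega) le_rfl
      rw [← add_assoc]
      have hA3 : ∀ r, lo + s ≤ r → r < lo + s + s → c₃.row r ∈
          Submodule.span (ZMod 2) (a.row '' Set.Ico lo (lo + s + s)) := fun r hr hr' =>
        hA2' (e3.mem r hr hr')
      rcases lt_or_ge r (lo + s) with h5 | h5
      · have h6 := (g4' r hr h5).1
        rw [k3 r hr h5] at h6
        have h7 := hA1r (lo + s + s) (by omega) (e1.mem r hr h5)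
        have h8 : b.row r - c₁.row r ∈
            Submodule.span (ZMod 2) (a.row '' Set.Ico lo (lo + s + s)) := by
          refine Submodule.span_le.2 ?_ h6
          rintro _ ⟨r', hr1, rfl⟩
          exact hA3 r' hr1.1 hr1.2
        have := Submodule.add_mem _ h8 h7
        simpa using this
      · rw [hsecond r h5 (by omega)]; exact hA3 r h5 (by omega)
    · rw [f4.1, f4.2]
      rcases lt_or_ge r (lo + s) with h5 | h5
      · rw [(l3 r hr h5).1, (l3 r hr h5).2]; exact e1.flag r hr h5
      · exact e3.flag r h5 (by omega)
    · rw [f4.1] at hf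
      rw [f4.2]
      rcases lt_or_ge r' (lo + s) with h5 | h5
      · rw [(l3 r' hs1 h5).2]
        rw [(l3 r' hs1 h5).1] at hf
        rcases lt_or_ge r (lo + s) with h6 | h6
        · rw [(g4' r hr h6).2.1 _ fun r₁ hr₁ hr₁' => hz3 r₁ hr₁ hr₁' r' hs1 h5 hf, k3 r hr h6]
          exact e1.red r r' hr h6 hs1 h5 hf
        · rw [hsecond r h6 (by omega), hz3 r h6 (by omega) r' hs1 h5 hf, if_neg (by omega)]
      · rcases lt_or_ge r (lo + s) with h6 | h6
        · rw [(g4' r hr h6).2.2 r' h5 (by omega) hf, if_neg (by omega)]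
        · rw [hsecond r h6 (by omega)]
          exact e3.red r r' h6 (by omega) h5 (by omega) hf
    · rw [f4.1] at hf
      rcases lt_or_ge r (lo + s) with h5 | h5
      · rw [(l3 r hr h5).1] at hf
        exact e1.drop r hr h5 hf
      · have h6 := hA2 r h5 (by omega) (e3.drop r h5 (by omega) hf)
        have h7 := hA1r r h5 (hsub r h5 (by omega))
        have := Submodule.sub_mem _ h6 h7
        simpa using this

open Classical in
/-- Rows with pivots have different pivots. -/
theorem Eliminated.card_flag_le {D s c : ℕ} {a b : ElimState} (h : Eliminated D 0 s a b)
    (hc : ∀ r < s, ∀ j, c ≤ j → a.row r j = 0) :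
    ((Finset.range s).filter fun r => b.flag r = 1).card ≤ c := by
  rw [← Finset.card_range c]
  refine Finset.card_le_card_of_injOn b.piv ?_ ?_
  · intro r hr
    simp only [Finset.coe_filter, Finset.mem_range, Set.mem_ofPred_eq] at hr
    simp only [Finset.coe_range, Set.mem_Iio]
    by_contra hlt
    have h1 := h.red r r (by omega) (by omega) (by omega) (by omega) hr.2
    rw [if_pos rfl, eval_mem_span (S := a.row '' Set.Ico 0 (0 + s)) ?_
      (h.mem r (by omega) (by omega))] at h1
    · exact absurd h1 (by decide)
    · rintro _ ⟨r', hr', rfl⟩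
      exact hc r' (by have := hr'.2; omega) _ (by omega)
  · intro r hr r' hr' he
    simp only [Finset.coe_filter, Finset.mem_range, Set.mem_ofPred_eq] at hr hr'
    have h1 := h.red r r' (by omega) (by omega) (by omega) (by omega) hr'.2
    have h2 := h.red r r (by omega) (by omega) (by omega) (by omega) hr.2
    rw [← he, h2, if_pos rfl] at h1
    by_contra hne
    rw [if_neg hne] at h1
    exact absurd h1 (by decide)

/-! ### Elimination on the machine -/

/-- Look for a pivot of row `reg 34`. -/
def pivotProg : Cmd :=
  .seq (.sto 21 (.r 34) (.c 0)) <|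
  .for 36 4 <| .ite (.l 13 (.r 34 * .r 4 + .r 36))
    (.seq (.sto 21 (.r 34) (.c 1)) (.sto 20 (.r 34) (.r 36))) .skip

/-- Number `reg 36` of the places of block `reg 39` of the `reg 33` rows starting with `reg x`. -/
def blockEx (x : ℕ) : Ex := (.r x + .r 36 / .r 33) * .r 4 + (.r 39 * .r 33 + .r 36 % .r 33)

/-- Adds the product of the matrix in array `19` and of block `reg 39` of the rows starting with
`reg 35` to the same block of the rows starting with `reg 34`. -/
def blockProg (P : RamProg) : Cmd :=
  .seq (.for 36 37 (.sto 100 (.r 36) (.l 19 (.r 36)))) <|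
  .seq (.for 36 37 (.sto 101 (.r 36) (.l 13 (blockEx 35)))) <|
  .seq (.set 100 (.r 33)) <| .seq (.call P) <|
  .for 36 37 (.sto 13 (blockEx 34) ((.l 13 (blockEx 34) + .l 102 (.r 36)) % .c 2))

/-- Clears the pivots of the `reg 33` rows starting with `reg 35` in the rows starting with
`reg 34`. -/
def clearProg (P : RamProg) : Cmd :=
  .seq (.set 37 (.r 33 * .r 33)) <|
  .seq (.for 36 37 (.sto 19 (.r 36) (.l 21 (.r 35 + .r 36 % .r 33) *
    .l 13 ((.r 34 + .r 36 / .r 33) * .r 4 + .l 20 (.r 35 + .r 36 % .r 33))))) <|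
  .seq (.set 38 (.r 4 / .r 33)) <| .for 39 38 (blockProg P)

/-- `P` multiplies matrices of size at most `D` within time `mm`. -/
def MulProg (W D : ℕ) (P : RamProg) (mm : ℕ → ℕ) : Prop :=
  ∀ m, 1 ≤ m → m ≤ D → ∀ (M N : Matrix (Fin m) (Fin m) (ZMod 2)) (s : RamState), s.Fits W →
    s.reg 0 = m → s.HoldsMatrix 0 M → s.HoldsMatrix 1 N →
    ∃ s' t, RamRun W P s s' t ∧ t ≤ mm m ∧ s'.HoldsMatrix 2 (M * N)

/-- The memory holds a matrix with `2 D` rows and `D` columns and its pivots. -/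
structure RamState.HoldsElim (s : RamState) (D : ℕ) (a : ElimState) : Prop where
  row : ∀ r < 2 * D, ∀ j < D, s.arr 13 (r * D + j) = (a.row r j).val
  zero : ∀ r < 2 * D, ∀ j, D ≤ j → a.row r j = 0
  flag : ∀ r < 2 * D, s.arr 21 r = (a.flag r).val
  piv : ∀ r < 2 * D, s.arr 20 r = a.piv r
  piv_lt : ∀ r < 2 * D, a.piv r < D

theorem idx_inj {D a b x y : ℕ} (hx : x < D) (hy : y < D) (h : a * D + x = b * D + y) :
    a = b ∧ x = y := by
  rcases lt_trichotomy a b with hab | rfl | hab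
  · have := idx_lt hab hx (le_refl (b * D)); omega
  · exact ⟨rfl, by omega⟩
  · have := idx_lt hab hy (le_refl (a * D)); omega

theorem zmod2_val_lt (x : ZMod 2) : x.val < 2 := ZMod.val_lt x

theorem zmod2_val_add (x y : ZMod 2) : (x + y).val = (x.val + y.val) % 2 := ZMod.val_add x y

theorem zmod2_val_mul (x y : ZMod 2) : (x * y).val = x.val * y.val := by
  revert x y; decide

theorem zmod2_eq_one {x : ZMod 2} (h : x ≠ 0) : x = 1 := by revert x; decide

/-- The entries after clearing pivots. -/
def ElimState.clear (a : ElimState) (src size : ℕ) (r j : ℕ) : ZMod 2 :=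
  a.row r j + ∑ l ∈ Finset.range size,
    (a.flag (src + l) * a.row r (a.piv (src + l))) * a.row (src + l) j

section Spec
variable {W D : ℕ}

theorem pivotProg_spec {s : RamState} {a : ElimState} (hW : 2 * D * D ≤ W) (hD : s.reg 4 = D)
    (ha : s.HoldsElim D a) {dst : ℕ} (hdst : s.reg 34 = dst) (hlt : dst < 2 * D) :
    Tri W pivotProg s fun s' t => t ≤ 30 * D + 20 ∧
      ∃ b, s'.HoldsElim D b ∧ ElimTask.Step D ⟨0, dst, dst⟩ a b := by
  have hD0 : 0 < D := by omega
  have h1 : dst * D < W := mul_lt_of_idx hlt hD0 hW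
  have h2 : ∀ j < D, dst * D + j < W := fun j hj => idx_lt hlt hj hW
  refine Tri.of_wp ?_
  simp only [pivotProg, Cmd.wp, Cmd.wp_for]
  refine ⟨by simp, by simp, ?_⟩
  refine Tri.loop (N := D) (by simp [hD]) (by decide) rfl rfl
    (fun i s' => (∀ r < 2 * D, r ≠ dst → s'.arr 21 r = s.arr 21 r ∧ s'.arr 20 r = s.arr 20 r) ∧
      s'.arr 20 dst < D ∧ (s'.arr 21 dst = 1 ∧ a.row dst (s'.arr 20 dst) = 1 ∨
        s'.arr 21 dst = 0 ∧ ∀ j < i, a.row dst j = 0)) 15 ?_ ?_ ?_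
  · have := ha.piv_lt dst hlt
    rw [← ha.piv dst hlt] at this
    simp [hdst, this]
    intro r _ hr; simp [hr]
  · rintro i s₁ hi hf hi' hfr ⟨g1, g2, g3⟩
    have r4 : s₁.reg 4 = D := (hfr.r rfl).trans (by simp [hD])
    have r34 : s₁.reg 34 = dst := (hfr.r rfl).trans (by simp [hdst])
    have a13 : s₁.arr 13 = s.arr 13 := (hfr.a rfl).trans (by funext z; simp)
    refine Tri.of_wp ?_
    have e1 := ha.row dst hlt i hi
    simp [Cmd.wp, r4, r34, a13, hi', h1, h2 i hi, e1]
    constructor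
    · intro hne
      refine ⟨fun r hr hr' => ?_, hi, zmod2_eq_one hne⟩
      simp [hr', g1 r hr hr']
    · intro he
      refine ⟨g1, g2, g3.imp id fun h => ⟨h.1, fun j hj => ?_⟩⟩
      rcases Nat.lt_or_eq_of_le hj with hj | rfl
      · exact h.2 j hj
      · exact he
  · rintro s₁ t hf hx hfr ⟨g1, g2, g3⟩ ht
    have a13 : s₁.arr 13 = s.arr 13 := (hfr.a rfl).trans (by funext z; simp)
    simp
    refine ⟨by omega, ⟨a.row, fun r => if r = dst then (s₁.arr 21 dst : ZMod 2) else a.flag r,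
      fun r => if r = dst then s₁.arr 20 dst else a.piv r⟩, ⟨?_, ha.zero, ?_, ?_, ?_⟩, ?_⟩
    · rw [a13]; exact ha.row
    · intro r hr
      by_cases h : r = dst
      · subst h
        rcases g3 with g3 | g3 <;> simp [g3.1] <;> rfl
      · simp [h, g1 r hr h, ha.flag r hr]
    · intro r hr
      by_cases h : r = dst
      · simp [h]
      · simp [h, g1 r hr h, ha.piv r hr]
    · intro r hr
      by_cases h : r = dst
      · simp [h, g2]
      · simp [h, ha.piv_lt r hr]
    · simp only [ElimTask.Step, if_true]
      refine ⟨trivial, fun r hr => by simp [hr], ?_⟩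
      rcases g3 with g3 | g3
      · exact .inl ⟨by simp [g3.1], g2, g3.2⟩
      · refine .inr ⟨by simp [g3.1], ?_⟩
        funext j
        rcases lt_or_ge j D with h | h
        · exact g3.2 j h
        · exact ha.zero dst hlt j h

theorem blockEx_spec {x size β D i base : ℕ} {s : RamState} (hx : s.reg x = base)
    (h33 : s.reg 33 = size) (h4 : s.reg 4 = D) (h39 : s.reg 39 = β) (h36 : s.reg 36 = i)
    (hW : 2 * D * D ≤ W) (hbase : base + size ≤ 2 * D) (hβ : (β + 1) * size ≤ D)
    (hi : i < size * size) (hWD : 2 * D < W) :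
    (blockEx x).eval s = (base + i / size) * D + (β * size + i % size) ∧ (blockEx x).ok W s ∧
      (blockEx x).cost s = 15 ∧ i / size < size ∧ i % size < size ∧ β * size + i % size < D ∧
      (base + i / size) * D + (β * size + i % size) < W := by
  have hs : 0 < size := Nat.pos_of_ne_zero (by rintro rfl; simp at hi)
  have h1 : i / size < size := Nat.div_lt_of_lt_mul hi
  have h2 : i % size < size := Nat.mod_lt _ hs
  have h3 : β * size + i % size < D := by rw [Nat.add_mul] at hβ; omega
  have h4' : (base + i / size) * D + (β * size + i % size) < W := idx_lt (by omega) h3 hW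
  refine ⟨by simp [blockEx, *], ?_, by simp [blockEx], h1, h2, h3, h4'⟩
  simp [blockEx, hx, h33, h4, h39, h36]
  omega


/-- The entries of a matrix held in array `13`. -/
def RamState.HoldsRows (s : RamState) (D : ℕ) (cur : ℕ → ℕ → ZMod 2) : Prop :=
  ∀ r < 2 * D, ∀ j < D, s.arr 13 (r * D + j) = (cur r j).val

theorem blockProg_spec {P : RamProg} {mm : ℕ → ℕ} {s : RamState} {size dst src β : ℕ}
    {F cur : ℕ → ℕ → ZMod 2} (hP : MulProg W D P mm)
    (hW : 2 * D * D ≤ W) (hWD : 2 * D < W) (h4 : s.reg 4 = D) (h33 : s.reg 33 = size)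
    (h34 : s.reg 34 = dst) (h35 : s.reg 35 = src) (h37 : s.reg 37 = size * size)
    (h39 : s.reg 39 = β) (hs : 0 < size) (hdst : dst + size ≤ 2 * D) (hsrc : src + size ≤ 2 * D)
    (hβ : (β + 1) * size ≤ D)
    (hF : ∀ k < size, ∀ l < size, s.arr 19 (k * size + l) = (F k l).val)
    (hcur : s.HoldsRows D cur) :
    Tri W (blockProg P) s fun s' t => t ≤ mm size + 120 * (size * size) + 30 ∧
      s'.HoldsRows D fun r j => if (dst ≤ r ∧ r < dst + size) ∧ β * size ≤ j ∧ j < (β + 1) * size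
        then cur r j + ∑ l ∈ Finset.range size, F (r - dst) l * cur (src + l) j else cur r j := by
  refine Tri.of_wp ?_
  simp only [blockProg, Cmd.wp, Cmd.wp_for]
  have hsD : size ≤ D := by nlinarith
  refine Tri.scatter h37 (by decide) id (fun i => s.arr 19 i) 3 (by simp; omega) ?_ ?_
  · intro i hi h h1 h2; simp
  intro h₁ t₁ hf₁ g1 _ ht₁
  refine Tri.scatter (N := size * size) (by simp [h37]) (by decide) id
    (fun i => (cur (src + i / size) (β * size + i % size)).val) 17 (by simp; omega) ?_ ?_
  · intro i hi h _ _
    obtain ⟨e1, e2, e3, e4, e5, e6, e7⟩ := blockEx_spec (x := 35) (base := src) (size := size)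
      (β := β) (D := D) (i := i) (W := W)
      (s := ((((s.withArr 100 h₁).setReg 36 (size * size)).withArr 101 h).setReg 36 i))
      (by simp [h35]) (by simp [h33]) (by simp [h4]) (by simp [h39]) (by simp) hW hsrc hβ hi hWD
    refine ⟨by simp, e2, by simp, ?_, by simp [e3]⟩
    simp [e1]
    exact hcur _ (by omega) _ e6
  intro h₂ t₂ hf₂ g2 _ ht₂
  refine ⟨by simp, ?_⟩
  set s₃ := ((((s.withArr 100 h₁).setReg 36 (size * size)).withArr 101 h₂).setReg 36
    (size * size)).setReg 100 (Ex.eval (.r 33)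
      ((((s.withArr 100 h₁).setReg 36 (size * size)).withArr 101 h₂).setReg 36 (size * size)))
    with hs₃
  let M : Matrix (Fin size) (Fin size) (ZMod 2) := fun k l => F k l
  let N : Matrix (Fin size) (Fin size) (ZMod 2) := fun l j => cur (src + l) (β * size + j)
  refine Tri.call fun hf₃ => ?_
  have hidx : ∀ k l : Fin size, k.val * size + l.val < size * size := fun k l =>
    idx_lt k.2 l.2 le_rfl
  have hdiv : ∀ k l : Fin size, (k.val * size + l.val) / size = k.val := fun k l => by
    rw [Nat.add_comm, Nat.add_mul_div_right _ _ hs, Nat.div_eq_of_lt l.2, Nat.zero_add]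
  have hmod : ∀ k l : Fin size, (k.val * size + l.val) % size = l.val := fun k l => by
    rw [Nat.add_comm, Nat.add_mul_mod_self_right, Nat.mod_eq_of_lt l.2]
  obtain ⟨u, t₃, hr, ht₃, hu⟩ := hP size hs hsD M N s₃.view hf₃.view
    (by simp [RamState.view, hs₃, h33])
    (fun k l => by
      have := g1 _ (hidx k l)
      simp only [id] at this
      simp [RamState.view, hs₃, this, hF k k.2 l l.2, M])
    (fun k l => by
      have := g2 _ (hidx k l)
      simp only [id, hdiv, hmod] at this
      simp [RamState.view, hs₃, this, N])
  refine ⟨u, t₃, hr, ?_⟩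
  have r4 : (s₃.put u).reg 4 = D := by simp [RamState.put, hs₃, h4]
  have r33 : (s₃.put u).reg 33 = size := by simp [RamState.put, hs₃, h33]
  have r34 : (s₃.put u).reg 34 = dst := by simp [RamState.put, hs₃, h34]
  have r37 : (s₃.put u).reg 37 = size * size := by simp [RamState.put, hs₃, h37]
  have r39 : (s₃.put u).reg 39 = β := by simp [RamState.put, hs₃, h39]
  have a13 : (s₃.put u).arr 13 = s.arr 13 := by simp [RamState.put, hs₃]
  have a102 : (s₃.put u).arr 102 = u.arr 2 := by simp [RamState.put]
  generalize s₃.put u = s₄ at *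
  have hinj : ∀ i < size * size, ∀ j < size * size,
      (dst + j / size) * D + (β * size + j % size) = (dst + i / size) * D + (β * size + i % size) →
      j = i := by
    intro i hi j hj he
    have h1 := Nat.mod_lt i hs
    have h2 := Nat.mod_lt j hs
    rw [Nat.add_mul] at hβ
    obtain ⟨e1, e2⟩ := idx_inj (by omega) (by omega) he
    rw [← Nat.div_add_mod j size, ← Nat.div_add_mod i size]
    have : j / size = i / size := by omega
    have : j % size = i % size := by omega
    simp [*]
  have hprod : ∀ i < size * size, u.arr 2 i =
      (∑ l ∈ Finset.range size, F (i / size) l * cur (src + l) (β * size + i % size)).val := by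
    intro i hi
    have := hu ⟨i / size, Nat.div_lt_of_lt_mul hi⟩ ⟨i % size, Nat.mod_lt _ hs⟩
    simp only [Nat.div_add_mod'] at this
    rw [this, Finset.sum_range, Matrix.mul_apply]
  refine Tri.scatter (N := size * size) r37 (by decide)
    (fun i => (dst + i / size) * D + (β * size + i % size))
    (fun i => (cur (dst + i / size) (β * size + i % size) +
      ∑ l ∈ Finset.range size, F (i / size) l * cur (src + l) (β * size + i % size)).val) 40 ?_ ?_ ?_
  · intro i hi j hj he
    have := hinj i hi j (by omega) he
    omega
  · intro i hi h _ k2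
    obtain ⟨e1, e2, e3, e4, e5, e6, e7⟩ := blockEx_spec (x := 34) (base := dst) (size := size)
      (β := β) (D := D) (i := i) (W := W)
      (s := (s₄.withArr 13 h).setReg 36 i)
      (by simp [r34]) (by simp [r33]) (by simp [r4]) (by simp [r39]) (by simp) hW hdst hβ hi hWD
    have e8 : h ((dst + i / size) * D + (β * size + i % size)) =
        (cur (dst + i / size) (β * size + i % size)).val := by
      rw [k2 _ fun j hj he => by have := hinj i hi j (by omega) he.symm; omega, a13]
      exact hcur _ (by omega) _ e6
    have b1 := zmod2_val_lt (cur (dst + i / size) (β * size + i % size))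
    have b2 := zmod2_val_lt
      (∑ l ∈ Finset.range size, F (i / size) l * cur (src + l) (β * size + i % size))
    have e9 := hprod i hi
    rw [zmod2_val_add]
    simp [e1, e2, e3, e8, a102, e9]
    omega
  · intro h t₄ _ k1 k2 ht₄
    constructor
    · simp
      omega
    · intro r hr j hj
      simp only [RamState.arr_setReg, RamState.arr_withArr, if_true]
      split_ifs with hc
      · obtain ⟨⟨c1, c2⟩, c3, c4⟩ := hc
        rw [Nat.add_mul] at c4
        obtain ⟨k, rfl⟩ := Nat.exists_eq_add_of_le c1
        obtain ⟨l, rfl⟩ := Nat.exists_eq_add_of_le c3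
        have := k1 (k * size + l) (idx_lt (by omega) (by omega) le_rfl)
        have h1 := hdiv ⟨k, by omega⟩ ⟨l, by omega⟩
        have h2 := hmod ⟨k, by omega⟩ ⟨l, by omega⟩
        simp only at h1 h2
        rw [h1, h2] at this
        rw [this, Nat.add_sub_cancel_left]
      · rw [k2, a13]
        · exact hcur r hr j hj
        · intro i hi he
          have h1 := Nat.mod_lt i hs
          have h2 : i / size < size := Nat.div_lt_of_lt_mul hi
          rw [Nat.add_mul] at hβ
          obtain ⟨e1, e2⟩ := idx_inj hj (by omega) he
          have h3 : dst ≤ r := e1 ▸ Nat.le_add_right _ _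
          have h4 : β * size ≤ j := e2 ▸ Nat.le_add_right _ _
          exact hc ⟨⟨h3, by omega⟩, h4, by rw [Nat.add_mul]; omega⟩

theorem clearProg_spec {P : RamProg} {mm : ℕ → ℕ} {s : RamState} {a : ElimState}
    {size dst src : ℕ} (hP : MulProg W D P mm) (hW : 2 * D * D ≤ W) (hWD : 2 * D < W)
    (h4 : s.reg 4 = D) (h33 : s.reg 33 = size) (h34 : s.reg 34 = dst) (h35 : s.reg 35 = src)
    (hs : 0 < size) (hdst : dst + size ≤ 2 * D) (hsrc : src + size ≤ 2 * D)
    (hdis : dst + size ≤ src ∨ src + size ≤ dst) (hdvd : size ∣ D) (ha : s.HoldsElim D a) :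
    Tri W (clearProg P) s fun s' t =>
      t ≤ D / size * (mm size + 120 * (size * size) + 38) + 60 * (size * size) + 30 ∧
      ∃ b, s'.HoldsElim D b ∧ ElimTask.Step D ⟨size, dst, src⟩ a b := by
  obtain ⟨B, rfl⟩ := hdvd
  set D := size * B with hD
  have hB : D / size = B := Nat.mul_div_cancel_left B hs
  have hD0 : 0 < D := lt_of_le_of_lt (Nat.zero_le _) (ha.piv_lt dst (by omega))
  have hB0 : 0 < B := Nat.pos_of_ne_zero (by rintro rfl; simp [hD] at hD0)
  have hsD : size ≤ D := Nat.le_mul_of_pos_right _ hB0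
  have hss : size * size < W := by nlinarith
  refine Tri.of_wp ?_
  simp only [clearProg, Cmd.wp, Cmd.wp_for]
  refine ⟨by simp [h33, hss], ?_⟩
  let F : ℕ → ℕ → ZMod 2 := fun k l => a.flag (src + l) * a.row (dst + k) (a.piv (src + l))
  refine Tri.scatter (N := size * size) (by simp [h33]) (by decide) id
    (fun i => (F (i / size) (i % size)).val) 40 (by simp; omega) ?_ ?_
  · intro i hi h _ _
    have h1 : i / size < size := Nat.div_lt_of_lt_mul hi
    have h2 : i % size < size := Nat.mod_lt _ hs
    have e1 := ha.flag (src + i % size) (by omega)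
    have e2 := ha.piv (src + i % size) (by omega)
    have e3 := ha.piv_lt (src + i % size) (by omega)
    have e4 := ha.row (dst + i / size) (by omega) _ e3
    have e5 : (dst + i / size) * D + a.piv (src + i % size) < W := idx_lt (by omega) e3 hW
    have b1 := zmod2_val_lt (a.flag (src + i % size))
    have b2 := zmod2_val_lt (a.row (dst + i / size) (a.piv (src + i % size)))
    have b3 : (a.flag (src + i % size)).val *
        (a.row (dst + i / size) (a.piv (src + i % size))).val ≤ 1 * 1 :=
      Nat.mul_le_mul (by omega) (by omega)
    simp [h33, h34, h35, h4, e1, e2, e4, e5, F, zmod2_val_mul]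
    omega
  intro h t₁ hf₁ g1 _ ht₁
  have hcost : (Ex.r 33 * Ex.r 33).cost s = 3 := by simp
  have hcost2 : ∀ s', (Ex.r 4 / Ex.r 33).cost s' = 3 := fun s' => by simp
  refine ⟨by simp, ?_⟩
  refine Tri.loop (N := B) (by simp [h33, h4, hB]) (by decide) rfl rfl
    (fun β s' => s'.HoldsRows D fun r j => if (dst ≤ r ∧ r < dst + size) ∧ j < β * size then
      a.clear src size r j else a.row r j) (mm size + 120 * (size * size) + 30) ?_ ?_ ?_
  · intro r hr j hj
    simpa using ha.row r hr j hj
  · intro β s₁ hβ hf hi hfr hI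
    have hβ' : (β + 1) * size ≤ D := by rw [hD, Nat.mul_comm size]; gcongr; omega
    refine (blockProg_spec (F := F) hP hW hWD ((hfr.r rfl).trans (by simp [h4]))
      ((hfr.r rfl).trans (by simp [h33])) ((hfr.r rfl).trans (by simp [h34]))
      ((hfr.r rfl).trans (by simp [h35])) ((hfr.r rfl).trans (by simp [h33])) hi hs hdst hsrc
      hβ' ?_ hI).mono ?_
    · intro k hk l hl
      have e : s₁.arr 19 = h := (hfr.a rfl).trans (by simp)
      have := g1 (k * size + l) (idx_lt hk hl le_rfl)
      simp only [id] at this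
      rw [e, this]
      congr 2
      · rw [Nat.add_comm, Nat.add_mul_div_right _ _ hs, Nat.div_eq_of_lt hl, Nat.zero_add]
      · rw [Nat.add_comm, Nat.add_mul_mod_self_right, Nat.mod_eq_of_lt hl]
    · rintro s₂ t₂ - - ⟨ht₂, hs₂⟩
      refine ⟨ht₂, fun r hr j hj => ?_⟩
      rw [RamState.arr_setReg, hs₂ r hr j hj]
      congr 1
      beta_reduce
      have hsrow : (∑ l ∈ Finset.range size, F (r - dst) l *
          if (dst ≤ src + l ∧ src + l < dst + size) ∧ j < β * size then a.clear src size (src + l) j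
          else a.row (src + l) j) =
          ∑ l ∈ Finset.range size, F (r - dst) l * a.row (src + l) j :=
        Finset.sum_congr rfl fun l hl => by
          have := Finset.mem_range.1 hl
          rw [if_neg (by omega)]
      rw [hsrow]
      rw [Nat.add_mul, one_mul]
      by_cases hr1 : dst ≤ r ∧ r < dst + size
      · rcases lt_or_ge j (β * size) with h1 | h1
        · rw [if_neg (by omega), if_pos ⟨hr1, h1⟩, if_pos ⟨hr1, by omega⟩]
        · rcases lt_or_ge j (β * size + size) with h2 | h2
          · rw [if_pos ⟨hr1, h1, h2⟩, if_neg (by omega), if_pos ⟨hr1, h2⟩, ElimState.clear]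
            simp only [F]
            rw [Nat.add_sub_cancel' hr1.1]
          · rw [if_neg (by omega), if_neg (by omega), if_neg (by omega)]
      · rw [if_neg (by tauto), if_neg (by tauto), if_neg (by tauto)]
  · intro s₁ t hf hx hfr hI ht
    refine ⟨?_, ⟨fun r j => if (dst ≤ r ∧ r < dst + size) ∧ j < D then a.clear src size r j else
      a.row r j, a.flag, a.piv⟩, ⟨?_, ?_, ?_, ?_, ha.piv_lt⟩, ?_⟩
    · rw [hcost, hcost2, hB]
      have : B * (mm size + 120 * (size * size) + 30 + 8) =
        B * (mm size + 120 * (size * size) + 38) := by ring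
      omega
    · intro r hr j hj
      rw [hI r hr j hj, Nat.mul_comm B, ← hD]
    · intro r hr j hj
      simp only
      rw [if_neg (by omega), ha.zero r hr j hj]
    · intro r hr
      rw [(hfr.a rfl : s₁.arr 21 = _)]
      simpa using ha.flag r hr
    · intro r hr
      rw [(hfr.a rfl : s₁.arr 20 = _)]
      simpa using ha.piv r hr
    · simp only [ElimTask.Step, if_neg hs.ne', true_and]
      refine ⟨fun r hr => ?_, fun k hk => ?_⟩
      · funext j
        rw [if_neg]
        rintro ⟨⟨h1, h2⟩, -⟩
        exact hr (r - dst) (by omega) (by omega)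
      · funext j
        rw [Pi.add_apply, Finset.sum_apply]
        simp only [Pi.smul_apply, smul_eq_mul]
        by_cases hj : j < D
        · rw [if_pos ⟨⟨by omega, by omega⟩, hj⟩]; rfl
        · rw [if_neg (by tauto), Finset.sum_eq_zero, add_zero]
          intro l hl
          rw [ha.zero _ (by have := Finset.mem_range.1 hl; omega) j (by omega), mul_zero]

end Spec

/-! ### The list of tasks -/

/-- `reg 4` becomes the least power of two that is at least the square of `reg 3`, which is stored
in `reg 5`. -/
def dimProg : Cmd :=
  .seq (.set 5 (.r 3 * .r 3)) <| .seq (.set 4 (.c 1)) <|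
  .seq (.blk (.while (.lt (.r 4) (.r 5)) (.set 4 (.r 4 + .r 4)))) <| .set 28 (.r 4 + .r 4)

/-- Writes the codes of the tasks of elimination in `reg 28` rows into array `16`. -/
def codesProg : Cmd :=
  .seq (.sto 16 (.c 0) (.c 0)) <| .seq (.set 29 (.c 1)) <| .seq (.set 30 (.c 1)) <|
  .blk <| .while (.lt (.r 30) (.r 28)) <|
    .seq (.sto 16 (.r 29) (.r 30 * .r 28 * .r 28 + .r 30 * .r 28)) <|
    .seq (.for 31 29 (.sto 16 (.r 29 + .c 1 + .r 31) (.l 16 (.r 31) + .r 30 * (.r 28 + .c 1)))) <|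
    .seq (.sto 16 (.r 29 + .r 29 + .c 1) (.r 30 * .r 28 * .r 28 + .r 30)) <|
    .seq (.set 29 (.r 29 + .r 29 + .c 2)) (.set 30 (.r 30 + .r 30))

/-- Carries out the task with number `reg 31`. -/
def taskProg (P : RamProg) : Cmd :=
  .seq (.set 32 (.l 16 (.r 31))) <| .seq (.set 33 (.r 32 / (.r 28 * .r 28))) <|
  .seq (.set 34 (.r 32 / .r 28 % .r 28)) <| .seq (.set 35 (.r 32 % .r 28)) <|
  .ite (.r 33) (.blk (clearProg P)) (.blk pivotProg)

def ElimTask.code (M : ℕ) (T : ElimTask) : ℕ := T.size * M * M + T.dst * M + T.src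

theorem ElimTask.code_shift (M d : ℕ) (T : ElimTask) :
    (T.shift d).code M = T.code M + d * (M + 1) := by
  simp only [code, shift]; ring

theorem ElimTask.code_decode {M : ℕ} {T : ElimTask} (hd : T.dst < M) (hs : T.src < M) :
    T.code M / (M * M) = T.size ∧ T.code M / M % M = T.dst ∧ T.code M % M = T.src := by
  have hM : 0 < M := by omega
  have h1 : T.code M % M = T.src := by
    rw [code, ← Nat.add_mul, Nat.mul_comm, Nat.mul_add_mod, Nat.mod_eq_of_lt hs]
  have h2 : T.code M / M = T.size * M + T.dst := by
    rw [code, ← Nat.add_mul, Nat.mul_comm, Nat.mul_add_div hM, Nat.div_eq_of_lt hs, Nat.add_zero]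
  refine ⟨?_, ?_, h1⟩
  · rw [← Nat.div_div_eq_div_mul, h2, Nat.mul_comm, Nat.mul_add_div hM, Nat.div_eq_of_lt hd,
      Nat.add_zero]
  · rw [h2, Nat.mul_comm, Nat.mul_add_mod, Nat.mod_eq_of_lt hd]

theorem elimTasks_valid {lo J : ℕ} {T : ElimTask} (hT : T ∈ elimTasks lo J) :
    T.dst < lo + 2 ^ J ∧ T.src < lo + 2 ^ J ∧ (T.size = 0 ∧ T.src = T.dst ∨
      (∃ i < J, T.size = 2 ^ i) ∧ T.dst + T.size ≤ lo + 2 ^ J ∧ T.src + T.size ≤ lo + 2 ^ J ∧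
        (T.dst + T.size ≤ T.src ∨ T.src + T.size ≤ T.dst)) := by
  induction J generalizing lo with
  | zero =>
    rw [elimTasks, List.mem_singleton] at hT
    subst hT
    simp
  | succ J ih =>
    have hpow : 2 ^ (J + 1) = 2 ^ J + 2 ^ J := by ring
    have hpos : 0 < 2 ^ J := by positivity
    rw [elimTasks, elimTasks_shift] at hT
    simp only [List.mem_append, List.mem_singleton] at hT
    rw [hpow]
    rcases hT with ((hT | rfl) | hT) | rfl
    · obtain ⟨h1, h2, h3⟩ := ih hT
      refine ⟨by omega, by omega, h3.imp id ?_⟩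
      rintro ⟨⟨i, hi, hi'⟩, h⟩
      exact ⟨⟨i, by omega, hi'⟩, by omega⟩
    · exact ⟨by simp only; omega, by simp only; omega, .inr ⟨⟨J, by omega, rfl⟩, by simp only; omega⟩⟩
    · obtain ⟨h1, h2, h3⟩ := ih hT
      refine ⟨by omega, by omega, h3.imp id ?_⟩
      rintro ⟨⟨i, hi, hi'⟩, h⟩
      exact ⟨⟨i, by omega, hi'⟩, by omega⟩
    · exact ⟨by simp only; omega, by simp only; omega, .inr ⟨⟨J, by omega, rfl⟩, by simp only; omega⟩⟩

/-- Array `16` starts with the codes of the tasks in the list. -/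
def RamState.HoldsTasks (s : RamState) (M : ℕ) (l : List ElimTask) : Prop :=
  s.reg 29 = l.length ∧ ∀ i (h : i < l.length), s.arr 16 i = (l[i]).code M

section Spec
variable {W : ℕ}

theorem dimProg_spec {s : RamState} {q : ℕ} (hq : s.reg 3 = q) (hq0 : 0 < q) (hW : 4 * (q * q) < W) :
    Tri W dimProg s fun s' t => t ≤ 10 * (q * q) + 20 ∧ s'.reg 5 = q * q ∧ ∃ J, s'.reg 4 = 2 ^ J ∧
      s'.reg 28 = 2 * 2 ^ J ∧ q * q ≤ 2 ^ J ∧ 2 ^ J < 2 * (q * q) := by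
  have hqq : 0 < q * q := Nat.mul_pos hq0 hq0
  refine Tri.of_wp ?_
  simp only [dimProg, Cmd.wp]
  refine ⟨by simp [hq]; omega, by simp, ?_⟩
  have key : ∀ k J : ℕ, ∀ s : RamState, q * q ≤ 2 ^ J + k → 2 ^ J < 2 * (q * q) →
      s.reg 5 = q * q → s.reg 4 = 2 ^ J →
      Tri W (.while (.lt (.r 4) (.r 5)) (.set 4 (.r 4 + .r 4))) s fun s' t =>
        t ≤ 8 * k + 4 ∧ s'.reg 5 = q * q ∧ ∃ J, s'.reg 4 = 2 ^ J ∧ q * q ≤ 2 ^ J ∧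
          2 ^ J < 2 * (q * q) := by
    intro k
    induction k using Nat.strong_induction_on with
    | _ k ih =>
      intro J s hk hJ h5 h4
      by_cases h : 2 ^ J < q * q
      · have hJ0 : 0 < 2 ^ J := by positivity
        refine Tri.while_step (by simp) (by simp [h5, h4, h]) (Tri.of_wp ?_)
        simp only [Cmd.wp]
        refine ⟨by simp [h4]; omega, ?_⟩
        refine (ih (k - 2 ^ J) (by omega) (J + 1) _ (by rw [pow_succ]; omega)
          (by rw [pow_succ]; omega) (by simp [h5]) (by simp [h4]; ring)).mono ?_
        rintro s' t - - ⟨h1, h2⟩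
        refine ⟨?_, h2⟩
        simp
        omega
      · refine Tri.while_stop (by simp) (by simp [h5, h4]; omega) ⟨by simp, h5, J, h4, by omega, hJ⟩
  refine (key (q * q) 0 _ (by simp) (by simp; omega) (by simp [hq]) (by simp)).mono ?_
  rintro s' t - - ⟨h1, h2, J, h3, h4, h5⟩
  refine ⟨by simp [h3]; omega, ?_, by simp [h2], J, by simp [h3], by simp [h3]; omega, h4, h5⟩
  simp; omega

theorem codesProg_spec {s : RamState} {K : ℕ} (hM : s.reg 28 = 2 ^ K)
    (hW : (2 ^ K) ^ 3 ≤ W) (hW' : 6 * 2 ^ K < W) :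
    Tri W codesProg s fun s' t => t ≤ 400 * 2 ^ K ∧
      s'.HoldsTasks (2 ^ K) (elimTasks 0 K) := by
  set M := 2 ^ K with hMK
  have hM0 : 0 < M := by positivity
  have hcodelt : ∀ size dst src : ℕ, size < M → dst < M → src < M →
      ElimTask.code M ⟨size, dst, src⟩ < W := fun size dst src h1 h2 h3 => by
    refine lt_of_lt_of_le ?_ hW
    have : M ^ 3 = M * M * M := by ring
    rw [this, ElimTask.code]
    have h4 : size * M + dst < M * M := idx_lt h1 h2 le_rfl
    have h5 := idx_lt (n := M) h4 h3 le_rfl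
    simp only
    rw [← Nat.add_mul]
    exact h5
  have key : ∀ k j : ℕ, ∀ s : RamState, j + k = K → s.reg 28 = M → s.reg 30 = 2 ^ j →
      s.HoldsTasks M (elimTasks 0 j) →
      Tri W (.while (.lt (.r 30) (.r 28)) <|
        .seq (.sto 16 (.r 29) (.r 30 * .r 28 * .r 28 + .r 30 * .r 28)) <|
        .seq (.for 31 29 (.sto 16 (.r 29 + .c 1 + .r 31) (.l 16 (.r 31) + .r 30 * (.r 28 + .c 1)))) <|
        .seq (.sto 16 (.r 29 + .r 29 + .c 1) (.r 30 * .r 28 * .r 28 + .r 30)) <|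
        .seq (.set 29 (.r 29 + .r 29 + .c 2)) (.set 30 (.r 30 + .r 30))) s fun s' t =>
      t + 180 * 2 ^ j ≤ 180 * 2 ^ K + 4 ∧ s'.HoldsTasks M (elimTasks 0 K) := by
    intro k
    induction k with
    | zero =>
      intro j s hj h28 h30 hT
      obtain rfl : j = K := by omega
      exact Tri.while_stop (by simp) (by simp [h28, h30, hMK]) ⟨by simp; omega, hT⟩
    | succ k ih =>
      intro j s hj h28 h30 hT
      have hlt : 2 ^ (j + 1) ≤ M := Nat.pow_le_pow_right (by omega) (by omega)
      rw [pow_succ] at hlt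
      have hj0 : 0 < 2 ^ j := by positivity
      have hlen := elimTasks_length 0 j
      set l := elimTasks 0 j with hl
      obtain ⟨h29, h16⟩ := hT
      have hc1 := hcodelt (2 ^ j) (2 ^ j) 0 (by omega) (by omega) (by omega)
      have hc2 := hcodelt (2 ^ j) 0 (2 ^ j) (by omega) (by omega) (by omega)
      simp only [ElimTask.code] at hc1 hc2
      refine Tri.while_step (by simp) (by simp [h28, h30]; omega) (Tri.of_wp ?_)
      simp only [Cmd.wp, Cmd.wp_for]
      have hm1 : 2 ^ j * M * M < W := by omega
      have hm2 : 2 ^ j * M < W := by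
        refine lt_of_le_of_lt ?_ hm1
        exact Nat.le_mul_of_pos_right _ hM0
      refine ⟨by simp, by simp [h28, h30]; omega, ?_⟩
      have hget : ∀ i (h : i < l.length), l[i].dst < 2 ^ j ∧ l[i].src < 2 ^ j ∧
          l[i].size < 2 ^ j := fun i h => by
        obtain ⟨h1, h2, h3⟩ := elimTasks_valid (List.getElem_mem h)
        refine ⟨by omega, by omega, ?_⟩
        rcases h3 with h3 | h3
        · omega
        · obtain ⟨i', hi', h4⟩ := h3.1
          rw [h4]; exact Nat.pow_lt_pow_right (by omega) hi'
      refine Tri.scatter (N := l.length) (by simp [h29]) (by decide) (fun i => l.length + 1 + i)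
        (fun i => if h : i < l.length then (l[i].shift (2 ^ j)).code M else 0) 30
        (by intros; omega) ?_ ?_
      · intro i hi h _ h2
        have e1 : h i = l[i].code M := by
          rw [h2 _ fun j' _ => by omega, ← h16 i hi]
          simp [h29]; omega
        obtain ⟨g1, g2, g3⟩ := hget i hi
        have e2 : (l[i].shift (2 ^ j)).code M < W :=
          hcodelt _ _ _ (by omega) (by omega) (by omega)
        rw [ElimTask.code_shift] at e2
        simp [h28, h29, h30, hi, e1, ElimTask.code_shift]
        omega
      intro h t₁ hf₁ k1 k2 ht₁
      have hst : ∀ i, i ≠ l.length → i < l.length + 1 → h i = s.arr 16 i := fun i h1 h2 => by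
        rw [k2 _ fun j' _ => by omega]; simp [h29, h1]
      refine ⟨by simp [h29]; omega, by simp [h28, h30]; omega, by simp [h29]; omega,
        by simp [h30]; omega, ?_⟩
      refine (ih (j + 1) _ (by omega) (by simp [h28]) (by simp [h30]; ring) ?_).mono ?_
      · constructor
        · simp [h29, elimTasks]; rw [← hl]; omega
        · intro i hi
          simp only [elimTasks, List.length_append, List.length_map, List.length_singleton] at hi
          rw [← hl] at hi
          simp only [RamState.arr_setReg]
          rw [RamState.arr_setArr]
          have he : (Ex.r 29 + Ex.r 29 + Ex.c 1).eval
            ((((s.setArr 16 (Ex.eval (.r 29) s) (Ex.eval (.r 30 * .r 28 * .r 28 + .r 30 * .r 28) s)).withArr 16 h).setReg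
              31 l.length)) = l.length + 1 + l.length := by simp [h29]; omega
          rw [he]
          simp only [elimTasks, ← hl, Nat.zero_add, true_and]
          rcases lt_trichotomy i l.length with h1 | h1 | h1
          · rw [if_neg (by omega), List.getElem_append_left (by simp; omega),
              List.getElem_append_left (by simp; omega), List.getElem_append_left (by omega),
              RamState.arr_setReg, RamState.arr_withArr, if_pos rfl, hst i (by omega) (by omega),
              h16 i h1]
          · subst h1
            rw [if_neg (by omega), List.getElem_append_left (by simp),
              List.getElem_append_left (by simp), List.getElem_append_right (by omega),
              RamState.arr_setReg, RamState.arr_withArr, if_pos rfl,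
              k2 _ fun j' _ => by omega]
            simp [h29, h28, h30, ElimTask.code]
          · rcases lt_or_ge i (l.length + 1 + l.length) with h2 | h2
            · rw [if_neg (by omega), List.getElem_append_left (by simp; omega),
                List.getElem_append_right (by simp; omega),
                RamState.arr_setReg, RamState.arr_withArr, if_pos rfl]
              have := k1 (i - (l.length + 1)) (by omega)
              rw [Nat.add_sub_cancel' (by omega), dif_pos (by omega)] at this
              rw [this]
              simp
            · obtain rfl : i = l.length + 1 + l.length := by omega
              rw [if_pos rfl, List.getElem_append_right (by simp; omega)]
              simp [h28, h30, ElimTask.code]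
      · rintro s' t - - ⟨h1, h2⟩
        refine ⟨?_, h2⟩
        simp
        rw [pow_succ] at h1
        omega
  refine Tri.of_wp ?_
  simp only [codesProg, Cmd.wp]
  refine ⟨by simp, by simp, by simp, by simp, ?_⟩
  refine (key K 0 _ (by omega) (by simp [hM]) (by simp) ⟨by simp [elimTasks], ?_⟩).mono ?_
  · intro i hi
    simp only [elimTasks, List.length_singleton] at hi
    obtain rfl : i = 0 := by omega
    simp [elimTasks, ElimTask.code]
  · rintro s' t - - ⟨h1, h2⟩
    refine ⟨?_, h2⟩
    simp
    omega

/-- A bound on the time for a task. -/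
def ElimTask.cost (mm : ℕ → ℕ) (D : ℕ) (T : ElimTask) : ℕ :=
  if T.size = 0 then 30 * D + 70 else
    D / T.size * (mm T.size + 120 * (T.size * T.size) + 38) + 60 * (T.size * T.size) + 70

theorem elimProg_spec {P : RamProg} {mm : ℕ → ℕ} {J : ℕ} {s : RamState} {a : ElimState}
    (hP : MulProg W (2 ^ J) P mm) (hW : (2 ^ (J + 1)) ^ 3 ≤ W) (h4 : s.reg 4 = 2 ^ J)
    (h28 : s.reg 28 = 2 * 2 ^ J)
    (hT : s.HoldsTasks (2 ^ (J + 1)) (elimTasks 0 (J + 1))) (ha : s.HoldsElim (2 ^ J) a) :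
    Tri W (.loopFor 31 29 (taskProg P)) s fun s' t =>
      t ≤ ((elimTasks 0 (J + 1)).map (ElimTask.cost mm (2 ^ J))).sum + 6 ∧
      ∃ b, s'.HoldsElim (2 ^ J) b ∧ Eliminated (2 ^ J) 0 (2 * 2 ^ J) a b := by
  set l := elimTasks 0 (J + 1) with hl
  have hpow : 2 ^ (J + 1) = 2 * 2 ^ J := by ring
  have hJ0 : 0 < 2 ^ J := by positivity
  have hW1 : 2 * 2 ^ J * 2 ^ J ≤ W := by
    refine le_trans ?_ hW
    rw [hpow]
    have : (2 * 2 ^ J) ^ 3 = 2 * 2 ^ J * 2 ^ J * (4 * 2 ^ J) := by ring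
    rw [this]
    exact Nat.le_mul_of_pos_right _ (by omega)
  have hW2 : 2 * 2 ^ J * (2 * 2 ^ J) < W := by
    refine lt_of_lt_of_le ?_ hW
    rw [hpow]
    have : (2 * 2 ^ J) ^ 3 = 2 * 2 ^ J * (2 * 2 ^ J) * (2 * 2 ^ J) := by ring
    rw [this]
    exact (Nat.lt_mul_iff_one_lt_right (by positivity)).2 (by omega)
  have hW3 : 2 * 2 ^ J < W := by nlinarith
  refine Tri.loop_time hT.1 (by decide) rfl rfl (fun i s' t =>
    (∃ b, s'.HoldsElim (2 ^ J) b ∧ ElimTask.Steps (2 ^ J) (l.take i) a b) ∧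
    t ≤ ((l.take i).map (ElimTask.cost mm (2 ^ J))).sum) ?_ ?_ ?_
  · refine ⟨⟨a, ⟨?_, ha.zero, ?_, ?_, ha.piv_lt⟩, by simp [ElimTask.Steps]⟩, by simp⟩
    · simpa using ha.row
    · simpa using ha.flag
    · simpa using ha.piv
  · rintro i s₁ t hi hf hi' hfr ⟨⟨b, hb, hsteps⟩, ht⟩
    have r4 : s₁.reg 4 = 2 ^ J := (hfr.r rfl).trans h4
    have r28 : s₁.reg 28 = 2 * 2 ^ J := (hfr.r rfl).trans h28
    have a16 : s₁.arr 16 = s.arr 16 := hfr.a rfl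
    have hcode := hT.2 i hi
    set T := l[i] with hTi
    obtain ⟨v1, v2, v3⟩ := elimTasks_valid (List.getElem_mem hi)
    rw [← hTi, Nat.zero_add] at v1 v2 v3
    obtain ⟨d1, d2, d3⟩ := ElimTask.code_decode v1 v2
    rw [hpow] at d1 d2 d3 hcode v1 v2 v3
    have htake : l.take (i + 1) = l.take i ++ [T] := by
      rw [List.take_add_one, List.getElem?_eq_getElem hi]; rfl
    have fin : ∀ (s' : RamState) (t'' : ℕ) (b' : ElimState), s'.HoldsElim (2 ^ J) b' →
        T.Step (2 ^ J) b b' → t'' + 8 ≤ T.cost mm (2 ^ J) →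
        (∃ b, (s'.setReg 31 (i + 1)).HoldsElim (2 ^ J) b ∧
          ElimTask.Steps (2 ^ J) (l.take (i + 1)) a b) ∧
        t + t'' + 8 ≤ ((l.take (i + 1)).map (ElimTask.cost mm (2 ^ J))).sum := by
      intro s' t'' b' hb' hst ht'
      refine ⟨⟨b', ⟨?_, hb'.zero, ?_, ?_, hb'.piv_lt⟩, ?_⟩, ?_⟩
      · simpa using hb'.row
      · simpa using hb'.flag
      · simpa using hb'.piv
      · rw [htake, ElimTask.steps_append]
        exact ⟨b, hsteps, ElimTask.steps_singleton.2 hst⟩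
      · rw [htake, List.map_append, List.sum_append, List.map_singleton, List.sum_singleton]
        omega
    refine Tri.of_wp ?_
    simp only [taskProg, Cmd.wp]
    refine ⟨by simp, by simp [r28, hW2], by simp, by simp, by simp, fun h => ?_, fun h => ?_⟩
    · have hs : T.size ≠ 0 := by simpa [hi', r28, a16, hcode, d1] using h
      rcases v3 with v3 | ⟨⟨k, hk, hk'⟩, v4, v5, v6⟩
      · exact absurd v3.1 hs
      refine (clearProg_spec (a := b) (size := T.size) (dst := T.dst) (src := T.src) hP hW1 hW3
        (by simp [r4]) (by simp [hi', r28, a16, hcode, d1]) (by simp [hi', r28, a16, hcode, d2])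
        (by simp [hi', r28, a16, hcode, d3]) (Nat.pos_of_ne_zero hs) v4 v5 v6 ?_ ?_).mono ?_
      · rw [hk']; exact pow_dvd_pow 2 (by omega)
      · exact ⟨by simpa using hb.row, hb.zero, by simpa using hb.flag, by simpa using hb.piv,
          hb.piv_lt⟩
      · rintro s' t' - - ⟨ht', b', hb', hst⟩
        refine fin _ _ b' hb' hst ?_
        rw [ElimTask.cost, if_neg hs]
        simp
        omega
    · have hs : T.size = 0 := by simpa [hi', r28, a16, hcode, d1] using h
      rcases v3 with v3 | ⟨⟨k, hk, hk'⟩, v4, v5, v6⟩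
      · refine (pivotProg_spec (a := b) (dst := T.dst) hW1 (by simp [r4]) ?_
          (by simp [hi', r28, a16, hcode, d2]) v1).mono ?_
        · exact ⟨by simpa using hb.row, hb.zero, by simpa using hb.flag, by simpa using hb.piv,
            hb.piv_lt⟩
        · rintro s' t' - - ⟨ht', b', hb', hst⟩
          have hTe : T = ⟨0, T.dst, T.dst⟩ := by
            have : T = ⟨T.size, T.dst, T.src⟩ := rfl
            rwa [hs, v3.2] at this
          refine fin _ _ b' hb' (hTe ▸ hst) ?_
          rw [ElimTask.cost, if_pos hs]
          simp
          omega
      · rw [hs] at hk'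
        exact absurd hk'.symm (by positivity)
  · rintro s₁ t hf hx hfr ⟨⟨b, hb, hsteps⟩, ht⟩
    rw [List.take_length] at hsteps ht
    refine ⟨by omega, b, hb, ?_⟩
    have := eliminated_tasks hsteps
    rwa [hpow] at this

end Spec

/-! ### Counting edges -/

section Edges
variable {n : ℕ} (G : SimpleGraph (Fin n)) [DecidableRel G.Adj]

/-- The sum of the degrees in the subgraph induced by `Z`, or twice the number of its edges. -/
def degSum (Z : Finset (Fin n)) : ℕ := ∑ v ∈ Z, (Z.filter (G.Adj v)).card

variable {G}

theorem degree_induce (Z : Finset (Fin n)) (v : {v // v ∈ (Z : Set (Fin n))})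
    [Fintype ((G.induce (Z : Set (Fin n))).neighborSet v)] :
    (G.induce (Z : Set (Fin n))).degree v = (Z.filter (G.Adj v)).card := by
  rw [← SimpleGraph.card_neighborFinset_eq_degree]
  refine Finset.card_bij (fun u _ => u.1) ?_ ?_ ?_
  · intro u hu
    rw [SimpleGraph.mem_neighborFinset] at hu
    exact Finset.mem_filter.2 ⟨u.2, hu⟩
  · intro u _ u' _ h; exact Subtype.ext h
  · intro u hu
    rw [Finset.mem_filter] at hu
    exact ⟨⟨u, hu.1⟩, by rw [SimpleGraph.mem_neighborFinset]; exact hu.2, rfl⟩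

open Classical in
theorem degSum_eq (Z : Finset (Fin n)) :
    degSum G Z = 2 * (G.induce (Z : Set (Fin n))).edgeFinset.card := by
  rw [← SimpleGraph.sum_degrees_eq_twice_card_edges, degSum, ← Finset.sum_coe_sort]
  exact Finset.sum_congr rfl fun v _ => (degree_induce Z v).symm

theorem degSum_even (Z : Finset (Fin n)) : 2 ∣ degSum G Z := by
  rw [degSum_eq]; exact dvd_mul_right _ _

/-- Vertices connected in the subgraph induced by `Z`. -/
def Conn (G : SimpleGraph (Fin n)) (Z : Finset (Fin n)) : Fin n → Fin n → Prop :=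
  Relation.ReflTransGen fun a b => a ∈ Z ∧ b ∈ Z ∧ G.Adj a b

theorem Conn.symm {Z : Finset (Fin n)} {a b : Fin n} (h : Conn G Z a b) : Conn G Z b a := by
  induction h with
  | refl => exact .refl
  | tail _ hbc ih => exact .head ⟨hbc.2.1, hbc.1, hbc.2.2.symm⟩ ih

theorem Conn.mono {Z Z' : Finset (Fin n)} (hZ : Z ⊆ Z') {a b : Fin n} (h : Conn G Z a b) :
    Conn G Z' a b :=
  Relation.ReflTransGen.mono (fun _ _ h => ⟨hZ h.1, hZ h.2.1, h.2.2⟩) _ _ h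

theorem reachable_induce {Z : Finset (Fin n)} (a b : {v // v ∈ (Z : Set (Fin n))}) :
    (G.induce (Z : Set (Fin n))).Reachable a b ↔ Conn G Z a b := by
  rw [SimpleGraph.reachable_iff_reflTransGen]
  constructor
  · intro h
    induction h with
    | refl => exact .refl
    | @tail b c _ hbc ih => exact .tail ih ⟨b.2, c.2, hbc⟩
  · obtain ⟨b, hb⟩ := b
    intro h
    simp only at h
    induction h with
    | refl => exact .refl
    | @tail c d hac hbc ih => exact .tail (ih hbc.1) (by simpa using hbc.2.2)

/-- Any two members of `Z` are connected in the subgraph induced by `Z`. -/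
def ConnSet (G : SimpleGraph (Fin n)) (Z : Finset (Fin n)) : Prop :=
  ∀ a ∈ Z, ∀ b ∈ Z, Conn G Z a b

theorem isTree_induce_iff (Z : Finset (Fin n)) : (G.induce (Z : Set (Fin n))).IsTree ↔
    ConnSet G Z ∧ degSum G Z + 2 = 2 * Z.card := by
  classical
  have hcard : Fintype.card {v // v ∈ (Z : Set (Fin n))} = Z.card := by simp
  rw [SimpleGraph.isTree_iff_connected_and_card, degSum_eq, Nat.card_eq_fintype_card,
    Nat.card_eq_fintype_card, ← SimpleGraph.edgeFinset_card, hcard]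
  constructor
  · rintro ⟨h1, h2⟩
    exact ⟨fun a ha b hb => (reachable_induce ⟨a, ha⟩ ⟨b, hb⟩).1 (h1.preconnected _ _), by omega⟩
  · rintro ⟨h1, h2⟩
    refine ⟨?_, by omega⟩
    have : Nonempty {v // v ∈ (Z : Set (Fin n))} := by
      rw [← Fintype.card_pos_iff, hcard]; omega
    exact ⟨fun a b => (reachable_induce a b).2 (h1 a a.2 b b.2)⟩

/-- All nonempty induced subgraphs have fewer edges than vertices. -/
def Sparse (G : SimpleGraph (Fin n)) [DecidableRel G.Adj] (Z : Finset (Fin n)) : Prop :=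
  ∀ Z' ⊆ Z, Z'.Nonempty → degSum G Z' < 2 * Z'.card

theorem sparse_of_isTree {Z : Finset (Fin n)} (h : (G.induce (Z : Set (Fin n))).IsTree) :
    Sparse G Z := by
  classical
  intro Z' hZ' hne
  have hac : (G.induce (Z' : Set (Fin n))).IsAcyclic :=
    h.isAcyclic.embedding (G.induceHomOfLE (by simpa using hZ'))
  have : Nonempty {v // v ∈ (Z' : Set (Fin n))} := ⟨⟨hne.choose, hne.choose_spec⟩⟩
  obtain ⟨T, hT⟩ := SimpleGraph.connected_top.exists_isTree_le_of_le_of_isAcyclic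
    (le_top (a := G.induce (Z' : Set (Fin n)))) hac
  have h1 := hT.2.2.card_edgeFinset
  have h2 : (G.induce (Z' : Set (Fin n))).edgeFinset.card ≤ T.edgeFinset.card :=
    Finset.card_le_card (SimpleGraph.edgeFinset_mono hT.1)
  have hcard : Fintype.card ((Z' : Set (Fin n)) : Type _) = Z'.card := by simp
  rw [degSum_eq]
  simp only [hcard] at h1
  omega

theorem degSum_union {X Y : Finset (Fin n)} (h : Disjoint X Y) : degSum G (X ∪ Y) =
    degSum G X + degSum G Y + 2 * ∑ v ∈ X, (Y.filter (G.Adj v)).card := by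
  have h1 : ∀ v, ((X ∪ Y).filter (G.Adj v)).card =
      (X.filter (G.Adj v)).card + (Y.filter (G.Adj v)).card := fun v => by
    rw [Finset.filter_union, Finset.card_union_of_disjoint]
    exact Finset.disjoint_filter_filter h
  have h2 : ∑ v ∈ Y, (X.filter (G.Adj v)).card = ∑ v ∈ X, (Y.filter (G.Adj v)).card := by
    simp only [Finset.card_filter]
    rw [Finset.sum_comm]
    simp only [G.adj_comm]
  rw [degSum, Finset.sum_union h, Finset.sum_congr rfl fun v _ => h1 v,
    Finset.sum_congr (s₁ := Y) rfl fun v _ => h1 v, Finset.sum_add_distrib, Finset.sum_add_distrib,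
    h2, degSum, degSum]
  ring

variable (G)

/-- The members of `X` with at least two neighbors in `R'`. -/
def coreSet (R' X : Finset (Fin n)) : Finset (Fin n) :=
  X.filter fun v => 2 ≤ (R'.filter (G.Adj v)).card

/-- The members of `X` with exactly one neighbor in `R'`. -/
def oneSet (R' X : Finset (Fin n)) : Finset (Fin n) :=
  X.filter fun v => (R'.filter (G.Adj v)).card = 1

/-- A number determining the difference of the numbers of edges and vertices of `X ∪ Y`. -/
def sigVal (R' X : Finset (Fin n)) : ℕ :=
  degSum G X + 2 * (oneSet G R' X).card + 2 * n - 2 * X.card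

/-- `X` is empty or has fewer edges than vertices. -/
def Light (X : Finset (Fin n)) : Prop := X = ∅ ∨ degSum G X < 2 * X.card

variable {G}

theorem nbrEquiv_two {A Y R' : Finset (Fin n)} (h : NbrEquiv G 2 Aᶜ Y R') {v : Fin n} (hv : v ∈ A) :
    min 2 (Y.filter (G.Adj v)).card = min 2 (R'.filter (G.Adj v)).card := by
  have := h v (by simpa using hv)
  have e : ∀ Z : Finset (Fin n), Z ∩ G.neighborFinset v = Z.filter (G.Adj v) := fun Z => by
    ext; simp
  rwa [e, e] at this

theorem sum_cross {A X Y R' : Finset (Fin n)} (h : NbrEquiv G 2 Aᶜ Y R') (hX : X ⊆ A) :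
    ∑ v ∈ X, (Y.filter (G.Adj v)).card = (oneSet G R' X).card +
      ∑ u ∈ Y, ((coreSet G R' X).filter (G.Adj u)).card := by
  have h1 : ∑ u ∈ Y, ((coreSet G R' X).filter (G.Adj u)).card =
      ∑ v ∈ X, if 2 ≤ (R'.filter (G.Adj v)).card then (Y.filter (G.Adj v)).card else 0 := by
    rw [← Finset.sum_filter]
    simp only [Finset.card_filter]
    rw [Finset.sum_comm]
    simp only [G.adj_comm, coreSet, Finset.card_filter]
  rw [h1, oneSet, Finset.card_filter, ← Finset.sum_add_distrib]
  refine Finset.sum_congr rfl fun v hv => ?_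
  have := nbrEquiv_two h (hX hv)
  split_ifs <;> omega

/-- The signature determines the difference of the numbers of edges and vertices. -/
theorem balance_eq {A X X' Y R' : Finset (Fin n)} (h : NbrEquiv G 2 Aᶜ Y R') (hX : X ⊆ A)
    (hX' : X' ⊆ A) (hY : Y ⊆ Aᶜ) (hv : sigVal G R' X = sigVal G R' X')
    (hc : ∀ u ∈ Aᶜ, ((coreSet G R' X).filter (G.Adj u)).card =
      ((coreSet G R' X').filter (G.Adj u)).card) :
    degSum G (X ∪ Y) + 2 = 2 * (X ∪ Y).card ↔ degSum G (X' ∪ Y) + 2 = 2 * (X' ∪ Y).card := by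
  have d1 : Disjoint X Y := Finset.disjoint_of_subset_left hX
    (Finset.disjoint_of_subset_right hY disjoint_compl_right)
  have d2 : Disjoint X' Y := Finset.disjoint_of_subset_left hX'
    (Finset.disjoint_of_subset_right hY disjoint_compl_right)
  rw [degSum_union d1, degSum_union d2, Finset.card_union_of_disjoint d1,
    Finset.card_union_of_disjoint d2, sum_cross h hX, sum_cross h hX',
    Finset.sum_congr rfl fun u hu => hc u (hY hu)]
  have l1 : X.card ≤ n := by simpa using Finset.card_le_univ X
  have l2 : X'.card ≤ n := by simpa using Finset.card_le_univ X'
  unfold sigVal at hv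
  omega

theorem Sparse.light {X Y : Finset (Fin n)} (h : Sparse G (X ∪ Y)) : Light G X := by
  rcases X.eq_empty_or_nonempty with h' | h'
  · exact .inl h'
  · exact .inr (h X Finset.subset_union_left h')

theorem sigVal_lt {R' X : Finset (Fin n)} (hn : 0 < n) (h : Light G X) :
    sigVal G R' X / 2 < 2 * n ∧ 2 ∣ sigVal G R' X := by
  have l1 : (oneSet G R' X).card ≤ X.card := Finset.card_filter_le _ _
  have l2 : X.card ≤ n := by simpa using Finset.card_le_univ X
  have := degSum_even (G := G) X
  unfold sigVal
  constructor
  · rcases h with rfl | h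
    · simp [degSum, oneSet]; omega
    · omega
  · omega

end Edges

/-! ### Forests and private neighbors -/

section Forest
variable {n : ℕ} {G : SimpleGraph (Fin n)} [DecidableRel G.Adj] {A Y : Finset (Fin n)}

/-- The members of `Y` with at least two neighbors in `Z`. -/
def shared (G : SimpleGraph (Fin n)) [DecidableRel G.Adj] (Y Z : Finset (Fin n)) :
    Finset (Fin n) :=
  Y.filter fun u => 2 ≤ (Z.filter (G.Adj u)).card

theorem Sparse.exists_shared_le_one {X Z : Finset (Fin n)} (h : Sparse G (X ∪ Y))
    (hd : Disjoint X Y) (hZ : Z ⊆ X) (hne : Z.Nonempty) :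
    ∃ z ∈ Z, ((shared G Y Z).filter (G.Adj z)).card ≤ 1 := by
  by_contra! hcon
  have hU : shared G Y Z ⊆ Y := Finset.filter_subset _ _
  have hd' : Disjoint Z (shared G Y Z) :=
    Finset.disjoint_of_subset_left hZ (Finset.disjoint_of_subset_right hU hd)
  have h1 := h (Z ∪ shared G Y Z) (Finset.union_subset_union hZ hU)
    (hne.mono Finset.subset_union_left)
  rw [degSum_union hd', Finset.card_union_of_disjoint hd'] at h1
  have h2 : Z.card * 2 ≤ ∑ v ∈ Z, ((shared G Y Z).filter (G.Adj v)).card := by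
    rw [← smul_eq_mul]; exact Finset.card_nsmul_le_sum _ _ _ fun v hv => hcon v hv
  have h3 : (shared G Y Z).card * 2 ≤ ∑ v ∈ Z, ((shared G Y Z).filter (G.Adj v)).card := by
    have : ∑ v ∈ Z, ((shared G Y Z).filter (G.Adj v)).card =
        ∑ u ∈ shared G Y Z, (Z.filter (G.Adj u)).card := by
      simp only [Finset.card_filter]
      rw [Finset.sum_comm]
      simp only [G.adj_comm]
    rw [this, ← smul_eq_mul]
    exact Finset.card_nsmul_le_sum _ _ _ fun u hu => (Finset.mem_filter.1 hu).2
  omega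

/-- A neighbor of `z` in `Y` without other neighbors in `Z`. -/
theorem exists_private {Z : Finset (Fin n)} {z : Fin n} (hz : z ∈ Z)
    (h1 : ((shared G Y Z).filter (G.Adj z)).card ≤ 1) (h2 : 2 ≤ (Y.filter (G.Adj z)).card) :
    ∃ u ∈ Y, G.Adj u z ∧ (Z.filter (G.Adj u)).card = 1 := by
  have : ∃ u ∈ Y.filter (G.Adj z), u ∉ (shared G Y Z).filter (G.Adj z) := by
    by_contra! hcon
    have := Finset.card_le_card (fun u hu => hcon u hu : Y.filter (G.Adj z) ⊆ _)
    omega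
  obtain ⟨u, hu, hu'⟩ := this
  rw [Finset.mem_filter] at hu
  simp only [Finset.mem_filter, shared, not_and] at hu'
  have h3 : (Z.filter (G.Adj u)).card < 2 := by
    by_contra hc
    exact hu' ⟨hu.1, by omega⟩ hu.2
  have h4 : 0 < (Z.filter (G.Adj u)).card :=
    Finset.card_pos.2 ⟨z, Finset.mem_filter.2 ⟨hz, hu.2.symm⟩⟩
  exact ⟨u, hu.1, hu.2.symm, by omega⟩

open Classical in
theorem peel_subset (Z : Finset (Fin n)) : peel G A Z ⊆ Z := Finset.filter_subset _ _

open Classical in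
theorem iterate_peel_eq_empty {Z : Finset (Fin n)}
    (h : ∀ Z' ⊆ Z, Z'.Nonempty → ∃ z ∈ Z', HasPrivate G A Z' z) : (peel G A)^[n] Z = ∅ := by
  have key : ∀ i, (peel G A)^[i] Z ⊆ Z ∧
      ((peel G A)^[i] Z = ∅ ∨ ((peel G A)^[i] Z).card + i ≤ Z.card) := by
    intro i
    induction i with
    | zero => exact ⟨subset_rfl, .inr (by simp)⟩
    | succ i ih =>
      rw [Function.iterate_succ_apply']
      refine ⟨(peel_subset _).trans ih.1, ?_⟩
      rcases Finset.eq_empty_or_nonempty ((peel G A)^[i] Z) with he | hne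
      · left; rw [he]; simp [peel]
      · right
        obtain ⟨z, hz, hz'⟩ := h _ ih.1 hne
        have h1 := ih.2.resolve_left hne.ne_empty
        have : (peel G A ((peel G A)^[i] Z)).card < ((peel G A)^[i] Z).card := by
          refine Finset.card_lt_card ⟨peel_subset _, fun hs => ?_⟩
          exact (Finset.mem_filter.1 (hs hz)).2 hz'
        omega
  rcases (key n).2 with h1 | h1
  · exact h1
  · have : Z.card ≤ n := by simpa using Finset.card_le_univ Z
    exact Finset.card_eq_zero.1 (by omega)

open Classical in
theorem exists_hasPrivate_of_iterate_peel {Z : Finset (Fin n)} {i : ℕ}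
    (h : (peel G A)^[i] Z = ∅) : ∀ Z' ⊆ Z, Z'.Nonempty → ∃ z ∈ Z', HasPrivate G A Z' z := by
  intro Z' hZ' hne
  by_contra! hcon
  have key : ∀ i, Z' ⊆ (peel G A)^[i] Z := by
    intro i
    induction i with
    | zero => exact hZ'
    | succ i ih =>
      rw [Function.iterate_succ_apply']
      intro z hz
      refine Finset.mem_filter.2 ⟨ih hz, fun hp => hcon z hz ?_⟩
      obtain ⟨u, hu, huz, hc⟩ := hp
      refine ⟨u, hu, huz, le_antisymm ?_ ?_⟩
      · rw [← hc]; exact Finset.card_le_card (Finset.filter_subset_filter _ ih)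
      · exact Finset.card_pos.2 ⟨z, Finset.mem_filter.2 ⟨hz, huz⟩⟩
  obtain ⟨z, hz⟩ := hne
  simpa [h] using key i hz

/-- The cores of partial solutions can be peeled off. -/
theorem Sparse.peel_core {X R' : Finset (Fin n)} (h : Sparse G (X ∪ Y)) (hX : X ⊆ A)
    (hY : Y ⊆ Aᶜ) (hR : NbrEquiv G 2 Aᶜ Y R') : (peel G A)^[n] (coreSet G R' X) = ∅ := by
  have d1 : Disjoint X Y := Finset.disjoint_of_subset_left hX
    (Finset.disjoint_of_subset_right hY disjoint_compl_right)
  refine iterate_peel_eq_empty fun Z hZ hne => ?_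
  have hZX : Z ⊆ X := hZ.trans (Finset.filter_subset _ _)
  obtain ⟨z, hz, h1⟩ := h.exists_shared_le_one d1 hZX hne
  have h2 := nbrEquiv_two hR (hX (hZX hz))
  have h3 := (Finset.mem_filter.1 (hZ hz)).2
  obtain ⟨u, hu, hu', hu''⟩ := exists_private hz h1 (by omega)
  exact ⟨z, hz, u, by simpa using hY hu, hu', hu''⟩

/-- Half of the core of a partial solution consists of vertices with private neighbors. -/
theorem Sparse.exists_good {X R' : Finset (Fin n)} (h : Sparse G (X ∪ Y)) (hX : X ⊆ A)
    (hY : Y ⊆ Aᶜ) (hR : NbrEquiv G 2 Aᶜ Y R') :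
    ∃ S ∈ goods G A, (coreSet G R' X).card ≤ 2 * S.card := by
  classical
  have d1 : Disjoint X Y := Finset.disjoint_of_subset_left hX
    (Finset.disjoint_of_subset_right hY disjoint_compl_right)
  have key : ∀ Z ⊆ coreSet G R' X, ∃ (p : Fin n → Fin n) (col : Fin n → Bool),
      Set.InjOn p Z ∧ ∀ z ∈ Z, p z ∈ Y ∧ G.Adj (p z) z ∧
        ∀ z' ∈ Z, z' ≠ z → G.Adj (p z) z' → col z' ≠ col z := by
    intro Z
    induction Z using Finset.strongInduction with
    | H Z ih =>
      intro hZ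
      rcases Z.eq_empty_or_nonempty with rfl | hne
      · exact ⟨id, fun _ => true, by simp, by simp⟩
      have hZX : Z ⊆ X := hZ.trans (Finset.filter_subset _ _)
      obtain ⟨z, hz, h1⟩ := h.exists_shared_le_one d1 hZX hne
      have h2 := nbrEquiv_two hR (hX (hZX hz))
      have h3 := (Finset.mem_filter.1 (hZ hz)).2
      obtain ⟨u, hu, hu', hu''⟩ := exists_private hz h1 (by omega)
      have huz : ∀ z' ∈ Z, G.Adj u z' → z' = z := fun z' hz' ha =>
        Finset.card_le_one.1 hu''.le z' (by simp [hz', ha]) z (by simp [hz, hu'])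
      obtain ⟨p, col, hinj, hp⟩ := ih (Z.erase z) (Finset.erase_ssubset hz)
        ((Finset.erase_subset _ _).trans hZ)
      -- at most one of the chosen neighbors is adjacent to the new vertex
      have huniq : ∀ a ∈ Z.erase z, ∀ b ∈ Z.erase z, G.Adj (p a) z → G.Adj (p b) z → a = b := by
        intro a ha b hb haz hbz
        refine hinj ha hb (Finset.card_le_one.1 h1 _ ?_ _ ?_)
        · refine Finset.mem_filter.2 ⟨Finset.mem_filter.2 ⟨(hp a ha).1, ?_⟩, haz.symm⟩
          exact Finset.one_lt_card.2 ⟨a, by simp [Finset.mem_of_mem_erase ha, (hp a ha).2.1], z,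
            by simp [hz, haz], Finset.ne_of_mem_erase ha⟩
        · refine Finset.mem_filter.2 ⟨Finset.mem_filter.2 ⟨(hp b hb).1, ?_⟩, hbz.symm⟩
          exact Finset.one_lt_card.2 ⟨b, by simp [Finset.mem_of_mem_erase hb, (hp b hb).2.1], z,
            by simp [hz, hbz], Finset.ne_of_mem_erase hb⟩
      obtain ⟨c, hc⟩ : ∃ c : Bool, ∀ a ∈ Z.erase z, G.Adj (p a) z → c ≠ col a := by
        by_cases hex : ∃ a ∈ Z.erase z, G.Adj (p a) z
        · obtain ⟨a, ha, haz⟩ := hex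
          refine ⟨!col a, fun b hb hbz => ?_⟩
          rw [huniq a ha b hb haz hbz]; simp
        · push Not at hex
          exact ⟨true, fun a ha haz => absurd haz (hex a ha)⟩
      refine ⟨Function.update p z u, Function.update col z c, ?_, ?_⟩
      · intro a ha b hb hab
        by_cases haz : a = z <;> by_cases hbz : b = z
        · rw [haz, hbz]
        · rw [haz, Function.update_self, Function.update_of_ne hbz] at hab
          have := (hp b (Finset.mem_erase.2 ⟨hbz, hb⟩)).2.1
          rw [← hab] at this
          exact absurd (huz b hb this) hbz
        · rw [hbz, Function.update_self, Function.update_of_ne haz] at hab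
          have := (hp a (Finset.mem_erase.2 ⟨haz, ha⟩)).2.1
          rw [hab] at this
          exact absurd (huz a ha this) haz
        · rw [Function.update_of_ne haz, Function.update_of_ne hbz] at hab
          exact hinj (Finset.mem_erase.2 ⟨haz, ha⟩) (Finset.mem_erase.2 ⟨hbz, hb⟩) hab
      · intro a ha
        by_cases haz : a = z
        · subst haz
          rw [Function.update_self, Function.update_self]
          exact ⟨hu, hu', fun z' hz' hne ha' => absurd (huz z' hz' ha') hne⟩
        · rw [Function.update_of_ne haz, Function.update_of_ne haz]
          have ha' := Finset.mem_erase.2 ⟨haz, ha⟩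
          refine ⟨(hp a ha').1, (hp a ha').2.1, fun z' hz' hne hadj => ?_⟩
          by_cases hzz : z' = z
          · rw [hzz, Function.update_self]
            exact hc a ha' (hzz ▸ hadj)
          · rw [Function.update_of_ne hzz]
            exact (hp a ha').2.2 z' (Finset.mem_erase.2 ⟨hzz, hz'⟩) hne hadj
  obtain ⟨p, col, -, hp⟩ := key _ subset_rfl
  have hgood : ∀ c : Bool, (coreSet G R' X).filter (fun z => col z = c) ∈ goods G A := by
    intro c
    refine Finset.mem_filter.2 ⟨Finset.mem_powerset.2 ?_, ?_⟩
    · exact (Finset.filter_subset _ _).trans ((Finset.filter_subset _ _).trans hX)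
    · rw [peel, Finset.filter_eq_empty_iff]
      intro z hz
      rw [Finset.mem_filter] at hz
      rw [not_not]
      obtain ⟨h1, h2, h3⟩ := hp z hz.1
      refine ⟨p z, by simpa using hY h1, h2, Finset.card_eq_one.2 ⟨z, ?_⟩⟩
      ext z'
      simp only [Finset.mem_filter, Finset.mem_singleton]
      constructor
      · rintro ⟨⟨h4, h5⟩, h6⟩
        by_contra hne
        exact h3 z' h4 hne h6 (h5.trans hz.2.symm)
      · rintro rfl; exact ⟨hz, h2⟩
  have hsum := Finset.card_filter_add_card_filter_not (s := coreSet G R' X) (fun z => col z = true)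
  simp only [Bool.not_eq_true] at hsum
  rcases le_total ((coreSet G R' X).filter (fun z => col z = true)).card
    ((coreSet G R' X).filter (fun z => col z = false)).card with hle | hle
  · exact ⟨_, hgood false, by omega⟩
  · exact ⟨_, hgood true, by omega⟩

end Forest

/-! ### Connectedness and cuts -/

section Cuts
variable {n : ℕ} (G : SimpleGraph (Fin n)) [DecidableRel G.Adj]

/-- The component of `v` in the subgraph induced by `X` meets `S`. -/
def Sees (X S : Finset (Fin n)) (v : Fin n) : Prop := ∃ v' ∈ X, Conn G X v v' ∧ v' ∈ S

/-- Each component of the subgraph induced by `X` meets exactly one of `S` and `T`. -/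
def Splits (X S T : Finset (Fin n)) : Prop := ∀ v ∈ X, Xor (Sees G X S v) (Sees G X T v)

/-- The entry for `X` in column `j`, where `L` lists `q` sets. -/
def Entry (L : ℕ → Finset (Fin n)) (q : ℕ) (X : Finset (Fin n)) (j : ℕ) : Prop :=
  if j = 0 then ConnSet G X else Splits G X (L (j / q)) (L (j % q))

open Classical in
/-- The row for `X`. -/
noncomputable def rowVec (L : ℕ → Finset (Fin n)) (q : ℕ) (X : Finset (Fin n)) (j : ℕ) : ZMod 2 :=
  if j < q * q ∧ Entry G L q X j then 1 else 0

variable {G} {A X Y : Finset (Fin n)}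

/-- The component of `v` in the subgraph induced by `X` has a neighbor `y`. -/
def Linked (G : SimpleGraph (Fin n)) (X : Finset (Fin n)) (v y : Fin n) : Prop :=
  ∃ v' ∈ X, Conn G X v v' ∧ G.Adj y v'

theorem sees_nbhd (hX : X ⊆ A) (Y₁ : Finset (Fin n)) (v : Fin n) :
    Sees G X (nbhd G A Y₁) v ↔ ∃ y ∈ Y₁, Linked G X v y := by
  constructor
  · rintro ⟨v', h1, h2, h3⟩
    obtain ⟨y, hy, hyv⟩ := (Finset.mem_filter.1 h3).2
    exact ⟨y, hy, v', h1, h2, hyv⟩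
  · rintro ⟨y, hy, v', h1, h2, hyv⟩
    exact ⟨v', h1, h2, Finset.mem_filter.2 ⟨hX h1, y, hy, hyv⟩⟩

theorem splits_nbhd (hX : X ⊆ A) (Y₁ Y₂ : Finset (Fin n)) :
    Splits G X (nbhd G A Y₁) (nbhd G A Y₂) ↔
      ∀ v ∈ X, Xor (∃ y ∈ Y₁, Linked G X v y) (∃ y ∈ Y₂, Linked G X v y) := by
  simp only [Splits, sees_nbhd hX]

/-- No edges of the subgraph induced by `Z` leave `K`. -/
def ClosedIn (G : SimpleGraph (Fin n)) (Z K : Finset (Fin n)) : Prop :=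
  ∀ a ∈ K, ∀ b ∈ Z, G.Adj a b → b ∈ K

theorem ClosedIn.conn {Z K : Finset (Fin n)} (h : ClosedIn G Z K) {a b : Fin n} (ha : a ∈ K)
    (hab : Conn G Z a b) : b ∈ K := by
  induction hab with
  | refl => exact ha
  | tail _ hbc ih => exact h _ ih _ hbc.2.1 hbc.2.2

theorem Linked.conn {v y : Fin n} (hy : y ∈ Y) (h : Linked G X v y) : Conn G (X ∪ Y) v y := by
  obtain ⟨v', h1, h2, h3⟩ := h
  exact (h2.mono Finset.subset_union_left).tail
    ⟨Finset.mem_union_left _ h1, Finset.mem_union_right _ hy, h3.symm⟩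

/-- If the graph induced by `X ∪ Y` is connected, then all components of `X` have neighbors. -/
theorem ConnSet.exists_linked (h : ConnSet G (X ∪ Y)) (hd : Disjoint X Y) (hY : Y.Nonempty)
    {v : Fin n} (hv : v ∈ X) : ∃ y ∈ Y, Linked G X v y := by
  classical
  by_contra! hcon
  obtain ⟨y, hy⟩ := hY
  have hcl : ClosedIn G (X ∪ Y) (X.filter (Conn G X v)) := by
    intro a ha b hb hab
    rw [Finset.mem_filter] at ha ⊢
    rcases Finset.mem_union.1 hb with hb | hb
    · exact ⟨hb, ha.2.tail ⟨ha.1, hb, hab⟩⟩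
    · exact absurd ⟨a, ha.1, ha.2, hab.symm⟩ (hcon b hb)
  have := hcl.conn (Finset.mem_filter.2 ⟨hv, .refl⟩)
    (h v (Finset.mem_union_left _ hv) y (Finset.mem_union_right _ hy))
  exact Finset.disjoint_left.1 hd (Finset.mem_filter.1 this).1 hy

open Classical in
/-- The sides containing `y₀` of the cuts of `Y` without edges across. -/
noncomputable def cutSides (G : SimpleGraph (Fin n)) (Y : Finset (Fin n)) (y₀ : Fin n) :
    Finset (Finset (Fin n)) :=
  Y.powerset.filter fun Y₁ => y₀ ∈ Y₁ ∧ ClosedIn G Y Y₁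

theorem flip_inside {y y₁ k l v : Prop} (h : y → l → (v ↔ k)) (h₁ : y₁ → y) (hv : v) :
    ((y ∧ (y₁ ↔ ¬ k)) ∧ l ↔ (y ∧ ¬ y₁) ∧ l) ∧ ((y ∧ ¬ (y ∧ (y₁ ↔ ¬ k))) ∧ l ↔ y₁ ∧ l) := by
  tauto

theorem flip_outside {y y₁ k l v : Prop} (h : y → l → (v ↔ k)) (h₁ : y₁ → y) (hv : ¬ v) :
    ((y ∧ (y₁ ↔ ¬ k)) ∧ l ↔ y₁ ∧ l) ∧
      ((y ∧ ¬ (y ∧ (y₁ ↔ ¬ k))) ∧ l ↔ (y ∧ ¬ y₁) ∧ l) := by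
  tauto

open Classical in
/-- The number of consistent cuts is odd if and only if the graph is connected. -/
theorem sum_cutSides (hX : X ⊆ A) (hY : Y ⊆ Aᶜ) {y₀ : Fin n} (hy₀ : y₀ ∈ Y) :
    (∑ Y₁ ∈ cutSides G Y y₀,
      if Splits G X (nbhd G A Y₁) (nbhd G A (Y \ Y₁)) then (1 : ZMod 2) else 0) =
    if ConnSet G (X ∪ Y) then 1 else 0 := by
  have hd : Disjoint X Y := Finset.disjoint_of_subset_left hX
    (Finset.disjoint_of_subset_right hY disjoint_compl_right)
  simp only [splits_nbhd hX]
  split_ifs with hconn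
  · rw [Finset.sum_eq_single Y]
    · rw [if_pos]
      intro v hv
      exact .inl ⟨hconn.exists_linked hd ⟨y₀, hy₀⟩ hv, by simp⟩
    · intro Y₁ hY₁ hne
      rw [cutSides, Finset.mem_filter, Finset.mem_powerset] at hY₁
      obtain ⟨h1, h2, h3⟩ := hY₁
      rw [if_neg]
      intro hs
      refine hne (Finset.Subset.antisymm h1 fun y hy => ?_)
      have hcl : ClosedIn G (X ∪ Y) (Y₁ ∪ X.filter fun v => ∃ y ∈ Y₁, Linked G X v y) := by
        intro a ha b hb hab
        rw [Finset.mem_union, Finset.mem_filter] at ha ⊢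
        rcases ha with ha | ⟨ha, y', hy', v', h4, h5, h6⟩
        · rcases Finset.mem_union.1 hb with hb | hb
          · exact .inr ⟨hb, a, ha, b, hb, .refl, hab⟩
          · exact .inl (h3 a ha b hb hab)
        · rcases Finset.mem_union.1 hb with hb | hb
          · exact .inr ⟨hb, y', hy', v', h4, .head ⟨hb, ha, hab.symm⟩ h5, h6⟩
          · left
            by_contra hb'
            rcases hs a ha with hs | hs
            · exact hs.2 ⟨b, Finset.mem_sdiff.2 ⟨hb, hb'⟩, a, ha, .refl, hab.symm⟩
            · exact hs.2 ⟨y', hy', v', h4, h5, h6⟩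
      have := hcl.conn (Finset.mem_union_left _ h2)
        (hconn y₀ (Finset.mem_union_right _ hy₀) y (Finset.mem_union_right _ hy))
      rcases Finset.mem_union.1 this with h | h
      · exact h
      · exact absurd hy (Finset.disjoint_left.1 hd (Finset.mem_filter.1 h).1)
    · intro h
      refine absurd ?_ h
      rw [cutSides, Finset.mem_filter, Finset.mem_powerset]
      exact ⟨subset_rfl, hy₀, fun _ _ b hb _ => hb⟩
  · obtain ⟨b, hb, hnb⟩ : ∃ b ∈ X ∪ Y, ¬ Conn G (X ∪ Y) y₀ b := by
      by_contra! hall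
      exact hconn fun a ha b hb => (hall a ha).symm.trans (hall b hb)
    let K := (X ∪ Y).filter fun a => ¬ Conn G (X ∪ Y) y₀ a
    have hKcl : ClosedIn G (X ∪ Y) K := by
      intro a ha c hc hac
      rw [Finset.mem_filter] at ha ⊢
      exact ⟨hc, fun h => ha.2 (h.tail ⟨hc, ha.1, hac.symm⟩)⟩
    have hy₀K : y₀ ∉ K := fun h => (Finset.mem_filter.1 h).2 .refl
    have hbK : b ∈ K := Finset.mem_filter.2 ⟨hb, hnb⟩
    have hlink : ∀ v ∈ X, ∀ y ∈ Y, Linked G X v y → (v ∈ K ↔ y ∈ K) := fun v hv y hy h =>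
      ⟨fun hv => hKcl.conn hv (h.conn hy), fun hy' => hKcl.conn hy' (h.conn hy).symm⟩
    clear_value K
    by_cases hKY : (K ∩ Y).Nonempty
    · obtain ⟨g, hg⟩ : ∃ g : Finset (Fin n) → Finset (Fin n),
          ∀ Y₁ y, y ∈ g Y₁ ↔ y ∈ Y ∧ (y ∈ Y₁ ↔ y ∉ K) :=
        ⟨fun Y₁ => Y.filter fun y => (y ∈ Y₁ ↔ y ∉ K), fun Y₁ y => Finset.mem_filter⟩
      have hgg : ∀ Y₁ ⊆ Y, g (g Y₁) = Y₁ := fun Y₁ h1 => by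
        ext y
        rw [hg, hg]
        have := @h1 y
        tauto
      refine Finset.sum_involution (fun Y₁ _ => g Y₁) ?_ ?_ ?_ ?_
      · intro Y₁ hY₁
        rw [cutSides, Finset.mem_filter, Finset.mem_powerset] at hY₁
        have hiff : (∀ v ∈ X, Xor (∃ y ∈ g Y₁, Linked G X v y) (∃ y ∈ Y \ g Y₁, Linked G X v y)) ↔
            ∀ v ∈ X, Xor (∃ y ∈ Y₁, Linked G X v y) (∃ y ∈ Y \ Y₁, Linked G X v y) := by
          refine forall₂_congr fun v hv => ?_
          by_cases hvK : v ∈ K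
          · have e := fun y => flip_inside (hlink v hv y) (@hY₁.1 y) hvK
            have e1 : (∃ y ∈ g Y₁, Linked G X v y) ↔ ∃ y ∈ Y \ Y₁, Linked G X v y := by
              simp only [hg, Finset.mem_sdiff, (e _).1]
            have e2 : (∃ y ∈ Y \ g Y₁, Linked G X v y) ↔ ∃ y ∈ Y₁, Linked G X v y := by
              simp only [hg, Finset.mem_sdiff, (e _).2]
            rw [e1, e2, xor_comm]
          · have e := fun y => flip_outside (hlink v hv y) (@hY₁.1 y) hvK
            have e1 : (∃ y ∈ g Y₁, Linked G X v y) ↔ ∃ y ∈ Y₁, Linked G X v y := by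
              simp only [hg, (e _).1]
            have e2 : (∃ y ∈ Y \ g Y₁, Linked G X v y) ↔ ∃ y ∈ Y \ Y₁, Linked G X v y := by
              simp only [hg, Finset.mem_sdiff, (e _).2]
            rw [e1, e2]
        simp only [hiff]
        exact CharTwo.add_self_eq_zero _
      · intro Y₁ _ _ he
        obtain ⟨y, hy⟩ := hKY
        rw [Finset.mem_inter] at hy
        have : y ∈ g Y₁ ↔ y ∈ Y₁ := by rw [he]
        rw [hg] at this
        simp only [hy.1, hy.2, not_true, iff_false, true_and] at this
        exact iff_not_self this.symm
      · intro Y₁ hY₁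
        rw [cutSides, Finset.mem_filter, Finset.mem_powerset] at hY₁ ⊢
        refine ⟨fun y hy => ((hg _ _).1 hy).1,
          (hg _ _).2 ⟨hy₀, by simp [hY₁.2.1, hy₀K]⟩, ?_⟩
        intro a ha c hc hac
        rw [hg] at ha ⊢
        have h1 : a ∈ Y₁ ↔ c ∈ Y₁ := ⟨fun h => hY₁.2.2 a h c hc hac,
          fun h => hY₁.2.2 c h a ha.1 hac.symm⟩
        have h2 : a ∈ K ↔ c ∈ K :=
          ⟨fun h => hKcl a h c (Finset.mem_union_right _ hc) hac,
            fun h => hKcl c h a (Finset.mem_union_right _ ha.1) hac.symm⟩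
        exact ⟨hc, by rw [← h1, ← h2]; exact ha.2⟩
      · intro Y₁ hY₁
        rw [cutSides, Finset.mem_filter, Finset.mem_powerset] at hY₁
        exact hgg Y₁ hY₁.1
    · refine Finset.sum_eq_zero fun Y₁ hY₁ => ?_
      rw [cutSides, Finset.mem_filter, Finset.mem_powerset] at hY₁
      have hKY' : ∀ y ∈ Y, y ∉ K := fun y hy hyK => hKY ⟨y, Finset.mem_inter.2 ⟨hyK, hy⟩⟩
      have hbX : b ∈ X := (Finset.mem_union.1 hb).resolve_right fun h => hKY' b h hbK
      rw [if_neg]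
      intro hs
      rcases hs b hbX with ⟨⟨y, hy, hl⟩, -⟩ | ⟨⟨y, hy, hl⟩, -⟩
      · exact hKY' y (hY₁.1 hy) ((hlink b hbX y (hY₁.1 hy) hl).1 hbK)
      · have hy := (Finset.mem_sdiff.1 hy).1
        exact hKY' y hy ((hlink b hbX y hy hl).1 hbK)

/-- Same signature: the data of `X` that determine which `Y` balance the number of edges. -/
structure SameSig (G : SimpleGraph (Fin n)) [DecidableRel G.Adj] (A R' X X' : Finset (Fin n)) :
    Prop where
  val : sigVal G R' X = sigVal G R' X'
  count : ∀ u ∈ Aᶜ, ((coreSet G R' X).filter (G.Adj u)).card =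
    ((coreSet G R' X').filter (G.Adj u)).card

/-- For each `Y` there is a linear functional recognizing the sets that form a tree with `Y`. -/
theorem exists_functional {R' : Finset (Fin n)} {L : ℕ → Finset (Fin n)} {q : ℕ} (hY : Y ⊆ Aᶜ)
    (hR : NbrEquiv G 2 Aᶜ Y R') (hL : (Finset.range q).image L = nbhds G A) (hq : 0 < q)
    (hL0 : L 0 = ∅) :
    ∃ φ : (ℕ → ZMod 2) →ₗ[ZMod 2] ZMod 2,
      (∀ X ⊆ A, (G.induce (↑(X ∪ Y) : Set (Fin n))).IsTree → φ (rowVec G L q X) = 1) ∧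
      ∀ X ⊆ A, ∀ X' ⊆ A, (G.induce (↑(X ∪ Y) : Set (Fin n))).IsTree → SameSig G A R' X X' →
        Light G X' → φ (rowVec G L q X') = 1 → (G.induce (↑(X' ∪ Y) : Set (Fin n))).IsTree := by
  classical
  simp only [isTree_induce_iff]
  by_cases hN : nbhd G A Y = ∅
  · have hadj : ∀ y ∈ Y, ∀ v ∈ A, ¬ G.Adj y v := fun y hy v hv h => by
      have : v ∈ nbhd G A Y := Finset.mem_filter.2 ⟨hv, y, hy, h⟩
      rw [hN] at this
      simp at this
    have h0 : ∀ X, rowVec G L q X 0 = if ConnSet G X then 1 else 0 := fun X => by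
      simp [rowVec, Entry, hq]
    have hor : ∀ X ⊆ A, ConnSet G (X ∪ Y) → Y = ∅ ∨ X = ∅ := fun X hX h => by
      by_contra! hcon
      have hd : Disjoint X Y := Finset.disjoint_of_subset_left hX
        (Finset.disjoint_of_subset_right hY disjoint_compl_right)
      obtain ⟨v, hv⟩ := hcon.2
      obtain ⟨y, hy, v', hv', -, ha⟩ := h.exists_linked hd hcon.1 hv
      exact hadj y hy v' (hX hv') ha
    refine ⟨LinearMap.proj 0, fun X hX h => ?_, fun X hX X' hX' h hs hl hφ => ?_⟩
    · rw [LinearMap.proj_apply, h0, if_pos]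
      rcases hor X hX h.1 with rfl | rfl
      · simpa using h.1
      · simp [ConnSet]
    · rw [LinearMap.proj_apply, h0] at hφ
      have hc : ConnSet G X' := by
        by_contra hc
        rw [if_neg hc] at hφ
        exact absurd hφ (by decide)
      rcases hor X hX h.1 with rfl | rfl
      · exact ⟨by simpa using hc, (balance_eq hR hX hX' hY hs.val hs.count).1 h.2⟩
      · have hone : oneSet G R' X' = ∅ := by
          rw [oneSet, Finset.filter_eq_empty_iff]
          intro v hv
          have h1 := nbrEquiv_two hR (hX' hv)
          have h2 : (Y.filter (G.Adj v)).card = 0 := by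
            rw [Finset.card_eq_zero, Finset.filter_eq_empty_iff]
            exact fun y hy hvy => hadj y hy v (hX' hv) hvy.symm
          omega
        have hv := hs.val
        have hcard : X'.card ≤ n := by simpa using Finset.card_le_univ X'
        have h0 : sigVal G R' ∅ = 2 * n := by simp [sigVal, degSum, oneSet]
        rw [h0, sigVal, hone, Finset.card_empty] at hv
        rcases hl with rfl | hl
        · exact h
        · omega
  · obtain ⟨v, hv⟩ := Finset.nonempty_of_ne_empty hN
    obtain ⟨hvA, y₀, hy₀, hyv⟩ := Finset.mem_filter.1 hv
    have hidx : ∀ Y₁ ⊆ Y, ∃ i < q, L i = nbhd G A Y₁ := fun Y₁ h => by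
      have : nbhd G A Y₁ ∈ nbhds G A :=
        Finset.mem_image_of_mem _ (Finset.mem_powerset.2 (h.trans hY))
      rw [← hL, Finset.mem_image] at this
      obtain ⟨i, hi, h⟩ := this
      exact ⟨i, Finset.mem_range.1 hi, h⟩
    choose! idx hidx1 hidx2 using hidx
    let col : Finset (Fin n) → ℕ := fun Y₁ => idx Y₁ * q + idx (Y \ Y₁)
    have hcol : ∀ Y₁ ⊆ Y, ∀ X, rowVec G L q X (col Y₁) =
        if Splits G X (nbhd G A Y₁) (nbhd G A (Y \ Y₁)) then 1 else 0 := by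
      intro Y₁ h X
      have i1 := hidx1 Y₁ h
      have i2 := hidx1 (Y \ Y₁) Finset.sdiff_subset
      have j1 : col Y₁ / q = idx Y₁ := by
        simp only [col]
        rw [Nat.add_comm, Nat.add_mul_div_right _ _ hq, Nat.div_eq_of_lt i2, Nat.zero_add]
      have j2 : col Y₁ % q = idx (Y \ Y₁) := by
        simp only [col]
        rw [Nat.add_comm, Nat.add_mul_mod_self_right, Nat.mod_eq_of_lt i2]
      have hne : col Y₁ ≠ 0 := by
        intro h0
        rw [h0, Nat.zero_div] at j1
        rw [h0, Nat.zero_mod] at j2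
        have k1 := hidx2 Y₁ h
        have k2 := hidx2 (Y \ Y₁) Finset.sdiff_subset
        rw [← j1, hL0] at k1
        rw [← j2, hL0] at k2
        by_cases hy : y₀ ∈ Y₁
        · have : v ∈ nbhd G A Y₁ := Finset.mem_filter.2 ⟨hvA, y₀, hy, hyv⟩
          rw [← k1] at this; simp at this
        · have : v ∈ nbhd G A (Y \ Y₁) :=
            Finset.mem_filter.2 ⟨hvA, y₀, Finset.mem_sdiff.2 ⟨hy₀, hy⟩, hyv⟩
          rw [← k2] at this; simp at this
      have hlt : col Y₁ < q * q := idx_lt i1 i2 le_rfl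
      simp only [rowVec, Entry, if_neg hne, hlt, true_and]
      rw [j1, j2, hidx2 Y₁ h, hidx2 (Y \ Y₁) Finset.sdiff_subset]
    have hφ : ∀ X ⊆ A, (∑ Y₁ ∈ cutSides G Y y₀, LinearMap.proj (R := ZMod 2) (col Y₁) :
        (ℕ → ZMod 2) →ₗ[ZMod 2] ZMod 2) (rowVec G L q X) =
        if ConnSet G (X ∪ Y) then 1 else 0 := fun X hX => by
      rw [LinearMap.sum_apply, ← sum_cutSides hX hY hy₀]
      refine Finset.sum_congr rfl fun Y₁ hY₁ => ?_
      rw [cutSides, Finset.mem_filter, Finset.mem_powerset] at hY₁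
      rw [LinearMap.proj_apply, hcol Y₁ hY₁.1]
    refine ⟨_, fun X hX h => (hφ X hX).trans (if_pos h.1), fun X hX X' hX' h hs hl h1 => ?_⟩
    rw [hφ X' hX'] at h1
    refine ⟨?_, (balance_eq hR hX hX' hY hs.val hs.count).1 h.2⟩
    by_contra hc
    rw [if_neg hc] at h1
    exact absurd h1 (by decide)

end Cuts

/-! ### The number of signatures -/

theorem le_width {n : ℕ} (f : Finset (Fin n) → ℕ) {T x : LayoutTree (Fin n)} (h : x ∈ T.nodes) :
    f x.verts ≤ T.width f := by
  have key : ∀ l : List (LayoutTree (Fin n)), x ∈ l →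
      f x.verts ≤ (l.map fun x => f x.verts).foldr max 0 := by
    intro l
    induction l with
    | nil => simp
    | cons y l ih =>
      intro hx
      rw [List.map_cons, List.foldr_cons]
      rcases List.mem_cons.1 hx with rfl | hx
      · exact le_max_left _ _
      · exact (ih hx).trans (le_max_right _ _)
  exact key _ h

section Count
variable {n : ℕ} (G : SimpleGraph (Fin n)) [DecidableRel G.Adj] (A : Finset (Fin n))

/-- The numbers of neighbors in `Z` of the vertices outside of `A`. -/
def cntVec (Z : Finset (Fin n)) (u : Fin n) : ℕ := if u ∈ A then 0 else (Z.filter (G.Adj u)).card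

/-- All nonempty subsets of `Z` contain a vertex with a private neighbor. -/
def Peelable (Z : Finset (Fin n)) : Prop :=
  ∀ Z' ⊆ Z, Z'.Nonempty → ∃ z ∈ Z', HasPrivate G A Z' z

variable {G A}

theorem card_nbhds_le_nec : (nbhds G A).card ≤ nec G 1 A := by
  have hcl : ∀ S ∈ nbhds G A, S ⊆ A ∧ S = nbhd G A
      (Aᶜ.filter fun u => min 1 ((A \ S) ∩ G.neighborFinset u).card = 0) := by
    intro S hS
    obtain ⟨Y, hY, rfl⟩ := Finset.mem_image.1 hS
    rw [Finset.mem_powerset] at hY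
    refine ⟨Finset.filter_subset _ _, ?_⟩
    have h0 : ∀ u, min 1 ((A \ nbhd G A Y) ∩ G.neighborFinset u).card = 0 ↔
        ∀ v ∈ A, G.Adj u v → v ∈ nbhd G A Y := fun u => by
      have : min 1 ((A \ nbhd G A Y) ∩ G.neighborFinset u).card = 0 ↔
          ((A \ nbhd G A Y) ∩ G.neighborFinset u).card = 0 := by omega
      rw [this, Finset.card_eq_zero, Finset.eq_empty_iff_forall_notMem]
      simp only [Finset.mem_inter, Finset.mem_sdiff, SimpleGraph.mem_neighborFinset, not_and]
      refine forall_congr' fun v => ?_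
      tauto
    simp only [h0]
    refine Finset.Subset.antisymm (fun v hv => ?_) fun v hv => ?_
    · have hv' := hv
      obtain ⟨hvA, u, hu, huv⟩ := Finset.mem_filter.1 hv
      refine Finset.mem_filter.2 ⟨hvA, u, Finset.mem_filter.2 ⟨hY hu, fun v' hv' huv' => ?_⟩, huv⟩
      exact Finset.mem_filter.2 ⟨hv', u, hu, huv'⟩
    · obtain ⟨hvA, u, hu, huv⟩ := Finset.mem_filter.1 hv
      exact (Finset.mem_filter.1 hu).2 v hvA huv
  unfold nec
  rw [← Nat.card_eq_finsetCard]
  refine Nat.card_le_card_of_injective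
    (fun S : nbhds G A => (Quotient.mk (nbrSetoid G 1 A) ⟨A \ S.1, Finset.sdiff_subset⟩)) ?_
  rintro ⟨S, hS⟩ ⟨S', hS'⟩ h
  have h' : NbrEquiv G 1 A (A \ S) (A \ S') := Quotient.exact h
  refine Subtype.ext ?_
  simp only
  rw [(hcl S hS).2, (hcl S' hS').2]
  congr 1
  exact Finset.filter_congr fun u hu => by rw [h' u hu]

/-- Families of small subsets of a set that is not everything. -/
theorem card_small_le {F : Finset (Finset (Fin n))} {k : ℕ} (h : A ≠ Finset.univ ∨ k = 0)
    (hF : ∀ Z ∈ F, Z ⊆ A ∧ Z.card ≤ k) : F.card ≤ n ^ k := by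
  classical
  rcases h with h | rfl
  · obtain ⟨u, hu⟩ : ∃ u, u ∉ A := by
      by_contra! hcon
      exact h (Finset.eq_univ_iff_forall.2 hcon)
    have hsub : F ⊆ (Finset.univ : Finset (Fin k → Fin n)).image
        fun g => Finset.univ.image g ∩ A := by
      intro Z hZ
      obtain ⟨h1, h2⟩ := hF Z hZ
      obtain ⟨e⟩ : Nonempty (Z ↪ Fin k) :=
        Function.Embedding.nonempty_of_card_le (by simpa using h2)
      refine Finset.mem_image.2 ⟨Function.extend e (fun z => z.1) fun _ => u, Finset.mem_univ _, ?_⟩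
      ext z
      simp only [Finset.mem_inter, Finset.mem_image, Finset.mem_univ, true_and]
      constructor
      · rintro ⟨⟨i, hi⟩, hzA⟩
        by_cases hex : ∃ a, e a = i
        · obtain ⟨a, rfl⟩ := hex
          rw [e.injective.extend_apply] at hi
          exact hi ▸ a.2
        · rw [Function.extend_apply' _ _ _ hex] at hi
          exact absurd (hi ▸ hzA) hu
      · intro hz
        exact ⟨⟨e ⟨z, hz⟩, by rw [e.injective.extend_apply]⟩, h1 hz⟩
    refine (Finset.card_le_card hsub).trans (Finset.card_image_le.trans ?_)
    simp
  · have : F ⊆ {∅} := fun Z hZ => by simpa using (hF Z hZ).2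
    simpa using Finset.card_le_card this

theorem Peelable.twins {Z : Finset (Fin n)} (h : Peelable G A Z) {v v' : Fin n} (hv : v ∈ Z)
    (hv' : v' ∈ Z) (ht : ∀ u ∉ A, G.Adj u v ↔ G.Adj u v') : v = v' := by
  by_contra hne
  obtain ⟨z, hz, u, hu, huz, hc⟩ := h {v, v'}
    (Finset.insert_subset hv (Finset.singleton_subset_iff.2 hv')) ⟨v, by simp⟩
  have hvv : G.Adj u v ∧ G.Adj u v' := by
    rcases Finset.mem_insert.1 hz with rfl | hz
    · exact ⟨huz, (ht u hu).1 huz⟩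
    · rw [Finset.mem_singleton] at hz
      exact ⟨(ht u hu).2 (hz ▸ huz), hz ▸ huz⟩
  have := Finset.card_le_one.1 hc.le v (by simp [hvv]) v' (by simp [hvv])
  exact hne this

open Classical in
theorem card_cntVec_mw {F : Finset (Finset (Fin n))} (hF : ∀ Z ∈ F, Z ⊆ A ∧ Peelable G A Z) :
    (F.image (cntVec G A)).card ≤ 2 ^ mwCut G A := by
  have hsub : F.image (cntVec G A) ⊆ (A.image fun v => G.neighborFinset v ∩ Aᶜ).powerset.image
      fun 𝒯 u => (𝒯.filter fun t => u ∈ t).card := by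
    intro c hc
    obtain ⟨Z, hZ, rfl⟩ := Finset.mem_image.1 hc
    obtain ⟨h1, h2⟩ := hF Z hZ
    refine Finset.mem_image.2 ⟨Z.image fun v => G.neighborFinset v ∩ Aᶜ,
      Finset.mem_powerset.2 (Finset.image_subset_image h1), ?_⟩
    have hinj : Set.InjOn (fun v => G.neighborFinset v ∩ Aᶜ) Z := by
      intro v hv v' hv' he
      refine h2.twins hv hv' fun u hu => ?_
      have := Finset.ext_iff.1 he u
      simpa [hu, G.adj_comm u] using this
    funext u
    rw [Finset.filter_image, Finset.card_image_of_injOn (hinj.mono (Finset.coe_subset.2 (Finset.filter_subset _ _))), cntVec]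
    split_ifs with hu
    · rw [Finset.card_eq_zero, Finset.filter_eq_empty_iff]
      simp [hu]
    · congr 1
      ext v
      simp [hu, G.adj_comm u]
  refine (Finset.card_le_card hsub).trans (Finset.card_image_le.trans ?_)
  rw [Finset.card_powerset]
  rfl

section Rank
variable {K : Type*} [Field K]

/-- Few columns determine the vectors in the row space. -/
theorem exists_columns {ι κ : Type*} [Fintype ι] [Fintype κ] (M : Matrix ι κ K) :
    ∃ J : Finset κ, J.card ≤ M.rank ∧
      ∀ x : ι → K, (∀ j ∈ J, Matrix.vecMul x M j = 0) → Matrix.vecMul x M = 0 := by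
  classical
  obtain ⟨b, hb, hspan, hli⟩ := exists_linearIndependent K (Set.range M.col)
  have hfin : b.Finite := (Set.finite_range _).subset hb
  have := hfin.fintype
  choose g hg using fun v : b => hb v.2
  refine ⟨Finset.univ.image g, ?_, fun x hx => ?_⟩
  · refine Finset.card_image_le.trans ?_
    rw [Matrix.rank_eq_finrank_span_cols, ← hspan]
    rw [finrank_span_set_eq_card (s := b) hli, Set.toFinset_card, Finset.card_univ]
  · funext j
    let ψ : (ι → K) →ₗ[K] K := ∑ i, x i • LinearMap.proj i
    have hψ : ∀ v, ψ v = ∑ i, x i * v i := fun v => by simp [ψ]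
    have hmul : ∀ j, Matrix.vecMul x M j = ψ (M.col j) := fun j => by
      rw [hψ]; rfl
    have hle : Submodule.span K b ≤ LinearMap.ker ψ := by
      refine Submodule.span_le.2 fun v hv => ?_
      have := hx (g ⟨v, hv⟩) (Finset.mem_image_of_mem _ (Finset.mem_univ _))
      rw [hmul, hg ⟨v, hv⟩] at this
      exact this
    rw [hspan] at hle
    have : M.col j ∈ LinearMap.ker ψ := hle (Submodule.subset_span ⟨j, rfl⟩)
    rw [hmul]
    exact this

open Classical in
/-- The indicator vector of a set of vertices. -/
noncomputable def indVec (K : Type*) [Field K] (A Z : Finset (Fin n)) (v : {v // v ∈ A}) : K :=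
  if v.1 ∈ Z then 1 else 0

theorem vecMul_cutMatrix (x : {v // v ∈ A} → K) (u : {v // v ∈ Aᶜ}) :
    Matrix.vecMul x (cutMatrix G K A) u =
      ∑ v : {v // v ∈ A}, if G.Adj u v then x v else 0 := by
  rw [Matrix.vecMul, dotProduct]
  refine Finset.sum_congr rfl fun v _ => ?_
  simp [cutMatrix, SimpleGraph.adjMatrix_apply, G.adj_comm]

theorem vecMul_indVec {Z : Finset (Fin n)} (hZ : Z ⊆ A) (u : {v // v ∈ Aᶜ}) :
    Matrix.vecMul (indVec K A Z) (cutMatrix G K A) u = ((cntVec G A Z u : ℕ) : K) := by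
  rw [vecMul_cutMatrix, cntVec, if_neg (Finset.mem_compl.1 u.2), Finset.card_filter, Nat.cast_sum]
  have h1 : ∀ v : {v // v ∈ A}, (if G.Adj u v then indVec K A Z v else 0) =
      (fun v => if v ∈ Z ∧ G.Adj u v then (1 : K) else 0) v.1 := fun v => by
    simp only [indVec]
    by_cases h2 : G.Adj u v <;> by_cases h3 : v.1 ∈ Z <;> simp [h2, h3]
  rw [Finset.sum_congr rfl fun v _ => h1 v,
    Finset.sum_coe_sort A (fun v => if v ∈ Z ∧ G.Adj u v then (1 : K) else 0)]
  rw [← Finset.sum_subset hZ]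
  · refine Finset.sum_congr rfl fun v hv => ?_
    by_cases h2 : G.Adj u v <;> simp [hv, h2]
  · intro v _ hv
    simp [hv]

/-- Rows of peelable sets are linearly independent. -/
theorem Peelable.eq_zero {Z : Finset (Fin n)} (h : Peelable G A Z) {x : {v // v ∈ A} → K}
    (hx : ∀ v, v.1 ∉ Z → x v = 0) (h0 : Matrix.vecMul x (cutMatrix G K A) = 0) : x = 0 := by
  classical
  by_contra hne
  obtain ⟨v₀, hv₀⟩ : ∃ v, x v ≠ 0 := by
    by_contra! hcon
    exact hne (funext hcon)
  let Z' : Finset (Fin n) := Z.filter fun v => ∃ h : v ∈ A, x ⟨v, h⟩ ≠ 0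
  obtain ⟨z, hz, u, hu, huz, hc⟩ := h Z' (Finset.filter_subset _ _)
    ⟨v₀, Finset.mem_filter.2 ⟨by_contra fun h => hv₀ (hx v₀ h), v₀.2, hv₀⟩⟩
  obtain ⟨hzZ, hzA, hxz⟩ := Finset.mem_filter.1 hz
  have := congrFun h0 ⟨u, by simpa using hu⟩
  rw [vecMul_cutMatrix, Finset.sum_eq_single (⟨z, hzA⟩ : {v // v ∈ A})] at this
  · rw [if_pos huz] at this
    exact hxz this
  · intro v _ hvz
    by_cases huv : G.Adj u v
    · rw [if_pos huv]
      by_contra hxv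
      refine hvz (Subtype.ext ?_)
      refine Finset.card_le_one.1 hc.le v.1 (Finset.mem_filter.2 ⟨Finset.mem_filter.2
        ⟨by_contra fun h => hxv (hx v h), v.2, hxv⟩, huv⟩) z (Finset.mem_filter.2 ⟨hz, huz⟩)
    · rw [if_neg huv]
  · intro h; exact absurd (Finset.mem_univ _) h

theorem Peelable.card_le {Z : Finset (Fin n)} (h : Peelable G A Z) (hZ : Z ⊆ A)
    {J : Finset {v // v ∈ Aᶜ}} (hJ : ∀ x : {v // v ∈ A} → K,
      (∀ j ∈ J, Matrix.vecMul x (cutMatrix G K A) j = 0) →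
      Matrix.vecMul x (cutMatrix G K A) = 0) : Z.card ≤ J.card := by
  classical
  let ext' : (Z → K) →ₗ[K] ({v // v ∈ A} → K) :=
    { toFun := fun x v => if hv : v.1 ∈ Z then x ⟨v.1, hv⟩ else 0
      map_add' := fun x y => by funext v; simp only [Pi.add_apply]; split_ifs <;> simp
      map_smul' := fun c x => by
        funext v; simp only [Pi.smul_apply, RingHom.id_apply]; split_ifs <;> simp }
  let res : (Z → K) →ₗ[K] (J → K) :=
    (LinearMap.funLeft K K (fun j : J => j.1)).comp
      ((Matrix.vecMulLinear (cutMatrix G K A)).comp ext')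
  have hinj : Function.Injective res := by
    rw [← LinearMap.ker_eq_bot, LinearMap.ker_eq_bot']
    intro x hx
    have h1 : ext' x = 0 := by
      refine h.eq_zero (fun v hv => dif_neg hv) (hJ _ fun j hj => ?_)
      exact congrFun hx ⟨j, hj⟩
    funext v
    have := congrFun h1 ⟨v.1, hZ v.2⟩
    simpa [ext'] using this
  have := LinearMap.finrank_le_finrank_of_injective hinj
  simpa using this

open Classical in
theorem card_cntVec_rwQ {F : Finset (Finset (Fin n))} (hF : ∀ Z ∈ F, Z ⊆ A ∧ Peelable G A Z) :
    (F.image (cntVec G A)).card ≤ (rwQCut G A + 1) ^ rwQCut G A := by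
  obtain ⟨J, hJ1, hJ2⟩ := exists_columns (cutMatrix G ℚ A)
  change J.card ≤ rwQCut G A at hJ1
  set r := rwQCut G A
  have hmap : (F.image (cntVec G A)).card ≤
      (Fintype.piFinset fun _ : J => Finset.range (r + 1)).card := by
    refine Finset.card_le_card_of_injOn (fun c j => c j.1.1) ?_ ?_
    · intro c hc
      obtain ⟨Z, hZ, rfl⟩ := Finset.mem_image.1 hc
      obtain ⟨h1, h2⟩ := hF Z hZ
      rw [Finset.mem_coe, Fintype.mem_piFinset]
      intro j
      have h3 := h2.card_le h1 hJ2
      have h4 : cntVec G A Z j.1.1 ≤ Z.card := by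
        unfold cntVec
        split_ifs
        · omega
        · exact Finset.card_filter_le _ _
      exact Finset.mem_range.2 (Nat.lt_succ_of_le (h4.trans (h3.trans hJ1)))
    · intro c hc c' hc' he
      obtain ⟨Z, hZ, rfl⟩ := Finset.mem_image.1 hc
      obtain ⟨Z', hZ', rfl⟩ := Finset.mem_image.1 hc'
      have h0 := hJ2 (indVec ℚ A Z - indVec ℚ A Z') fun j hj => by
        have := congrFun he ⟨j, hj⟩
        simp only at this
        rw [Matrix.sub_vecMul, Pi.sub_apply, vecMul_indVec (hF Z hZ).1, vecMul_indVec (hF Z' hZ').1,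
          this, sub_self]
      funext u
      by_cases hu : u ∈ A
      · simp [cntVec, hu]
      · have := congrFun h0 ⟨u, by simpa using hu⟩
        rw [Matrix.sub_vecMul, Pi.sub_apply, vecMul_indVec (hF Z hZ).1,
          vecMul_indVec (hF Z' hZ').1, Pi.zero_apply, sub_eq_zero] at this
        exact_mod_cast this
  refine hmap.trans ?_
  rw [Fintype.card_piFinset]
  simp only [Finset.card_range, Finset.prod_const, Finset.card_univ, Fintype.card_coe]
  exact Nat.pow_le_pow_right (by omega) hJ1

open Classical in
theorem card_cntVec_rw {F : Finset (Finset (Fin n))} (hF : ∀ Z ∈ F, Z ⊆ A ∧ Peelable G A Z) :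
    (F.image (cntVec G A)).card ≤ 2 ^ (rwCut G A * rwCut G A) := by
  obtain ⟨J, hJ1, hJ2⟩ := exists_columns (cutMatrix G (ZMod 2) A)
  change J.card ≤ rwCut G A at hJ1
  set r := rwCut G A
  let ρ : Fin n → J → ZMod 2 := fun v j => if G.Adj j.1.1 v then 1 else 0
  have hrow : ∀ v ∈ A, ∀ u : {v // v ∈ Aᶜ}, Matrix.vecMul (indVec (ZMod 2) A {v})
      (cutMatrix G (ZMod 2) A) u = if G.Adj u v then 1 else 0 := fun v hv u => by
    rw [vecMul_indVec (Finset.singleton_subset_iff.2 hv), cntVec, if_neg (Finset.mem_compl.1 u.2),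
      Finset.filter_singleton]
    split_ifs <;> simp
  have hρ : ∀ v ∈ A, ∀ v' ∈ A, ρ v = ρ v' → ∀ u ∉ A, G.Adj u v ↔ G.Adj u v' := by
    intro v hv v' hv' he u hu
    have h0 := hJ2 (indVec (ZMod 2) A {v} - indVec (ZMod 2) A {v'}) fun j hj => by
      rw [Matrix.sub_vecMul, Pi.sub_apply, hrow v hv, hrow v' hv', sub_eq_zero]
      exact congrFun he ⟨j, hj⟩
    have := congrFun h0 ⟨u, by simpa using hu⟩
    rw [Matrix.sub_vecMul, Pi.sub_apply, hrow v hv, hrow v' hv', Pi.zero_apply, sub_eq_zero] at this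
    by_cases h1 : G.Adj u v <;> by_cases h2 : G.Adj u v' <;> simp_all
  have hρ0 : ∀ v ∈ A, ρ v = 0 → ∀ u ∉ A, ¬ G.Adj u v := by
    intro v hv he u hu
    have h0 := hJ2 (indVec (ZMod 2) A {v}) fun j hj => by
      rw [hrow v hv]
      exact congrFun he ⟨j, hj⟩
    have := congrFun h0 ⟨u, by simpa using hu⟩
    rw [hrow v hv] at this
    by_contra h1
    simp [h1] at this
  let dec : (J → ZMod 2) → Fin n → ℕ := fun p u =>
    if u ∉ A ∧ ∃ v ∈ A, ρ v = p ∧ G.Adj u v then 1 else 0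
  have hdec0 : dec 0 = 0 := by
    funext u
    simp only [dec, Pi.zero_apply, ite_eq_right_iff, one_ne_zero, imp_false, not_and, not_exists]
    exact fun hu v hv he => hρ0 v hv he u hu
  have hdec : ∀ v ∈ A, ∀ u, dec (ρ v) u = if u ∉ A ∧ G.Adj u v then 1 else 0 := by
    intro v hv u
    simp only [dec]
    refine if_congr (and_congr_right fun hu => ⟨?_, fun h => ⟨v, hv, rfl, h⟩⟩) rfl rfl
    rintro ⟨v', hv', he, h⟩
    exact (hρ v' hv' v hv he u hu).1 h
  have hsub : F.image (cntVec G A) ⊆ (Finset.univ : Finset (Fin r → J → ZMod 2)).image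
      fun g => ∑ i, dec (g i) := by
    intro c hc
    obtain ⟨Z, hZ, rfl⟩ := Finset.mem_image.1 hc
    obtain ⟨h1, h2⟩ := hF Z hZ
    have h3 := h2.card_le h1 hJ2
    obtain ⟨e⟩ : Nonempty (Z ↪ Fin r) :=
      Function.Embedding.nonempty_of_card_le (by simpa using h3.trans hJ1)
    refine Finset.mem_image.2 ⟨Function.extend e (fun z => ρ z.1) 0, Finset.mem_univ _, ?_⟩
    have h4 : ∑ i, dec (Function.extend e (fun z => ρ z.1) 0 i) =
        ∑ i ∈ Finset.univ.map e, dec (Function.extend e (fun z => ρ z.1) 0 i) := by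
      refine (Finset.sum_subset (Finset.subset_univ _) fun i _ hi => ?_).symm
      rw [Function.extend_apply', Pi.zero_apply, hdec0]
      rintro ⟨a, rfl⟩
      exact hi (Finset.mem_map_of_mem _ (Finset.mem_univ _))
    rw [h4, Finset.sum_map]
    simp only [e.injective.extend_apply]
    rw [Finset.sum_coe_sort Z (fun z => dec (ρ z))]
    funext u
    rw [Finset.sum_apply, Finset.sum_congr rfl fun v hv => hdec v (h1 hv) u, cntVec]
    by_cases hu : u ∈ A <;> simp [hu]
  refine (Finset.card_le_card hsub).trans (Finset.card_image_le.trans ?_)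
  simp only [Finset.card_univ, Fintype.card_fun, ZMod.card, Fintype.card_coe, Fintype.card_fin]
  rw [← pow_mul]
  exact Nat.pow_le_pow_right (by omega) (Nat.mul_le_mul_right _ hJ1)

end Rank

end Count

/-! ### Viable sets -/

section Viable
variable {n : ℕ} {G : SimpleGraph (Fin n)} [DecidableRel G.Adj] {A : Finset (Fin n)}

theorem peelable_of_iterate {Z : Finset (Fin n)} {i : ℕ} (h : (peel G A)^[i] Z = ∅) :
    Peelable G A Z := exists_hasPrivate_of_iterate_peel h

theorem hasPrivate_of_goods {S : Finset (Fin n)} (hS : S ∈ goods G A) {v : Fin n} (hv : v ∈ S) :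
    HasPrivate G A S v := by
  by_contra h
  have : v ∈ peel G A S := by simp [peel, hv, h]
  rw [(Finset.mem_filter.1 hS).2] at this
  simp at this

theorem card_le_mimCut {S : Finset (Fin n)} (hS : S ∈ goods G A) : S.card ≤ mimCut G A := by
  classical
  have hSA : S ⊆ A := Finset.mem_powerset.1 (Finset.mem_filter.1 hS).1
  have hp : ∀ v : Fin n, ∃ u, v ∈ S → u ∉ A ∧ G.Adj u v ∧ ∀ v' ∈ S, G.Adj u v' → v' = v := by
    intro v
    by_cases hv : v ∈ S
    · obtain ⟨u, hu, huv, hc⟩ := hasPrivate_of_goods hS hv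
      exact ⟨u, fun _ => ⟨hu, huv, fun v' hv' h => Finset.card_le_one.1 hc.le v'
        (by simp [hv', h]) v (by simp [hv, huv])⟩⟩
    · exact ⟨v, fun h => absurd h hv⟩
  choose p hp using hp
  have hpS : ∀ v ∈ S, p v ∉ S := fun v hv h => (hp v hv).1 (hSA h)
  have hinj : ∀ v ∈ S, ∀ v' ∈ S, p v = p v' → v = v' := fun v hv v' hv' h =>
    (hp v' hv').2.2 v hv (h ▸ (hp v hv).2.1)
  let M : (cutGraph G A).Subgraph :=
    { verts := {v | v ∈ S ∨ ∃ z ∈ S, p z = v}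
      Adj := fun a b => a ∈ S ∧ b = p a ∨ b ∈ S ∧ a = p b
      adj_sub := by
        rintro a b (⟨h, rfl⟩ | ⟨h, rfl⟩)
        · exact ⟨(hp a h).2.1.symm, .inl ⟨hSA h, (hp a h).1⟩⟩
        · exact ⟨(hp b h).2.1, .inr ⟨(hp b h).1, hSA h⟩⟩
      edge_vert := by
        rintro a b (⟨h, rfl⟩ | ⟨h, rfl⟩)
        · exact .inl h
        · exact .inr ⟨b, h, rfl⟩
      symm := ⟨fun _ _ h => h.symm⟩ }
  have hM1 : M.IsMatching := by
    rintro v (hv | ⟨z, hz, rfl⟩)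
    · refine ⟨p v, .inl ⟨hv, rfl⟩, ?_⟩
      rintro y (⟨-, rfl⟩ | ⟨hy, rfl⟩)
      · rfl
      · exact absurd hv (hpS y hy)
    · refine ⟨z, .inr ⟨hz, rfl⟩, ?_⟩
      rintro y (⟨h, -⟩ | ⟨hy, h⟩)
      · exact absurd h (hpS z hz)
      · exact hinj y hy z hz h.symm
  have hM2 : M.IsInduced := by
    rintro a (ha | ⟨z, hz, rfl⟩) b (hb | ⟨z', hz', rfl⟩) ⟨h, hab⟩
    · rcases hab with ⟨-, h'⟩ | ⟨h', -⟩
      · exact absurd (hSA hb) h'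
      · exact absurd (hSA ha) h'
    · refine .inl ⟨ha, ?_⟩
      rw [(hp z' hz').2.2 a ha h.symm]
    · refine .inr ⟨hb, ?_⟩
      rw [(hp z hz).2.2 b hb h]
    · rcases hab with ⟨h', -⟩ | ⟨-, h'⟩
      · exact absurd h' (hp z hz).1
      · exact absurd h' (hp z' hz').1
  have hM3 : S.card ≤ M.edgeSet.ncard := by
    rw [← Set.ncard_coe_finset]
    refine Set.ncard_le_ncard_of_injOn (fun v => s(v, p v)) ?_ ?_ (Set.toFinite _)
    · intro v hv
      exact SimpleGraph.Subgraph.mem_edgeSet.2 (.inl ⟨hv, rfl⟩)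
    · intro v hv v' hv' h
      rcases Sym2.eq_iff.1 h with ⟨h, -⟩ | ⟨h, -⟩
      · exact h
      · exact absurd (Finset.mem_coe.1 hv) (h ▸ hpS v' hv')
  refine hM3.trans (le_csSup ⟨(Set.univ : Set (Sym2 (Fin n))).ncard, ?_⟩ ⟨M, hM1, hM2, rfl⟩)
  rintro k ⟨M', -, -, rfl⟩
  exact Set.ncard_le_ncard (Set.subset_univ _) (Set.toFinite _)

theorem sup_goods_le : (goods G A).sup Finset.card ≤ mimCut G A :=
  Finset.sup_le fun _ h => card_le_mimCut h

theorem ne_univ_or_sup_goods : A ≠ Finset.univ ∨ (goods G A).sup Finset.card = 0 := by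
  by_cases h : A = Finset.univ
  · refine .inr (Nat.le_zero.1 (Finset.sup_le fun S hS => ?_))
    rw [Nat.le_zero, Finset.card_eq_zero, Finset.eq_empty_iff_forall_notMem]
    intro v hv
    obtain ⟨u, hu, -⟩ := hasPrivate_of_goods hS hv
    exact hu (h ▸ Finset.mem_univ u)
  · exact .inl h

theorem card_goods_le (hn : 0 < n) : (goods G A).card ≤ n ^ mimCut G A :=
  (card_small_le (A := A) (ne_univ_or_sup_goods (G := G)) fun _ hS =>
    ⟨Finset.mem_powerset.1 (Finset.mem_filter.1 hS).1, Finset.le_sup (f := Finset.card) hS⟩).trans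
    (Nat.pow_le_pow_right hn sup_goods_le)

variable (G A)

/-- A necessary condition, depending on the width parameter, for inducing a tree together with some
set equivalent to `R'`. -/
def Viable (f : WidthParam) (R' X : Finset (Fin n)) : Prop :=
  Light G X ∧ match f with
    | .mim => (coreSet G R' X).card ≤ 2 * (goods G A).sup Finset.card
    | _ => (peel G A)^[n] (coreSet G R' X) = ∅

/-- The signature of `X`: the numbers of neighbors in its core, and its value. -/
def sigRow (R' X : Finset (Fin n)) (u : ℕ) : ℕ :=
  if h : u < n then cntVec G A (coreSet G R' X) ⟨u, h⟩ else sigVal G R' X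

variable {G A}

theorem viable_of_isTree {f : WidthParam} {R' X Y : Finset (Fin n)} (hX : X ⊆ A) (hY : Y ⊆ Aᶜ)
    (hR : NbrEquiv G 2 Aᶜ Y R') (h : (G.induce (↑(X ∪ Y) : Set (Fin n))).IsTree) :
    Viable G A f R' X := by
  have hs := sparse_of_isTree h
  refine ⟨hs.light, ?_⟩
  have h1 := hs.peel_core hX hY hR
  cases f
  · exact h1
  · exact h1
  · exact h1
  · obtain ⟨S, hS, hc⟩ := hs.exists_good hX hY hR
    exact hc.trans (Nat.mul_le_mul_left _ (Finset.le_sup (f := Finset.card) hS))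

theorem sameSig_of_sigRow {R' X X' : Finset (Fin n)}
    (h : ∀ u < n + 1, sigRow G A R' X u = sigRow G A R' X' u) : SameSig G A R' X X' := by
  constructor
  · simpa [sigRow] using h n (by omega)
  · intro u hu
    simpa [sigRow, cntVec, Finset.mem_compl.1 hu] using h u (by omega)

open Classical in
theorem card_sigRow_le {f : WidthParam} {R' : Finset (Fin n)} {T x : LayoutTree (Fin n)}
    (hn : 0 < n) (hx : x ∈ T.nodes) {F : Finset (Finset (Fin n))}
    (hF : ∀ X ∈ F, X ⊆ x.verts ∧ Viable G x.verts f R' X) :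
    (F.image (sigRow G x.verts R')).card ≤ classBound G T f := by
  set A := x.verts with hA
  let F' := F.image (coreSet G R')
  have h1 : (F.image (sigRow G A R')).card ≤ (F'.image (cntVec G A)).card * (2 * n) := by
    rw [← Finset.card_range (2 * n), ← Finset.card_product]
    refine Finset.card_le_card_of_injOn (fun r => (fun u : Fin n => r u, r n / 2)) ?_ ?_
    · intro r hr
      obtain ⟨X, hX, rfl⟩ := Finset.mem_image.1 hr
      refine Finset.mem_product.2 ⟨Finset.mem_image.2 ⟨_, Finset.mem_image_of_mem _ hX, ?_⟩, ?_⟩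
      · funext u; simp [sigRow]
      · have := (sigVal_lt (R' := R') hn (hF X hX).2.1).1
        simpa [sigRow] using this
    · intro r hr r' hr' he
      obtain ⟨X, hX, rfl⟩ := Finset.mem_image.1 hr
      obtain ⟨X', hX', rfl⟩ := Finset.mem_image.1 hr'
      have e1 := (Prod.ext_iff.1 he).1
      have e2 := (Prod.ext_iff.1 he).2
      have d1 := (sigVal_lt (R' := R') hn (hF X hX).2.1).2
      have d2 := (sigVal_lt (R' := R') hn (hF X' hX').2.1).2
      funext u
      by_cases hu : u < n
      · exact congrFun e1 ⟨u, hu⟩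
      · simp only [sigRow, hu, dif_neg, not_false_iff, lt_irrefl] at e2 ⊢
        omega
  have hcore : ∀ Z ∈ F', Z ⊆ A := by
    intro Z hZ
    obtain ⟨X, hX, rfl⟩ := Finset.mem_image.1 hZ
    exact (Finset.filter_subset _ _).trans (hF X hX).1
  cases f with
  | mw =>
    refine h1.trans (Nat.mul_le_mul_right _ ((card_cntVec_mw fun Z hZ => ⟨hcore Z hZ, ?_⟩).trans
      (Nat.pow_le_pow_right (by omega) (le_width (mwCut G) hx))))
    obtain ⟨X, hX, rfl⟩ := Finset.mem_image.1 hZ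
    exact peelable_of_iterate (hF X hX).2.2
  | rw =>
    have := le_width (rwCut G) hx
    refine h1.trans (Nat.mul_le_mul_right _ ((card_cntVec_rw fun Z hZ => ⟨hcore Z hZ, ?_⟩).trans
      (Nat.pow_le_pow_right (by omega) ?_)))
    · obtain ⟨X, hX, rfl⟩ := Finset.mem_image.1 hZ
      exact peelable_of_iterate (hF X hX).2.2
    · have := Nat.mul_le_mul this this
      nlinarith
  | rwQ =>
    have : rwQCut G A ≤ _ := le_width (rwQCut G) hx
    refine h1.trans (Nat.mul_le_mul_right _ ((card_cntVec_rwQ fun Z hZ => ⟨hcore Z hZ, ?_⟩).trans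
      ((Nat.pow_le_pow_right (by omega) this).trans (Nat.pow_le_pow_left (by omega) _))))
    obtain ⟨X, hX, rfl⟩ := Finset.mem_image.1 hZ
    exact peelable_of_iterate (hF X hX).2.2
  | mim =>
    refine h1.trans ?_
    have h2 : F'.card ≤ n ^ (2 * (goods G A).sup Finset.card) := by
      refine card_small_le (A := A) ?_ fun Z hZ => ⟨hcore Z hZ, ?_⟩
      · exact (ne_univ_or_sup_goods (G := G) (A := A)).imp id fun h => by omega
      · obtain ⟨X, hX, rfl⟩ := Finset.mem_image.1 hZ
        exact (hF X hX).2.2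
    have h3 : n ^ (2 * (goods G A).sup Finset.card) ≤ n ^ (2 * T.width (mimCut G)) :=
      Nat.pow_le_pow_right hn (Nat.mul_le_mul_left _ (sup_goods_le.trans (le_width (mimCut G) hx)))
    calc _ ≤ n ^ (2 * T.width (mimCut G)) * (2 * n) :=
          Nat.mul_le_mul_right _ (Finset.card_image_le.trans (h2.trans h3))
      _ = classBound G T .mim := by simp only [classBound, pow_succ]; ring

theorem two_mul_le_classBound {f : WidthParam} {T : LayoutTree (Fin n)} (hn : 0 < n) :
    2 * n ≤ classBound G T f := by
  cases f with
  | mw => exact Nat.le_mul_of_pos_left _ (by positivity)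
  | rw => exact Nat.le_mul_of_pos_left _ (by positivity)
  | rwQ => exact Nat.le_mul_of_pos_left _ (by positivity)
  | mim =>
    simp only [classBound, pow_succ]
    have : 0 < n ^ (2 * T.width (mimCut G)) := by positivity
    nlinarith [Nat.le_mul_of_pos_left n this]

theorem card_goods_mul_le_classBound {T x : LayoutTree (Fin n)} (hn : 0 < n) (hx : x ∈ T.nodes) :
    (goods G x.verts).card * n ≤ classBound G T .mim := by
  have h1 := card_goods_le (G := G) (A := x.verts) hn
  have h2 : n ^ mimCut G x.verts ≤ n ^ (2 * T.width (mimCut G)) :=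
    Nat.pow_le_pow_right hn ((le_width (mimCut G) hx).trans (by omega))
  simp only [classBound, pow_succ]
  have := Nat.mul_le_mul_right n (h1.trans h2)
  omega

end Viable

/-! ### Connected components -/

/-- Writes the table in array `8` at the places from `reg 22` on labels of the components of the
subgraph induced by the set whose indicator vector starts at the place `reg 22` of array `3`. -/
def labelProg : Cmd :=
  .seq (.for 12 0 (.sto 8 (.r 22 + .r 12) (.r 12))) <| .for 21 8 <|
  .ite (.l 0 (.r 21) * .l 3 (.r 22 + .r 21 / .r 0) * .l 3 (.r 22 + .r 21 % .r 0))
    (.seq (.set 24 (.l 8 (.r 22 + .r 21 / .r 0))) <|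
      .seq (.set 25 (.l 8 (.r 22 + .r 21 % .r 0))) <|
      .for 12 0 (.sto 8 (.r 22 + .r 12) (.eq (.l 8 (.r 22 + .r 12)) (.r 25) * .r 24 +
        (.c 1 - .eq (.l 8 (.r 22 + .r 12)) (.r 25)) * .l 8 (.r 22 + .r 12)))) .skip

section Label
variable {n : ℕ} {G : SimpleGraph (Fin n)} [DecidableRel G.Adj] {X : Finset (Fin n)}

/-- The labels from place `b` of array `8` on distinguish the components of the subgraph induced
by `X`. -/
def RamState.HoldsLabels (s : RamState) (G : SimpleGraph (Fin n)) (b : ℕ) (X : Finset (Fin n)) :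
    Prop := ∀ v v' : Fin n, s.arr 8 (b + v) = s.arr 8 (b + v') ↔ Conn G X v v'

theorem labelProg_spec {W b : ℕ} {s : RamState} (hG : s.HoldsGraph G) (hn2 : s.reg 8 = n * n)
    (hb : s.reg 22 = b) (hbW : b + n ≤ W) (hX : ∀ v < n, s.arr 3 (b + v) = ind X v) :
    Tri W labelProg s fun s' t => t ≤ 200 * n ^ 3 + 100 ∧ s'.HoldsLabels G b X ∧
      ∀ p, (∀ v < n, p ≠ b + v) → s'.arr 8 p = s.arr 8 p := by
  refine Tri.intro fun hW3 hf => ?_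
  have hn := hG.1
  refine Tri.of_wp ?_
  simp only [labelProg, Cmd.wp, Cmd.wp_for]
  refine Tri.scatter (N := n) hn (by decide) (fun v => b + v) (fun v => v) 4
    (by intros; omega) ?_ ?_
  · intro v hv h h1 h2
    simp [hb]; omega
  intro h t₁ hf₁ h1 h2 ht₁
  refine Tri.loop (N := n * n) (by simp [hn2]) (by decide) rfl rfl (fun k s' =>
    (∀ v v' : Fin n, s'.arr 8 (b + v) = s'.arr 8 (b + v') → Conn G X v v') ∧
    (∀ u v : Fin n, u.val * n + v < k → u ∈ X → v ∈ X → G.Adj u v →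
      s'.arr 8 (b + u) = s'.arr 8 (b + v)) ∧
    ∀ p, (∀ v < n, p ≠ b + v) → s'.arr 8 p = s.arr 8 p) (70 * n + 60) ?_ ?_ ?_
  · refine ⟨fun v v' hv => ?_, by simp, fun p hp => ?_⟩
    · simp only [RamState.arr_setReg, RamState.arr_withArr, if_true, h1 v v.2, h1 v' v'.2] at hv
      rw [Fin.ext hv]
      exact .refl
    · simp [h2 p hp]
  · rintro k s' hk hf' hsk hfr ⟨i1, i2, i3⟩
    have hnp : 0 < n := Nat.pos_of_ne_zero (by rintro rfl; simp at hk)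
    have r0 : s'.reg 0 = n := (hfr.r rfl).trans (by simp [hn])
    have r22 : s'.reg 22 = b := (hfr.r rfl).trans (by simp [hb])
    have a0 : s'.arr 0 = s.arr 0 := (hfr.a rfl).trans (by simp)
    have a3 : s'.arr 3 = s.arr 3 := (hfr.a rfl).trans (by simp)
    obtain ⟨u, hu⟩ : ∃ u : Fin n, u.val = k / n := ⟨⟨k / n, Nat.div_lt_of_lt_mul hk⟩, rfl⟩
    obtain ⟨v, hv⟩ : ∃ v : Fin n, v.val = k % n := ⟨⟨k % n, Nat.mod_lt _ hnp⟩, rfl⟩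
    have huv : u.val * n + v = k := by rw [hu, hv]; exact Nat.div_add_mod' k n
    have hmk := hv.symm
    have hdec : ∀ u' v' : Fin n, u'.val * n + v' < k + 1 →
        u'.val * n + v' < k ∨ u' = u ∧ v' = v := fun u' v' h' => by
      rcases Nat.lt_succ_iff_lt_or_eq.1 h' with h' | h'
      · exact .inl h'
      · refine .inr ⟨Fin.ext ?_, Fin.ext ?_⟩
        · rw [hu, ← h', mul_comm, Nat.mul_add_div hnp, Nat.div_eq_of_lt v'.2, add_zero]
        · rw [hv, ← h', mul_comm, Nat.mul_add_mod, Nat.mod_eq_of_lt v'.2]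
    have e0 : s.arr 0 k = if G.Adj u v then 1 else 0 := by rw [← huv]; exact hG.2 u v
    have e3 := hX u u.2
    have e3' := hX v v.2
    rw [ind_val] at e3 e3'
    have hle : b + u < W := by omega
    have hle' : b + v < W := by omega
    refine Tri.of_wp ?_
    simp only [Cmd.wp, Cmd.wp_for]
    simp only [Ex.ok_mul, Ex.ok_l, Ex.ok_r, Ex.ok_add, Ex.ok_div, Ex.ok_mod, Ex.eval_mul, Ex.eval_l,
      Ex.eval_r, Ex.eval_add, Ex.eval_div, Ex.eval_mod, hsk, r0, r22, a0, a3, ← hu, ← hv, e0, e3, e3',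
      Ex.cost_mul, Ex.cost_l, Ex.cost_r, Ex.cost_add, Ex.cost_div, Ex.cost_mod, true_and, and_true,
      RamState.arr_setReg, RamState.reg_setReg]
    have hb1 : (if G.Adj u v then 1 else 0) * (if u ∈ X then 1 else 0) ≤ 1 := by split_ifs <;> simp
    have hb2 : (if G.Adj u v then 1 else 0) * (if u ∈ X then 1 else 0) *
      (if v ∈ X then 1 else 0) ≤ 1 := by split_ifs <;> simp
    refine ⟨⟨⟨hle, by omega⟩, hle', by omega⟩, fun hne => ?_, fun he => ?_⟩
    · have hadj : G.Adj u v := by by_contra h; simp [h] at hne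
      have huX : u ∈ X := by by_contra h; simp [h] at hne
      have hvX : v ∈ X := by by_contra h; simp [h] at hne
      have hstep : Conn G X u v := .single ⟨huX, hvX, hadj⟩
      set lu := s'.arr 8 (b + u) with hlu
      set lv := s'.arr 8 (b + v) with hlv
      have hluW : lu < W := hf'.2 _ _
      have hlvW : lv < W := hf'.2 _ _
      simp only [hle, true_and]
      refine ⟨by simpa [← hv, r0] using hle', ?_⟩
      refine Tri.scatter (N := n) (by simp [r0]) (by decide) (fun v => b + v)
        (fun z => if s'.arr 8 (b + z) = lv then lu else s'.arr 8 (b + z)) 30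
        (by intros; omega) ?_ ?_
      · intro z hz h g1 g2
        have hz' : h (b + z) = s'.arr 8 (b + z) := by
          rw [g2 _ fun j hj => by omega]; simp
        have hzW : s'.arr 8 (b + z) < W := hf'.2 _ _
        have hbz : b + z < W := by omega
        by_cases hc : s'.arr 8 (b + z) = lv
        · simp [hc, hbz, hz', r22, hmk, ← hlv]; omega
        · simp [hc, hbz, hzW, hz', r22, hmk, ← hlv]; omega
      · intro h t₂ hf₂ g1 g2 ht₂
        refine ⟨by omega, fun x y hxy => ?_, fun x y hk' hx hy hxy => ?_, fun p hp => ?_⟩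
        · simp only [RamState.arr_setReg, RamState.arr_withArr, if_true, g1 x x.2, g1 y y.2] at hxy
          split_ifs at hxy with c1 c2 c2
          · exact i1 x y (c1.trans c2.symm)
          · exact (i1 x v c1).trans (hstep.symm.trans (i1 u y hxy))
          · exact (i1 x u hxy).trans (hstep.trans (i1 v y c2.symm))
          · exact i1 x y hxy
        · simp only [RamState.arr_setReg, RamState.arr_withArr, if_true, g1 x x.2, g1 y y.2]
          rcases hdec x y hk' with hk' | ⟨rfl, rfl⟩
          · rw [i2 x y hk' hx hy hxy]
          · simp only [← hlu, ← hlv, if_true]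
            split_ifs <;> rfl
        · simp [g2 p hp, i3 p hp]
    · refine ⟨by omega, by simpa using i1, fun x y hk' hx hy hxy => ?_, by simpa using i3⟩
      rcases hdec x y hk' with hk' | ⟨rfl, rfl⟩
      · exact i2 x y hk' hx hy hxy
      · simp [hx, hy, hxy] at he
  · rintro s' t hf' hsk hfr ⟨i1, i2, i3⟩ ht
    refine ⟨?_, fun x y => ⟨i1 x y, fun h => ?_⟩, i3⟩
    · have e1 : n * n * (70 * n + 60 + 8) = 70 * n ^ 3 + 68 * n ^ 2 := by ring
      rcases Nat.eq_zero_or_pos n with rfl | hnp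
      · simp at ht ht₁ ⊢; omega
      have e2 : n ^ 2 ≤ n ^ 3 := Nat.pow_le_pow_right hnp (by omega)
      have e3 : n ≤ n ^ 3 := Nat.le_self_pow (by omega) n
      nlinarith
    · induction h with
      | refl => rfl
      | tail _ h ih =>
        rw [ih]
        refine i2 _ _ ?_ h.1 h.2.1 h.2.2
        exact idx_lt (Fin.is_lt _) (Fin.is_lt _) le_rfl

end Label

/-! ### Signatures -/

/-- The number of neighbors of vertex `reg v` in the set held in array `a`. -/
def nbEx (v a : ℕ) : Ex := .sum 41 0 (.l 0 (.r v * .r 0 + .r 41) * .l a (.r 41))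

/-- Copies the set whose indicator vector starts at the place `reg 22` of array `3` to array `17`,
computes its core in array `7`, and its size, its degree sum and its number of vertices with one
neighbor in the set held in array `2` in the registers `24`, `25` and `26`. -/
def setProg : Cmd :=
  .seq (.for 12 0 (.sto 17 (.r 12) (.l 3 (.r 22 + .r 12)))) <|
  .seq (.for 12 0 (.sto 7 (.r 12) (.l 17 (.r 12) * .lt (.c 1) (nbEx 12 2)))) <|
  .seq (.set 24 (.sum 40 0 (.l 17 (.r 40)))) <|
  .seq (.set 25 (.sum 40 0 (.l 17 (.r 40) * nbEx 40 17)))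
  (.set 26 (.sum 40 0 (.l 17 (.r 40) * .eq (nbEx 40 2) (.c 1))))

/-- Stores in weight array `1` at the place `reg 20` the weight of the set held in array `17`. -/
def weightProg : Cmd :=
  .seq (.wzero 0) <| .seq (.for 12 0 (.ite (.l 17 (.r 12))
    (.seq (.wload 1 0 (.r 12)) (.wplus 0 0 1)) .skip)) (.wsto 1 (.r 20) 0)

/-- Writes the signature as row number `reg 17` of the table in array `10`. -/
def sigProg : Cmd :=
  .seq (.for 12 0 (.sto 10 (.r 17 * .r 23 + .r 12) ((.c 1 - .l 1 (.r 12)) * nbEx 12 7)))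
  (.sto 10 (.r 17 * .r 23 + .r 0) (.r 25 + .c 2 * .r 26 + .c 2 * .r 0 - .c 2 * .r 24))

/-- Decides in register `18` whether the set is viable. -/
def viableProg (f : WidthParam) : Cmd :=
  .seq (.set 18 (.lt (.c 0) (.eq (.r 24) (.c 0) + .lt (.r 25) (.c 2 * .r 24)))) <|
  match f with
  | .mim => .set 18 (.r 18 * .lt (.sum 40 0 (.l 7 (.r 40))) (.c 2 * .r 14 + .c 1))
  | _ => .seq (.blk (.loopFor 13 0 peelProg))
      (.set 18 (.r 18 * .eq (.sum 40 0 (.l 7 (.r 40))) (.c 0)))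

section Sig
variable {n : ℕ} {G : SimpleGraph (Fin n)} [DecidableRel G.Adj] {X A R' : Finset (Fin n)}

theorem nbEx_spec {W v a : ℕ} (hv : v ≠ 41) {s : RamState} {S : Finset (Fin n)}
    (hG : s.HoldsGraph G) (hS : s.HoldsSet a S) (hn2 : n * n < W) {u : Fin n}
    (hu : s.reg v = u) :
    (nbEx v a).eval s = (S.filter (G.Adj u)).card ∧ (nbEx v a).ok W s ∧
      (nbEx v a).cost s = n * 10 + 1 := by
  have hn := hG.1
  have hun : ∀ i < n, u.val * n + i < W := fun i hi => idx_lt u.2 hi hn2.le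
  have hev : ∀ i (hi : i < n), s.arr 0 (u.val * n + i) * s.arr a i =
      if (⟨i, hi⟩ : Fin n) ∈ S.filter (G.Adj u) then 1 else 0 := fun i hi => by
    have e1 := hG.2 u ⟨i, hi⟩
    have e2 := hS ⟨i, hi⟩
    simp only at e1 e2
    rw [e1, e2]
    by_cases h1 : G.Adj u ⟨i, hi⟩ <;> by_cases h2 : (⟨i, hi⟩ : Fin n) ∈ S <;> simp [Finset.mem_filter, h1, h2]
  have hsum : ∑ i ∈ Finset.range n, s.arr 0 (u.val * n + i) * s.arr a i =
      (S.filter (G.Adj u)).card := by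
    rw [sum_indicator_eq_card (p := fun v => v ∈ S.filter (G.Adj u)) fun v => hev v v.2]
    rw [Finset.filter_univ_mem]
  have hnn : n ≤ n * n := Nat.le_mul_self n
  refine ⟨?_, ?_, ?_⟩
  · simp [nbEx, hn, hv, hu, hsum]
  · simp only [nbEx, Ex.ok_sum, Ex.ok_mul, Ex.ok_l, Ex.ok_add, Ex.ok_r, Ex.eval_mul, Ex.eval_r,
      Ex.eval_add, Ex.eval_l, RamState.reg_setReg, RamState.arr_setReg, if_true, if_neg hv, hn, hu,
      (by decide : (0 : ℕ) ≠ 41), if_false, true_and, hsum]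
    refine ⟨fun i hi => ⟨⟨?_, hun i hi⟩, ?_⟩, card_lt_cap (by omega) _⟩
    · have := hun i hi; omega
    · rw [hev i hi]
      split_ifs <;> omega
  · simp [nbEx, hn]
    ring

theorem setProg_spec {W b : ℕ} {s : RamState} (hG : s.HoldsGraph G) (hR : s.HoldsSet 2 R')
    (hn2 : n * n < W) (hb : s.reg 22 = b) (hbW : b + n ≤ W)
    (hX : ∀ v < n, s.arr 3 (b + v) = ind X v) :
    Tri W setProg s fun s' t => t ≤ 200 * n ^ 2 + 100 ∧ s'.HoldsSet 17 X ∧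
      s'.HoldsSet 7 (coreSet G R' X) ∧ s'.reg 24 = X.card ∧ s'.reg 25 = degSum G X ∧
      s'.reg 26 = (oneSet G R' X).card := by
  refine Tri.intro fun hW3 hf => ?_
  have hn := hG.1
  have hnn : n ≤ n * n := Nat.le_mul_self n
  refine Tri.of_wp ?_
  simp only [setProg, Cmd.wp, Cmd.wp_for]
  refine Tri.scatter (N := n) hn (by decide) id (fun v => ind X v) 10
    (by simp; omega) ?_ ?_
  · intro v hv h h1 h2
    simp [hb, hX v hv]; omega
  intro h t₁ hf₁ h1 h2 ht₁
  set s₁ := (s.withArr 17 h).setReg 12 n with hs₁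
  have hG₁ : s₁.HoldsGraph G := HoldsGraph_of_eq hG (by simp [hs₁]) (by simp [hs₁])
  have hR₁ : s₁.HoldsSet 2 R' := HoldsSet_of_eq hR (by simp [hs₁])
  have hX₁ : s₁.HoldsSet 17 X := fun v => by have := h1 v v.2; simpa [hs₁] using this
  refine Tri.scatter (N := n) (by simp [hs₁, hn]) (by decide) id
    (fun v => ind (coreSet G R' X) v) (n * 10 + 20) (by simp; omega) ?_ ?_
  · intro v hv h' h1' h2'
    obtain ⟨e1, e2, e3⟩ := nbEx_spec (W := W) (v := 12) (a := 2) (S := R') (u := ⟨v, hv⟩)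
      (s := (s₁.withArr 7 h').setReg 12 v) (by decide)
      (HoldsGraph_of_eq hG₁ (by simp) (by simp)) (HoldsSet_of_eq hR₁ (by simp)) hn2 (by simp)
    have e4 := hX₁ ⟨v, hv⟩
    have e5 := ind_val (coreSet G R' X) ⟨v, hv⟩
    simp only at e4 e5
    simp only [Ex.ok_r, Ex.eval_r, Ex.ok_mul, Ex.ok_l, Ex.ok_lt, Ex.ok_c, e1, e2, e3, Ex.eval_mul,
      Ex.eval_l, Ex.eval_lt, Ex.eval_c, RamState.reg_setReg, RamState.arr_setReg,
      RamState.reg_withArr, RamState.arr_withArr, if_true, (by decide : (17 : ℕ) ≠ 7), if_false, e4, e5, Ex.cost_mul,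
      Ex.cost_l, Ex.cost_r, Ex.cost_lt, Ex.cost_c, id, true_and]
    have e6 : ∀ x : ℕ, (1 < x) = (2 ≤ x) := fun x => rfl
    simp only [coreSet, Finset.mem_filter, e6]
    by_cases c1 : (⟨v, hv⟩ : Fin n) ∈ X <;>
      by_cases c2 : 2 ≤ (R'.filter (G.Adj ⟨v, hv⟩)).card <;> simp [c1, c2] <;> omega
  intro h' t₂ hf₂ h1' h2' ht₂
  set s₂ := (s₁.withArr 7 h').setReg 12 n with hs₂
  have hG₂ : s₂.HoldsGraph G := HoldsGraph_of_eq hG₁ (by simp [hs₂]) (by simp [hs₂])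
  have hR₂ : s₂.HoldsSet 2 R' := HoldsSet_of_eq hR₁ (by simp [hs₂])
  have hX₂ : s₂.HoldsSet 17 X := HoldsSet_of_eq hX₁ (by simp [hs₂])
  have hC₂ : s₂.HoldsSet 7 (coreSet G R' X) := fun v => by
    have := h1' v v.2; simpa [hs₂] using this
  have e0 := sum_set_eq_card hX₂
  have r0 : s₂.reg 0 = n := hG₂.1
  have hv2 : ∀ v (hv : v < n), s₂.arr 17 v = if (⟨v, hv⟩ : Fin n) ∈ X then 1 else 0 :=
    fun v hv => hX₂ ⟨v, hv⟩
  have k1 := fun (x : ℕ) (v : ℕ) (hv : v < n) => nbEx_spec (W := W) (v := 40) (a := 17) (S := X)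
    (u := ⟨v, hv⟩) (s := (s₂.setReg 24 x).setReg 40 v) (by decide)
    (HoldsGraph_of_eq hG₂ (by simp) (by simp)) (HoldsSet_of_eq hX₂ (by simp)) hn2 (by simp)
  have k2 := fun (x y : ℕ) (v : ℕ) (hv : v < n) => nbEx_spec (W := W) (v := 40) (a := 2) (S := R')
    (u := ⟨v, hv⟩) (s := ((s₂.setReg 24 x).setReg 25 y).setReg 40 v) (by decide)
    (HoldsGraph_of_eq hG₂ (by simp) (by simp)) (HoldsSet_of_eq hR₂ (by simp)) hn2 (by simp)
  have f1 : ∀ x, ∑ v ∈ Finset.range n,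
      s₂.arr 17 v * (nbEx 40 17).eval ((s₂.setReg 24 x).setReg 40 v) = degSum G X := fun x => by
    rw [Finset.sum_range, degSum, ← Finset.sum_subset (Finset.subset_univ X)]
    · refine Finset.sum_congr rfl fun v hv => ?_
      rw [(k1 x v v.2).1, hv2 v v.2, if_pos hv, one_mul]
    · intro v _ hv
      rw [hv2 v v.2, if_neg hv, zero_mul]
  have f2 : ∀ x y, ∑ v ∈ Finset.range n,
      (s₂.arr 17 v * if (nbEx 40 2).eval (((s₂.setReg 24 x).setReg 25 y).setReg 40 v) = 1
        then 1 else 0) = (oneSet G R' X).card := fun x y => by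
    rw [sum_indicator_eq_card (p := fun v => v ∈ oneSet G R' X)]
    · simp
    · intro v
      rw [(k2 x y v v.2).1, hv2 v v.2, oneSet]
      by_cases c1 : v ∈ X <;> by_cases c2 : (R'.filter (G.Adj v)).card = 1 <;> simp [c1, c2]
  have hcap : ∀ Z : Finset (Fin n), Z.card < W := card_lt_cap (by omega)
  have hdeg : degSum G X < W := by
    refine lt_of_le_of_lt ((Finset.sum_le_card_nsmul X _ n fun v _ => ?_).trans ?_) hn2
    · simpa using Finset.card_le_univ (X.filter (G.Adj v))
    · rw [smul_eq_mul]
      exact Nat.mul_le_mul_right _ (by simpa using Finset.card_le_univ X)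
  have q1 : ∑ v ∈ Finset.range n, (1 + 1 + (nbEx 40 17).cost ((s₂.setReg 24 X.card).setReg 40 v) +
      1 + 1) = n * (n * 10 + 5) := by
    rw [Finset.sum_congr rfl fun v hv => by rw [(k1 _ v (Finset.mem_range.1 hv)).2.2]]
    rw [Finset.sum_const, Finset.card_range, smul_eq_mul]
    ring
  have q2 : ∑ v ∈ Finset.range n, (1 + 1 + ((nbEx 40 2).cost
      (((s₂.setReg 24 X.card).setReg 25 (degSum G X)).setReg 40 v) + 1 + 1) + 1 + 1) =
      n * (n * 10 + 7) := by
    rw [Finset.sum_congr rfl fun v hv => by rw [(k2 _ _ v (Finset.mem_range.1 hv)).2.2]]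
    rw [Finset.sum_const, Finset.card_range, smul_eq_mul]
    ring
  simp only [Ex.ok_sum, Ex.ok_l, Ex.ok_r, Ex.ok_mul, Ex.ok_eq, Ex.ok_c, Ex.eval_sum, Ex.eval_l,
    Ex.eval_r, Ex.eval_mul, Ex.eval_eq, Ex.eval_c, RamState.reg_setReg, RamState.arr_setReg, if_true,
    (by decide : (0 : ℕ) ≠ 24), (by decide : (0 : ℕ) ≠ 25), if_false, r0, e0, f1, f2,
    Ex.cost_sum, Ex.cost_l, Ex.cost_r, Ex.cost_mul, Ex.cost_eq, Ex.cost_c, true_and, and_true,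
    hcap, hdeg]
  refine ⟨fun _ _ => trivial, fun v hv => ⟨(k1 _ v hv).2.1, ?_⟩, fun v hv => ⟨⟨(k2 _ _ v hv).2.1,
    by omega⟩, ?_⟩, ?_, HoldsSet_of_eq hX₂ (by simp), HoldsSet_of_eq hC₂ (by simp), ?_, ?_⟩
  · rw [(k1 _ v hv).1, hv2 v hv]
    have := hcap (X.filter (G.Adj ⟨v, hv⟩))
    split_ifs <;> simp <;> omega
  · rw [hv2 v hv]
    split_ifs <;> simp <;> omega
  · rw [q1, q2]
    simp only [Finset.sum_const, Finset.card_range, smul_eq_mul]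
    nlinarith
  · simp
  · simp

theorem weightProg_spec {W i : ℕ} {s : RamState} {w : Fin n → ℚ} (hn : s.reg 0 = n)
    (hX : s.HoldsSet 17 X) (hw : s.HoldsWeights w) (hi : s.reg 20 = i) :
    Tri W weightProg s fun s' t => t ≤ 30 * n + 100 ∧ s'.warr 1 i = ∑ v ∈ X, w v ∧
      ∀ j ≠ i, s'.warr 1 j = s.warr 1 j := by
  refine Tri.of_wp ?_
  simp only [weightProg, Cmd.wp, Cmd.wp_for]
  refine Tri.loop (N := n) (by simp [hn]) (by decide) rfl rfl (fun k s' =>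
    s'.wreg 0 = ∑ v ∈ X.filter (fun v => v.val < k), w v) 10 (by simp) ?_ ?_
  · intro k s' hk hf hsk hfr hI
    have hX' := hX ⟨k, hk⟩
    have a17 : s'.arr 17 = s.arr 17 := hfr.a rfl
    have w0 : s'.warr 0 = s.warr 0 := hfr.wa rfl
    refine Tri.of_wp ?_
    simp only at hX'
    simp only [Cmd.wp, Ex.ok_l, Ex.ok_r, Ex.eval_l, Ex.eval_r, hsk, a17, hX', true_and]
    have hsplit : X.filter (fun v => v.val < k + 1) =
        X.filter (fun v => v.val < k) ∪ X.filter fun v => v = ⟨k, hk⟩ := by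
      ext v
      simp only [Finset.mem_filter, Finset.mem_union, Fin.ext_iff]
      constructor
      · rintro ⟨h1, h2⟩
        rcases Nat.lt_succ_iff_lt_or_eq.1 h2 with h | h
        · exact .inl ⟨h1, h⟩
        · exact .inr ⟨h1, h⟩
      · rintro (⟨h1, h2⟩ | ⟨h1, h2⟩)
        · exact ⟨h1, by omega⟩
        · exact ⟨h1, by omega⟩
    have hd : Disjoint (X.filter (fun v => v.val < k)) (X.filter fun v => v = ⟨k, hk⟩) := by
      rw [Finset.disjoint_left]
      intro v h1 h2
      have := (Finset.mem_filter.1 h1).2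
      rw [(Finset.mem_filter.1 h2).2] at this
      simp at this
    rw [hsplit, Finset.sum_union hd, Finset.filter_eq']
    refine ⟨fun hne => ?_, fun he => ?_⟩
    · have hkX : (⟨k, hk⟩ : Fin n) ∈ X := by by_contra h; simp [h] at hne
      have := hw ⟨k, hk⟩
      simp only at this
      simp [hkX, hI, w0, this]
    · have hkX : (⟨k, hk⟩ : Fin n) ∉ X := by by_contra h; simp [h] at he
      simp [hkX, hI]
  · intro s' t hf hsk hfr hI ht
    have w1 : s'.warr 1 = s.warr 1 := (hfr.wa rfl).trans (by simp)
    have r20 : s'.reg 20 = i := (hfr.r rfl).trans (by simp [hi])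
    refine ⟨trivial, ?_, ?_, fun j hj => ?_⟩
    · simp; omega
    · rw [Finset.filter_true_of_mem (by simp)] at hI
      simp [r20, hI]
    · simp [r20, hj, w1]

theorem sigProg_spec {W c : ℕ} {s : RamState} (hG : s.HoldsGraph G) (hA : s.HoldsSet 1 A)
    (hC : s.HoldsSet 7 (coreSet G R' X)) (hn2 : 6 * (n * n) < W) (hnp : 0 < n)
    (h24 : s.reg 24 = X.card) (h25 : s.reg 25 = degSum G X)
    (h26 : s.reg 26 = (oneSet G R' X).card) (h23 : s.reg 23 = n + 1) (h17 : s.reg 17 = c)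
    (hcW : (c + 1) * (n + 1) ≤ W) :
    Tri W sigProg s fun s' t => t ≤ 100 * n ^ 2 + 100 ∧
      (∀ v < n + 1, s'.arr 10 (c * (n + 1) + v) = sigRow G A R' X v) ∧
      ∀ p < c * (n + 1), s'.arr 10 p = s.arr 10 p := by
  refine Tri.intro fun hW3 hf => ?_
  have hn := hG.1
  have hnn : n ≤ n * n := Nat.le_mul_self n
  have hidx : ∀ v < n + 1, c * (n + 1) + v < W := fun v hv => idx_lt (Nat.lt_succ_self c) hv hcW
  refine Tri.of_wp ?_
  simp only [sigProg, Cmd.wp, Cmd.wp_for]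
  refine Tri.scatter (N := n) hn (by decide) (fun v => c * (n + 1) + v)
    (fun v => sigRow G A R' X v) (n * 10 + 20) (by intros; omega) ?_ ?_
  · intro v hv h h1 h2
    obtain ⟨e1, e2, e3⟩ := nbEx_spec (W := W) (v := 12) (a := 7) (S := coreSet G R' X)
      (u := ⟨v, hv⟩) (s := (s.withArr 10 h).setReg 12 v) (by decide)
      (HoldsGraph_of_eq hG (by simp) (by simp)) (HoldsSet_of_eq hC (by simp)) (by omega) (by simp)
    have e4 := hA ⟨v, hv⟩
    simp only at e4
    have hw := hidx v (by omega)
    have hw0 := hidx 0 (by omega)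
    have hcap := card_lt_cap (W := W) (by omega) ((coreSet G R' X).filter (G.Adj ⟨v, hv⟩))
    simp only [Ex.ok_r, Ex.eval_r, Ex.ok_mul, Ex.ok_l, Ex.ok_sub, Ex.ok_c, Ex.ok_add, Ex.eval_add,
      e1, e2, e3, Ex.eval_mul,
      Ex.eval_l, Ex.eval_sub, Ex.eval_c, RamState.reg_setReg, RamState.arr_setReg,
      RamState.reg_withArr, RamState.arr_withArr, if_true, (by decide : (1 : ℕ) ≠ 10), (by decide : (17 : ℕ) ≠ 12),
      (by decide : (23 : ℕ) ≠ 12), if_false, e4, h17, h23, Ex.cost_mul,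
      Ex.cost_l, Ex.cost_r, Ex.cost_sub, Ex.cost_c, Ex.cost_add, true_and, hw, sigRow, hv, dif_pos,
      cntVec]
    by_cases c1 : (⟨v, hv⟩ : Fin n) ∈ A <;> simp [c1] <;> omega
  intro h t₁ hf₁ h1 h2 ht₁
  have hone : (oneSet G R' X).card ≤ n := by simpa using Finset.card_le_univ (oneSet G R' X)
  have hXn : X.card ≤ n := by simpa using Finset.card_le_univ X
  have hdeg : degSum G X ≤ n * n := by
    refine (Finset.sum_le_card_nsmul X _ n fun v _ => ?_).trans ?_
    · simpa using Finset.card_le_univ (X.filter (G.Adj v))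
    · rw [smul_eq_mul]
      exact Nat.mul_le_mul_right _ hXn
  have hw := hidx n (by omega)
  have hw0 := hidx 0 (by omega)
  simp [h17, h23, h24, h25, h26, hn, hw]
  refine ⟨by omega, by omega, ?_, fun v hv => ?_, fun p hp => ?_⟩
  · nlinarith
  · rcases hv.lt_or_eq with hv | rfl
    · rw [if_neg (by omega), h1 v hv]
    · simp [sigRow, sigVal]
  · rw [if_neg (by omega), h2 p fun v _ => by omega]

theorem viableProg_spec {W : ℕ} {s : RamState} {f : WidthParam} (hG : s.HoldsGraph G)
    (hA : s.HoldsSet 1 A) (hC : s.HoldsSet 7 (coreSet G R' X)) (hn2 : 6 * (n * n) < W) (hnp : 0 < n)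
    (h24 : s.reg 24 = X.card) (h25 : s.reg 25 = degSum G X)
    (h14 : f = .mim → s.reg 14 = (goods G A).sup Finset.card) :
    Tri W (viableProg f) s fun s' t => t ≤ 300 * n ^ 3 + 100 ∧
      s'.reg 18 ≤ 1 ∧ (s'.reg 18 = 1 ↔ Viable G A f R' X) := by
  classical
  refine Tri.intro fun hW3 hf => ?_
  have hn := hG.1
  have hnn : n ≤ n * n := Nat.le_mul_self n
  have hXn : X.card ≤ n := by simpa using Finset.card_le_univ X
  have hn3 : n ≤ n ^ 3 := Nat.le_self_pow (by omega) n
  set L := if Light G X then 1 else 0 with hL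
  have hLe : (if 0 < (if X.card = 0 then 1 else 0) + (if degSum G X < 2 * X.card then 1 else 0)
      then 1 else 0) = L := by
    simp only [hL, Light, Finset.card_eq_zero]
    by_cases c1 : X = ∅ <;> by_cases c2 : degSum G X < 2 * X.card <;> simp [c1, c2]
  have hcap : ∀ Z : Finset (Fin n), Z.card < W := card_lt_cap (by omega)
  have hL1 : L ≤ 1 := by simp only [hL]; split_ifs <;> simp
  have hLL : L = 1 ↔ Light G X := by simp [hL]
  cases f with
  | mim =>
    have h14 := h14 rfl
    have hmu : (goods G A).sup Finset.card ≤ n :=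
      Finset.sup_le fun S _ => by simpa using Finset.card_le_univ S
    have e7 := sum_set_eq_card hC
    have hle : (coreSet G R' X).card < 2 * (goods G A).sup Finset.card + 1 ↔
        (coreSet G R' X).card ≤ 2 * (goods G A).sup Finset.card := Nat.lt_succ_iff
    have hb : ∀ p : Prop, [Decidable p] → L * (if p then 1 else 0) ≤ 1 ∧
        (L * (if p then 1 else 0) = 1 ↔ L = 1 ∧ p) := fun p _ => by
      by_cases c : p <;> simp [c] <;> omega
    have hb' := hb ((coreSet G R' X).card ≤ 2 * (goods G A).sup Finset.card)
    refine Tri.of_wp ?_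
    simp only [viableProg, Cmd.wp, Ex.ok_lt, Ex.ok_c, Ex.ok_add, Ex.ok_eq, Ex.ok_r, Ex.ok_mul,
      Ex.ok_sum, Ex.ok_l, Ex.eval_sum, Ex.eval_l, RamState.arr_setReg, RamState.reg_setReg, if_true,
      Ex.eval_lt, Ex.eval_eq, Ex.eval_r, Ex.eval_c, Ex.eval_add, Ex.eval_mul, h24, h25, hLe, hn, e7,
      (by decide : (0 : ℕ) ≠ 18), (by decide : (14 : ℕ) ≠ 18), if_false, h14, hle,
      Viable, ← hLL, Ex.cost_lt, Ex.cost_add, Ex.cost_mul, Ex.cost_c, Ex.cost_r, Ex.cost_sum,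
      Ex.cost_l, Ex.cost_eq, Finset.sum_const, Finset.card_range, smul_eq_mul, hcap, true_and,
      and_true]
    refine ⟨by split_ifs <;> omega, ?_, by omega, hb'.1, hb'.2⟩
    refine ⟨⟨fun _ _ => trivial, by omega⟩, by omega⟩
  | _ =>
    refine Tri.of_wp ?_
    simp only [viableProg, Cmd.wp, Ex.ok_lt, Ex.ok_c, Ex.ok_add, Ex.ok_eq, Ex.ok_r, Ex.ok_mul,
      Ex.eval_lt, Ex.eval_eq, Ex.eval_r, Ex.eval_c, Ex.eval_add, Ex.eval_mul, h24, h25, hLe]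
    refine ⟨⟨by omega, ⟨⟨trivial, by omega⟩, ⟨trivial, ⟨by omega, trivial, by omega⟩⟩,
      by split_ifs <;> omega⟩⟩, ?_⟩
    refine (peel_iterate_spec (A := A) (HoldsGraph_of_eq hG (by simp) (by simp))
      (HoldsSet_of_eq hA (by simp)) (by omega) hnp (HoldsSet_of_eq hC (by simp))).mono ?_
    rintro s₁ t₁ - hfr ⟨ht₁, hP⟩
    have e7 := sum_set_eq_card hP
    have r0 : s₁.reg 0 = n := (hfr.r rfl).trans (by simp [hn])
    have r18 : s₁.reg 18 = L := (hfr.r rfl).trans (by simp)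
    have hcw := hcap ((peel G A)^[n] (coreSet G R' X))
    have hb : ∀ p : Prop, [Decidable p] → L * (if p then 1 else 0) ≤ 1 ∧
        (L * (if p then 1 else 0) = 1 ↔ L = 1 ∧ p) := fun p _ => by
      by_cases c : p <;> simp [c] <;> omega
    have hb' := hb ((peel G A)^[n] (coreSet G R' X) = ∅)
    simp only [Ex.ok_r, Ex.ok_sum, Ex.ok_l, Ex.eval_r, Ex.eval_sum, Ex.eval_l, Ex.cost_mul, Ex.cost_r, Ex.cost_eq, Ex.cost_sum,
      Ex.cost_l, Ex.cost_c, Ex.cost_lt, Ex.cost_add, RamState.reg_setReg, RamState.arr_setReg, if_true,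
      r0, r18, e7, hcw, Viable, ← hLL, Finset.card_eq_zero, Finset.sum_const, Finset.card_range,
      smul_eq_mul, true_and, and_true]
    exact ⟨⟨⟨fun _ _ => trivial, by omega⟩, by omega⟩, by omega, hb'.1, hb'.2⟩

end Sig

/-! ### Grouping by signature -/

/-- If `reg 18` is nonzero, stores the class of set number `reg 20`, whose signature is row number
`reg 17` of the table in array `10`. -/
def lookupProg : Cmd :=
  .ite (.r 18) (.ite (foundEx 10 17 23) (.sto 15 (.r 20) (indexEx 10 17 23 + .c 1))
    (.seq (.set 17 (.r 17 + .c 1)) (.sto 15 (.r 20) (.r 17)))) (.sto 15 (.r 20) (.c 0))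

/-- Computes the labels, the weight and the signature class of set number `reg 20`. -/
def classifyStep (f : WidthParam) : Cmd :=
  .seq (.set 22 (.r 20 * .r 0)) <| .seq (.blk labelProg) <| .seq (.blk setProg) <|
  .seq (.blk weightProg) <| .seq (.blk sigProg) <| .seq (.blk (viableProg f)) <|
  .blk lookupProg

/-- Computes the labels, the weights and the signature classes of all sets in array `3`; the number
of classes is stored in register `17`. -/
def classifyProg (f : WidthParam) : Cmd :=
  .seq (.set 8 (.r 0 * .r 0)) <| .seq (.set 23 (.r 0 + .c 1)) <| .seq (.set 17 (.c 0)) <|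
  .for 20 1 (classifyStep f)

section Classify
variable {n : ℕ} (G : SimpleGraph (Fin n)) [DecidableRel G.Adj] (A R' : Finset (Fin n))

/-- Array `15` holds the signature classes of the first `i` sets, counted from `1`, and `0` for the
sets that are not viable; there are `m` classes, with signatures in array `10`. -/
structure Classified (f : WidthParam) (w : Fin n → ℚ) (X : ℕ → Finset (Fin n)) (s : RamState)
    (i m : ℕ) : Prop where
  labels : ∀ j < i, s.HoldsLabels G (j * n) (X j)
  weight : ∀ j < i, s.warr 1 j = ∑ v ∈ X j, w v
  rep : ∃ rep : ℕ → ℕ, (∀ k < m, rep k < i ∧ Viable G A f R' (X (rep k)) ∧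
    ∀ v < n + 1, s.arr 10 (k * (n + 1) + v) = sigRow G A R' (X (rep k)) v) ∧
    Set.InjOn (fun k => sigRow G A R' (X (rep k))) (Set.Iio m)
  cls : ∀ j < i, (s.arr 15 j = 0 ∧ ¬ Viable G A f R' (X j)) ∨ ∃ c < m, s.arr 15 j = c + 1 ∧
    Viable G A f R' (X j) ∧ ∀ v < n + 1, s.arr 10 (c * (n + 1) + v) = sigRow G A R' (X j) v

variable {G A R'}

theorem sigRow_ext {X X' : Finset (Fin n)}
    (h : ∀ v < n + 1, sigRow G A R' X v = sigRow G A R' X' v) :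
    sigRow G A R' X = sigRow G A R' X' := by
  funext v
  by_cases hv : v < n
  · exact h v (by omega)
  · have := h n (by omega)
    simpa [sigRow, hv] using this

theorem Classified.of_eq {f : WidthParam} {w : Fin n → ℚ} {X : ℕ → Finset (Fin n)}
    {s s' : RamState} {i m : ℕ} (h : Classified G A R' f w X s i m) (h8 : s'.arr 8 = s.arr 8)
    (h10 : s'.arr 10 = s.arr 10) (h15 : s'.arr 15 = s.arr 15) (h1 : s'.warr 1 = s.warr 1) :
    Classified G A R' f w X s' i m :=
  ⟨fun j hj v v' => by rw [h8]; exact h.labels j hj v v', fun j hj => by rw [h1]; exact h.weight j hj,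
    by rw [h10]; exact h.rep, by rw [h10, h15]; exact h.cls⟩

open Classical in
theorem Classified.le {f : WidthParam} {w : Fin n → ℚ} {X : ℕ → Finset (Fin n)}
    {s : RamState} {i m B : ℕ} (h : Classified G A R' f w X s i m) (hX : ∀ j < i, X j ⊆ A)
    (hB : ∀ F : Finset (Finset (Fin n)), (∀ X ∈ F, X ⊆ A ∧ Viable G A f R' X) →
      (F.image (sigRow G A R')).card ≤ B) : m ≤ B := by
  obtain ⟨rep, h1, h2⟩ := h.rep
  have h3 := hB ((Finset.range m).image fun k => X (rep k)) fun Y hY => by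
    obtain ⟨k, hk, rfl⟩ := Finset.mem_image.1 hY
    have := h1 k (Finset.mem_range.1 hk)
    exact ⟨hX _ this.1, this.2.1⟩
  rw [Finset.image_image, Finset.card_image_of_injOn] at h3
  · simpa using h3
  · intro a ha b hb hab
    exact h2 (by simpa using ha) (by simpa using hb) hab

theorem Classified.sameSig {f : WidthParam} {w : Fin n → ℚ} {X : ℕ → Finset (Fin n)}
    {s : RamState} {i m : ℕ} (h : Classified G A R' f w X s i m) {j j' c : ℕ} (hj : j < i)
    (hj' : j' < i) (hc : s.arr 15 j = c + 1) (hc' : s.arr 15 j' = c + 1) :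
    SameSig G A R' (X j) (X j') := by
  rcases h.cls j hj with h1 | ⟨d, -, h1, -, h2⟩
  · omega
  rcases h.cls j' hj' with h1' | ⟨d', -, h1', -, h2'⟩
  · omega
  obtain rfl : d = c := by omega
  obtain rfl : d' = d := by omega
  exact sameSig_of_sigRow fun u hu => (h2 u hu).symm.trans (h2' u hu)

theorem lookupProg_spec {W i m : ℕ} {s₅ : RamState} {f : WidthParam} {w : Fin n → ℚ}
    {X : ℕ → Finset (Fin n)} (hmn : (m + 2) * (n + 1) ≤ W) (hC : Classified G A R' f w X s₅ i m)
    (hL : s₅.HoldsLabels G (i * n) (X i)) (hwi : s₅.warr 1 i = ∑ v ∈ X i, w v)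
    (hnew : ∀ v < n + 1, s₅.arr 10 (m * (n + 1) + v) = sigRow G A R' (X i) v)
    (q20 : s₅.reg 20 = i) (q17 : s₅.reg 17 = m) (q23 : s₅.reg 23 = n + 1) (h18 : s₅.reg 18 ≤ 1)
    (hV : s₅.reg 18 = 1 ↔ Viable G A f R' (X i)) :
    Tri W lookupProg s₅ fun s' t => t ≤ 300 + 50 * (m * (n + 1)) ∧ ∃ m', s'.reg 17 = m' ∧
      Classified G A R' f w X s' (i + 1) m' := by
  refine Tri.intro fun hW3 hf₅ => ?_
  obtain ⟨rep, hrep, hinj⟩ := hC.rep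
  have hrep5 : ∀ k < m, ∀ v < n + 1, s₅.arr 10 (k * (n + 1) + v) = sigRow G A R' (X (rep k)) v :=
    fun k hk => (hrep k hk).2.2
  have hcls := hC.cls
  have hlab : ∀ j < i + 1, s₅.HoldsLabels G (j * n) (X j) := by
    intro j hj
    rcases Nat.lt_succ_iff_lt_or_eq.1 hj with hj | rfl
    exacts [hC.labels j hj, hL]
  have hwt : ∀ j < i + 1, s₅.warr 1 j = ∑ v ∈ X j, w v := by
    intro j hj
    rcases Nat.lt_succ_iff_lt_or_eq.1 hj with hj | rfl
    exacts [hC.weight j hj, hwi]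
  have hmW : (m + 1) * (n + 1) ≤ W := (Nat.mul_le_mul_right _ (by omega)).trans hmn
  have hmW' : (s₅.reg 17 + 1) * s₅.reg 23 ≤ W := by rw [q17, q23]; exact hmW
  obtain ⟨f1, f2, f3⟩ := foundEx_spec (a := 10) (y := 17) (w := 23) (by decide) (by decide) hf₅ hmW'
  rw [q17, q23] at f1 f3
  have hm1 : m + 2 ≤ W := (Nat.le_mul_of_pos_right _ (by omega)).trans hmn
  have hfc : m * ((n + 1) * 14 + 4) + 1 ≤ 18 * (m * (n + 1)) + 1 := by nlinarith
  have hic : m * ((n + 1) * 14 + 6) + 1 ≤ 20 * (m * (n + 1)) + 1 := by nlinarith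
  refine Tri.of_wp ?_
  simp only [lookupProg, Cmd.wp]
  refine ⟨trivial, fun hne => ⟨f2, fun hfd => ?_, fun hfd => ?_⟩, fun he => ?_⟩
  · simp only [Ex.eval_r] at hne
    have hv := hV.1 (by omega)
    obtain ⟨j, hj, hjv⟩ := f1.1 hfd
    have huniq : ∀ k < s₅.reg 17, (∀ v < s₅.reg 23, s₅.arr 10 (k * s₅.reg 23 + v) =
        s₅.arr 10 (s₅.reg 17 * s₅.reg 23 + v)) ↔ k = j := by
      intro k hk
      rw [q17] at hk ⊢
      rw [q23]
      refine ⟨fun h => hinj (by simpa using hk) (by simpa using hj) (sigRow_ext fun v hv => ?_), ?_⟩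
      · rw [← hrep5 k hk v hv, ← hrep5 j hj v hv, h v hv, hjv v hv]
      · rintro rfl; exact hjv
    obtain ⟨g1, g2, g3⟩ := indexEx_spec (a := 10) (y := 17) (w := 23) (by decide) (by decide) hf₅
      hmW' (j := j) (by omega) huniq
    rw [q17, q23] at g3
    simp only [Ex.ok_r, Ex.ok_add, g1, g2, Ex.ok_c, Ex.eval_c, Ex.eval_add, Ex.eval_r, q20, f3, g3,
      Ex.cost_add, Ex.cost_r, Ex.cost_c, true_and]
    refine ⟨by omega, by omega, m, by simp [q17], ⟨fun k hk v v' => by simpa using hlab k hk v v',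
      by simpa using hwt, ⟨rep, fun k hk => ⟨by have := (hrep k hk).1; omega, (hrep k hk).2.1,
        by simpa using hrep5 k hk⟩, hinj⟩, fun k hk => ?_⟩⟩
    rcases Nat.lt_succ_iff_lt_or_eq.1 hk with hk | rfl
    · simpa [show k ≠ i by omega] using hcls k hk
    · refine .inr ⟨j, hj, by simp, hv, fun v hv => ?_⟩
      simp only [RamState.arr_setArr, if_false, (by decide : (10 : ℕ) ≠ 15), false_and]
      rw [hjv v hv, hnew v hv]
  · simp only [Ex.eval_r] at hne
    have hv := hV.1 (by omega)
    have hnf : ∀ k < m, ¬ ∀ v < n + 1, s₅.arr 10 (k * (n + 1) + v) = s₅.arr 10 (m * (n + 1) + v) :=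
      fun k hk h => absurd hfd (f1.2 ⟨k, hk, h⟩)
    simp only [Ex.ok_r, Ex.ok_add, Ex.ok_c, Ex.eval_c, Ex.eval_add, Ex.eval_r, q20, q17, f3,
      Ex.cost_add, Ex.cost_r, Ex.cost_c, true_and, RamState.reg_setReg, if_true,
      (by decide : (20 : ℕ) ≠ 17), if_false]
    refine ⟨by omega, by omega, m + 1, by simp, ⟨fun k hk v v' => by simpa using hlab k hk v v',
      by simpa using hwt, ⟨Function.update rep m i, fun k hk => ?_, ?_⟩, fun k hk => ?_⟩⟩
    · rcases Nat.lt_succ_iff_lt_or_eq.1 hk with hk | rfl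
      · rw [Function.update_of_ne (by omega)]
        exact ⟨by have := (hrep k hk).1; omega, (hrep k hk).2.1, by simpa using hrep5 k hk⟩
      · rw [Function.update_self]
        exact ⟨by omega, hv, by simpa using hnew⟩
    · intro k hk k' hk' he
      simp only [Set.mem_Iio] at hk hk'
      have key : ∀ k < m, sigRow G A R' (X (rep k)) ≠ sigRow G A R' (X i) := fun k hk h =>
        hnf k hk fun v hv => by rw [hrep5 k hk v hv, hnew v hv, h]
      simp only [Function.update_apply] at he
      split_ifs at he with c1 c2 c2
      · omega
      · exact absurd he.symm (key k' (by omega))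
      · exact absurd he (key k (by omega))
      · exact hinj (by simp; omega) (by simp; omega) he
    · rcases Nat.lt_succ_iff_lt_or_eq.1 hk with hk | rfl
      · rcases hcls k hk with h | ⟨c, hc, h⟩
        · exact .inl (by simpa [show k ≠ i by omega] using h)
        · exact .inr ⟨c, by omega, by simpa [show k ≠ i by omega] using h⟩
      · exact .inr ⟨m, by omega, by simp, hv, by simpa using hnew⟩
  · simp only [Ex.eval_r] at he
    have hv : ¬ Viable G A f R' (X i) := fun h => by have := hV.2 h; omega
    simp only [Ex.ok_r, Ex.ok_c, Ex.eval_c, Ex.eval_r, q20, Ex.cost_r, Ex.cost_c,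
      true_and]
    refine ⟨by omega, by omega, m, by simp [q17], ⟨fun k hk v v' => by simpa using hlab k hk v v',
      by simpa using hwt, ⟨rep, fun k hk => ⟨by have := (hrep k hk).1; omega, (hrep k hk).2.1,
        by simpa using hrep5 k hk⟩, hinj⟩, fun k hk => ?_⟩⟩
    rcases Nat.lt_succ_iff_lt_or_eq.1 hk with hk | rfl
    · simpa [show k ≠ i by omega] using hcls k hk
    · exact .inl ⟨by simp, hv⟩

open Classical in
theorem classifyStep_spec {W B a i m : ℕ} {s : RamState} {f : WidthParam} {w : Fin n → ℚ}
    {X : ℕ → Finset (Fin n)} (hnp : 0 < n) (hn2 : 6 * (n * n) < W) (haW : a * n ≤ W)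
    (hBW : (B + 2) * (n + 1) ≤ W) (hG : s.HoldsGraph G) (hA : s.HoldsSet 1 A) (hR : s.HoldsSet 2 R')
    (hw : s.HoldsWeights w) (hX : ∀ j < a, ∀ v < n, s.arr 3 (j * n + v) = ind (X j) v)
    (hXA : ∀ j < a, X j ⊆ A)
    (h14 : f = .mim → s.reg 14 = (goods G A).sup Finset.card)
    (hB : ∀ F : Finset (Finset (Fin n)), (∀ X ∈ F, X ⊆ A ∧ Viable G A f R' X) →
      (F.image (sigRow G A R')).card ≤ B) (h8 : s.reg 8 = n * n) (h23 : s.reg 23 = n + 1)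
    (hia : i < a) (h20 : s.reg 20 = i) (h17 : s.reg 17 = m) (hC : Classified G A R' f w X s i m) :
    Tri W (classifyStep f) s fun s' t => t ≤ 2000 * n ^ 3 + 100 * (B * n) ∧ ∃ m', s'.reg 17 = m' ∧
      Classified G A R' f w X s' (i + 1) m' := by
  refine Tri.intro fun hW3 hf => ?_
  have hn := hG.1
  have hmB : m ≤ B := hC.le (fun j hj => hXA j (by omega)) hB
  have hin : i * n < W := mul_lt_of_idx hia hnp haW
  have hbW : i * n + n ≤ W := by
    have : (i + 1) * n ≤ a * n := Nat.mul_le_mul_right n hia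
    rw [Nat.add_mul] at this; omega
  have hmW : (m + 1) * (n + 1) ≤ W := (Nat.mul_le_mul_right _ (by omega)).trans hBW
  have hnnW : n * n < W := by omega
  refine Tri.of_wp ?_
  simp only [classifyStep, Cmd.wp]
  refine ⟨by simp [h20, hn, hin], ?_⟩
  have e22 : (Ex.r 20 * Ex.r 0).eval s = i * n := by simp [h20, hn]
  rw [e22]
  set s₀ := s.setReg 22 (i * n) with hs₀
  refine (labelProg_spec (s := s₀) (X := X i) (HoldsGraph_of_eq hG (by simp [hs₀]) (by simp [hs₀]))
    (by simp [hs₀, h8]) (b := i * n) (by simp [hs₀]) hbW (by simpa [hs₀] using hX i hia)).mono ?_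
  rintro s₁ t₁ hf₁ hfr₁ ⟨ht₁, hL₁, hk₁⟩
  have r1 : ∀ x, x ≠ 22 → labelProg.mr x = false → s₁.reg x = s.reg x := fun x hx hx' =>
    (hfr₁.r hx').trans (by simp [hs₀, hx])
  have a1 : ∀ x, labelProg.ma x = false → s₁.arr x = s.arr x := fun x hx' => hfr₁.a hx'
  have hG₁ : s₁.HoldsGraph G := HoldsGraph_of_eq hG (r1 _ (by decide) rfl) (a1 _ rfl)
  have hwa₁ : s₁.warr = s.warr := funext fun x => hfr₁.wa rfl
  refine (setProg_spec (s := s₁) (X := X i) (b := i * n) hG₁ (HoldsSet_of_eq hR (a1 _ rfl)) hnnW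
    ((hfr₁.r rfl).trans (by simp [hs₀])) hbW (by rw [a1 _ rfl]; exact hX i hia)).mono ?_
  rintro s₂ t₂ hf₂ hfr₂ ⟨ht₂, hX₂, hC₂, hc₂, hd₂, ho₂⟩
  have hwa₂ : s₂.warr = s.warr := (funext fun x => hfr₂.wa rfl).trans hwa₁
  have a2 : ∀ x, setProg.ma x = false → s₂.arr x = s₁.arr x := fun x hx' => hfr₂.a hx'
  have r2 : ∀ x, setProg.mr x = false → s₂.reg x = s₁.reg x := fun x hx' => hfr₂.r hx'
  have hG₂ : s₂.HoldsGraph G := HoldsGraph_of_eq hG₁ (r2 _ rfl) (a2 _ rfl)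
  refine (weightProg_spec (s := s₂) (X := X i) (w := w) (i := i) hG₂.1 hX₂
    (by unfold RamState.HoldsWeights; rw [hwa₂]; exact hw)
    ((r2 _ rfl).trans ((r1 _ (by decide) rfl).trans h20))).mono ?_
  rintro s₃ t₃ hf₃ hfr₃ ⟨ht₃, hw₃, hwo₃⟩
  have a3 : ∀ x, s₃.arr x = s₂.arr x := fun x => hfr₃.a rfl
  have r3 : ∀ x, weightProg.mr x = false → s₃.reg x = s₂.reg x := fun x hx' => hfr₃.r hx'
  have hG₃ : s₃.HoldsGraph G := HoldsGraph_of_eq hG₂ (r3 _ rfl) (a3 _)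
  refine (sigProg_spec (s := s₃) (X := X i) (A := A) (R' := R') (c := m) hG₃
    (HoldsSet_of_eq hA ((a3 _).trans ((a2 _ rfl).trans (a1 _ rfl)))) (HoldsSet_of_eq hC₂ (a3 _)) hn2
    hnp ((r3 _ rfl).trans hc₂) ((r3 _ rfl).trans hd₂) ((r3 _ rfl).trans ho₂)
    ((r3 _ rfl).trans ((r2 _ rfl).trans ((r1 _ (by decide) rfl).trans h23)))
    ((r3 _ rfl).trans ((r2 _ rfl).trans ((r1 _ (by decide) rfl).trans h17))) hmW).mono ?_
  rintro s₄ t₄ hf₄ hfr₄ ⟨ht₄, hrow₄, hold₄⟩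
  have a4 : ∀ x, sigProg.ma x = false → s₄.arr x = s₃.arr x := fun x hx' => hfr₄.a hx'
  have r4 : ∀ x, sigProg.mr x = false → s₄.reg x = s₃.reg x := fun x hx' => hfr₄.r hx'
  have hG₄ : s₄.HoldsGraph G := HoldsGraph_of_eq hG₃ (r4 _ rfl) (a4 _ rfl)
  refine (viableProg_spec (s := s₄) (X := X i) (A := A) (R' := R') (f := f) hG₄
    (HoldsSet_of_eq hA ((a4 _ rfl).trans ((a3 _).trans ((a2 _ rfl).trans (a1 _ rfl)))))
    (HoldsSet_of_eq hC₂ ((a4 _ rfl).trans (a3 _))) hn2 hnp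
    ((r4 _ rfl).trans ((r3 _ rfl).trans hc₂)) ((r4 _ rfl).trans ((r3 _ rfl).trans hd₂)) fun h =>
    ((r4 _ rfl).trans ((r3 _ rfl).trans ((r2 _ rfl).trans ((r1 _ (by decide) rfl).trans
      (h14 h)))))).mono ?_
  rintro s₅ t₅ hf₅ hfr₅ ⟨ht₅, h18, hV⟩
  have a5 : ∀ x ∈ [8, 10, 15], s₅.arr x = s₄.arr x := fun x hx => hfr₅.a (by
    fin_cases hx <;> cases f <;> rfl)
  have r5 : ∀ x ∈ [17, 20, 23], s₅.reg x = s₄.reg x := fun x hx => hfr₅.r (by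
    fin_cases hx <;> cases f <;> rfl)
  have w5 : s₅.warr = s₄.warr := funext fun x => hfr₅.wa (by cases f <;> rfl)
  have q20 : s₅.reg 20 = i := (r5 _ (by decide)).trans ((r4 _ rfl).trans
    ((r3 _ rfl).trans ((r2 _ rfl).trans ((r1 _ (by decide) rfl).trans h20))))
  have q17 : s₅.reg 17 = m := (r5 _ (by decide)).trans ((r4 _ rfl).trans
    ((r3 _ rfl).trans ((r2 _ rfl).trans ((r1 _ (by decide) rfl).trans h17))))
  have q23 : s₅.reg 23 = n + 1 := (r5 _ (by decide)).trans
    ((r4 _ rfl).trans ((r3 _ rfl).trans ((r2 _ rfl).trans ((r1 _ (by decide) rfl).trans h23))))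
  have c10 : s₅.arr 10 = s₄.arr 10 := a5 _ (by decide)
  have c15 : s₅.arr 15 = s.arr 15 := (a5 _ (by decide)).trans ((a4 _ rfl).trans
    ((a3 _).trans ((a2 _ rfl).trans (a1 _ rfl))))
  have c8 : s₅.arr 8 = s₁.arr 8 := (a5 _ (by decide)).trans ((a4 _ rfl).trans
    ((a3 _).trans (a2 _ rfl)))
  have cw : s₅.warr = s₃.warr := w5.trans (funext fun x => hfr₄.wa rfl)
  have hnew : ∀ v < n + 1, s₅.arr 10 (m * (n + 1) + v) = sigRow G A R' (X i) v := by
    rw [c10]; exact hrow₄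
  have hold : ∀ k < m, ∀ v < n + 1, s₅.arr 10 (k * (n + 1) + v) = s.arr 10 (k * (n + 1) + v) := by
    intro k hk v hv
    rw [c10, hold₄ _ (idx_lt hk hv le_rfl), a3, a2 _ rfl, a1 _ rfl]
  have hlab : ∀ j < i + 1, s₅.HoldsLabels G (j * n) (X j) := by
    intro j hj
    rcases Nat.lt_succ_iff_lt_or_eq.1 hj with hj | rfl
    · intro v v'
      have hne : ∀ v < n, ∀ v' < n, j * n + v ≠ i * n + v' := fun v hv v' _ => by
        have := idx_lt (W := i * n) hj hv le_rfl
        omega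
      rw [c8, hk₁ _ fun u hu => hne v v.2 u hu, hk₁ _ fun u hu => hne v' v'.2 u hu]
      exact hC.labels j hj v v'
    · intro v v'
      rw [c8]; exact hL₁ v v'
  have hwt : ∀ j < i + 1, s₅.warr 1 j = ∑ v ∈ X j, w v := by
    intro j hj
    rcases Nat.lt_succ_iff_lt_or_eq.1 hj with hj | rfl
    · rw [cw, hwo₃ _ (by omega), hwa₂]; exact hC.weight j hj
    · rw [cw, hw₃]
  have hsame : Classified G A R' f w X s₅ i m := by
    obtain ⟨rep, hrep, hinj⟩ := hC.rep
    refine ⟨fun j hj => hlab j (by omega), fun j hj => hwt j (by omega), ⟨rep, fun k hk =>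
      ⟨(hrep k hk).1, (hrep k hk).2.1, fun v hv => (hold k hk v hv).trans ((hrep k hk).2.2 v hv)⟩,
      hinj⟩, fun j hj => ?_⟩
    rw [c15]
    refine (hC.cls j hj).imp id ?_
    rintro ⟨c, hc, h1, h2, h3⟩
    exact ⟨c, hc, h1, h2, fun v hv => (hold c hc v hv).trans (h3 v hv)⟩
  refine (lookupProg_spec (W := W) ((Nat.mul_le_mul_right _ (by omega)).trans hBW) hsame
    (hlab i (by omega)) (hwt i (by omega)) hnew q20 q17 q23 h18 hV).mono ?_
  rintro s₆ t₆ - - ⟨ht₆, h6⟩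
  refine ⟨?_, h6⟩
  have e0 : (Ex.r 20 * Ex.r 0).cost s = 3 := rfl
  have e1 : n ≤ n ^ 3 := Nat.le_self_pow (by omega) n
  have e2 : n ^ 2 ≤ n ^ 3 := Nat.pow_le_pow_right hnp (by omega)
  have e3 : m * (n + 1) ≤ B * (2 * n) := Nat.mul_le_mul hmB (by omega)
  have e4 : B * (2 * n) = 2 * (B * n) := by ring
  omega

open Classical in
theorem classifyProg_spec {W B a : ℕ} {s : RamState} {f : WidthParam} {w : Fin n → ℚ}
    {X : ℕ → Finset (Fin n)} (hnp : 0 < n) (hn2 : 6 * (n * n) < W) (haW : a * n ≤ W)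
    (hBW : (B + 2) * (n + 1) ≤ W) (hG : s.HoldsGraph G) (hA : s.HoldsSet 1 A) (hR : s.HoldsSet 2 R')
    (hw : s.HoldsWeights w) (ha : s.reg 1 = a)
    (hX : ∀ j < a, ∀ v < n, s.arr 3 (j * n + v) = ind (X j) v) (hXA : ∀ j < a, X j ⊆ A)
    (h14 : f = .mim → s.reg 14 = (goods G A).sup Finset.card)
    (hB : ∀ F : Finset (Finset (Fin n)), (∀ X ∈ F, X ⊆ A ∧ Viable G A f R' X) →
      (F.image (sigRow G A R')).card ≤ B) :
    Tri W (classifyProg f) s fun s' t => t ≤ (a + 1) * (2100 * n ^ 3 + 100 * (B * n)) ∧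
      ∃ m, s'.reg 17 = m ∧ Classified G A R' f w X s' a m := by
  refine Tri.intro fun hW3 hf => ?_
  have hn := hG.1
  have hnn : n ≤ n * n := Nat.le_mul_self n
  refine Tri.of_wp ?_
  simp only [classifyProg, Cmd.wp, Cmd.wp_for]
  have hr : ∀ x ∈ [0, 8, 14, 23], (Cmd.loopFor 20 1 (classifyStep f)).mr x = false := by
    intro x hx
    fin_cases hx <;> cases f <;> rfl
  have har : ∀ x, x < 4 → (Cmd.loopFor 20 1 (classifyStep f)).ma x = false := by
    intro x hx
    interval_cases x <;> cases f <;> rfl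
  have hwar : (Cmd.loopFor 20 1 (classifyStep f)).mwa 0 = false := by cases f <;> rfl
  refine ⟨by simp [hn]; omega, by simp [hn]; omega, by simp, ?_⟩
  refine Tri.loop (N := a) (by simp [ha]) (by decide) (by cases f <;> rfl) (by cases f <;> rfl)
    (fun i s' => ∃ m, s'.reg 17 = m ∧ Classified G A R' f w X s' i m)
    (2000 * n ^ 3 + 100 * (B * n)) ?_ ?_ ?_
  · exact ⟨0, by simp, ⟨by simp, by simp, ⟨id, by simp, by simp⟩, by simp⟩⟩
  · rintro i s' hi hf' hi' hfr ⟨m, h17, hC⟩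
    have r0 : s'.reg 0 = s.reg 0 := (hfr.r (hr _ (by decide))).trans (by simp)
    have r14 : s'.reg 14 = s.reg 14 := (hfr.r (hr _ (by decide))).trans (by simp)
    have r8 : s'.reg 8 = n * n := (hfr.r (hr _ (by decide))).trans (by simp [hn])
    have r23 : s'.reg 23 = n + 1 := (hfr.r (hr _ (by decide))).trans (by simp [hn])
    have ar : ∀ x, x < 4 → s'.arr x = s.arr x := fun x hx => (hfr.a (har x hx)).trans (by simp)
    have hw0 : s'.warr 0 = s.warr 0 := (hfr.wa hwar).trans (by simp)
    refine (classifyStep_spec (B := B) hnp hn2 haW hBW (HoldsGraph_of_eq hG r0 (ar 0 (by decide)))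
      (HoldsSet_of_eq hA (ar 1 (by decide))) (HoldsSet_of_eq hR (ar 2 (by decide))) (w := w)
      (fun v => by rw [hw0]; exact hw v) (by rw [ar 3 (by decide)]; exact hX) hXA
      (fun h => by rw [r14]; exact h14 h) hB r8 r23 hi hi' h17 hC).mono ?_
    rintro s₁ t₁ - - ⟨h1, m', h2, h3⟩
    exact ⟨h1, m', by simp [h2], h3.of_eq (by simp) (by simp) (by simp) (by simp)⟩
  · rintro s' t hf' hi' hfr ⟨m, h17, hC⟩ ht
    refine ⟨?_, m, h17, hC⟩
    have e1 : n ≤ n ^ 3 := Nat.le_self_pow (by omega) n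
    have e2 : a * (2000 * n ^ 3 + 100 * (B * n) + 8) ≤ a * (2100 * n ^ 3 + 100 * (B * n)) :=
      Nat.mul_le_mul_left _ (by omega)
    simp only [Ex.cost_mul, Ex.cost_r, Ex.cost_add, Ex.cost_c]
    rw [Nat.add_mul, one_mul]
    omega

end Classify

/-! ### Filling the matrix -/

/-- Whether the component of vertex `reg 40` contains a member of the set whose indicator vector
starts at the place `e` of array `5`. -/
def seesEx (e : Ex) : Ex :=
  .lt (.c 0) (.sum 41 0 (.l 3 (.r 22 + .r 41) * .eq (.l 8 (.r 22 + .r 40)) (.l 8 (.r 22 + .r 41)) *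
    .l 5 (e + .r 41)))

/-- The entry in column `reg 12` for the set whose indicator vector starts at the place `reg 22` of
array `3`. -/
def splitEx : Ex :=
  .eq (.sum 40 0 (.l 3 (.r 22 + .r 40) *
    .eq (seesEx (.r 12 / .r 3 * .r 0)) (seesEx (.r 12 % .r 3 * .r 0)))) (.c 0)

/-- Whether the set whose indicator vector starts at the place `reg 22` of array `3` is connected. -/
def connEx : Ex :=
  .eq (.sum 40 0 (.sum 41 0 (.l 3 (.r 22 + .r 40) * .l 3 (.r 22 + .r 41) *
    (.c 1 - .eq (.l 8 (.r 22 + .r 40)) (.l 8 (.r 22 + .r 41)))))) (.c 0)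

section Entry
variable {n : ℕ} {G : SimpleGraph (Fin n)} {X : Finset (Fin n)}

open Classical in
theorem seesEx_spec {W b d c : ℕ} {s : RamState} {S : Finset (Fin n)} {v : Fin n} {e : Ex}
    (hnW : n < W) (hn : s.reg 0 = n) (hb : s.reg 22 = b) (hbW : b + n ≤ W)
    (hX : ∀ v < n, s.arr 3 (b + v) = ind X v) (hL : s.HoldsLabels G b X)
    (hv : s.reg 40 = v) (hdW : d + n ≤ W)
    (he : ∀ i < n, e.eval (s.setReg 41 i) = d ∧ e.ok W (s.setReg 41 i) ∧ e.cost (s.setReg 41 i) = c)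
    (hS : ∀ v < n, s.arr 5 (d + v) = ind S v) :
    (seesEx e).eval s = (if Sees G X S v then 1 else 0) ∧ (seesEx e).ok W s ∧
      (seesEx e).cost s = n * (c + 19) + 3 := by
  have hlab : ∀ u : Fin n, s.arr 8 (b + v) = s.arr 8 (b + u) ↔ Conn G X v u := hL v
  have hev : ∀ u : Fin n, ind X u * (if s.arr 8 (b + v) = s.arr 8 (b + u) then 1 else 0) * ind S u =
      if u ∈ X ∧ Conn G X v u ∧ u ∈ S then 1 else 0 := fun u => by
    rw [ind_val, ind_val, if_congr (hlab u) rfl rfl]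
    by_cases h1 : u ∈ X <;> by_cases h2 : u ∈ S <;> by_cases h3 : Conn G X v u <;> simp [h1, h2, h3]
  have hval : ∀ i < n, (Ex.l 3 (.r 22 + .r 41) * .eq (.l 8 (.r 22 + .r 40)) (.l 8 (.r 22 + .r 41)) *
      .l 5 (e + .r 41)).eval (s.setReg 41 i) =
      ind X i * (if s.arr 8 (b + v) = s.arr 8 (b + i) then 1 else 0) * ind S i := fun i hi => by
    simp [hb, hv, (he i hi).1, hX i hi, hS i hi]
  have htot : ∑ i ∈ Finset.range n,
      ind X i * (if s.arr 8 (b + v) = s.arr 8 (b + i) then 1 else 0) * ind S i =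
      (Finset.univ.filter fun u => u ∈ X ∧ Conn G X v u ∧ u ∈ S).card :=
    sum_indicator_eq_card hev
  have hcard := card_lt_cap hnW (Finset.univ.filter fun u => u ∈ X ∧ Conn G X v u ∧ u ∈ S)
  have hpos : 0 < (Finset.univ.filter fun u => u ∈ X ∧ Conn G X v u ∧ u ∈ S).card ↔ Sees G X S v := by
    rw [Finset.card_pos]
    constructor
    · rintro ⟨u, hu⟩; exact ⟨u, by simpa using hu⟩
    · rintro ⟨u, hu⟩; exact ⟨u, by simpa using hu⟩
  refine ⟨?_, ?_, ?_⟩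
  · rw [seesEx, Ex.eval_lt, Ex.eval_c, Ex.eval_sum, hn,
      Finset.sum_congr rfl fun i hi => hval i (Finset.mem_range.1 hi), htot]
    exact if_congr hpos rfl rfl
  · simp only [seesEx, Ex.ok_lt, Ex.ok_c, Ex.ok_sum, hn]
    rw [Finset.sum_congr rfl fun i hi => hval i (Finset.mem_range.1 hi), htot]
    refine ⟨by simp, fun i hi => ?_, hcard⟩
    have h1 := ind_le X i
    have h2 := ind_le S i
    have h3 : ind X i * (if s.arr 8 (b + v) = s.arr 8 (b + i) then 1 else 0) ≤ 1 := by
      split_ifs <;> simp [h1]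
    have h4 : ind X i * (if s.arr 8 (b + v) = s.arr 8 (b + i) then 1 else 0) * ind S i ≤ 1 :=
      Nat.mul_le_mul h3 h2
    simp only [Ex.ok_mul, Ex.ok_l, Ex.ok_add, Ex.ok_r, Ex.ok_eq, Ex.eval_r, RamState.reg_setReg,
      RamState.arr_setReg, if_true, (by decide : (22 : ℕ) ≠ 41), (by decide : (40 : ℕ) ≠ 41), if_false,
      hb, hv, (he i hi).1, (he i hi).2.1, true_and, Ex.eval_mul, Ex.eval_eq, Ex.eval_l, Ex.eval_add,
      hX i hi, hS i hi]
    have := v.2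
    exact ⟨⟨by omega, ⟨by omega, by omega⟩, by omega⟩, by omega, by omega⟩
  · simp only [seesEx, Ex.cost_lt, Ex.cost_c, Ex.cost_sum, hn]
    rw [Finset.sum_congr rfl fun i hi => show _ = c + 19 by
      simp only [Ex.cost_mul, Ex.cost_l, Ex.cost_add, Ex.cost_r, Ex.cost_eq,
        (he i (Finset.mem_range.1 hi)).2.2]
      ring]
    simp only [Finset.sum_const, Finset.card_range, smul_eq_mul]
    ring

open Classical in
theorem splitEx_spec {W b q j : ℕ} {s : RamState} {L : ℕ → Finset (Fin n)}
    (hnW : n < W) (hn : s.reg 0 = n) (hb : s.reg 22 = b) (hbW : b + n ≤ W)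
    (hX : ∀ v < n, s.arr 3 (b + v) = ind X v) (hL : s.HoldsLabels G b X)
    (hqW : q * n ≤ W) (hq : s.reg 3 = q) (hj : s.reg 12 = j) (hjq : j < q * q)
    (hS : ∀ i < q, ∀ v < n, s.arr 5 (i * n + v) = ind (L i) v) :
    splitEx.eval s = (if Splits G X (L (j / q)) (L (j % q)) then 1 else 0) ∧ splitEx.ok W s ∧
      splitEx.cost s ≤ n * (n * 60 + 30) + 10 := by
  have hq0 : 0 < q := Nat.pos_of_ne_zero (by rintro rfl; simp at hjq)
  have h1 : j / q < q := Nat.div_lt_of_lt_mul hjq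
  have h2 : j % q < q := Nat.mod_lt _ hq0
  have hdW : ∀ i < q, i * n + n ≤ W := fun i hi => by
    have : (i + 1) * n ≤ q * n := Nat.mul_le_mul_right n hi
    rw [Nat.add_mul] at this; omega
  have hW1 : ∀ i < q, i * n < W := fun i hi => by
    rcases Nat.eq_zero_or_pos n with h | h
    · rw [h]; omega
    · have := hdW i hi; omega
  have he1 : ∀ v i : ℕ, (Ex.r 12 / .r 3 * .r 0).eval ((s.setReg 40 v).setReg 41 i) = j / q * n ∧
      (Ex.r 12 / .r 3 * .r 0).ok W ((s.setReg 40 v).setReg 41 i) ∧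
      (Ex.r 12 / .r 3 * .r 0).cost ((s.setReg 40 v).setReg 41 i) = 5 := fun v i => by
    have := hW1 _ h1
    refine ⟨by simp [hj, hq, hn], ?_, by simp⟩
    simpa [hj, hq, hn] using this
  have he2 : ∀ v i : ℕ, (Ex.r 12 % .r 3 * .r 0).eval ((s.setReg 40 v).setReg 41 i) = j % q * n ∧
      (Ex.r 12 % .r 3 * .r 0).ok W ((s.setReg 40 v).setReg 41 i) ∧
      (Ex.r 12 % .r 3 * .r 0).cost ((s.setReg 40 v).setReg 41 i) = 5 := fun v i => by
    have := hW1 _ h2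
    refine ⟨by simp [hj, hq, hn], ?_, by simp⟩
    simpa [hj, hq, hn] using this
  have a1 : ∀ v, (s.setReg 40 v).reg 0 = n := by simp [hn]
  have a2 : ∀ v, (s.setReg 40 v).reg 22 = b := by simp [hb]
  have a3 : ∀ v, ∀ v' < n, (s.setReg 40 v).arr 3 (b + v') = ind X v' := by simpa using hX
  have a4 : ∀ v, (s.setReg 40 v).HoldsLabels G b X := fun v u u' => by simpa using hL u u'
  have key1 : ∀ v (hv : v < n), (seesEx (.r 12 / .r 3 * .r 0)).eval (s.setReg 40 v) =
      (if Sees G X (L (j / q)) ⟨v, hv⟩ then 1 else 0) ∧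
      (seesEx (.r 12 / .r 3 * .r 0)).ok W (s.setReg 40 v) ∧
      (seesEx (.r 12 / .r 3 * .r 0)).cost (s.setReg 40 v) = n * (5 + 19) + 3 := by
    intro v hv
    have a5 : (s.setReg 40 v).reg 40 = (⟨v, hv⟩ : Fin n) := by simp
    have a6 : ∀ v' < n, (s.setReg 40 v).arr 5 (j / q * n + v') = ind (L (j / q)) v' := by
      simpa using hS _ h1
    exact seesEx_spec hnW (a1 v) (a2 v) hbW (a3 v) (a4 v) a5 (hdW _ h1) (fun i _ => he1 v i) a6
  have key2 : ∀ v (hv : v < n), (seesEx (.r 12 % .r 3 * .r 0)).eval (s.setReg 40 v) =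
      (if Sees G X (L (j % q)) ⟨v, hv⟩ then 1 else 0) ∧
      (seesEx (.r 12 % .r 3 * .r 0)).ok W (s.setReg 40 v) ∧
      (seesEx (.r 12 % .r 3 * .r 0)).cost (s.setReg 40 v) = n * (5 + 19) + 3 := by
    intro v hv
    have a5 : (s.setReg 40 v).reg 40 = (⟨v, hv⟩ : Fin n) := by simp
    have a6 : ∀ v' < n, (s.setReg 40 v).arr 5 (j % q * n + v') = ind (L (j % q)) v' := by
      simpa using hS _ h2
    exact seesEx_spec hnW (a1 v) (a2 v) hbW (a3 v) (a4 v) a5 (hdW _ h2) (fun i _ => he2 v i) a6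
  have hval : ∀ v (hv : v < n), (Ex.l 3 (.r 22 + .r 40) *
      .eq (seesEx (.r 12 / .r 3 * .r 0)) (seesEx (.r 12 % .r 3 * .r 0))).eval (s.setReg 40 v) =
      if (⟨v, hv⟩ : Fin n) ∈ X ∧ (Sees G X (L (j / q)) ⟨v, hv⟩ ↔ Sees G X (L (j % q)) ⟨v, hv⟩)
        then 1 else 0 := fun v hv => by
    have e1 := ind_val X ⟨v, hv⟩
    simp only at e1
    rw [Ex.eval_mul, Ex.eval_eq, (key1 v hv).1, (key2 v hv).1, Ex.eval_l]
    simp only [Ex.eval_add, Ex.eval_r, RamState.reg_setReg, RamState.arr_setReg, if_true,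
      (by decide : (22 : ℕ) ≠ 40), if_false, hb, hX v hv, e1]
    by_cases c1 : (⟨v, hv⟩ : Fin n) ∈ X <;> by_cases c2 : Sees G X (L (j / q)) ⟨v, hv⟩ <;>
      by_cases c3 : Sees G X (L (j % q)) ⟨v, hv⟩ <;> simp [c1, c2, c3]
  have htot : ∑ v ∈ Finset.range n, (Ex.l 3 (.r 22 + .r 40) *
      .eq (seesEx (.r 12 / .r 3 * .r 0)) (seesEx (.r 12 % .r 3 * .r 0))).eval (s.setReg 40 v) =
      (Finset.univ.filter fun v => v ∈ X ∧ (Sees G X (L (j / q)) v ↔ Sees G X (L (j % q)) v)).card :=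
    sum_indicator_eq_card fun v => hval v v.2
  refine ⟨?_, ?_, ?_⟩
  · rw [splitEx, Ex.eval_eq, Ex.eval_c, Ex.eval_sum, hn, htot]
    refine if_congr ?_ rfl rfl
    rw [Finset.card_eq_zero, Finset.filter_eq_empty_iff]
    refine ⟨fun h v hv => ?_, fun h v _ hv => ?_⟩
    · have := h (Finset.mem_univ v)
      rw [xor_iff_not_iff]
      tauto
    · have := h v hv.1
      rw [xor_iff_not_iff] at this
      exact this hv.2
  · rw [splitEx, Ex.ok_eq, Ex.ok_sum, hn, htot]
    refine ⟨⟨fun v hv => ?_, card_lt_cap hnW _⟩, by simp⟩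
    have e1 := hval v hv
    rw [Ex.eval_mul] at e1
    rw [Ex.ok_mul, e1, Ex.ok_eq]
    refine ⟨?_, ⟨(key1 v hv).2.1, (key2 v hv).2.1⟩, by split_ifs <;> omega⟩
    simp [hb]; omega
  · rw [splitEx, Ex.cost_eq, Ex.cost_sum, hn]
    have e1 : ∀ v ∈ Finset.range n, (Ex.l 3 (.r 22 + .r 40) *
        .eq (seesEx (.r 12 / .r 3 * .r 0)) (seesEx (.r 12 % .r 3 * .r 0))).cost (s.setReg 40 v) + 1 ≤
        n * 52 + 20 := fun v hv => by
      rw [Ex.cost_mul, Ex.cost_eq, (key1 v (Finset.mem_range.1 hv)).2.2,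
        (key2 v (Finset.mem_range.1 hv)).2.2]
      simp; omega
    have := Finset.sum_le_card_nsmul _ _ _ e1
    simp only [Finset.card_range, smul_eq_mul, Ex.cost_c] at this ⊢
    have e2 : n * (n * 52 + 20) ≤ n * (n * 60 + 30) := Nat.mul_le_mul_left _ (by omega)
    omega

open Classical in
theorem connEx_spec {W b : ℕ} {s : RamState}
    (hnW : n * n < W) (hn : s.reg 0 = n) (hb : s.reg 22 = b) (hbW : b + n ≤ W)
    (hX : ∀ v < n, s.arr 3 (b + v) = ind X v) (hL : s.HoldsLabels G b X) :
    connEx.eval s = (if ConnSet G X then 1 else 0) ∧ connEx.ok W s ∧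
      connEx.cost s = n * (n * 22 + 2) + 3 := by
  have hnn : n ≤ n * n := Nat.le_mul_self n
  have hval : ∀ v (hv : v < n), ∀ u (hu : u < n), (Ex.l 3 (.r 22 + .r 40) * .l 3 (.r 22 + .r 41) *
      (.c 1 - .eq (.l 8 (.r 22 + .r 40)) (.l 8 (.r 22 + .r 41)))).eval
        ((s.setReg 40 v).setReg 41 u) = if (⟨u, hu⟩ : Fin n) ∈ X ∧ (⟨v, hv⟩ : Fin n) ∈ X ∧
          ¬ Conn G X ⟨v, hv⟩ ⟨u, hu⟩ then 1 else 0 := fun v hv u hu => by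
    have e1 := ind_val X ⟨v, hv⟩
    have e2 := ind_val X ⟨u, hu⟩
    have e3 := hL ⟨v, hv⟩ ⟨u, hu⟩
    simp only at e1 e2 e3
    simp only [Ex.eval_mul, Ex.eval_l, Ex.eval_add, Ex.eval_r, Ex.eval_sub, Ex.eval_eq, Ex.eval_c,
      RamState.reg_setReg, RamState.arr_setReg, if_true, (by decide : (22 : ℕ) ≠ 40),
      (by decide : (22 : ℕ) ≠ 41), (by decide : (40 : ℕ) ≠ 41), if_false, hb, hX v hv, hX u hu, e1, e2,
      e3]
    by_cases c1 : (⟨v, hv⟩ : Fin n) ∈ X <;> by_cases c2 : (⟨u, hu⟩ : Fin n) ∈ X <;>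
      by_cases c3 : Conn G X ⟨v, hv⟩ ⟨u, hu⟩ <;> simp [c1, c2, c3]
  have hin : ∀ v (hv : v < n), (Ex.sum 41 0 (.l 3 (.r 22 + .r 40) * .l 3 (.r 22 + .r 41) *
      (.c 1 - .eq (.l 8 (.r 22 + .r 40)) (.l 8 (.r 22 + .r 41))))).eval (s.setReg 40 v) =
      (Finset.univ.filter fun u => u ∈ X ∧ (⟨v, hv⟩ : Fin n) ∈ X ∧ ¬ Conn G X ⟨v, hv⟩ u).card :=
    fun v hv => by
      rw [Ex.eval_sum]
      simp only [RamState.reg_setReg, (by decide : (0 : ℕ) ≠ 40), if_false, hn]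
      exact sum_indicator_eq_card fun u => hval v hv u u.2
  have hle : ∀ v (hv : v < n), (Finset.univ.filter fun u => u ∈ X ∧ (⟨v, hv⟩ : Fin n) ∈ X ∧
      ¬ Conn G X ⟨v, hv⟩ u).card ≤ n := fun v hv => by
    simpa using Finset.card_le_univ (Finset.univ.filter fun u => u ∈ X ∧ (⟨v, hv⟩ : Fin n) ∈ X ∧
      ¬ Conn G X ⟨v, hv⟩ u)
  refine ⟨?_, ?_, ?_⟩
  · rw [connEx, Ex.eval_eq, Ex.eval_c, Ex.eval_sum, hn]
    refine if_congr ?_ rfl rfl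
    rw [Finset.sum_eq_zero_iff]
    constructor
    · intro h a ha c hc
      have := h a.1 (Finset.mem_range.2 a.2)
      rw [hin a a.2, Finset.card_eq_zero, Finset.filter_eq_empty_iff] at this
      by_contra hcon
      exact this (Finset.mem_univ c) ⟨hc, ha, hcon⟩
    · intro h v hv
      rw [hin v (Finset.mem_range.1 hv), Finset.card_eq_zero, Finset.filter_eq_empty_iff]
      rintro u - ⟨h1, h2, h3⟩
      exact h3 (h _ h2 _ h1)
  · rw [connEx, Ex.ok_eq, Ex.ok_sum, hn]
    refine ⟨⟨fun v hv => ?_, ?_⟩, by simp⟩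
    · have e1 := hin v hv
      rw [Ex.eval_sum] at e1
      rw [Ex.ok_sum, e1]
      simp only [RamState.reg_setReg, (by decide : (0 : ℕ) ≠ 40), if_false, hn]
      refine ⟨fun u hu => ?_, lt_of_le_of_lt (hle v hv) (by omega)⟩
      have e2 := hval v hv u hu
      rw [Ex.eval_mul] at e2
      rw [Ex.ok_mul, e2]
      have h1 := ind_le X v
      have h2 := ind_le X u
      have h3 : ind X v * ind X u ≤ 1 := Nat.mul_le_mul h1 h2
      refine ⟨?_, ?_, by split_ifs <;> omega⟩
      · simp [hb, hX v hv, hX u hu]; omega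
      · simp [hb]; omega
    · refine lt_of_le_of_lt (Finset.sum_le_card_nsmul _ _ n fun v hv => ?_) (by simpa using hnW)
      rw [hin v (Finset.mem_range.1 hv)]
      exact hle _ _
  · simp [connEx, hn]; ring

end Entry

/-- Writes the entries of row number `reg 21` of the matrix. -/
def fillEntries : Cmd :=
  .seq (.set 22 (.l 12 (.r 21) * .r 0)) <|
  .seq (.for 12 5 (.sto 13 (.r 21 * .r 4 + .r 12) splitEx)) (.sto 13 (.r 21 * .r 4) connEx)

/-- Fills row number `reg 21` of the matrix. -/
def fillRow : Cmd :=
  .seq (.sto 20 (.r 21) (.c 0)) <| .seq (.sto 21 (.r 21) (.c 0)) <|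
  .seq (.for 12 4 (.sto 13 (.r 21 * .r 4 + .r 12) (.c 0))) <|
  .ite (.lt (.r 21) (.r 25)) (.blk fillEntries) .skip

/-- Fills the matrix in array `13` with the rows of the sets whose numbers are the first `reg 25`
entries of array `12`. -/
def fillProg : Cmd := .loopFor 21 28 fillRow

section Fill
variable {n : ℕ} {G : SimpleGraph (Fin n)}

theorem rowVec_val {L : ℕ → Finset (Fin n)} {q j : ℕ} (hj : j < q * q) (X : Finset (Fin n))
    [Decidable (Entry G L q X j)] :
    (rowVec G L q X j).val = if Entry G L q X j then 1 else 0 := by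
  by_cases h : Entry G L q X j
  · simp [rowVec, hj, h, ZMod.val_one]
  · simp [rowVec, h]

set_option maxHeartbeats 1000000 in
theorem fillEntries_spec {W a q D r : ℕ} {s : RamState} {L X : ℕ → Finset (Fin n)} (hnp : 0 < n)
    (hnW : n * n < W) (hn : s.reg 0 = n) (haW : a * n ≤ W) (hqW : q * n ≤ W)
    (hDW : 2 * D * D ≤ W) (hq : s.reg 3 = q) (hq2 : s.reg 5 = q * q) (hq0 : 0 < q) (hD : s.reg 4 = D)
    (hqD : q * q ≤ D) (hr : s.reg 21 = r) (hrD : r < 2 * D)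
    (hX : ∀ i < a, ∀ v < n, s.arr 3 (i * n + v) = ind (X i) v)
    (hL : ∀ i < a, s.HoldsLabels G (i * n) (X i))
    (hS : ∀ i < q, ∀ v < n, s.arr 5 (i * n + v) = ind (L i) v)
    (hba : s.arr 12 r < a) (h0 : ∀ j < D, s.arr 13 (r * D + j) = 0) :
    Tri W fillEntries s fun s' t => t ≤ 180 * D * n ^ 2 ∧
      (∀ j < D, s'.arr 13 (r * D + j) = (rowVec G L q (X (s.arr 12 r)) j).val) ∧
      ∀ p < r * D, s'.arr 13 p = s.arr 13 p := by
  classical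
  refine Tri.intro fun hW3 hf => ?_
  have hD0 : 0 < D := lt_of_lt_of_le (Nat.mul_pos hq0 hq0) hqD
  have hidx : ∀ j < D, r * D + j < W := fun j hj => idx_lt hrD hj hDW
  have hidx0 : r * D < W := hidx 0 hD0
  have hnn : n ≤ n * n := Nat.le_mul_self n
  have hDn : D ≤ D * n ^ 2 := Nat.le_mul_of_pos_right _ (by positivity)
  have hn2 : n ^ 2 ≤ D * n ^ 2 := Nat.le_mul_of_pos_left _ hD0
  refine Tri.of_wp ?_
  simp only [fillEntries, Cmd.wp, Cmd.wp_for]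
  set i := s.arr 12 r with hi
  have hin : i * n < W := mul_lt_of_idx hba hnp haW
  have hbW : i * n + n ≤ W := by
    have : (i + 1) * n ≤ a * n := Nat.mul_le_mul_right n hba
    rw [Nat.add_mul] at this; omega
  have e22 : (Ex.l 12 (.r 21) * .r 0).eval s = i * n := by simp [hr, hn, hi]
  refine ⟨⟨by simp, by simp, by rw [Ex.eval_mul] at e22; omega⟩, ?_⟩
  rw [e22]
  have common : ∀ (h' : ℕ → ℕ) (j : ℕ), (((s.setReg 22 (i * n)).withArr 13 h').setReg 12 j).reg 0 = n
      ∧ (((s.setReg 22 (i * n)).withArr 13 h').setReg 12 j).reg 22 = i * n ∧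
      (∀ v < n, (((s.setReg 22 (i * n)).withArr 13 h').setReg 12 j).arr 3 (i * n + v) =
        ind (X i) v) ∧
      (((s.setReg 22 (i * n)).withArr 13 h').setReg 12 j).HoldsLabels G (i * n) (X i) ∧
      (((s.setReg 22 (i * n)).withArr 13 h').setReg 12 j).reg 3 = q ∧
      (((s.setReg 22 (i * n)).withArr 13 h').setReg 12 j).reg 12 = j ∧
      (((s.setReg 22 (i * n)).withArr 13 h').setReg 12 j).reg 21 = r ∧
      (((s.setReg 22 (i * n)).withArr 13 h').setReg 12 j).reg 4 = D ∧
      ∀ k < q, ∀ v < n, (((s.setReg 22 (i * n)).withArr 13 h').setReg 12 j).arr 5 (k * n + v) =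
        ind (L k) v := fun h' j => by
    refine ⟨by simp [hn], by simp, fun v hv => ?_, fun v v' => ?_, by simp [hq], by simp,
      by simp [hr], by simp [hD], fun k hk v hv => ?_⟩
    · simpa using hX i hba v hv
    · simpa using hL i hba v v'
    · simpa using hS k hk v hv
  refine Tri.scatter (N := q * q) (by simp [hq2]) (by decide) (fun j => r * D + j)
    (fun j => if Splits G (X i) (L (j / q)) (L (j % q)) then 1 else 0) (n * (n * 60 + 30) + 20)
    (by intros; omega) ?_ ?_
  · intro j hj h' h1' h2'
    obtain ⟨c1, c2, c3, c4, c5, c7, c8, c9, c6⟩ := common h' j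
    obtain ⟨f1, f2, f3⟩ := splitEx_spec (W := W) (by omega) c1 c2 hbW c3 c4 hqW c5 c7 hj c6
    refine ⟨?_, f2, ?_, f1, ?_⟩
    · simp only [Ex.ok_add, Ex.ok_mul, Ex.ok_r, Ex.eval_mul, Ex.eval_r, c7, c8, c9, hidx0,
        hidx j (by omega), true_and]
    · simp only [Ex.eval_add, Ex.eval_mul, Ex.eval_r, c7, c8, c9]
    · simp only [Ex.cost_add, Ex.cost_mul, Ex.cost_r]; omega
  intro h' t₂ hf₂ h1' h2' ht₂
  obtain ⟨c1, c2, c3, c4, c5, c7, c8, c9, c6⟩ := common h' (q * q)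
  obtain ⟨f1, f2, f3⟩ := connEx_spec (W := W) hnW c1 c2 hbW c3 c4
  have e13 : (((s.setReg 22 (i * n)).withArr 13 h').setReg 12 (q * q)).arr 13 = h' := by simp
  clear_value i
  generalize ((s.setReg 22 (i * n)).withArr 13 h').setReg 12 (q * q) = s₃ at *
  simp only [Ex.ok_mul, Ex.ok_r, Ex.eval_mul, Ex.eval_r, c8, c9, hidx0, f2, f1, f3, true_and,
    RamState.arr_setArr, e13, Ex.cost_mul, Ex.cost_r, Ex.cost_l]
  refine ⟨?_, fun j hj => ?_, fun p hp => ?_⟩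
  · have t2 : q * q * (n * (n * 60 + 30) + 20 + 9) ≤ D * (119 * n ^ 2) := by
      refine Nat.mul_le_mul hqD ?_
      nlinarith
    have t3 : D * (119 * n ^ 2) = 119 * (D * n ^ 2) := by ring
    have t4 : 180 * D * n ^ 2 = 180 * (D * n ^ 2) := by ring
    have t5 : n * (n * 22 + 2) ≤ 24 * n ^ 2 := by nlinarith
    have t6 : 1 ≤ n ^ 2 := Nat.one_le_pow _ _ hnp
    omega
  · by_cases hj0 : j = 0
    · subst hj0
      rw [if_pos (by simp), rowVec_val (Nat.mul_pos hq0 hq0)]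
      simp [Entry]
    · rw [if_neg (by simp [hj0])]
      by_cases hjq : j < q * q
      · rw [h1' j hjq, rowVec_val hjq]
        simp [Entry, hj0]
      · rw [h2' _ fun k hk => by omega]
        have := h0 j hj
        simp [this, rowVec, hjq]
  · rw [if_neg (by omega), h2' p fun k hk => by omega]
    simp

theorem fillRow_spec {W a q D r : ℕ} {s : RamState} {L X : ℕ → Finset (Fin n)} (hnp : 0 < n)
    (hnW : n * n < W) (hn : s.reg 0 = n) (haW : a * n ≤ W) (hqW : q * n ≤ W)
    (hDW : 2 * D * D ≤ W) (hq : s.reg 3 = q) (hq2 : s.reg 5 = q * q) (hq0 : 0 < q) (hD : s.reg 4 = D)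
    (hqD : q * q ≤ D) (hr : s.reg 21 = r) (hrD : r < 2 * D)
    (hX : ∀ i < a, ∀ v < n, s.arr 3 (i * n + v) = ind (X i) v)
    (hL : ∀ i < a, s.HoldsLabels G (i * n) (X i))
    (hS : ∀ i < q, ∀ v < n, s.arr 5 (i * n + v) = ind (L i) v)
    (hbuf : r < s.reg 25 → s.arr 12 r < a) :
    Tri W fillRow s fun s' t => t ≤ 250 * D * n ^ 2 ∧ s'.arr 20 = Function.update (s.arr 20) r 0 ∧
      s'.arr 21 = Function.update (s.arr 21) r 0 ∧
      (∀ j < D, s'.arr 13 (r * D + j) =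
        (if r < s.reg 25 then rowVec G L q (X (s.arr 12 r)) j else 0).val) ∧
      ∀ p < r * D, s'.arr 13 p = s.arr 13 p := by
  classical
  refine Tri.intro fun hW3 hf => ?_
  have hD0 : 0 < D := lt_of_lt_of_le (Nat.mul_pos hq0 hq0) hqD
  have hidx : ∀ j < D, r * D + j < W := fun j hj => idx_lt hrD hj hDW
  have hidx0 : r * D < W := hidx 0 hD0
  have hnn : n ≤ n * n := Nat.le_mul_self n
  refine Tri.of_wp ?_
  simp only [fillRow, Cmd.wp, Cmd.wp_for]
  refine ⟨by simp, by simp, by simp, by simp, ?_⟩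
  simp only [Ex.eval_r, Ex.eval_c, RamState.reg_setArr, hr]
  set s₁ := (s.setArr 20 r 0).setArr 21 r 0 with hs₁
  have a20 : s₁.arr 20 = Function.update (s.arr 20) r 0 := by
    funext z; simp [hs₁, Function.update_apply]
  have a21 : s₁.arr 21 = Function.update (s.arr 21) r 0 := by
    funext z; simp [hs₁, Function.update_apply]
  have ao : ∀ x, x ≠ 20 → x ≠ 21 → s₁.arr x = s.arr x := fun x h1 h2 => by
    funext z; simp [hs₁, h1, h2]
  have r₁ : s₁.reg = s.reg := by simp [hs₁]
  refine Tri.scatter (N := D) (by simp [r₁, hD]) (by decide) (fun j => r * D + j) (fun _ => 0) 6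
    (by intros; omega) ?_ ?_
  · intro j hj h h1 h2
    simp [r₁, hr, hD, hidx0, hidx j hj]
  intro h t₁ hf₁ h1 h2 ht₁
  set s₂ := (s₁.withArr 13 h).setReg 12 D with hs₂
  have e1 : n ^ 2 = n * n := sq n
  have hDn : D ≤ D * n ^ 2 := Nat.le_mul_of_pos_right _ (by positivity)
  have hn2 : n ^ 2 ≤ D * n ^ 2 := Nat.le_mul_of_pos_left _ hD0
  refine ⟨by simp, fun hne => ?_, fun he => ?_⟩
  · have hlt : r < s.reg 25 := by
      by_contra hcon; simp [hs₂, r₁, hr, hcon] at hne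
    refine (fillEntries_spec (s := s₂) (G := G) (L := L) (X := X) (a := a) hnp hnW
      (by simp [hs₂, r₁, hn]) haW hqW hDW (by simp [hs₂, r₁, hq]) (by simp [hs₂, r₁, hq2]) hq0
      (by simp [hs₂, r₁, hD]) hqD (by simp [hs₂, r₁, hr]) hrD
      (by simpa [hs₂, ao] using hX)
      (fun i hi v v' => by simpa [hs₂, ao] using hL i hi v v') (by simpa [hs₂, ao] using hS)
      (by simpa [hs₂, ao] using hbuf hlt)
      (fun j hj => by simpa [hs₂] using h1 j hj)).mono ?_
    rintro s₃ t₃ - hfr ⟨k1, k2, k3⟩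
    refine ⟨?_, ?_, ?_, fun j hj => ?_, fun p hp => ?_⟩
    · simp only [Ex.cost_r, Ex.cost_lt, Ex.cost_c]
      have t4 : 250 * D * n ^ 2 = 250 * (D * n ^ 2) := by ring
      have t5 : 180 * D * n ^ 2 = 180 * (D * n ^ 2) := by ring
      have t6 : 1 ≤ n ^ 2 := Nat.one_le_pow _ _ hnp
      omega
    · rw [hfr.a rfl, ← a20]; simp [hs₂]
    · rw [hfr.a rfl, ← a21]; simp [hs₂]
    · rw [if_pos hlt, k2 j hj]
      simp [hs₂, ao]
    · have e3 : s₂.arr 13 p = h p := by simp [hs₂]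
      rw [k3 p hp, e3, h2 p fun k hk => by omega, ao 13 (by decide) (by decide)]
  · have hlt : ¬ r < s.reg 25 := by
      intro hcon; simp [hs₂, r₁, hr, hcon] at he
    refine ⟨?_, by rw [← a20]; simp [hs₂], by rw [← a21]; simp [hs₂], fun j hj => ?_, fun p hp => ?_⟩
    · simp only [Ex.cost_r, Ex.cost_lt, Ex.cost_c]
      have t4 : 250 * D * n ^ 2 = 250 * (D * n ^ 2) := by ring
      have t6 : 1 ≤ n ^ 2 := Nat.one_le_pow _ _ hnp
      omega
    · rw [if_neg hlt]
      simp [hs₂, h1 j hj]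
    · have e3 : s₂.arr 13 p = h p := by simp [hs₂]
      rw [e3, h2 p fun k hk => by omega, ao 13 (by decide) (by decide)]

theorem fillProg_spec {W a q D : ℕ} {s : RamState} {L X : ℕ → Finset (Fin n)} (hnp : 0 < n)
    (hnW : n * n < W) (hn : s.reg 0 = n) (haW : a * n ≤ W) (hqW : q * n ≤ W)
    (hDW : 2 * D * D ≤ W) (hq : s.reg 3 = q) (hq2 : s.reg 5 = q * q) (hq0 : 0 < q) (hD : s.reg 4 = D)
    (hD2 : s.reg 28 = 2 * D) (hqD : q * q ≤ D)
    (hX : ∀ i < a, ∀ v < n, s.arr 3 (i * n + v) = ind (X i) v)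
    (hL : ∀ i < a, s.HoldsLabels G (i * n) (X i))
    (hS : ∀ i < q, ∀ v < n, s.arr 5 (i * n + v) = ind (L i) v)
    (hbuf : ∀ r < s.reg 25, s.arr 12 r < a) :
    Tri W fillProg s fun s' t => t ≤ 600 * D ^ 2 * n ^ 2 ∧
      s'.HoldsElim D ⟨fun r => if r < s.reg 25 then rowVec G L q (X (s.arr 12 r)) else 0, 0, 0⟩ := by
  have hD0 : 0 < D := lt_of_lt_of_le (Nat.mul_pos hq0 hq0) hqD
  refine Tri.loop (N := 2 * D) hD2 (by decide) rfl rfl (fun i s' =>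
    (∀ r < i, ∀ j < D, s'.arr 13 (r * D + j) =
      (if r < s.reg 25 then rowVec G L q (X (s.arr 12 r)) j else 0).val) ∧
    (∀ r < i, s'.arr 20 r = 0) ∧ ∀ r < i, s'.arr 21 r = 0) (250 * D * n ^ 2) (by simp) ?_ ?_
  · rintro r s' hr hf hr' hfr ⟨h1, h2, h3⟩
    have r25 : s'.reg 25 = s.reg 25 := hfr.r rfl
    have a12 : s'.arr 12 = s.arr 12 := hfr.a rfl
    have a3 : s'.arr 3 = s.arr 3 := hfr.a rfl
    have a5 : s'.arr 5 = s.arr 5 := hfr.a rfl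
    have a8 : s'.arr 8 = s.arr 8 := hfr.a rfl
    refine (fillRow_spec (s := s') (G := G) (L := L) (X := X) (a := a) hnp hnW
      ((hfr.r rfl).trans hn) haW hqW hDW
      ((hfr.r rfl).trans hq) ((hfr.r rfl).trans hq2) hq0 ((hfr.r rfl).trans hD) hqD hr' hr
      (by rw [a3]; exact hX) (fun i hi v v' => by rw [a8]; exact hL i hi v v')
      (by rw [a5]; exact hS) (by rw [r25, a12]; exact hbuf r)).mono ?_
    rintro s₁ t₁ - - ⟨k1, k2, k3, k4, k5⟩
    rw [r25, a12] at k4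
    refine ⟨k1, fun r' hr'' j hj => ?_, fun r' hr'' => ?_, fun r' hr'' => ?_⟩
    · rcases Nat.lt_succ_iff_lt_or_eq.1 hr'' with hr'' | rfl
      · rw [RamState.arr_setReg, k5 _ (idx_lt hr'' hj le_rfl)]
        exact h1 r' hr'' j hj
      · exact k4 j hj
    · rw [RamState.arr_setReg, k2, Function.update_apply]
      split_ifs with hc
      · rfl
      · exact h2 r' (by omega)
    · rw [RamState.arr_setReg, k3, Function.update_apply]
      split_ifs with hc
      · rfl
      · exact h3 r' (by omega)
  · rintro s' t hf hr hfr ⟨h1, h2, h3⟩ ht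
    refine ⟨?_, fun r hr j hj => ?_, fun r hr j hj => ?_, fun r hr => ?_, fun r hr => ?_,
      fun r hr => by simpa using hD0⟩
    · have e1 : 2 * D * (250 * D * n ^ 2 + 8) = 500 * (D ^ 2 * n ^ 2) + 16 * D := by ring
      have e2 : 600 * D ^ 2 * n ^ 2 = 600 * (D ^ 2 * n ^ 2) := by ring
      have e3 : D ≤ D ^ 2 * n ^ 2 := (Nat.le_self_pow (by decide) D).trans
        (Nat.le_mul_of_pos_right _ (by positivity))
      omega
    · rw [h1 r hr j hj]
      by_cases hc : r < s.reg 25 <;> simp [hc]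
    · simp only
      split_ifs
      · simp [rowVec, show ¬ j < q * q by omega]
      · rfl
    · simp [h3 r hr]
    · simp [h2 r hr]

end Fill

/-! ### The sorted buffer -/

/-- `i` is at least as good as `j`. -/
def OptKind.Better (o : OptKind) (wt : ℕ → ℚ) (i j : ℕ) : Prop :=
  match o with
  | .min => wt i ≤ wt j
  | .max => wt j ≤ wt i

theorem OptKind.Better.refl (o : OptKind) (wt : ℕ → ℚ) (i : ℕ) : o.Better wt i i := by
  cases o <;> exact le_refl _

theorem OptKind.Better.trans {o : OptKind} {wt : ℕ → ℚ} {i j k : ℕ} (h : o.Better wt i j)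
    (h' : o.Better wt j k) : o.Better wt i k := by
  cases o
  · exact le_trans (α := ℚ) h h'
  · exact le_trans (α := ℚ) h' h

theorem OptKind.Better.total (o : OptKind) (wt : ℕ → ℚ) (i j : ℕ) :
    o.Better wt i j ∨ o.Better wt j i := by
  cases o
  · exact le_total (wt i) (wt j)
  · exact le_total (wt j) (wt i)

/-- The first `N` values of `f` enumerate `S` without repetition, the best ones first. -/
structure SortedEnum (o : OptKind) (wt : ℕ → ℚ) (f : ℕ → ℕ) (N : ℕ) (S : Finset ℕ) : Prop where
  image : (Finset.range N).image f = S
  card : S.card = N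
  sorted : ∀ i j, i < j → j < N → o.Better wt (f i) (f j)

theorem SortedEnum.notMem_image {o : OptKind} {wt : ℕ → ℚ} {f : ℕ → ℕ} {N r : ℕ} {S : Finset ℕ}
    (hS : SortedEnum o wt f N S) (hr : r < N) : f r ∉ (Finset.range r).image f := fun h => by
  obtain ⟨r', h1, h2⟩ := Finset.mem_image.1 h
  have hi := Finset.injOn_of_card_image_eq (s := Finset.range N) (f := f)
    (by rw [hS.image, hS.card, Finset.card_range])
  have := Finset.mem_range.1 h1
  have := hi (by simp; omega) (by simpa using hr) h2
  omega

/-- Inserts the number in register `26` into the sorted list in array `12`. -/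
def insertStep (o : OptKind) : Cmd :=
  .seq (.wload 0 1 (.r 27)) <| .seq (.wload 1 1 (.l 12 (.r 19))) <|
  .seq (.wle 30 (match o with | .min => 0 | .max => 1) (match o with | .min => 1 | .max => 0)) <|
  .ite (.r 30)
    (.seq (.set 30 (.l 12 (.r 19))) <| .seq (.sto 12 (.r 19) (.r 27)) (.set 27 (.r 30))) .skip

def insertProg (o : OptKind) : Cmd :=
  .seq (.set 27 (.r 26)) <| .seq (.for 19 25 (insertStep o)) <|
  .seq (.sto 12 (.r 25) (.r 27)) (.set 25 (.r 25 + .c 1))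

theorem insertStep_spec {W : ℕ} {o : OptKind} {s : RamState} :
    Tri W (insertStep o) s fun s' t => t ≤ 22 ∧
      (o.Better (s.warr 1) (s.reg 27) (s.arr 12 (s.reg 19)) ∧ s'.reg 27 = s.arr 12 (s.reg 19) ∧
        s'.arr 12 = Function.update (s.arr 12) (s.reg 19) (s.reg 27) ∨
      ¬ o.Better (s.warr 1) (s.reg 27) (s.arr 12 (s.reg 19)) ∧ s'.reg 27 = s.reg 27 ∧
        s'.arr 12 = s.arr 12) := by
  refine Tri.of_wp ?_
  cases o
  all_goals
    simp only [insertStep, Cmd.wp]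
    refine ⟨by simp, by simp, by simp, fun h => ?_, fun h => ?_⟩
    · refine ⟨by simp, by simp, by simp, by simp, by simp, .inl ⟨?_, by simp, ?_⟩⟩
      · simpa [OptKind.Better] using h
      · funext z; simp [Function.update_apply]
    · refine ⟨by simp, .inr ⟨?_, by simp, by simp⟩⟩
      simpa [OptKind.Better] using h

theorem insertProg_spec {W N i : ℕ} {o : OptKind} {s : RamState} {S : Finset ℕ}
    (hN : s.reg 25 = N) (hNW : N + 1 < W) (hi : s.reg 26 = i)
    (hS : SortedEnum o (s.warr 1) (s.arr 12) N S) (hiS : i ∉ S) :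
    Tri W (insertProg o) s fun s' t => t ≤ 30 * N + 30 ∧ s'.reg 25 = N + 1 ∧
      SortedEnum o (s.warr 1) (s'.arr 12) (N + 1) (insert i S) := by
  set wt := s.warr 1 with hwt
  set f := s.arr 12 with hf
  refine Tri.of_wp ?_
  simp only [insertProg, Cmd.wp, Cmd.wp_for]
  refine ⟨by simp, ?_⟩
  refine Tri.loop (N := N) (by simp [hN]) (by decide) rfl rfl (fun p s' =>
    (∀ r, p ≤ r → s'.arr 12 r = f r) ∧
    insert (s'.reg 27) ((Finset.range p).image (s'.arr 12)) = insert i ((Finset.range p).image f) ∧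
    (∀ j k, j < k → k < p → o.Better wt (s'.arr 12 j) (s'.arr 12 k)) ∧
    (∀ j < p, o.Better wt (s'.arr 12 j) (s'.reg 27)) ∧
    (s'.reg 27 = i ∧ (∀ r < p, s'.arr 12 r = f r) ∨
      ∀ r, p ≤ r → r < N → o.Better wt (s'.reg 27) (f r))) 22 ?_ ?_ ?_
  · simp [hi, hf]
  · rintro p s' hp hf' hp' hfr ⟨h1, h2, h3, h4, h5⟩
    have hw1 : s'.warr 1 = wt := (hfr.wa rfl).trans (by simp [hwt])
    refine insertStep_spec.mono ?_
    rintro s₁ t₁ - - ⟨ht, hc⟩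
    rw [hw1, hp', h1 p le_rfl] at hc
    refine ⟨ht, ?_⟩
    simp only [RamState.arr_setReg, RamState.reg_setReg, if_neg (by decide : (27 : ℕ) ≠ 19)]
    rcases hc with ⟨c1, c2, c3⟩ | ⟨c1, c2, c3⟩
    · rw [c2, c3]
      have hlt : ∀ r < p, Function.update (s'.arr 12) p (s'.reg 27) r = s'.arr 12 r := fun r hr =>
        Function.update_of_ne hr.ne _ _
      refine ⟨fun r hr => ?_, ?_, fun j k hjk hk => ?_, fun j hj => ?_,
        .inr fun r hr hr' => hS.sorted p r (by omega) hr'⟩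
      · rw [Function.update_of_ne (by omega), h1 r (by omega)]
      · rw [Finset.range_add_one, Finset.image_insert, Finset.image_insert, Function.update_self,
          Finset.image_congr (g := s'.arr 12) fun r hr => hlt r (Finset.mem_range.1 hr), h2,
          Finset.insert_comm]
      · rw [hlt j (by omega)]
        rcases Nat.lt_succ_iff_lt_or_eq.1 hk with hk | rfl
        · rw [hlt k hk]; exact h3 j k hjk hk
        · rw [Function.update_self]; exact h4 j hjk
      · rcases Nat.lt_succ_iff_lt_or_eq.1 hj with hj | rfl
        · rw [hlt j hj]; exact (h4 j hj).trans c1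
        · rw [Function.update_self]; exact c1
    · rw [c2, c3]
      obtain ⟨g1, g2⟩ : s'.reg 27 = i ∧ ∀ r < p, s'.arr 12 r = f r :=
        h5.resolve_right fun h => c1 (h p le_rfl hp)
      have g3 : ∀ r < p + 1, s'.arr 12 r = f r := fun r hr => by
        rcases Nat.lt_succ_iff_lt_or_eq.1 hr with hr | rfl
        · exact g2 r hr
        · exact h1 r le_rfl
      refine ⟨fun r hr => h1 r (by omega), ?_, fun j k hjk hk => ?_, fun j hj => ?_, .inl ⟨g1, g3⟩⟩
      · rw [g1, Finset.image_congr fun r hr => g3 r (Finset.mem_range.1 hr)]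
      · rw [g3 j (by omega), g3 k hk]; exact hS.sorted j k hjk (by omega)
      · rcases Nat.lt_succ_iff_lt_or_eq.1 hj with hj | rfl
        · exact h4 j hj
        · rw [h1 j le_rfl]; exact (OptKind.Better.total o wt _ _).resolve_left c1
  · rintro s' t hf' h19 hfr ⟨h1, h2, h3, h4, h5⟩ ht
    have r25 : s'.reg 25 = N := (hfr.r rfl).trans (by simp [hN])
    refine ⟨by simp, by simp, by simp [r25]; omega, ?_, by simp [r25], ?_, ?_, ?_⟩
    · simp; omega
    · have hlt : ∀ r < N, (s'.setArr 12 N (s'.reg 27)).arr 12 r = s'.arr 12 r := fun r hr => by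
        simp [hr.ne]
      simp only [Ex.eval_r, r25, RamState.arr_setReg]
      rw [Finset.range_add_one, Finset.image_insert,
        Finset.image_congr (g := s'.arr 12) fun r hr => hlt r (Finset.mem_range.1 hr)]
      simp [h2, hS.image]
    · rw [Finset.card_insert_of_notMem hiS, hS.card]
    · intro j k hjk hk
      have hj : j ≠ N := by omega
      rcases Nat.lt_succ_iff_lt_or_eq.1 hk with hk | rfl
      · simpa [r25, hj, hk.ne] using h3 j k hjk hk
      · simpa [r25, hj] using h4 j hjk

/-! ### Discarding dependent rows -/

/-- Keeps those entries of the list in array `12` whose flag is set. -/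
def compressProg : Cmd :=
  .seq (.set 27 (.c 0)) <|
  .seq (.for 19 25 (.ite (.l 21 (.r 19))
    (.seq (.sto 12 (.r 27) (.l 12 (.r 19))) (.set 27 (.r 27 + .c 1))) .skip)) (.set 25 (.r 27))

theorem compressProg_spec {W N : ℕ} {o : OptKind} {wt : ℕ → ℚ} {s : RamState} {S : Finset ℕ}
    {v : ℕ → ℕ → ZMod 2} {flag : ℕ → ZMod 2} (hN : s.reg 25 = N)
    (hS : SortedEnum o wt (s.arr 12) N S) (hflag : ∀ r < N, s.arr 21 r = (flag r).val)
    (h01 : ∀ r < N, flag r = 0 ∨ flag r = 1)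
    (hdrop : ∀ r < N, flag r = 0 →
      v (s.arr 12 r) ∈ Submodule.span (ZMod 2) ((v ∘ s.arr 12) '' Set.Iio r)) :
    Tri W compressProg s fun s' t => t ≤ 30 * N + 12 ∧ ∃ S' ⊆ S,
      s'.reg 25 = ((Finset.range N).filter fun r => flag r = 1).card ∧
      SortedEnum o wt (s'.arr 12) (s'.reg 25) S' ∧
      ∀ j ∈ S, v j ∈ Submodule.span (ZMod 2) (v '' {i | i ∈ S' ∧ o.Better wt i j}) := by
  set f := s.arr 12 with hf
  have hinj := fun r => hS.notMem_image (r := r)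
  refine Tri.intro fun hW3 hfit => ?_
  have hNW : N < W := by have := hfit.1 25; omega
  refine Tri.of_wp ?_
  simp only [compressProg, Cmd.wp, Cmd.wp_for]
  refine ⟨by simp, ?_⟩
  refine Tri.loop (N := N) (by simp [hN]) (by decide) rfl rfl (fun p s' => s'.reg 27 ≤ p ∧
    (∀ r, p ≤ r → s'.arr 12 r = f r) ∧ ∃ S' ⊆ (Finset.range p).image f,
      s'.reg 27 = ((Finset.range p).filter fun r => flag r = 1).card ∧
      SortedEnum o wt (s'.arr 12) (s'.reg 27) S' ∧
      ∀ j < p, v (f j) ∈ Submodule.span (ZMod 2) (v '' {i | i ∈ S' ∧ o.Better wt i (f j)})) 14 ?_ ?_ ?_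
  · exact ⟨by simp, by simp [hf], ∅, by simp, by simp, ⟨by simp, by simp, by simp⟩, by simp⟩
  · rintro p s' hp hf' hp' hfr ⟨h0, h1, S', hS', hc, hE, hsp⟩
    have a21 : s'.arr 21 p = (flag p).val := by
      rw [hfr.a rfl]; simpa using hflag p hp
    have hsub : (Finset.range p).image f ⊆ (Finset.range (p + 1)).image f :=
      Finset.image_subset_image (by simp)
    refine Tri.of_wp ?_
    simp only [Cmd.wp]
    refine ⟨by simp, fun h => ?_, fun h => ?_⟩
    · have hfl : flag p = 1 := (h01 p hp).resolve_left fun h0 => by simp [hp', a21, h0] at h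
      have hnot : f p ∉ S' := fun h => hinj p hp (hS' h)
      have hlt : ∀ r < s'.reg 27, r ≠ s'.reg 27 := fun r hr => hr.ne
      have hE1 : ∀ r < s'.reg 27, ∃ r' < p, s'.arr 12 r = f r' := fun r hr => by
        have : s'.arr 12 r ∈ S' := by
          rw [← hE.image]; exact Finset.mem_image_of_mem _ (Finset.mem_range.2 hr)
        obtain ⟨r', h1, h2⟩ := Finset.mem_image.1 (hS' this)
        exact ⟨r', Finset.mem_range.1 h1, h2.symm⟩
      refine ⟨by simp, by simp, by simp; omega, by simp, by simp; omega, fun r hr => ?_,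
        insert (f p) S', ?_, ?_, ⟨?_, ?_, ?_⟩, ?_⟩
      · have : r ≠ s'.reg 27 := by omega
        simp [this, h1 r (by omega)]
      · refine Finset.insert_subset ?_ (hS'.trans hsub)
        exact Finset.mem_image_of_mem _ (by simp)
      · rw [Finset.range_add_one, Finset.filter_insert, if_pos hfl, Finset.card_insert_of_notMem
          (by simp), ← hc]
        simp
      · simp only [Ex.eval_add, Ex.eval_r, Ex.eval_c, RamState.reg_setReg, RamState.reg_setArr,
          RamState.arr_setReg, if_neg (by decide : (27 : ℕ) ≠ 19), if_true]
        rw [Finset.range_add_one, Finset.image_insert, Finset.image_congr (g := s'.arr 12)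
          fun r hr => by simp [hlt r (Finset.mem_range.1 hr)], hE.image]
        simp [hp', h1 p le_rfl]
      · rw [Finset.card_insert_of_notMem hnot, hE.card]; simp
      · intro j k hjk hk
        simp at hk
        have hj : j < s'.reg 27 := by omega
        rcases Nat.lt_or_eq_of_le hk with hk | rfl
        · simpa [hlt j hj, hlt k hk] using hE.sorted j k hjk hk
        · obtain ⟨r', h2, h3⟩ := hE1 j hj
          simpa [hlt j hj, hp', h1 p le_rfl, h3] using hS.sorted r' p h2 hp
      · intro j hj
        rcases Nat.lt_succ_iff_lt_or_eq.1 hj with hj | rfl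
        · refine Submodule.span_mono (Set.image_mono ?_) (hsp j hj)
          exact fun i hi => ⟨Finset.mem_insert_of_mem hi.1, hi.2⟩
        · exact Submodule.subset_span ⟨_, ⟨Finset.mem_insert_self _ _, .refl _ _ _⟩, rfl⟩
    · have hfl : flag p = 0 := by
        have : (flag p).val = 0 := by simpa [hp', a21] using h
        exact (ZMod.val_eq_zero _).1 this
      refine ⟨by simp, by simp; omega, fun r hr => by simpa using h1 r (by omega), S',
        hS'.trans hsub, ?_, by simpa using hE, ?_⟩
      · rw [Finset.range_add_one, Finset.filter_insert, if_neg (by simp [hfl]), ← hc]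
        simp
      · intro j hj
        rcases Nat.lt_succ_iff_lt_or_eq.1 hj with hj | rfl
        · exact hsp j hj
        · refine Submodule.span_le.2 ?_ (hdrop j hp hfl)
          rintro _ ⟨r, hr, rfl⟩
          refine Submodule.span_mono (Set.image_mono ?_) (hsp r hr)
          exact fun i hi => ⟨hi.1, hi.2.trans (hS.sorted r j hr hp)⟩
  · rintro s' t hf' h19 hfr ⟨h0, h1, S', hS', hc, hE, hsp⟩ ht
    rw [hS.image] at hS'
    refine ⟨by simp, by simp; omega, S', hS', by simp [hc], by simpa using hE, fun j hj => ?_⟩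
    rw [← hS.image] at hj
    obtain ⟨r, hr, rfl⟩ := Finset.mem_image.1 hj
    exact hsp r (Finset.mem_range.1 hr)

/-! ### Processing one class -/

/-- Everything that is needed to reduce the buffer is in place. -/
structure ReduceCtx {n : ℕ} (W a q J : ℕ) (P : RamProg) (mm : ℕ → ℕ) (G : SimpleGraph (Fin n))
    (L X : ℕ → Finset (Fin n)) (s : RamState) : Prop where
  n_pos : 0 < n
  nn : n * n < W
  an : a * n ≤ W
  qn : q * n ≤ W
  q_pos : 0 < q
  qq : q * q ≤ 2 ^ J
  lt_qq : 2 ^ J < 2 * (q * q)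
  cube : (2 ^ (J + 1)) ^ 3 ≤ W
  mul : MulProg W (2 ^ J) P mm
  r0 : s.reg 0 = n
  r1 : s.reg 1 = a
  r3 : s.reg 3 = q
  r4 : s.reg 4 = 2 ^ J
  r5 : s.reg 5 = q * q
  r28 : s.reg 28 = 2 * 2 ^ J
  tasks : s.HoldsTasks (2 ^ (J + 1)) (elimTasks 0 (J + 1))
  sets : ∀ i < a, ∀ v < n, s.arr 3 (i * n + v) = ind (X i) v
  labels : ∀ i < a, s.HoldsLabels G (i * n) (X i)
  nbhds : ∀ i < q, ∀ v < n, s.arr 5 (i * n + v) = ind (L i) v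

theorem ReduceCtx.of_eq {n W a q J : ℕ} {P : RamProg} {mm : ℕ → ℕ} {G : SimpleGraph (Fin n)}
    {L X : ℕ → Finset (Fin n)} {s s' : RamState} (h : ReduceCtx W a q J P mm G L X s)
    (hr : ∀ x ∈ [0, 1, 3, 4, 5, 28, 29], s'.reg x = s.reg x)
    (ha : ∀ x ∈ [3, 5, 8, 16], s'.arr x = s.arr x) : ReduceCtx W a q J P mm G L X s' :=
  { h with
    r0 := (hr 0 (by decide)).trans h.r0
    r1 := (hr 1 (by decide)).trans h.r1
    r3 := (hr 3 (by decide)).trans h.r3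
    r4 := (hr 4 (by decide)).trans h.r4
    r5 := (hr 5 (by decide)).trans h.r5
    r28 := (hr 28 (by decide)).trans h.r28
    tasks := by
      unfold RamState.HoldsTasks
      rw [hr 29 (by decide), ha 16 (by decide)]; exact h.tasks
    sets := by rw [ha 3 (by decide)]; exact h.sets
    labels i hi v v' := by rw [ha 8 (by decide)]; exact h.labels i hi v v'
    nbhds := by rw [ha 5 (by decide)]; exact h.nbhds }

theorem ReduceCtx.frame {n W a q J : ℕ} {P : RamProg} {mm : ℕ → ℕ} {G : SimpleGraph (Fin n)}
    {L X : ℕ → Finset (Fin n)} {s s' : RamState} {p : Cmd} (h : ReduceCtx W a q J P mm G L X s)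
    (hfr : Frame p s s') (hr : ([0, 1, 3, 4, 5, 28, 29].all fun x => !p.mr x) = true)
    (ha : ([3, 5, 8, 16].all fun x => !p.ma x) = true) : ReduceCtx W a q J P mm G L X s' :=
  h.of_eq (fun x hx => hfr.r (by simpa using List.all_eq_true.1 hr x hx))
    fun x hx => hfr.a (by simpa using List.all_eq_true.1 ha x hx)

/-- Replaces the list in array `12` by a part of it whose rows span the same space. -/
def reduceProg (P : RamProg) : Cmd :=
  .seq (.blk fillProg) <| .seq (.blk (.loopFor 31 29 (taskProg P))) (.blk compressProg)

/-- The time for the elimination. -/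
def elimTime (mm : ℕ → ℕ) (J : ℕ) : ℕ :=
  ((elimTasks 0 (J + 1)).map (ElimTask.cost mm (2 ^ J))).sum

section Reduce
variable {n W a q J : ℕ} {P : RamProg} {mm : ℕ → ℕ} {G : SimpleGraph (Fin n)}
  {L X : ℕ → Finset (Fin n)} {s : RamState} {o : OptKind}

/-- The time for a reduction. -/
def reduceTime (n : ℕ) (mm : ℕ → ℕ) (J : ℕ) : ℕ := 700 * (2 ^ J) ^ 2 * n ^ 2 + elimTime mm J

/-- The best sets in `T` generate the rows of the sets in `S`. -/
def Generates (o : OptKind) (wt : ℕ → ℚ) (v : ℕ → ℕ → ZMod 2) (T S : Finset ℕ) : Prop :=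
  ∀ j ∈ S, v j ∈ Submodule.span (ZMod 2) (v '' {i | i ∈ T ∧ o.Better wt i j})

theorem Generates.refl (o : OptKind) (wt : ℕ → ℚ) (v : ℕ → ℕ → ZMod 2) (S : Finset ℕ) :
    Generates o wt v S S := fun j hj => Submodule.subset_span ⟨j, ⟨hj, .refl _ _ _⟩, rfl⟩

theorem Generates.trans {wt : ℕ → ℚ} {v : ℕ → ℕ → ZMod 2} {S T U : Finset ℕ}
    (h : Generates o wt v U T) (h' : Generates o wt v T S) : Generates o wt v U S := fun j hj => by
  refine Submodule.span_le.2 ?_ (h' j hj)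
  rintro _ ⟨i, hi, rfl⟩
  refine Submodule.span_mono (Set.image_mono ?_) (h i hi.1)
  exact fun k hk => ⟨hk.1, hk.2.trans hi.2⟩

theorem Generates.insert {wt : ℕ → ℚ} {v : ℕ → ℕ → ZMod 2} {S T : Finset ℕ}
    (h : Generates o wt v T S) (i : ℕ) : Generates o wt v (insert i T) (insert i S) := fun j hj => by
  rcases Finset.mem_insert.1 hj with rfl | hj
  · exact Submodule.subset_span ⟨_, ⟨Finset.mem_insert_self _ _, .refl _ _ _⟩, rfl⟩
  · refine Submodule.span_mono (Set.image_mono ?_) (h j hj)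
    exact fun k hk => ⟨Finset.mem_insert_of_mem hk.1, hk.2⟩

theorem reduceProg_spec {N : ℕ} {wt : ℕ → ℚ} {S : Finset ℕ} (hc : ReduceCtx W a q J P mm G L X s)
    (hN : s.reg 25 = N) (hND : N ≤ 2 * 2 ^ J) (hS : SortedEnum o wt (s.arr 12) N S)
    (hSa : ∀ i ∈ S, i < a) :
    Tri W (reduceProg P) s fun s' t => t ≤ reduceTime n mm J ∧ s'.reg 25 ≤ q * q ∧ ∃ S' ⊆ S,
      SortedEnum o wt (s'.arr 12) (s'.reg 25) S' ∧
      Generates o wt (fun i => rowVec G L q (X i)) S' S := by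
  have hmem : ∀ r < N, s.arr 12 r < a := fun r hr => hSa _ (by
    rw [← hS.image]; exact Finset.mem_image_of_mem _ (Finset.mem_range.2 hr))
  have hDW : 2 * 2 ^ J * 2 ^ J ≤ W := by
    refine le_trans ?_ hc.cube
    have : (2 ^ (J + 1)) ^ 3 = 2 * 2 ^ J * 2 ^ J * (4 * 2 ^ J) := by ring
    rw [this]
    exact Nat.le_mul_of_pos_right _ (by positivity)
  refine Tri.of_wp ?_
  simp only [reduceProg, Cmd.wp]
  refine (fillProg_spec hc.n_pos hc.nn hc.r0 hc.an hc.qn hDW hc.r3 hc.r5 hc.q_pos hc.r4 hc.r28 hc.qq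
    hc.sets hc.labels hc.nbhds (by rw [hN]; exact hmem)).mono ?_
  rintro s₁ t₁ - hfr₁ ⟨ht₁, he₁⟩
  have hc₁ := hc.frame hfr₁ rfl rfl
  refine (elimProg_spec hc₁.mul hc₁.cube hc₁.r4 hc₁.r28 hc₁.tasks he₁).mono ?_
  rintro s₂ t₂ - hfr₂ ⟨ht₂, b, hb, hE⟩
  have a12 : s₂.arr 12 = s.arr 12 := (hfr₂.a rfl).trans (hfr₁.a rfl)
  have r25 : s₂.reg 25 = N := (hfr₂.r rfl).trans ((hfr₁.r rfl).trans hN)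
  refine (compressProg_spec (v := fun i => rowVec G L q (X i)) (flag := b.flag) r25
    (by rw [a12]; exact hS) (fun r hr => hb.flag r (by omega))
    (fun r hr => (hE.flag r (by omega) (by omega)).imp id And.left) fun r hr h => ?_).mono ?_
  · have := hE.drop r (by omega) (by omega) h
    simp only [hN, if_pos hr] at this
    rw [a12]
    refine Submodule.span_mono ?_ this
    rintro _ ⟨i, hi, rfl⟩
    have hi' : i < r := hi.2
    exact ⟨i, hi', by simp [if_pos (hi'.trans hr)]⟩
  · rintro s₃ t₃ - - ⟨ht₃, S', hS', h25, hE', hG⟩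
    refine ⟨?_, ?_, S', hS', hE', hG⟩
    · have h1 : 0 < n ^ 2 := pow_pos hc.n_pos 2
      have h2 : 2 ^ J ≤ (2 ^ J) ^ 2 * n ^ 2 :=
        (Nat.le_self_pow (by decide) _).trans (Nat.le_mul_of_pos_right _ h1)
      have h3 : 0 < 2 ^ J := by positivity
      have e1 : 600 * (2 ^ J) ^ 2 * n ^ 2 = 600 * ((2 ^ J) ^ 2 * n ^ 2) := by ring
      have e2 : 700 * (2 ^ J) ^ 2 * n ^ 2 = 700 * ((2 ^ J) ^ 2 * n ^ 2) := by ring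
      rw [reduceTime, elimTime]
      omega
    · rw [h25]
      refine le_trans (Finset.card_le_card (Finset.filter_subset_filter _
        (Finset.range_subset_range.2 hND))) (hE.card_flag_le fun r _ j hj => ?_)
      simp only
      split_ifs
      · simp [rowVec, show ¬ j < q * q by omega]
      · rfl

end Reduce

/-- Adds the set with number `reg 26` to the buffer, if it belongs to class `reg 24`. -/
def feedStep (o : OptKind) (P : RamProg) : Cmd :=
  .ite (.eq (.l 15 (.r 26)) (.r 24 + .c 1))
    (.seq (.blk (insertProg o)) (.ite (.eq (.r 25) (.r 28)) (.blk (reduceProg P)) .skip)) .skip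

/-- Appends the sets in the buffer to the output. -/
def emitProg : Cmd :=
  .loopFor 19 25 <| .seq (.for 12 0 (.sto 4 (.r 2 * .r 0 + .r 12)
    (.l 3 (.l 12 (.r 19) * .r 0 + .r 12)))) (.set 2 (.r 2 + .c 1))

/-- Outputs representatives for class `reg 24`. -/
def classStep (o : OptKind) (P : RamProg) : Cmd :=
  .seq (.set 25 (.c 0)) <| .seq (.for 26 1 (feedStep o P)) <|
  .seq (.ite (.lt (.r 5) (.r 25)) (.blk (reduceProg P)) .skip) (.blk emitProg)

def classesProg (o : OptKind) (P : RamProg) : Cmd :=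
  .seq (.set 2 (.c 0)) (.for 24 17 (classStep o P))

/-- The numbers below `i` of the sets in class `k`. -/
def classMembers (cls : ℕ → ℕ) (k i : ℕ) : Finset ℕ := (Finset.range i).filter fun j => cls j = k + 1

theorem classMembers_succ (cls : ℕ → ℕ) (k i : ℕ) : classMembers cls k (i + 1) =
    if cls i = k + 1 then insert i (classMembers cls k i) else classMembers cls k i := by
  rw [classMembers, Finset.range_add_one, Finset.filter_insert]; rfl

theorem notMem_classMembers (cls : ℕ → ℕ) (k i : ℕ) : i ∉ classMembers cls k i := by
  simp [classMembers]

/-- The output consists of the sets with numbers in `U`. -/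
def RamState.Emitted {n : ℕ} (s : RamState) (X : ℕ → Finset (Fin n)) (U : Finset ℕ) : Prop :=
  s.reg 2 = U.card ∧ ∃ g : ℕ → ℕ, (Finset.range U.card).image g = U ∧
    ∀ r < U.card, ∀ v < n, s.arr 4 (r * n + v) = ind (X (g r)) v

section Classes
variable {n W a q J : ℕ} {P : RamProg} {mm : ℕ → ℕ} {G : SimpleGraph (Fin n)}
  {L X : ℕ → Finset (Fin n)} {s : RamState} {o : OptKind} {k : ℕ}

theorem ReduceCtx.lt (hc : ReduceCtx W a q J P mm G L X s) : 2 * 2 ^ J + 1 < W := by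
  refine lt_of_lt_of_le ?_ hc.cube
  have h1 : 2 ^ (J + 1) = 2 * 2 ^ J := by ring
  have h2 : 0 < 2 ^ J := by positivity
  rw [h1]
  have : (2 * 2 ^ J) ^ 3 = 2 * 2 ^ J * (4 * (2 ^ J * 2 ^ J)) := by ring
  rw [this]
  nlinarith [Nat.mul_le_mul h2 h2]

theorem feedStep_spec {i : ℕ} {S : Finset ℕ} (hc : ReduceCtx W a q J P mm G L X s)
    (h24 : s.reg 24 = k) (hk : k + 1 < W) (h26 : s.reg 26 = i) (hia : i < a) (h25 : s.reg 25 < 2 * 2 ^ J)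
    (hE : SortedEnum o (s.warr 1) (s.arr 12) (s.reg 25) S) (hiS : i ∉ S) (hSa : ∀ j ∈ S, j < a) :
    Tri W (feedStep o P) s fun s' t =>
      (s.arr 15 i ≠ k + 1 ∧ t ≤ 12 ∧ s'.reg 25 = s.reg 25 ∧ s'.arr 12 = s.arr 12) ∨
      (s.arr 15 i = k + 1 ∧ s'.reg 25 < 2 * 2 ^ J ∧ ∃ S' ⊆ insert i S, ∃ e,
        SortedEnum o (s.warr 1) (s'.arr 12) (s'.reg 25) S' ∧
        Generates o (s.warr 1) (fun i => rowVec G L q (X i)) S' (insert i S) ∧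
        2 ^ J * e + s'.reg 25 ≤ s.reg 25 + 1 ∧ t ≤ 60 * 2 ^ J + 60 + e * reduceTime n mm J) := by
  have hW := hc.lt
  refine Tri.of_wp ?_
  simp only [feedStep, Cmd.wp]
  refine ⟨by simp [h24, hk], fun h => ?_, fun h => ?_⟩
  · refine (insertProg_spec rfl (by omega) h26 hE hiS).mono ?_
    rintro s₁ t₁ - hfr₁ ⟨ht₁, h1, hE₁⟩
    have hc₁ : ReduceCtx W a q J P mm G L X s₁ := hc.frame hfr₁ (by cases o <;> rfl) (by cases o <;> rfl)
    refine ⟨by simp, fun h' => ?_, fun h' => ?_⟩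
    · have h3 : s.reg 25 + 1 = 2 * 2 ^ J := by simpa [h1, hc₁.r28] using h'
      refine (reduceProg_spec hc₁ h1 (by omega) hE₁ fun j hj => ?_).mono ?_
      · rcases Finset.mem_insert.1 hj with rfl | hj
        · exact hia
        · exact hSa j hj
      · rintro s₂ t₂ - - ⟨ht₂, hq, S', hS', hE₂, hG⟩
        have := hc.qq
        have hD : 0 < 2 ^ J := by positivity
        exact .inr ⟨by simpa [h26, h24] using h, by omega, S', hS', 1, hE₂, hG, by omega, by simp; omega⟩
    · have h3 : s.reg 25 + 1 ≠ 2 * 2 ^ J := by simpa [h1, hc₁.r28] using h'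
      exact .inr ⟨by simpa [h26, h24] using h, by omega, _, subset_rfl, 0, by rw [h1]; exact hE₁,
        .refl _ _ _ _, by omega, by simp; omega⟩
  · exact .inl ⟨by simpa [h26, h24] using h, by simp⟩

theorem feedLoop_spec (hc : ReduceCtx W a q J P mm G L X s) (h24 : s.reg 24 = k) (hk : k + 1 < W)
    (h25 : s.reg 25 = 0) :
    Tri W (.loopFor 26 1 (feedStep o P)) s fun s' t => s'.reg 25 ≤ 2 * 2 ^ J ∧
      ∃ S ⊆ classMembers (s.arr 15) k a, ∃ rr, SortedEnum o (s.warr 1) (s'.arr 12) (s'.reg 25) S ∧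
      Generates o (s.warr 1) (fun i => rowVec G L q (X i)) S (classMembers (s.arr 15) k a) ∧
      2 ^ J * rr + s'.reg 25 ≤ (classMembers (s.arr 15) k a).card ∧
      t ≤ a * 20 + (classMembers (s.arr 15) k a).card * (60 * 2 ^ J + 70) + rr * reduceTime n mm J + 6 := by
  set M := classMembers (s.arr 15) k with hM
  set R := reduceTime n mm J with hR
  have hD0 : 0 < 2 ^ J := by positivity
  refine Tri.loop_time hc.r1 (by decide) (by cases o <;> rfl) (by cases o <;> rfl) (fun i s' t =>
    s'.reg 25 < 2 * 2 ^ J ∧ ∃ S ⊆ M i, ∃ rr, SortedEnum o (s.warr 1) (s'.arr 12) (s'.reg 25) S ∧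
      Generates o (s.warr 1) (fun i => rowVec G L q (X i)) S (M i) ∧
      2 ^ J * rr + s'.reg 25 ≤ (M i).card ∧
      t ≤ i * 20 + (M i).card * (60 * 2 ^ J + 70) + rr * R) ?_ ?_ ?_
  · refine ⟨by simp [h25], ∅, by simp, 0, ⟨by simp [h25], by simp [h25], by simp [h25]⟩, ?_,
      by simp [h25], by simp⟩
    intro j hj
    simp [M, classMembers] at hj
  · rintro i s' t hi hf hi' hfr ⟨h1, S, hS, rr, hE, hG, hrr, ht⟩
    have hc' : ReduceCtx W a q J P mm G L X s' := hc.frame hfr rfl rfl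
    have r24 : s'.reg 24 = k := (hfr.r rfl).trans h24
    have a15 : s'.arr 15 = s.arr 15 := hfr.a rfl
    have w1 : s'.warr 1 = s.warr 1 := hfr.wa rfl
    have hMa : ∀ j ∈ M i, j < i := fun j hj => Finset.mem_range.1 (Finset.mem_filter.1 hj).1
    refine (feedStep_spec (S := S) hc' r24 hk hi' hi h1 (by rw [w1]; exact hE)
      (fun h => notMem_classMembers _ _ _ (hS h)) fun j hj => (hMa j (hS hj)).trans hi).mono ?_
    rintro s₁ t₁ - - hpost
    simp only [RamState.arr_setReg, RamState.reg_setReg, if_neg (by decide : (25 : ℕ) ≠ 26)]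
    rw [a15, w1, ← hR] at hpost
    have hMs : M (i + 1) = if s.arr 15 i = k + 1 then insert i (M i) else M i :=
      classMembers_succ _ _ _
    rcases hpost with ⟨c1, c2, c3, c4⟩ | ⟨c1, c2, S', hS', e, c3, c4, c5, c6⟩
    · rw [if_neg c1] at hMs
      rw [hMs, c3, c4]
      exact ⟨h1, S, hS, rr, hE, hG, hrr, by omega⟩
    · rw [if_pos c1] at hMs
      have hcard : (M (i + 1)).card = (M i).card + 1 := by
        rw [hMs, Finset.card_insert_of_notMem (notMem_classMembers _ _ _)]
      rw [hcard, hMs]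
      refine ⟨c2, S', hS'.trans (Finset.insert_subset_insert _ hS), rr + e, c3,
        c4.trans (hG.insert i), by rw [Nat.mul_add]; omega, ?_⟩
      have e1 := Nat.add_mul (M i).card 1 (60 * 2 ^ J + 70)
      have e2 := Nat.add_mul rr e R
      omega
  · rintro s' t hf h26 hfr ⟨h1, S, hS, rr, hE, hG, hrr, ht⟩
    exact ⟨h1.le, S, hS, rr, hE, hG, hrr, by omega⟩

theorem emitProg_spec {N : ℕ} {S U : Finset ℕ} {wt : ℕ → ℚ}
    (hc : ReduceCtx W a q J P mm G L X s) (hN : s.reg 25 = N) (hE : SortedEnum o wt (s.arr 12) N S)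
    (hU : s.Emitted X U) (hUS : Disjoint U S) (hUa : ∀ i ∈ U, i < a) (hSa : ∀ i ∈ S, i < a) :
    Tri W emitProg s fun s' t => t ≤ N * (40 * n + 30) + 6 ∧ s'.Emitted X (U ∪ S) := by
  set f := s.arr 12 with hf
  have hmem : ∀ p < N, f p ∈ S := fun p hp => by
    rw [← hE.image]; exact Finset.mem_image_of_mem _ (Finset.mem_range.2 hp)
  have hinj := fun r => hE.notMem_image (r := r)
  refine Tri.loop hN (by decide) rfl rfl (fun p s' => s'.Emitted X (U ∪ (Finset.range p).image f))
    (40 * n + 22) ?_ ?_ ?_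
  · simpa [RamState.Emitted] using hU
  · rintro p s' hp hfit hp' hfr ⟨h2, g, hg, hout⟩
    have hc' : ReduceCtx W a q J P mm G L X s' := hc.frame hfr rfl rfl
    have a12 : s'.arr 12 = f := hfr.a rfl
    set V := U ∪ (Finset.range p).image f with hV
    have hfp : f p ∉ V := fun h => by
      rcases Finset.mem_union.1 h with h | h
      · exact Finset.disjoint_left.1 hUS h (hmem p hp)
      · exact hinj p hp h
    have hVa : ∀ i ∈ insert (f p) V, i < a := fun i hi => by
      rcases Finset.mem_insert.1 hi with rfl | hi
      · exact hSa _ (hmem p hp)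
      rcases Finset.mem_union.1 hi with hi | hi
      · exact hUa i hi
      · obtain ⟨r, hr, rfl⟩ := Finset.mem_image.1 hi
        exact hSa _ (hmem r ((Finset.mem_range.1 hr).trans hp))
    have hVc : V.card + 1 ≤ a := by
      rw [← Finset.card_insert_of_notMem hfp, ← Finset.card_range a]
      exact Finset.card_le_card fun i hi => Finset.mem_range.2 (hVa i hi)
    have hfa : f p < a := hVa _ (Finset.mem_insert_self _ _)
    have haW := hc.an
    have hn := hc.n_pos
    have haW' : a < W := hc'.r1 ▸ hfit.1 1
    have hnn := hc.nn
    have hnW : n < W := lt_of_le_of_lt (Nat.le_mul_self n) hnn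
    have hidx : ∀ c < a, ∀ v < n, c * n + v < W := fun c hcl v hv => idx_lt hcl hv haW
    refine Tri.of_wp ?_
    simp only [Cmd.wp, Cmd.wp_for]
    refine Tri.scatter (N := n) hc'.r0 (by decide) (fun v => V.card * n + v)
      (fun v => ind (X (f p)) v) 30 (fun i _ j hj => by omega) ?_ ?_
    · intro i hi h _ _
      have h1 := hidx V.card (by omega) i hi
      have h3 := hidx (f p) hfa i hi
      have h4 := hidx V.card (by omega) 0 hn
      have h5 := hidx (f p) hfa 0 hn
      refine ⟨?_, ?_, ?_, ?_, ?_⟩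
      · simp [h2, hc'.r0]; omega
      · simp [a12, hp', hc'.r0]; omega
      · simp [h2, hc'.r0]
      · simp [a12, hp', hc'.r0, hc'.sets _ hfa i hi]
      · simp
    · intro h t hfit' hh ho ht
      refine ⟨by simp [h2]; omega, by simp; omega, ?_⟩
      have hVs : U ∪ (Finset.range (p + 1)).image f = insert (f p) V := by
        rw [Finset.range_add_one, Finset.image_insert, Finset.union_insert]
      rw [hVs]
      refine ⟨by simp [h2, Finset.card_insert_of_notMem hfp], Function.update g V.card (f p), ?_, ?_⟩
      · rw [Finset.card_insert_of_notMem hfp, Finset.range_add_one, Finset.image_insert,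
          Function.update_self, Finset.image_congr (g := g) fun r hr =>
            Function.update_of_ne (Finset.mem_range.1 hr).ne _ _, hg]
      · intro r hr v hv
        rw [Finset.card_insert_of_notMem hfp] at hr
        simp only [RamState.arr_setReg, RamState.arr_withArr, if_true]
        rcases Nat.lt_succ_iff_lt_or_eq.1 hr with hr | rfl
        · rw [Function.update_of_ne hr.ne, ho _ fun j hj h => ?_, hout r hr v hv]
          exact hr.ne (idx_inj hv hj h).1
        · rw [Function.update_self]; exact hh v hv
  · rintro s' t - - - h ht
    rw [hE.image] at h
    exact ⟨by omega, h⟩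

theorem classStep_spec {U : Finset ℕ} (hc : ReduceCtx W a q J P mm G L X s) (h24 : s.reg 24 = k)
    (hk : k + 1 < W) (hU : s.Emitted X U) (hUa : ∀ i ∈ U, i < a ∧ s.arr 15 i ≤ k) :
    Tri W (classStep o P) s fun s' t => ∃ S ⊆ classMembers (s.arr 15) k a, ∃ rr,
      s'.Emitted X (U ∪ S) ∧ S.card ≤ q * q ∧
      Generates o (s.warr 1) (fun i => rowVec G L q (X i)) S (classMembers (s.arr 15) k a) ∧
      2 ^ J * rr ≤ 2 * (classMembers (s.arr 15) k a).card ∧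
      t ≤ a * 20 + (classMembers (s.arr 15) k a).card * (60 * 2 ^ J + 40 * n + 100) +
        rr * reduceTime n mm J + 30 := by
  set M := classMembers (s.arr 15) k a with hM
  have hMa : ∀ i ∈ M, i < a ∧ s.arr 15 i = k + 1 := fun i hi => by
    simpa [M, classMembers] using hi
  have hdis : ∀ S ⊆ M, Disjoint U S := fun S hS => Finset.disjoint_left.2 fun i h h' => by
    have h1 := (hUa i h).2
    have h2 := (hMa i (hS h')).2
    omega
  refine Tri.of_wp ?_
  simp only [classStep, Cmd.wp, Cmd.wp_for]
  refine ⟨by simp, ?_⟩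
  have hc₀ : ReduceCtx W a q J P mm G L X (s.setReg 25 0) :=
    hc.of_eq (fun x hx => by simp; rintro rfl; simp at hx) fun x _ => by simp
  refine (feedLoop_spec (o := o) hc₀ (k := k) (by simp [h24]) hk (by simp)).mono ?_
  simp only [RamState.arr_setReg, RamState.warr_setReg, ← hM]
  rintro s₁ t₁ - hfr₁ ⟨hle, S, hS, rr, hE, hG, hrr, ht₁⟩
  have hc₁ : ReduceCtx W a q J P mm G L X s₁ := hc₀.frame hfr₁ rfl rfl
  have r2 : s₁.reg 2 = s.reg 2 := (hfr₁.r rfl).trans (by simp)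
  have a4 : s₁.arr 4 = s.arr 4 := (hfr₁.a rfl).trans (by simp)
  have hfin : ∀ {s₂ : RamState} {S' : Finset ℕ} {rr' N t : ℕ}, ReduceCtx W a q J P mm G L X s₂ →
      s₂.reg 25 = N → N ≤ q * q → s₂.reg 2 = s.reg 2 → s₂.arr 4 = s.arr 4 → S' ⊆ M →
      SortedEnum o (s.warr 1) (s₂.arr 12) N S' →
      Generates o (s.warr 1) (fun i => rowVec G L q (X i)) S' M → 2 ^ J * rr' ≤ 2 * M.card →
      t ≤ a * 20 + M.card * (60 * 2 ^ J + 70) + rr' * reduceTime n mm J + 24 →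
      Tri W emitProg s₂ fun s' t' => ∃ S ⊆ M, ∃ rr, s'.Emitted X (U ∪ S) ∧ S.card ≤ q * q ∧
      Generates o (s.warr 1) (fun i => rowVec G L q (X i)) S M ∧ 2 ^ J * rr ≤ 2 * M.card ∧
      t + t' ≤ a * 20 + M.card * (60 * 2 ^ J + 40 * n + 100) + rr * reduceTime n mm J + 30 := by
    intro s₂ S' rr' N t hc₂ h25 hN h2 h4 hS' hE' hG' hrr' ht
    refine (emitProg_spec (U := U) hc₂ h25 hE' ?_ (hdis S' hS') (fun i hi => (hUa i hi).1)
      fun i hi => (hMa i (hS' hi)).1).mono ?_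
    · unfold RamState.Emitted; rw [h2, h4]; exact hU
    · rintro s₃ t₃ - - ⟨ht₃, hem⟩
      refine ⟨S', hS', rr', hem, by rw [hE'.card]; exact hN, hG', hrr', ?_⟩
      have e1 : N * (40 * n + 30) ≤ M.card * (40 * n + 30) :=
        Nat.mul_le_mul_right _ (by rw [← hE'.card]; exact Finset.card_le_card hS')
      have e2 : M.card * (60 * 2 ^ J + 40 * n + 100) =
        M.card * (60 * 2 ^ J + 70) + M.card * (40 * n + 30) := by ring
      omega
  refine ⟨by simp, fun h => ?_, fun h => ?_⟩
  · have h1 : q * q < s₁.reg 25 := by simpa [hc₁.r5] using h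
    refine (reduceProg_spec (o := o) hc₁ rfl hle hE fun i hi => (hMa i (hS hi)).1).mono ?_
    rintro s₂ t₂ - hfr₂ ⟨ht₂, hq, S', hS', hE₂, hG₂⟩
    have hc₂ : ReduceCtx W a q J P mm G L X s₂ := hc₁.frame hfr₂ rfl rfl
    refine (hfin hc₂ rfl hq ((hfr₂.r rfl).trans r2) ((hfr₂.a rfl).trans a4) (hS'.trans hS) hE₂
      (hG₂.trans hG) (rr' := rr + 1) ?_ ?_ (t := (Ex.c 0).cost s + 1 + (t₁ +
        ((Ex.lt (.r 5) (.r 25)).cost s₁ + 1 + t₂)))).mono ?_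
    · have := hc.lt_qq
      rw [Nat.mul_add, mul_one]
      omega
    · rw [Nat.add_mul]; simp; omega
    · rintro s₃ t₃ - - ⟨S, h1, rr, h2, h3, h4, h5, h6⟩
      exact ⟨S, h1, rr, h2, h3, h4, h5, by omega⟩
  · have h1 : s₁.reg 25 ≤ q * q := by simpa [hc₁.r5] using h
    refine (hfin hc₁ rfl h1 r2 a4 hS hE hG (rr' := rr) (by omega) ?_ (t := (Ex.c 0).cost s + 1 + (t₁ +
        ((Ex.lt (.r 5) (.r 25)).cost s₁ + 1 + 1)))).mono ?_
    · simp; omega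
    · rintro s₃ t₃ - - ⟨S, h1, rr, h2, h3, h4, h5, h6⟩
      exact ⟨S, h1, rr, h2, h3, h4, h5, by omega⟩

theorem classesProg_spec {m : ℕ} (hc : ReduceCtx W a q J P mm G L X s) (hm : s.reg 17 = m)
    (hcls : ∀ i < a, s.arr 15 i ≤ m) :
    Tri W (classesProg o P) s fun s' t => ∃ U rr, s'.Emitted X U ∧ (∀ i ∈ U, i < a) ∧
      U.card ≤ m * (q * q) ∧ (∀ j < a, s.arr 15 j ≠ 0 → rowVec G L q (X j) ∈
        Submodule.span (ZMod 2) ((fun i => rowVec G L q (X i)) ''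
          {i | i ∈ U ∧ s.arr 15 i = s.arr 15 j ∧ o.Better (s.warr 1) i j})) ∧
      2 ^ J * rr ≤ 2 * a ∧
      t ≤ m * (a * 20 + 40) + a * (60 * 2 ^ J + 40 * n + 100) + rr * reduceTime n mm J + 10 := by
  refine Tri.intro fun _ hfit => ?_
  have hmW : m < W := hm ▸ hfit.1 17
  set K := 60 * 2 ^ J + 40 * n + 100 with hK
  set R := reduceTime n mm J with hR
  set F : ℕ → Finset ℕ := fun k => (Finset.range a).filter fun j => s.arr 15 j ≠ 0 ∧ s.arr 15 j ≤ k
    with hF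
  have hFs : ∀ k, (F (k + 1)).card = (F k).card + (classMembers (s.arr 15) k a).card := fun k => by
    have h1 : F (k + 1) = F k ∪ classMembers (s.arr 15) k a := by
      ext j; simp only [hF, classMembers, Finset.mem_filter, Finset.mem_union, ← and_or_left]
      exact and_congr_right fun _ => by omega
    rw [h1, Finset.card_union_of_disjoint]
    refine Finset.disjoint_left.2 fun j h h' => ?_
    simp only [hF, classMembers, Finset.mem_filter] at h h'
    omega
  refine Tri.of_wp ?_
  simp only [classesProg, Cmd.wp, Cmd.wp_for]
  refine ⟨by simp, ?_⟩
  have hc₀ : ReduceCtx W a q J P mm G L X (s.setReg 2 0) :=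
    hc.of_eq (fun x hx => by simp; rintro rfl; simp at hx) fun x _ => by simp
  refine Tri.loop_time (N := m) (by simp [hm]) (by decide) (by cases o <;> rfl) (by cases o <;> rfl)
    (fun k s' t => ∃ U rr, s'.Emitted X U ∧ (∀ i ∈ U, i < a ∧ s.arr 15 i ≤ k) ∧
      U.card ≤ k * (q * q) ∧ (∀ j < a, s.arr 15 j ≠ 0 → s.arr 15 j ≤ k → rowVec G L q (X j) ∈
        Submodule.span (ZMod 2) ((fun i => rowVec G L q (X i)) ''
          {i | i ∈ U ∧ s.arr 15 i = s.arr 15 j ∧ o.Better (s.warr 1) i j})) ∧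
      2 ^ J * rr ≤ 2 * (F k).card ∧ t ≤ k * (a * 20 + 40) + (F k).card * K + rr * R) ?_ ?_ ?_
  · refine ⟨∅, 0, ⟨by simp, id, by simp, by simp⟩, by simp, by simp, fun j _ h h' => ?_, by simp,
      by simp⟩
    omega
  · rintro k s' t hk hf h24 hfr ⟨U, rr, hem, hUa, hUc, hgen, hrr, ht⟩
    have hc' : ReduceCtx W a q J P mm G L X s' := hc₀.frame hfr rfl rfl
    have a15 : s'.arr 15 = s.arr 15 := (hfr.a rfl).trans (by simp)
    have w1 : s'.warr 1 = s.warr 1 := (hfr.wa rfl).trans (by simp)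
    refine (classStep_spec (o := o) hc' h24 (by omega) hem (by rw [a15]; exact hUa)).mono ?_
    rw [a15, w1, ← hR, ← hK]
    rintro s₁ t₁ - - ⟨S, hS, rr', hem', hSc, hG, hrr', ht₁⟩
    have hSm : ∀ i ∈ S, i < a ∧ s.arr 15 i = k + 1 := fun i hi => by
      simpa [classMembers] using hS hi
    refine ⟨U ∪ S, rr + rr', ?_, fun i hi => ?_, ?_, fun j hj h0 hjk => ?_, ?_, ?_⟩
    · simpa [RamState.Emitted] using hem'
    · rcases Finset.mem_union.1 hi with hi | hi
      · exact ⟨(hUa i hi).1, by have := (hUa i hi).2; omega⟩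
      · exact ⟨(hSm i hi).1, (hSm i hi).2.le⟩
    · refine (Finset.card_union_le _ _).trans ?_
      rw [Nat.add_mul]; omega
    · rcases Nat.lt_succ_iff_lt_or_eq.1 (Nat.lt_succ_of_le hjk) with hjk | hjk
      · refine Submodule.span_mono (Set.image_mono ?_) (hgen j hj h0 (by omega))
        exact fun i hi => ⟨Finset.mem_union_left _ hi.1, hi.2⟩
      · refine Submodule.span_mono (Set.image_mono ?_) (hG j (by simp [classMembers, hj, hjk]))
        exact fun i hi => ⟨Finset.mem_union_right _ hi.1, by rw [(hSm i hi.1).2, hjk], hi.2⟩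
    · rw [hFs, Nat.mul_add]; omega
    · have e1 := Nat.add_mul k 1 (a * 20 + 40)
      have e2 := Nat.add_mul (F k).card (classMembers (s.arr 15) k a).card K
      have e3 := Nat.add_mul rr rr' R
      rw [hFs]; omega
  · rintro s' t - - - ⟨U, rr, hem, hUa, hUc, hgen, hrr, ht⟩
    have hFa : (F m).card ≤ a := by simpa using Finset.card_filter_le (Finset.range a) _
    have := Nat.mul_le_mul_right K hFa
    exact ⟨U, rr, hem, fun i hi => (hUa i hi).1, hUc, fun j hj h0 => hgen j hj h0 (hcls j hj),
      by omega, by simp; omega⟩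

end Classes

/-! ### The reduction -/

/-- Computes `reg 14`, when it is needed. -/
def mimProg : WidthParam → Cmd
  | .mim => goodProg peelProg
  | _ => .skip

/-- The reduction, with the subroutine `P` for multiplying matrices. -/
def reductionProg (f : WidthParam) (o : OptKind) (P : RamProg) : Cmd :=
  .seq (.blk necProg) <| .seq (.blk (mimProg f)) <| .seq (.blk dimProg) <| .seq (.blk codesProg) <|
  .seq (.blk (classifyProg f)) (.blk (classesProg o P))

section Main
variable {n : ℕ} {G : SimpleGraph (Fin n)} [DecidableRel G.Adj] {A R' : Finset (Fin n)}
  {s : RamState} {W : ℕ}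

theorem mimProg_spec {f : WidthParam} {N : ℕ} (hnp : 0 < n) (hG : s.HoldsGraph G)
    (hA : s.HoldsSet 1 A) (hn2 : n * n ≤ W) (hN : n ≤ N) (hNW : (N + 2) * (n + 1) ≤ W)
    (hg : f = .mim → (goods G A).card * n ≤ N) :
    Tri W (mimProg f) s fun s' t => t ≤ 800 * (N * n ^ 2) ∧
      (f = .mim → s'.reg 14 = (goods G A).sup Finset.card) := by
  have hpos : 0 < N * n ^ 2 := Nat.mul_pos (by omega) (by positivity)
  have hskip : f ≠ .mim → Tri W .skip s fun s' t => t ≤ 800 * (N * n ^ 2) ∧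
      (f = .mim → s'.reg 14 = (goods G A).sup Finset.card) := fun h =>
    Tri.of_wp ⟨by omega, fun h' => absurd h' h⟩
  cases f with
  | mim =>
    have h1 := hg rfl
    refine (goodProg_spec (by nlinarith) hG hA hn2 hnp).mono ?_
    rintro s' t - - ⟨h2, h3⟩
    refine ⟨h2.trans ?_, fun _ => h3⟩
    calc 400 * n ^ 3 * ((goods G A).card + 1) = 400 * (((goods G A).card * n + n) * n ^ 2) := by ring
      _ ≤ 400 * ((N + N) * n ^ 2) := by gcongr
      _ = 800 * (N * n ^ 2) := by ring
  | _ => exact hskip (by simp)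

open Classical in
theorem reductionProg_spec {f : WidthParam} {o : OptKind} {P : RamProg} {mm : ℕ → ℕ} {N a q : ℕ}
    {w : Fin n → ℚ} {X : ℕ → Finset (Fin n)} (hnp : 0 < n) (hn2 : 6 * (n * n) < W)
    (hNW : (N + 2) * (n + 1) ≤ W) (haW : a * n ≤ W) (hqn : (q + 2) * n ≤ W) (hqW : 4 * (q * q) < W)
    (hJ : ∀ J, 2 ^ J < 2 * (q * q) →
      (2 ^ (J + 1)) ^ 3 ≤ W ∧ 6 * 2 ^ (J + 1) < W ∧ MulProg W (2 ^ J) P mm)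
    (hq : (nbhds G A).card = q) (hN : n ≤ N) (hg : f = .mim → (goods G A).card * n ≤ N)
    (hG : s.HoldsGraph G) (hA : s.HoldsSet 1 A) (hR : s.HoldsSet 2 R')
    (hw : s.HoldsWeights w) (ha : s.reg 1 = a)
    (hX : ∀ j < a, ∀ v < n, s.arr 3 (j * n + v) = ind (X j) v) (hXA : ∀ j < a, X j ⊆ A)
    (hB : ∀ F : Finset (Finset (Fin n)), (∀ X ∈ F, X ⊆ A ∧ Viable G A f R' X) →
      (F.image (sigRow G A R')).card ≤ N) :
    Tri W (reductionProg f o P) s fun s' t => ∃ U L J rr, 0 < q ∧ 2 ^ J < 2 * (q * q) ∧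
      (Finset.range q).image L = nbhds G A ∧ L 0 = ∅ ∧
      s'.Emitted X U ∧ (∀ i ∈ U, i < a) ∧ U.card ≤ N * (q * q) ∧
      (∀ j < a, Viable G A f R' (X j) → rowVec G L q (X j) ∈
        Submodule.span (ZMod 2) ((fun i => rowVec G L q (X i)) ''
          {i | i ∈ U ∧ SameSig G A R' (X j) (X i) ∧ Light G (X i) ∧
            o.Better (fun i => ∑ v ∈ X i, w v) i j})) ∧
      2 ^ J * rr ≤ 2 * a ∧
      t ≤ 200 * n ^ 2 * (q + 1) ^ 2 + 800 * (N * n ^ 2) + (10 * (q * q) + 20) + 800 * 2 ^ J +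
        (a + 1) * (2100 * n ^ 3 + 100 * (N * n)) + (N * (a * 20 + 40) +
        a * (60 * 2 ^ J + 40 * n + 100) + rr * reduceTime n mm J + 10) := by
  refine Tri.of_wp ?_
  simp only [reductionProg, Cmd.wp]
  refine (necProg_spec (by rw [hq]; exact hqn) hG hA (by omega) hnp).mono ?_
  rw [hq]
  rintro s₁ t₁ - fr₁ ⟨ht₁, h3₁, L, hL₁, hL0⟩
  have hq0 : 0 < q := by
    rw [← hq, Finset.card_pos]
    exact ⟨_, Finset.mem_image_of_mem _ (Finset.empty_mem_powerset _)⟩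
  have hG₁ : s₁.HoldsGraph G := HoldsGraph_of_eq hG (fr₁.r rfl) (fr₁.a rfl)
  have hA₁ : s₁.HoldsSet 1 A := HoldsSet_of_eq hA (fr₁.a rfl)
  refine (mimProg_spec hnp hG₁ hA₁ (by omega) hN hNW hg).mono ?_
  rintro s₂ t₂ - fr₂ ⟨ht₂, h14₂⟩
  refine (dimProg_spec (q := q) ((fr₂.r (by cases f <;> rfl)).trans h3₁) hq0 hqW).mono ?_
  rintro s₃ t₃ - fr₃ ⟨ht₃, h5₃, J, h4₃, h28₃, hqJ, hJq⟩
  obtain ⟨hJ1, hJ2, hJ3⟩ := hJ J hJq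
  refine (codesProg_spec (K := J + 1) (by rw [h28₃]; ring) hJ1 hJ2).mono ?_
  rintro s₄ t₄ - fr₄ ⟨ht₄, hT₄⟩
  have r0 : s₄.reg 0 = s.reg 0 := (fr₄.r rfl).trans ((fr₃.r rfl).trans ((fr₂.r (by cases f <;> rfl)).trans
    (fr₁.r rfl)))
  have r1 : s₄.reg 1 = s.reg 1 := (fr₄.r rfl).trans ((fr₃.r rfl).trans ((fr₂.r (by cases f <;> rfl)).trans
    (fr₁.r rfl)))
  have har : ∀ x < 4, s₄.arr x = s.arr x := fun x hx => by
    interval_cases x <;> exact (fr₄.a rfl).trans ((fr₃.a rfl).trans ((fr₂.a (by cases f <;> rfl)).trans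
      (fr₁.a rfl)))
  have hw0 : s₄.warr 0 = s.warr 0 := (fr₄.wa rfl).trans ((fr₃.wa rfl).trans
    ((fr₂.wa (by cases f <;> rfl)).trans (fr₁.wa rfl)))
  refine (classifyProg_spec (B := N) (w := w) (a := a) (X := X) (A := A) (R' := R') (f := f) hnp hn2 haW
    hNW (HoldsGraph_of_eq hG r0 (har 0 (by decide))) (HoldsSet_of_eq hA (har 1 (by decide)))
    (HoldsSet_of_eq hR (har 2 (by decide))) (fun v => by rw [hw0]; exact hw v) (r1.trans ha)
    (by rw [har 3 (by decide)]; exact hX) hXA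
    (fun h => (fr₄.r rfl).trans ((fr₃.r rfl).trans (h14₂ h))) hB).mono ?_
  rintro s₅ t₅ - fr₅ ⟨ht₅, m, h17, hC⟩
  have g5 : ∀ x ∈ [0, 1, 3, 4, 5, 28, 29], s₅.reg x = s₄.reg x := fun x hx => fr₅.r (by
    fin_cases hx <;> cases f <;> rfl)
  have g5a : ∀ x ∈ [3, 5, 16], s₅.arr x = s₄.arr x := fun x hx => fr₅.a (by
    fin_cases hx <;> cases f <;> rfl)
  have hm : m ≤ N := hC.le hXA hB
  have hctx : ReduceCtx W a q J P mm G L X s₅ :=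
    { n_pos := hnp
      nn := by omega
      an := haW
      qn := le_trans (Nat.mul_le_mul_right _ (by omega)) hqn
      q_pos := hq0
      qq := hqJ
      lt_qq := hJq
      cube := hJ1
      mul := hJ3
      r0 := (g5 _ (by decide)).trans (r0.trans hG.1)
      r1 := (g5 _ (by decide)).trans (r1.trans ha)
      r3 := (g5 _ (by decide)).trans ((fr₄.r rfl).trans ((fr₃.r rfl).trans
        ((fr₂.r (by cases f <;> rfl)).trans h3₁)))
      r4 := (g5 _ (by decide)).trans ((fr₄.r rfl).trans h4₃)
      r5 := (g5 _ (by decide)).trans ((fr₄.r rfl).trans h5₃)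
      r28 := (g5 _ (by decide)).trans ((fr₄.r rfl).trans h28₃)
      tasks := by
        unfold RamState.HoldsTasks
        rw [g5 _ (by decide), g5a _ (by decide)]; exact hT₄
      sets := by rw [g5a _ (by decide), har _ (by decide)]; exact hX
      labels := hC.labels
      nbhds := by
        have : s₅.arr 5 = s₁.arr 5 := (g5a _ (by decide)).trans ((fr₄.a rfl).trans ((fr₃.a rfl).trans
          (fr₂.a (by cases f <;> rfl))))
        rw [this]; exact hL₁.holds }
  have hcls : ∀ i < a, s₅.arr 15 i ≤ m := fun i hi => by
    rcases hC.cls i hi with h | ⟨c, hc, h, -⟩ <;> omega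
  refine (classesProg_spec (o := o) hctx h17 hcls).mono ?_
  rintro s₆ t₆ - - ⟨U, rr, hem, hUa, hUc, hgen, hrr, ht₆⟩
  refine ⟨U, L, J, rr, hq0, hJq, hL₁.img, hL0, hem, hUa, hUc.trans (Nat.mul_le_mul_right _ hm),
    fun j hj hv => ?_, hrr, ?_⟩
  · have h0 : ∀ i < a, s₅.arr 15 i ≠ 0 → Viable G A f R' (X i) := fun i hi h => by
      rcases hC.cls i hi with h1 | ⟨c, -, -, h1, -⟩
      · exact absurd h1.1 h
      · exact h1
    have hj0 : s₅.arr 15 j ≠ 0 := by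
      rcases hC.cls j hj with h1 | ⟨c, -, h1, -⟩
      · exact absurd hv h1.2
      · omega
    refine Submodule.span_mono (Set.image_mono ?_) (hgen j hj hj0)
    rintro i ⟨hi, hc, hb⟩
    obtain ⟨c, hc'⟩ := Nat.exists_eq_succ_of_ne_zero hj0
    refine ⟨hi, hC.sameSig hj (hUa i hi) hc' (hc.trans hc'), (h0 i (hUa i hi) (by omega)).1, ?_⟩
    cases o
    · exact (hC.weight i (hUa i hi)).symm.trans_le (hb.trans_eq (hC.weight j hj))
    · exact (hC.weight j hj).symm.trans_le (hb.trans_eq (hC.weight i (hUa i hi)))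
  · have e1 := Nat.mul_le_mul_right (a * 20 + 40) hm
    have e2 : 2 ^ (J + 1) = 2 * 2 ^ J := by ring
    omega

end Main

/-! ### Running commands on an arbitrary initial memory -/

/-- Sets registers `50, …, 49 + k` to zero. -/
def zeroRegs : ℕ → RamProg
  | 0 => .skip
  | k + 1 => .seq (zeroRegs k) (.instr (.const (50 + k) 0))

theorem zeroRegs_run {W : ℕ} {s : RamState} (hs : s.Fits W) (k : ℕ) :
    ∃ g : ℕ → ℕ, RamRun W (zeroRegs k) s { s with reg := g } (k + 1) ∧
      RamState.Fits { s with reg := g } W ∧ (∀ x < 50, g x = s.reg x) ∧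
      ∀ x, 50 ≤ x → x < 50 + k → g x = 0 := by
  induction k with
  | zero => exact ⟨s.reg, .skip s, hs, fun _ _ => rfl, fun x h h' => by omega⟩
  | succ k ih =>
    obtain ⟨g, h1, h2, h3, h4⟩ := ih
    have h5 : RamState.Fits { s with reg := Function.update g (50 + k) 0 } W := by
      refine ⟨fun x => ?_, h2.2⟩
      simp only [Function.update_apply]
      split_ifs
      · exact (Nat.zero_le _).trans_lt (hs.1 0)
      · exact h2.1 x
    refine ⟨Function.update g (50 + k) 0, .seq h1 (.instr (.const (50 + k) 0) _ h5), h5,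
      fun x hx => ?_, fun x hx hx' => ?_⟩
    · rw [Function.update_of_ne (by omega), h3 x hx]
    · rw [Function.update_apply]
      split_ifs with h
      · rfl
      · exact h4 x hx (by omega)

/-- The program for a command that may be started in any memory. -/
def Cmd.program (p : Cmd) : RamProg := .seq (zeroRegs 50) p.compile

theorem Tri.run {W : ℕ} {p : Cmd} (hp : p.wf = true) {s : RamState} (hW : 3 ≤ W) (hs : s.Fits W)
    {Q : RamState → ℕ → Prop} (h : ∀ g : ℕ → ℕ, RamState.Fits { s with reg := g } W →
      (∀ x < 50, g x = s.reg x) → Tri W p { s with reg := g } Q) :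
    ∃ s' t t', RamRun W p.program s s' t ∧ t ≤ 10 * t' + 51 ∧ Q s' t' := by
  obtain ⟨g, h1, h2, h3, h4⟩ := zeroRegs_run hs 50
  obtain ⟨s', t', hr, hQ⟩ := h g h2 h3 hW h2
  obtain ⟨⟨t, hr', ht⟩, -⟩ := hr.compile hW hp h2 fun x hx hx' => h4 x hx (by omega)
  exact ⟨s', _, t', .seq h1 hr', by omega, hQ⟩

/-! ### The time for multiplying matrices -/

/-- Multiplication of matrices by the definition. -/
def naiveMulProg : Cmd :=
  .loopFor 3 0 <| .for 4 0 <| .sto 2 (.r 3 * .r 0 + .r 4)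
    (.sum 5 0 (.l 0 (.r 3 * .r 0 + .r 5) * .l 1 (.r 5 * .r 0 + .r 4)) % .c 2)

theorem naiveMulProg_spec {W m : ℕ} {M N : Matrix (Fin m) (Fin m) (ZMod 2)} {s : RamState}
    (hW : m * m + m < W) (hm : s.reg 0 = m) (hM : s.HoldsMatrix 0 M) (hN : s.HoldsMatrix 1 N) :
    Tri W naiveMulProg s fun s' t => t ≤ m * (m * (m * 30 + 30) + 20) + 6 ∧
      s'.HoldsMatrix 2 (M * N) := by
  have hidx : ∀ i < m, ∀ j < m, i * m + j < W := fun i hi j hj => by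
    have := idx_lt (W := m * m) hi hj le_rfl
    omega
  have hidx0 : ∀ i < m, i * m < W := fun i hi => hidx i hi 0 (by omega)
  refine Tri.loop (N := m) hm (by decide) rfl rfl (fun i s' => ∀ i' < i, ∀ j (hi : i' < m) (hj : j < m),
    s'.arr 2 (i' * m + j) = ((M * N) ⟨i', hi⟩ ⟨j, hj⟩).val) (m * (m * 30 + 30) + 12) (by simp) ?_ ?_
  · rintro i s' hi hf hi' hfr hI
    have r0 : s'.reg 0 = m := (hfr.r rfl).trans hm
    have a0 : s'.arr 0 = s.arr 0 := hfr.a rfl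
    have a1 : s'.arr 1 = s.arr 1 := hfr.a rfl
    have hprod : ∀ j (hj : j < m), (∑ x ∈ Finset.range m, s.arr 0 (i * m + x) * s.arr 1 (x * m + j)) % 2 =
        ((M * N) ⟨i, hi⟩ ⟨j, hj⟩).val := fun j hj => by
      rw [← ZMod.val_natCast, Finset.sum_range]
      congr 1
      rw [Matrix.mul_apply]
      push_cast
      refine Finset.sum_congr rfl fun x _ => ?_
      rw [hM ⟨i, hi⟩ x, hN x ⟨j, hj⟩, ZMod.natCast_val, ZMod.natCast_val, ZMod.cast_id, ZMod.cast_id]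
    have hle : ∀ j < m, ∀ x < m, s.arr 0 (i * m + x) * s.arr 1 (x * m + j) ≤ 1 := fun j hj x hx => by
      have h1 := hM ⟨i, hi⟩ ⟨x, hx⟩
      have h2 := hN ⟨x, hx⟩ ⟨j, hj⟩
      simp only at h1 h2
      rw [h1, h2]
      exact Nat.mul_le_mul (Nat.le_of_lt_succ (ZMod.val_lt _)) (Nat.le_of_lt_succ (ZMod.val_lt _))
    refine Tri.of_wp ?_
    simp only [Cmd.wp_for]
    refine Tri.scatter (N := m) r0 (by decide) (fun j => i * m + j)
      (fun j => (∑ x ∈ Finset.range m, s.arr 0 (i * m + x) * s.arr 1 (x * m + j)) % 2) (m * 30 + 20)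
      (fun j _ j' _ => by omega) ?_ ?_
    · intro j hj h _ _
      have hs := Finset.sum_le_card_nsmul (Finset.range m) _ 1 fun x hx => hle j hj x (Finset.mem_range.1 hx)
      simp only [Finset.card_range, smul_eq_mul, mul_one] at hs
      refine ⟨?_, ?_, by simp [r0, hi'], by simp [r0, hi', a0, a1], ?_⟩
      · simp [r0, hi', hidx0 i hi, hidx i hi j hj]
      · simp only [Ex.ok_mod, Ex.ok_sum, Ex.ok_c]
        refine ⟨⟨fun x hx => ?_, ?_⟩, by simp⟩
        · replace hx : x < m := by simpa [r0] using hx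
          have := hle j hj x hx
          simp [r0, hi', a0, a1, hidx0 i hi, hidx i hi x hx, hidx0 x hx, hidx x hx j hj]
          omega
        · simpa [r0, hi', a0, a1] using lt_of_le_of_lt hs (by omega)
      · simp [r0]; ring_nf; omega
    · intro h t hf' hh ho ht
      refine ⟨by ring_nf at ht ⊢; omega, fun i' hi'' j h1 h2 => ?_⟩
      rcases Nat.lt_succ_iff_lt_or_eq.1 hi'' with h3 | rfl
      · simp only [RamState.arr_setReg, RamState.arr_withArr, if_true]
        rw [ho _ fun j' hj' h => ?_, hI i' h3 j h1 h2]
        have := (idx_inj h2 hj' h).1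
        omega
      · simp only [RamState.arr_setReg, RamState.arr_withArr, if_true]
        rw [hh j h2, hprod j h2]
  · rintro s' t - - - hI ht
    exact ⟨by ring_nf at ht ⊢; omega, fun i j => hI i i.2 j i.2 j.2⟩

theorem matMulTime_three : MatMulTime 3 := by
  refine ⟨naiveMulProg.program, 1000, 2, fun m hm M N W hW s hs h0 hM hN => ?_⟩
  have hmm : m ≤ m * m := Nat.le_mul_self m
  rw [pow_two] at hW
  obtain ⟨s', t, t', hr, ht, h1, h2⟩ := Tri.run (p := naiveMulProg) rfl (by omega) hs fun g _ hg =>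
    naiveMulProg_spec (M := M) (N := N) (by omega) ((hg 0 (by decide)).trans h0) hM hN
  refine ⟨s', t, hr, ?_, h2⟩
  have e1 : m ≤ m ^ 3 := Nat.le_self_pow (by decide) m
  have e2 : m ^ 2 ≤ m ^ 3 := Nat.pow_le_pow_right hm (by decide)
  have e3 : m * (m * (m * 30 + 30) + 20) = 30 * m ^ 3 + 30 * m ^ 2 + 20 * m := by ring
  have e4 : t ≤ 1000 * m ^ 3 := by omega
  calc (t : ℝ) ≤ ((1000 * m ^ 3 : ℕ) : ℝ) := by exact_mod_cast e4
    _ = _ := by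
        rw [show (3 : ℝ) = ((3 : ℕ) : ℝ) by norm_num, Real.rpow_natCast]
        push_cast
        ring

theorem MatMulTime.mono {σ τ : ℝ} (h : MatMulTime σ) (hστ : σ ≤ τ) : MatMulTime τ := by
  obtain ⟨P, C, k, hP⟩ := h
  refine ⟨P, C, k, fun m hm M N W hW s hs h0 hM hN => ?_⟩
  obtain ⟨s', t, h1, h2, h3⟩ := hP m hm M N W hW s hs h0 hM hN
  refine ⟨s', t, h1, h2.trans ?_, h3⟩
  gcongr
  exact_mod_cast hm

theorem matMulTime_of_exponent_lt {τ : ℝ} (h : matMulExponent < τ) : MatMulTime τ := by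
  obtain ⟨σ, hσ, hlt⟩ := exists_lt_of_csInf_lt ⟨3, matMulTime_three⟩ h
  exact MatMulTime.mono hσ hlt.le

/-- A program changes at most one cell of an array in a step. -/
theorem RamRun.exists_changed {W : ℕ} {p : RamProg} {s s' : RamState} {t : ℕ}
    (h : RamRun W p s s' t) (a : ℕ) :
    ∃ F : Finset ℕ, F.card ≤ t ∧ ∀ i ∉ F, s'.arr a i = s.arr a i := by
  have hseq : ∀ {s₁ s₂ s₃ : RamState} {t₁ t₂ : ℕ},
      (∃ F : Finset ℕ, F.card ≤ t₁ ∧ ∀ i ∉ F, s₂.arr a i = s₁.arr a i) →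
      (∃ F : Finset ℕ, F.card ≤ t₂ ∧ ∀ i ∉ F, s₃.arr a i = s₂.arr a i) →
      ∃ F : Finset ℕ, F.card ≤ t₁ + t₂ ∧ ∀ i ∉ F, s₃.arr a i = s₁.arr a i := by
    rintro s₁ s₂ s₃ t₁ t₂ ⟨F, h1, h2⟩ ⟨F', h3, h4⟩
    refine ⟨F ∪ F', (Finset.card_union_le _ _).trans (by omega), fun i hi => ?_⟩
    rw [Finset.notMem_union] at hi
    rw [h4 i hi.2, h2 i hi.1]
  induction h with
  | skip => exact ⟨∅, by simp, fun _ _ => rfl⟩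
  | instr i s _ =>
    cases i with
    | store b x y =>
      refine ⟨{s.reg x}, by simp, fun i hi => ?_⟩
      by_cases h : a = b
      · subst h
        simp [RamInstr.exec, Finset.notMem_singleton.1 hi]
      · simp [RamInstr.exec, h]
    | _ => exact ⟨∅, by simp, fun _ _ => rfl⟩
  | seq _ _ h1 h2 => exact hseq h1 h2
  | iteTrue _ _ h => exact h.imp fun F hF => ⟨by omega, hF.2⟩
  | iteFalse _ _ h => exact h.imp fun F hF => ⟨by omega, hF.2⟩
  | loopStop => exact ⟨∅, by simp, fun _ _ => rfl⟩
  | loopStep _ _ _ h1 h2 => exact (hseq h1 h2).imp fun F hF => ⟨by omega, hF.2⟩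

theorem MatMulTime.two_le {τ : ℝ} (h : MatMulTime τ) : 2 ≤ τ := by
  obtain ⟨P, C, k, hP⟩ := h
  by_contra! hτ
  have key : ∀ m : ℕ, 1 ≤ m → ((m : ℝ)) ^ (2 - τ) ≤ C := by
    intro m hm
    obtain ⟨s', t, hr, ht, h2⟩ := hP m hm (Matrix.of fun _ _ => 1) 1 (C * m ^ k + m + 2) (by omega)
      ⟨fun x => if x = 0 then m else 0, fun a i => if a = 0 then 1 else if a = 1 then
        (if i / m = i % m then 1 else 0) else 0, fun _ => 0, fun _ _ => 0⟩
      ⟨fun x => by simp only; split_ifs <;> omega, fun a i => by simp only; split_ifs <;> omega⟩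
      rfl (fun i j => by simp [ZMod.val_one]) fun i j => by
        have h1 : (i.val * m + j.val) / m = i := by
          rw [Nat.mul_comm, Nat.mul_add_div hm, Nat.div_eq_of_lt j.2, Nat.add_zero]
        have h2 : (i.val * m + j.val) % m = j := by
          rw [Nat.mul_comm, Nat.mul_add_mod, Nat.mod_eq_of_lt j.2]
        by_cases h : i = j
        · subst h
          simp [h1, Nat.mod_eq_of_lt i.2, ZMod.val_one]
        · simp [h1, h2, h, Fin.val_ne_of_ne h]
    obtain ⟨F, hF, hF'⟩ := hr.exists_changed 2
    have hsub : Finset.range (m * m) ⊆ F := fun p hp => by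
      rw [Finset.mem_range] at hp
      by_contra hpF
      have h3 := hF' p hpF
      have h4 := h2 ⟨p / m, Nat.div_lt_of_lt_mul hp⟩ ⟨p % m, Nat.mod_lt _ hm⟩
      rw [Matrix.mul_one] at h4
      simp only [Nat.div_add_mod'] at h4
      rw [h4] at h3
      simp [ZMod.val_one] at h3
    have hcard := Finset.card_le_card hsub
    rw [Finset.card_range] at hcard
    have hm0 : (0 : ℝ) < m := by exact_mod_cast hm
    have h5 : ((m : ℝ)) ^ (2 : ℝ) ≤ C * (m : ℝ) ^ τ := by
      refine le_trans ?_ ht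
      rw [Real.rpow_two, pow_two]
      exact_mod_cast hcard.trans hF
    rw [Real.rpow_sub hm0, div_le_iff₀ (Real.rpow_pos_of_pos hm0 _)]
    exact h5
  have hlim := (tendsto_rpow_atTop (show 0 < 2 - τ by linarith)).comp tendsto_natCast_atTop_atTop
  obtain ⟨m, h1, h2⟩ := ((hlim.eventually_gt_atTop (C : ℝ)).and
    (Filter.eventually_ge_atTop 1)).exists
  exact absurd (key m h2) (not_le.2 h1)

/-! ### The time for the elimination -/

theorem elimTasks_cost_le {c : ElimTask → ℝ} {B : ℝ} {J : ℕ} (hB : ∀ lo, c ⟨0, lo, lo⟩ ≤ B)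
    (hc : ∀ i < J, ∀ d r, c ⟨2 ^ i, d, r⟩ ≤ B * 2 ^ i) (lo : ℕ) :
    ((elimTasks lo J).map c).sum ≤ B * 2 ^ J * (J + 1) := by
  induction J generalizing lo with
  | zero => simpa [elimTasks] using hB lo
  | succ J ih =>
    have h1 := ih (fun i hi => hc i (by omega)) lo
    have h2 := ih (fun i hi => hc i (by omega)) (lo + 2 ^ J)
    have h3 := hc J (by omega) (lo + 2 ^ J) lo
    have h4 := hc J (by omega) lo (lo + 2 ^ J)
    rw [elimTasks, elimTasks_shift]
    simp only [List.map_append, List.sum_append, List.map_cons, List.map_nil, List.sum_singleton]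
    push_cast
    rw [pow_succ]
    linarith

theorem elimTime_le {mm : ℕ → ℕ} {C τ : ℝ} (hτ : 2 ≤ τ) (hC : 0 ≤ C)
    (hmm : ∀ m : ℕ, 1 ≤ m → (mm m : ℝ) ≤ C * (m : ℝ) ^ τ) (J : ℕ) :
    (elimTime mm J : ℝ) ≤ 2 * (C + 300) * 2 ^ J * ((2 : ℝ) ^ J) ^ (τ - 1) * (J + 2) := by
  set B := (C + 300) * ((2 : ℝ) ^ J) ^ (τ - 1) with hB
  have hpow : ∀ i : ℕ, (1 : ℝ) ≤ 2 ^ i := fun i => one_le_pow₀ (by norm_num)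
  have hself : ∀ i : ℕ, (2 : ℝ) ^ i ≤ ((2 : ℝ) ^ i) ^ (τ - 1) := fun i => by
    simpa using Real.rpow_le_rpow_of_exponent_le (hpow i) (show (1 : ℝ) ≤ τ - 1 by linarith)
  have h := elimTasks_cost_le (c := fun T => ((ElimTask.cost mm (2 ^ J) T : ℕ) : ℝ)) (B := B)
    (J := J + 1) (fun lo => ?_) (fun i hi d r => ?_) 0
  · rw [elimTime, Nat.cast_list_sum, List.map_map]
    refine h.trans_eq ?_
    rw [hB, pow_succ]; push_cast; ring
  · rw [ElimTask.cost, if_pos rfl]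
    push_cast
    have := hself J
    have := hpow J
    nlinarith
  · have h0 : (2 : ℕ) ^ i ≠ 0 := by positivity
    have hij : i ≤ J := by omega
    rw [ElimTask.cost, if_neg h0, Nat.pow_div hij (by norm_num)]
    push_cast
    set u : ℝ := 2 ^ i with hu
    set v : ℝ := 2 ^ (J - i) with hv
    have huv : (2 : ℝ) ^ J = v * u := by rw [hu, hv, ← pow_add, Nat.sub_add_cancel hij]
    have hu1 : 1 ≤ u := hpow i
    have hv1 : 1 ≤ v := hpow _
    have hu2 : u * u ≤ u ^ τ := by
      rw [← pow_two, ← Real.rpow_two]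
      exact Real.rpow_le_rpow_of_exponent_le hu1 hτ
    have hm : (mm (2 ^ i) : ℝ) ≤ C * u ^ τ := by
      simpa [hu] using hmm (2 ^ i) Nat.one_le_two_pow
    have hB' : v * u ^ τ ≤ ((2 : ℝ) ^ J) ^ (τ - 1) * u := by
      rw [huv, Real.mul_rpow (by positivity) (by positivity), mul_assoc, ← Real.rpow_add_one (by positivity),
        sub_add_cancel]
      gcongr
      exact hself _
    have hut : 1 ≤ u ^ τ := by nlinarith
    have e1 : v * (mm (2 ^ i) + 120 * (u * u) + 38) ≤ v * ((C + 158) * u ^ τ) := by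
      gcongr; nlinarith
    have e2 : 60 * (u * u) + 70 ≤ 130 * (v * u ^ τ) := by nlinarith
    have e3 := mul_le_mul_of_nonneg_left hB' (show 0 ≤ C + 300 by linarith)
    have e4 : 0 ≤ v * u ^ τ := by positivity
    rw [hB]
    nlinarith

/-! ### Representativity -/

theorem acyRepresents_image {n a : ℕ} {G : SimpleGraph (Fin n)} [DecidableRel G.Adj]
    {A R' : Finset (Fin n)} {w : Fin n → ℚ} {o : OptKind} {X : ℕ → Finset (Fin n)} {U : Finset ℕ}
    (hU : ∀ i ∈ U, i < a) (h : ∀ Y ⊆ Aᶜ, NbrEquiv G 2 Aᶜ Y R' → ∀ j < a,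
      (G.induce (↑(X j ∪ Y) : Set (Fin n))).IsTree → ∃ i ∈ U,
        (G.induce (↑(X i ∪ Y) : Set (Fin n))).IsTree ∧ o.Better (fun i => ∑ v ∈ X i, w v) i j) :
    AcyRepresents G w o A R' (U.image X) ((Finset.range a).image X) := by
  intro Y hY hYR
  have hsub : {b : EReal | ∃ Z ∈ U.image X, (G.induce (↑(Z ∪ Y) : Set (Fin n))).IsTree ∧
      b = (((∑ v ∈ Z, w v : ℚ) : ℝ) : EReal)} ⊆ {b : EReal | ∃ Z ∈ (Finset.range a).image X,
        (G.induce (↑(Z ∪ Y) : Set (Fin n))).IsTree ∧ b = (((∑ v ∈ Z, w v : ℚ) : ℝ) : EReal)} := by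
    rintro b ⟨Z, hZ, h1⟩
    exact ⟨Z, Finset.image_subset_image (fun i hi => Finset.mem_range.2 (hU i hi)) hZ, h1⟩
  cases o
  · refine le_antisymm (sInf_le_sInf hsub) (le_sInf ?_)
    rintro _ ⟨Z, hZ, h1, rfl⟩
    obtain ⟨j, hj, rfl⟩ := Finset.mem_image.1 hZ
    obtain ⟨i, hi, h2, h3⟩ := h Y hY hYR j (Finset.mem_range.1 hj) h1
    refine sInf_le_of_le ⟨X i, Finset.mem_image_of_mem _ hi, h2, rfl⟩ ?_
    exact EReal.coe_le_coe_iff.2 (Rat.cast_le.2 h3)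
  · refine le_antisymm (sSup_le ?_) (sSup_le_sSup hsub)
    rintro _ ⟨Z, hZ, h1, rfl⟩
    obtain ⟨j, hj, rfl⟩ := Finset.mem_image.1 hZ
    obtain ⟨i, hi, h2, h3⟩ := h Y hY hYR j (Finset.mem_range.1 hj) h1
    refine le_sSup_of_le ⟨X i, Finset.mem_image_of_mem _ hi, h2, rfl⟩ ?_
    exact EReal.coe_le_coe_iff.2 (Rat.cast_le.2 h3)

theorem RamState.Emitted.holdsFamily {n : ℕ} {s : RamState} {X : ℕ → Finset (Fin n)} {U : Finset ℕ}
    (h : s.Emitted X U) (hX : Set.InjOn X U) : s.HoldsFamily 2 4 (U.image X) := by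
  obtain ⟨h2, g, hg, hout⟩ := h
  have hcard : (U.image X).card = U.card := Finset.card_image_of_injOn hX
  refine ⟨h2.trans hcard.symm, Equiv.ofBijective (fun i => ⟨X (g i), ?_⟩)
    ((Fintype.bijective_iff_surjective_and_card _).2 ⟨?_, by simp only [Fintype.card_fin, Fintype.card_coe]⟩),
    fun i v => ?_⟩
  · exact Finset.mem_image_of_mem _
      (hg.subset (Finset.mem_image_of_mem _ (Finset.mem_range.2 (hcard ▸ i.2))))
  · rintro ⟨Z, hZ⟩
    obtain ⟨u, hu, rfl⟩ := Finset.mem_image.1 hZ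
    rw [← hg] at hu
    obtain ⟨r, hr, rfl⟩ := Finset.mem_image.1 hu
    exact ⟨⟨r, hcard ▸ Finset.mem_range.1 hr⟩, rfl⟩
  · rw [hout i (hcard ▸ i.2) v v.2, ind_val]
    rfl

theorem LayoutTree.pos_of_fin {n : ℕ} : LayoutTree (Fin n) → 0 < n
  | .leaf v => Fin.pos v
  | .node l _ => l.pos_of_fin

/-! ### The time bound -/

section Scale
variable {τ : ℝ} {n a c N : ℕ}

theorem sq_le_rpow {c : ℝ} (hτ : 2 ≤ τ) (hc : 1 ≤ c) : c ^ 2 ≤ c ^ (2 * (τ - 1)) := by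
  rw [← Real.rpow_two]
  exact Real.rpow_le_rpow_of_exponent_le hc (by linarith)

theorem mul_le_timeScale {α β γ : ℝ} (hβ : 0 ≤ β) (hγ : 0 ≤ γ) (h1 : α ≤ a + 1)
    (h2 : β ≤ (c : ℝ) ^ (2 * (τ - 1)) + N) (h3 : γ ≤ (n : ℝ) ^ 2) :
    α * β * γ ≤ timeScale τ n a c N := by
  unfold timeScale
  gcongr

theorem reduction_time_le {q D rr el K : ℝ} {J : ℕ} (hτ : 2 ≤ τ) (hc : (1 : ℝ) ≤ c) (hn : (1 : ℝ) ≤ n)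
    (hN : (2 * n : ℝ) ≤ N) (hq : 0 ≤ q) (hqc : q ≤ c) (hD0 : 0 < D) (hD : D ≤ 2 * c ^ 2)
    (hJ : (J + 2 : ℝ) ≤ 4 * n)
    (hr0 : 0 ≤ rr) (hrr : D * rr ≤ 2 * a) (hK : 0 ≤ K)
    (hel : el ≤ 2 * (K + 300) * D * D ^ (τ - 1) * (J + 2)) :
    10 * (200 * n ^ 2 * (q + 1) ^ 2 + 800 * (N * n ^ 2) + (10 * (q * q) + 20) + 800 * D +
        (a + 1) * (2100 * n ^ 3 + 100 * (N * n)) + (N * (a * 20 + 40) +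
        a * (60 * D + 40 * n + 100) + rr * (700 * D ^ 2 * n ^ 2 + el) + 10)) + 51 ≤
      (100000 + 160 * (K + 300) * 2 ^ (τ - 1)) * timeScale τ n a c N := by
  have ha : (0 : ℝ) ≤ a := a.cast_nonneg
  set E := (c : ℝ) ^ (2 * (τ - 1)) with hE
  set S := timeScale τ n a c N with hS
  have hcE : c ^ 2 ≤ E := sq_le_rpow hτ hc
  have hE1 : 1 ≤ E := by nlinarith
  have hn2 : (n : ℝ) ≤ (n : ℝ) ^ 2 := by nlinarith
  have h1 : (1 : ℝ) ≤ (n : ℝ) ^ 2 := hn.trans hn2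
  have key : ∀ {α β : ℝ}, 0 ≤ β → α ≤ a + 1 → β ≤ E + N → α * β * n ^ 2 ≤ S ∧ α * β * 1 ≤ S :=
    fun h2 h3 h4 => ⟨mul_le_timeScale h2 (by positivity) h3 h4 le_rfl,
      mul_le_timeScale h2 zero_le_one h3 h4 h1⟩
  have hE0 : 0 ≤ E := by linarith
  have hN0 : (0 : ℝ) ≤ N := by linarith
  obtain ⟨s1, s3⟩ := key (α := 1) hE0 (by linarith) (by linarith)
  obtain ⟨s2, s7⟩ := key (α := 1) hN0 (by linarith) (by linarith)
  obtain ⟨s4, s5⟩ := key (α := a + 1) hN0 le_rfl (by linarith)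
  obtain ⟨s8, s6⟩ := key (α := a) hE0 (by linarith) (by linarith)
  have hqq : q ^ 2 ≤ c ^ 2 := by gcongr
  have hDE : D ≤ 2 * E := by linarith
  have t1 : 200 * n ^ 2 * (q + 1) ^ 2 ≤ 800 * S := by
    have : (q + 1) ^ 2 ≤ 4 * E := by nlinarith
    have := mul_le_mul_of_nonneg_left this (show 0 ≤ 200 * (n : ℝ) ^ 2 by positivity)
    linarith
  have t2 : (a + 1) * (2100 * n ^ 3 + 100 * (N * n)) ≤ 1150 * S := by
    have e1 : 2100 * (n : ℝ) ^ 3 ≤ 1050 * (N * n ^ 2) := by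
      have := mul_le_mul_of_nonneg_right hN (show 0 ≤ 1050 * (n : ℝ) ^ 2 by positivity)
      linarith
    have e2 : (N * n : ℝ) ≤ N * n ^ 2 := by gcongr
    have := mul_le_mul_of_nonneg_left (add_le_add e1 (mul_le_mul_of_nonneg_left e2 (by norm_num : (0 : ℝ) ≤ 100)))
      (show 0 ≤ (a : ℝ) + 1 by linarith)
    linarith
  have t3 : a * (60 * D + 40 * n + 100) ≤ 240 * S := by
    have : 60 * D + 40 * n + 100 ≤ 220 * E + 20 * N := by linarith
    have := mul_le_mul_of_nonneg_left this ha
    linarith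
  have t4 : rr * (700 * D ^ 2 * n ^ 2 + el) ≤ (2800 + 16 * (K + 300) * 2 ^ (τ - 1)) * S := by
    have hDτ : D ^ (τ - 1) ≤ 2 ^ (τ - 1) * E := by
      refine (Real.rpow_le_rpow hD0.le hD (by linarith)).trans_eq ?_
      rw [Real.mul_rpow (by norm_num) (by positivity), hE, Real.rpow_mul (by linarith), Real.rpow_two]
    have e1 : 700 * D ^ 2 * n ^ 2 + el ≤
        D * (1400 * E * n ^ 2 + 8 * (K + 300) * (2 ^ (τ - 1) * E) * n ^ 2) := by
      have u1 : 700 * D ^ 2 * n ^ 2 ≤ D * (1400 * E * n ^ 2) := by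
        have := mul_le_mul_of_nonneg_left hDE (show 0 ≤ 700 * D * n ^ 2 by positivity)
        linarith
      have u2 : 2 * (K + 300) * D * D ^ (τ - 1) * (J + 2) ≤
          2 * (K + 300) * D * (2 ^ (τ - 1) * E) * (4 * n ^ 2) := by
        gcongr
        linarith
      linarith
    have e2 := mul_le_mul_of_nonneg_left e1 hr0
    have e3 := mul_le_mul_of_nonneg_right hrr
      (show 0 ≤ 1400 * E * n ^ 2 + 8 * (K + 300) * (2 ^ (τ - 1) * E) * n ^ 2 by positivity)
    have e4 := mul_le_mul_of_nonneg_left s8 (show 0 ≤ 2800 + 16 * (K + 300) * 2 ^ (τ - 1) by positivity)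
    linarith
  have t5 : 10 * (q * q) + 20 ≤ 30 * S := by nlinarith
  linarith

end Scale

theorem theorem5p8 (f : WidthParam) (o : OptKind) (τ : ℝ)
    (hτ : matMulExponent < τ ∨ MatMulTime τ) :
    ∃ (P : RamProg) (C k : ℕ),
      ∀ (n : ℕ) (G : SimpleGraph (Fin n)) [DecidableRel G.Adj] (w : Fin n → ℚ)
        (T : LayoutTree (Fin n)), T.IsLayout →
      ∀ x ∈ T.nodes, ∀ R R' : Finset (Fin n), R ⊆ x.verts → R' ⊆ x.vertsᶜ →
      ∀ 𝒜 : Finset (Finset (Fin n)),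
        (∀ X ∈ 𝒜, X ⊆ x.verts) → (∀ X ∈ 𝒜, NbrEquiv G 2 x.verts X R) →
      ∀ W : ℕ,
        C * timeScale τ n 𝒜.card (nec G 1 x.verts) (classBound G T f) ^ k ≤ (W : ℝ) →
      ∀ s : RamState, s.Fits W →
        s.HoldsGraph G → s.HoldsSet 1 x.verts → s.HoldsSet 2 R' → s.HoldsFamily 1 3 𝒜 →
        s.HoldsWeights w →
      ∃ (s' : RamState) (t : ℕ) (ℬ : Finset (Finset (Fin n))),
        RamRun W P s s' t ∧
        (t : ℝ) ≤ C * timeScale τ n 𝒜.card (nec G 1 x.verts) (classBound G T f) ∧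
        s'.HoldsFamily 2 4 ℬ ∧
        ℬ ⊆ 𝒜 ∧
        AcyRepresents G w o x.verts R' ℬ 𝒜 ∧
        ℬ.card ≤ classBound G T f * nec G 1 x.verts ^ 2 := by
  have hM : MatMulTime τ := hτ.elim matMulTime_of_exponent_lt id
  have hτ2 := hM.two_le
  obtain ⟨P, C, k, hP⟩ := hM
  obtain ⟨K, hK⟩ := exists_nat_ge (100000 + 160 * ((C : ℝ) + 300) * 2 ^ (τ - 1))
  refine ⟨(reductionProg f o P).program, K + C * 2 ^ k + 100, k + 3, fun n G _ w T _ x hx _ R' _ _ 𝒜 h𝒜 _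
    W hW s hs hG hA hR hF hw => ?_⟩
  have hn : 0 < n := T.pos_of_fin
  have hN : 2 * n ≤ classBound G T f := two_mul_le_classBound hn
  have hqc : (nbhds G x.verts).card ≤ nec G 1 x.verts := card_nbhds_le_nec
  have hq0 : 0 < (nbhds G x.verts).card :=
    Finset.card_pos.2 ⟨_, Finset.mem_image_of_mem _ (Finset.empty_mem_powerset _)⟩
  have hq2 : (nbhds G x.verts).card ≤ 2 ^ n := by simpa using Finset.card_le_univ (nbhds G x.verts)
  have hB := fun F => card_sigRow_le (G := G) (f := f) (R' := R') hn hx (F := F)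
  have hg : f = .mim → (goods G x.verts).card * n ≤ classBound G T f := by
    rintro rfl; exact card_goods_mul_le_classBound hn hx
  set A := x.verts
  set c := nec G 1 A
  set N := classBound G T f
  unfold RamState.HoldsFamily at hF
  generalize 𝒜.card = a at *
  obtain ⟨ha, e, he⟩ := hF
  generalize hq : (nbhds G A).card = q at *
  have hn1 : (1 : ℝ) ≤ n := by exact_mod_cast hn
  have hc1 : (1 : ℝ) ≤ c := by exact_mod_cast hq0.trans_le hqc
  have hE := sq_le_rpow hτ2 hc1
  have hqE : ((q * q : ℕ) : ℝ) ≤ (c : ℝ) ^ (2 * (τ - 1)) := by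
    refine le_trans ?_ hE
    rw [← pow_two]
    exact_mod_cast Nat.pow_le_pow_left hqc 2
  have hN0 : (0 : ℝ) ≤ N := N.cast_nonneg
  have ha0 : (0 : ℝ) ≤ a := a.cast_nonneg
  have hE1 : (1 : ℝ) ≤ (c : ℝ) ^ (2 * (τ - 1)) := by nlinarith
  set S := timeScale τ n a c N
  obtain ⟨B, hB1, hB2, hB3, hBS⟩ : ∃ B : ℕ, q * q * n ^ 2 ≤ B ∧ N * n ^ 2 ≤ B ∧ a * n ^ 2 ≤ B ∧ (B : ℝ) ≤ S := by
    have hn2 : (0 : ℝ) ≤ (n : ℝ) ^ 2 := by positivity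
    have s1 : ((q * q * n ^ 2 : ℕ) : ℝ) ≤ S := by
      rw [Nat.cast_mul, Nat.cast_pow, ← one_mul ((q * q : ℕ) : ℝ)]
      exact mul_le_timeScale (by positivity) hn2 (by linarith) (by linarith) le_rfl
    refine ⟨⌊S⌋₊, Nat.le_floor s1, Nat.le_floor ?_, Nat.le_floor ?_,
      Nat.floor_le ((Nat.cast_nonneg _).trans s1)⟩
    · rw [Nat.cast_mul, Nat.cast_pow, ← one_mul (N : ℝ)]
      exact mul_le_timeScale hN0 hn2 (by linarith) (by linarith) le_rfl
    · rw [Nat.cast_mul, Nat.cast_pow, ← mul_one (a : ℝ)]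
      exact mul_le_timeScale zero_le_one hn2 (by linarith) (by linarith) le_rfl
  have hBW : (K + C * 2 ^ k + 100) * B ^ (k + 3) ≤ W := by
    have : (((K + C * 2 ^ k + 100 : ℕ) : ℝ)) * (B : ℝ) ^ (k + 3) ≤ W := le_trans (by gcongr) hW
    exact_mod_cast this
  have hn2 : n * n ≤ B := by
    refine le_trans ?_ hB1
    rw [← pow_two]
    exact Nat.le_mul_of_pos_left _ (Nat.mul_pos hq0 hq0)
  have hB0 : 0 < B := (Nat.mul_pos hn hn).trans_le hn2
  have hbW : ∀ b j, b ≤ K + C * 2 ^ k + 100 → j ≤ k + 3 → b * B ^ j ≤ W := fun b j hb hj =>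
    (Nat.mul_le_mul hb (Nat.pow_le_pow_right hB0 hj)).trans hBW
  have h100 : 100 * B ≤ W := by simpa using hbW 100 1 (by omega) (by omega)
  have hqB : q * q ≤ B := (Nat.le_mul_of_pos_right _ (by positivity)).trans hB1
  have hnn : n ≤ n ^ 2 := Nat.le_self_pow (by decide) n
  have hNW : (N + 2) * (n + 1) ≤ W := by
    have h1 : (N + 2) * (n + 1) ≤ (2 * N) * (2 * n ^ 2) := Nat.mul_le_mul (by omega) (by omega)
    have h2 : (2 * N) * (2 * n ^ 2) = 4 * (N * n ^ 2) := by ring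
    omega
  have haW : a * n ≤ W := (Nat.mul_le_mul_left a hnn).trans (by omega)
  have hqW : (q + 2) * n ≤ W := by
    have h1 : (q + 2) * n ≤ (3 * (q * q)) * n ^ 2 :=
      Nat.mul_le_mul (by have := Nat.le_mul_self q; omega) hnn
    have h2 : 3 * (q * q) * n ^ 2 = 3 * (q * q * n ^ 2) := by ring
    omega
  set X : ℕ → Finset (Fin n) := fun j => if h : j < a then (e ⟨j, h⟩).val else ∅ with hXdef
  have hXe : ∀ j (h : j < a), X j = (e ⟨j, h⟩).val := fun j h => dif_pos h
  have hX𝒜 : ∀ j < a, X j ∈ 𝒜 := fun j h => by rw [hXe j h]; exact (e ⟨j, h⟩).2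
  have hXA : ∀ j < a, X j ⊆ A := fun j h => h𝒜 _ (hX𝒜 j h)
  have hXs : ∀ j < a, ∀ v < n, s.arr 3 (j * n + v) = ind (X j) v := fun j hj v hv => by
    rw [hXe j hj]
    exact (he ⟨j, hj⟩ ⟨v, hv⟩).trans (ind_val _ ⟨v, hv⟩).symm
  have hXim : (Finset.range a).image X = 𝒜 := by
    refine Finset.Subset.antisymm (fun Z hZ => ?_) fun Z hZ => ?_
    · obtain ⟨j, hj, rfl⟩ := Finset.mem_image.1 hZ
      exact hX𝒜 j (Finset.mem_range.1 hj)
    · refine Finset.mem_image.2 ⟨(e.symm ⟨Z, hZ⟩).val, Finset.mem_range.2 (e.symm ⟨Z, hZ⟩).2, ?_⟩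
      rw [hXe _ (e.symm ⟨Z, hZ⟩).2]
      simp
  let mm : ℕ → ℕ := fun m => ⌊C * (m : ℝ) ^ τ⌋₊
  have hmm : ∀ m : ℕ, (mm m : ℝ) ≤ C * (m : ℝ) ^ τ := fun m => Nat.floor_le (by positivity)
  obtain ⟨s', t, t', hr, ht, U, L, J, rr, -, hJ, hL, hL0, hem, hUa, hUc, hgen, hrr, ht'⟩ :=
    Tri.run (p := reductionProg f o P) (by cases f <;> cases o <;> rfl) (by omega) hs fun g _ hg' =>
      reductionProg_spec (s := { s with reg := g }) (mm := mm) (a := a) (w := w) (X := X) hn (by omega)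
        hNW haW hqW (by omega) (fun J hJ => by
          have h1 : 2 ^ (J + 1) ≤ 4 * B := by rw [pow_succ]; omega
          refine ⟨(Nat.pow_le_pow_left h1 3).trans ?_, by omega, fun m hm hmD M M' s hs h0 h1 h2 => ?_⟩
          · rw [mul_pow]
            exact hbW _ 3 (by omega) (by omega)
          · have h3 : C * m ^ k ≤ W := by
              refine le_trans ?_ (hbW (C * 2 ^ k) k (by omega) (by omega))
              rw [mul_assoc, ← mul_pow]
              exact Nat.mul_le_mul_left _ (Nat.pow_le_pow_left (by omega) k)
            obtain ⟨s', t, h4, h5, h6⟩ := hP m hm M M' W h3 s hs h0 h1 h2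
            exact ⟨s', t, h4, Nat.le_floor h5, h6⟩)
        hq (by omega) hg ⟨(hg' 0 (by decide)).trans hG.1, hG.2⟩ hA hR hw
        ((hg' 1 (by decide)).trans ha) hXs hXA hB
  refine ⟨s', t, U.image X, hr, ?_, hem.holdsFamily fun i hi j hj hij => ?_, fun Z hZ => ?_, ?_, ?_⟩
  · have hD : ((2 : ℝ) ^ J) ≤ 2 * (c : ℝ) ^ 2 := by
      have : 2 ^ J ≤ 2 * c ^ 2 := hJ.le.trans (by rw [pow_two]; gcongr)
      exact_mod_cast this
    have hJn : J + 2 ≤ 4 * n := by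
      have h1 : 2 ^ J < 2 ^ (2 * n + 1) := by
        refine hJ.trans_le ((Nat.mul_le_mul_left 2 (Nat.mul_le_mul hq2 hq2)).trans_eq ?_)
        ring
      have := (Nat.pow_lt_pow_iff_right (by decide)).1 h1
      omega
    have h1 := reduction_time_le (τ := τ) (n := n) (a := a) (c := c) (N := N) (q := q) (D := 2 ^ J)
      (rr := rr) (J := J) hτ2 hc1 hn1 (by exact_mod_cast hN) q.cast_nonneg (by exact_mod_cast hqc)
      (by positivity) hD (by exact_mod_cast hJn) rr.cast_nonneg (by exact_mod_cast hrr) C.cast_nonneg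
      (elimTime_le (mm := mm) hτ2 C.cast_nonneg (fun m _ => hmm m) J)
    have h2 : (t : ℝ) ≤ _ := (Nat.cast_le.2 (ht.trans (Nat.add_le_add_right
      (Nat.mul_le_mul_left 10 ht') 51))).trans (le_trans (by rw [reduceTime]; push_cast; exact le_rfl) h1)
    refine h2.trans (mul_le_mul_of_nonneg_right (hK.trans ?_) (B.cast_nonneg.trans hBS))
    push_cast
    have : (0 : ℝ) ≤ C * 2 ^ k := by positivity
    linarith
  · have h1 := hUa i hi
    have h2 := hUa j hj
    rw [hXe i h1, hXe j h2] at hij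
    simpa using e.injective (Subtype.ext hij)
  · obtain ⟨i, hi, rfl⟩ := Finset.mem_image.1 hZ
    exact hX𝒜 i (hUa i hi)
  · rw [← hXim]
    refine acyRepresents_image hUa fun Y hY hYR j hj htree => ?_
    obtain ⟨φ, h1, h2⟩ := exists_functional hY hYR hL hq0 hL0
    by_contra! hno
    have h5 : rowVec G L q (X j) ∈ LinearMap.ker φ := by
      refine Submodule.span_le.2 ?_ (hgen j hj (viable_of_isTree (hXA j hj) hY hYR htree))
      rintro _ ⟨i, ⟨hi, hsig, hlight, hb⟩, rfl⟩
      by_contra h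
      have h4 : φ (rowVec G L q (X i)) = 1 := Fin.eq_one_of_ne_zero _ h
      exact hno i hi (h2 _ (hXA j hj) _ (hXA i (hUa i hi)) htree hsig hlight h4) hb
    rw [LinearMap.mem_ker, h1 _ (hXA j hj) htree] at h5
    exact one_ne_zero h5
  · refine Finset.card_image_le.trans (hUc.trans (Nat.mul_le_mul_left _ ?_))
    rw [pow_two]
    exact Nat.mul_le_mul hqc hqc
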